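/- **Setting.** Let $\mathcal G$ be a graph on $N$ nodes with shortest-path distance $d_{\mathcal G}$. Consider $x_{t+1}=Ax_t+Bu_t+w_t(\theta^*_t)$, $0\le t<T$, where state, control and parameter are stacked from node blocks $x[i],u[i],\theta[i]$, the blocks $A[i,j],B[i,j]$ vanish unless $i=j$ or $i,j$ are adjacent, and $f_t(x,\theta)=\sum_i f_t[i](x[i],\theta[i])$, $c_t(u,\theta)=\sum_i c_t[i](u[i],\theta[i])$, $w_t(\theta)=(w_t[i](\theta[i]))_i$. Norms are 2-norms, respectively operator norms. For a matrix or vector $M$ let $M^{(i,\kappa)}$ be $M$ with the block rows $j$, $d_{\mathcal G}(i,j)>\kappa$, set to $0$. A pair $(A,B)$ is $(L,\gamma)$-stabilizable if some $K$ with $\|K\|\le L$ satisfies $\|(A-BK)^s\|\le L\gamma^s$ for all $s\ge 0$. Write $\tilde\Psi^{\ell}(A,B,f,c,g,x,\zeta)$ for the minimizer $(y_{0:\ell},v_{0:\ell-1})$ of $\sum_{\tau<\ell}\big(f_\tau(y_\tau)+c_{\tau}(v_\tau)\big)+g(y_\ell)$ subject to $y_0=x$, $y_{\tau+1}=Ay_\tau+Bv_\tau+\zeta_\tau$.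 At time $t$ forecasts $\theta_{t+n|t}$ of $\theta^*_{t+n}$ are available; put $\phi_{t+n|t}=\|\theta_{t+n|t}-\theta^*_{t+n}\|$ and $k'_t=\min(k,T-t)$. In the algorithm $uDTPC_k$ node $i$ applies at time $t$ the control $u_t[i]=v_0[i]$, where $(y,v)$ solves $\tilde\Psi^{k'_t}$ with the data $A^{(i,\kappa)},B^{(i,\kappa)}$, $f_{t+\tau}(\cdot,\theta_{t+\tau|t})$, $c_{t+\tau+1}(\cdot,\theta_{t+\tau|t})$, $x_t^{(i,\kappa)}$, $w_{t+\tau}(\theta_{t+\tau|t})^{(i,\kappa)}$, and terminal cost $F$ if $t<T-k$, $f_T(\cdot,\theta_{T|t})$ otherwise. The control error is $e_t=\|u_t-v^*_0\|$, where $(y^*,v^*)$ is the offline optimum from $x_t$, i.e. the solution of $\tilde\Psi^{T-t}$ with $A,B$, $x_t$, the true costs and disturbances (parameters $\theta^*$) and terminal cost $f_T(\cdot,\theta^*_T)$. **Assumptions.** Let $L>1$, $\mu>0$, $\gamma\in(0,1)$, $\sigma>0$, $d\in\mathbb N$. 1. $\|A\|,\|B\|,\|B^\dagger\|\le L$; the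 matrix $[B,AB,\dots,A^{d-1}B]$ has full row rank with smallest singular value at least $\sigma$; there is $\kappa_0<\mathrm{diam}(\mathcal G)$ such that $(A^{(i,\kappa)},B^{(i,\kappa)})$ is $(L,\gamma)$-stabilizable for all nodes $i$ and all $\kappa\ge\kappa_0$. 2. For all $t$ and all admissible $\theta$, $f_t(\cdot,\theta)$ and $c_t(\cdot,\theta)$ are $\mu$-strongly convex, $L$-smooth, $C^2$, nonnegative and zero at $0$. $F$ is $\mu$-strongly convex, $L$-smooth, $C^2$, and $F(x)=\beta(\|x\|)$ with $\beta$ strictly increasing, $\beta(0)=0$. 3. $|\{j: d_{\mathcal G}(i,j)=r\}|\le p(r)$ for all $i,r$, where $\lim_{r\to\infty}\log p(r)/r=0$. 4. $\|w_t(\theta)\|\le D$ for all $t$ and all admissible $\theta$; $w_t$ and the Hessians $\nabla^2_{xx}f_t$, $\nabla^2_{uu}c_t$ are $L$-Lipschitz in $\theta$. All $\theta^*_t$ and $\theta_{t+n|t}$ are admissible. 5. For every $t<T$, $\sum_{\tau<k'_t}\|w_{t+\tau}(\theta)\|\le D_k$, both for the true parameters and for the forecasts made at time $t$. **Constants.**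 $\mu_J=\frac{(1-\gamma)^2}{L^2(1+L^2)}$, $L_H=2L+1$, $\mu_H=\Big(\frac1\mu+\big(1+\frac{2L_H}{\mu}+\frac{L_H^2}{\mu^2}\big)\frac{L_H}{\mu_J}\Big)^{-1}$, $\rho=\Big(\frac{L_H^2-\mu_H^2}{L_H^2+\mu_H^2}\Big)^{1/2}$, $\alpha=\frac{L_H}{\mu_H^2\rho}$, $\delta_{\mathcal S}=\frac{\rho+1}2$, $\Gamma=\frac{4\alpha^2\delta_{\mathcal S}L}{(1-\delta_{\mathcal S})^2}\big(\sup_{r\ge0}(\rho/\delta_{\mathcal S})^rp(r)\big)^2p(1)$, $\Upsilon=\alpha L\big(1+\frac{2\alpha D}{1-\rho}\big)$. **Theorem.** There are $\Omega>0$ and $\delta_{\mathcal T}\in(0,1)$, depending only on $L,\mu,\gamma,\sigma,d$, such that the following holds for every such system. (a) (Role of $\Omega,\delta_{\mathcal T}$.) For every window of length $\ell\ge d$ inside $\{0,\dots,T\}$ and admissible parameters, the state trajectories $y,y'$ of the optimal control problems with prescribed initial states $x,x'$, final states $z,z'$ and disturbances $\zeta,\zeta'$ satisfy $$\|y_m-y'_m\|\le\Omega\Big(\delta_{\mathcal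 T}^m\|x-x'\|+\delta_{\mathcal T}^{\ell-m}\|z-z'\|+\sum_{l=0}^{\ell-1}\delta_{\mathcal T}^{|m-l|}\|\zeta_l-\zeta'_l\|\Big),\qquad 0\le m\le \ell .$$ (b) Put $C=\max(\Omega,\Gamma,\Upsilon)$, $\delta=\max(\delta_{\mathcal S},\delta_{\mathcal T})$, $\xi=1-\sqrt\delta$. Let $\varepsilon,R>0$, let $k,\kappa\in\mathbb N$ satisfy $$\kappa\ge\max\Big(\kappa_0,\frac{\log\frac{\sqrt\delta(1-\sqrt\delta)}{3C^2N}}{\log\delta}\Big),\qquad k\ge\frac{2\log\frac{\delta(1-\delta)}{6C^3}}{\log\delta},$$ and suppose that for all $t<T$ $$\sum_{\substack{0\le m<k\\ m\le t}}\ \sum_{n=0}^{k'_{t-m}}\phi_{t-m+n|t-m}\,\delta^{2n+m/2}\le\frac{\sqrt\delta}{3LC^2},\qquad \phi_{t+n|t}\le R(\delta+\varepsilon)^{-n}\quad(0\le n\le k'_t).$$ Then, along the trajectory $(x_t,u_t)$ generated by $uDTPC_k$, for every $0\le t<T$, $$e_t\le\Upsilon\sum_{n=0}^{k'_t}\rho^n(1+\rho^n\|x_t\|)\phi_{t+n|t}+\Gamma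 N(\|x_t\|+D_k)\delta_{\mathcal S}^\kappa+2\Omega^2\delta_{\mathcal T}^k\Big(\delta_{\mathcal T}^k\|x_t\|+\frac{2D}{1-\delta_{\mathcal T}}\Big)$$ and $$e_t^2\le\Big(\Upsilon\Big(\frac1{1-\rho}+\frac{R_0}{1-\rho^2}\Big)+C_\kappa+C_k\Big)\Big(\sum_{n=0}^{k'_t}\Upsilon(1+R_0\rho^n)\rho^n\phi_{t+n|t}^2+C_\kappa\delta_{\mathcal S}^{2\kappa}+C_k\delta_{\mathcal T}^{2k}\Big),$$ where $W=\frac{8LNC^2(\delta+\varepsilon)R}{(1-\delta)^2\varepsilon}D_k$, $R_0=\frac{C^2}{\xi^2}\|x_0\|+\frac{2CW}{\xi}$, $C_\kappa=\Gamma N(R_0+D_k)$ and $C_k=2\Omega^2\big(R_0+\frac{2D}{1-\delta_{\mathcal T}}\big)$. -/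

import Mathlib

open scoped Matrix.Norms.L2Operator
open Filter Topology

noncomputable section

namespace NetControl

/-! ## Stacked vectors and matrices over the nodes of a network -/

/-- Index set of a stacked vector whose block at node `i` has `n i` entries. -/
abbrev Idx {N : ℕ} (n : Fin N → ℕ) : Type := Σ i : Fin N, Fin (n i)

/-- Stacked real vectors, with the 2-norm. -/
abbrev Vec {N : ℕ} (n : Fin N → ℕ) : Type := EuclideanSpace ℝ (Idx n)

/-- The block `x[i]` of a stacked vector. -/
def blk {N : ℕ} {n : Fin N → ℕ} (x : Vec n) (i : Fin N) : EuclideanSpace ℝ (Fin (n i)) :=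
  WithLp.toLp 2 fun a => x ⟨i, a⟩

/-- Matrix times stacked vector. -/
def act {N : ℕ} {n m : Fin N → ℕ} (M : Matrix (Idx n) (Idx m) ℝ) (x : Vec m) : Vec n :=
  WithLp.toLp 2 (M.mulVec fun a => x a)

open Classical in
/-- The `(i, κ)`-truncation of a matrix: block rows outside the `κ`-hop neighbourhood of `i` are
set to zero. -/
def truncMat {N : ℕ} (G : SimpleGraph (Fin N)) (i : Fin N) (κ : ℕ) {n m : Fin N → ℕ}
    (M : Matrix (Idx n) (Idx m) ℝ) : Matrix (Idx n) (Idx m) ℝ :=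
  Matrix.of fun a b => if G.edist i a.1 ≤ (κ : ℕ∞) then M a b else 0

open Classical in
/-- The `(i, κ)`-truncation of a stacked vector. -/
def truncVec {N : ℕ} (G : SimpleGraph (Fin N)) (i : Fin N) (κ : ℕ) {n : Fin N → ℕ}
    (x : Vec n) : Vec n :=
  WithLp.toLp 2 fun a => if G.edist i a.1 ≤ (κ : ℕ∞) then x a else 0

/-! ## The networked, parametrized control problem -/

/-- The data of a networked control problem on `N` nodes: communication graph, block dimensions of
states, controls and parameters, system matrices, decentralized stage costs `f t i`, `c t i` and
disturbances `w t i` as functions of the local parameter, and the terminal cost `F`. -/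
structure Network (N : ℕ) where
  G : SimpleGraph (Fin N)
  nx : Fin N → ℕ
  nu : Fin N → ℕ
  nθ : Fin N → ℕ
  A : Matrix (Idx nx) (Idx nx) ℝ
  B : Matrix (Idx nx) (Idx nu) ℝ
  f : ℕ → (i : Fin N) → EuclideanSpace ℝ (Fin (nx i)) → EuclideanSpace ℝ (Fin (nθ i)) → ℝ
  c : ℕ → (i : Fin N) → EuclideanSpace ℝ (Fin (nu i)) → EuclideanSpace ℝ (Fin (nθ i)) → ℝ
  w : ℕ → (i : Fin N) → EuclideanSpace ℝ (Fin (nθ i)) → EuclideanSpace ℝ (Fin (nx i))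
  F : Vec nx → ℝ

namespace Network

variable {N : ℕ} (S : Network N)

/-- Aggregated state cost `f_t(x, θ) = ∑ i, f_t[i](x[i], θ[i])`. -/
def stateCost (t : ℕ) (θ : Vec S.nθ) (x : Vec S.nx) : ℝ :=
  ∑ i, S.f t i (blk x i) (blk θ i)

/-- Aggregated control cost `c_t(u, θ) = ∑ i, c_t[i](u[i], θ[i])`. -/
def controlCost (t : ℕ) (θ : Vec S.nθ) (u : Vec S.nu) : ℝ :=
  ∑ i, S.c t i (blk u i) (blk θ i)

/-- Stacked disturbance `w_t(θ) = (w_t[i](θ[i]))_i`. -/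
def disturbance (t : ℕ) (θ : Vec S.nθ) : Vec S.nx :=
  WithLp.toLp 2 fun a => S.w t a.1 (blk θ a.1) a.2

/-- The system matrices respect the graph: blocks of distinct non-adjacent nodes vanish. -/
def Networked : Prop :=
  (∀ a b, a.1 ≠ b.1 → ¬ S.G.Adj a.1 b.1 → S.A a b = 0) ∧
  (∀ a b, a.1 ≠ b.1 → ¬ S.G.Adj a.1 b.1 → S.B a b = 0)

end Network

/-! ## Finite-horizon optimal control problems -/

section OCP

variable {N : ℕ} {nx nu : Fin N → ℕ}

/-- `(y, v)` follows `y_{τ+1} = A y_τ + B v_τ + ζ_τ` for `τ < ℓ`, with `y_0 = x`. Only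
`y_0, …, y_ℓ`, `v_0, …, v_{ℓ-1}` and `ζ_0, …, ζ_{ℓ-1}` are relevant. -/
def Feasible (A : Matrix (Idx nx) (Idx nx) ℝ) (B : Matrix (Idx nx) (Idx nu) ℝ) (ℓ : ℕ)
    (x : Vec nx) (ζ : ℕ → Vec nx) (y : ℕ → Vec nx) (v : ℕ → Vec nu) : Prop :=
  y 0 = x ∧ ∀ τ < ℓ, y (τ + 1) = act A (y τ) + act B (v τ) + ζ τ

/-- Total cost `∑_{τ<ℓ} (f_τ(y_τ) + c_τ(v_τ)) + g(y_ℓ)`. -/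
def totalCost (ℓ : ℕ) (f : ℕ → Vec nx → ℝ) (c : ℕ → Vec nu → ℝ) (g : Vec nx → ℝ)
    (y : ℕ → Vec nx) (v : ℕ → Vec nu) : ℝ :=
  ∑ τ ∈ Finset.range ℓ, (f τ (y τ) + c τ (v τ)) + g (y ℓ)

/-- `(y, v)` solves the problem with free final state and terminal cost `g`. -/
def IsSolution (A : Matrix (Idx nx) (Idx nx) ℝ) (B : Matrix (Idx nx) (Idx nu) ℝ) (ℓ : ℕ)
    (f : ℕ → Vec nx → ℝ) (c : ℕ → Vec nu → ℝ) (g : Vec nx → ℝ)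
    (x : Vec nx) (ζ : ℕ → Vec nx) (y : ℕ → Vec nx) (v : ℕ → Vec nu) : Prop :=
  Feasible A B ℓ x ζ y v ∧
    ∀ y' v', Feasible A B ℓ x ζ y' v' → totalCost ℓ f c g y v ≤ totalCost ℓ f c g y' v'

/-- `(y, v)` solves the problem with prescribed final state `z`. -/
def IsTerminalSolution (A : Matrix (Idx nx) (Idx nx) ℝ) (B : Matrix (Idx nx) (Idx nu) ℝ) (ℓ : ℕ)
    (f : ℕ → Vec nx → ℝ) (c : ℕ → Vec nu → ℝ)
    (x : Vec nx) (ζ : ℕ → Vec nx) (z : Vec nx) (y : ℕ → Vec nx) (v : ℕ → Vec nu) : Prop :=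
  Feasible A B ℓ x ζ y v ∧ y ℓ = z ∧
    ∀ y' v', Feasible A B ℓ x ζ y' v' → y' ℓ = z →
      totalCost ℓ f c (f ℓ) y v ≤ totalCost ℓ f c (f ℓ) y' v'

end OCP

/-! ## Assumptions -/

/-- `(L, γ)`-stabilizability of `(A, B)`. -/
def Stabilizable {ι κ : Type} [Fintype ι] [DecidableEq ι] [Fintype κ] [DecidableEq κ] (L γ : ℝ)
    (A : Matrix ι ι ℝ) (B : Matrix ι κ ℝ) : Prop :=
  1 < L ∧ 0 < γ ∧ γ < 1 ∧
    ∃ K : Matrix κ ι ℝ, ‖K‖ ≤ L ∧ ∀ t : ℕ, ‖(A - B * K) ^ t‖ ≤ L * γ ^ t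

/-- `P` is the Moore–Penrose pseudo-inverse of the real matrix `M`. -/
def IsMoorePenrose {ι κ : Type} [Fintype ι] [Fintype κ] (M : Matrix ι κ ℝ) (P : Matrix κ ι ℝ) :
    Prop :=
  M * P * M = M ∧ P * M * P = P ∧ (M * P).transpose = M * P ∧ (P * M).transpose = P * M

/-- The reduced controllability matrix `[B, A B, …, A^{d-1} B]`. -/
def ctrbMat {ι κ : Type} [Fintype ι] [DecidableEq ι] [Fintype κ] (A : Matrix ι ι ℝ)
    (B : Matrix ι κ ℝ) (d : ℕ) : Matrix ι (Fin d × κ) ℝ :=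
  Matrix.of fun a jb => (A ^ (jb.1 : ℕ) * B) a jb.2

/-- Assumption on the system matrices. `ctrb` says that the smallest singular value of the
(full row rank) reduced controllability matrix `C` is at least `σ`, i.e. `C Cᵀ ⪰ σ² I`. -/
structure SystemAssumption {N : ℕ} (S : Network N) (L γ σ : ℝ) (d κ₀ : ℕ) : Prop where
  norm_A : ‖S.A‖ ≤ L
  norm_B : ‖S.B‖ ≤ L
  norm_pinv : ∃ P : Matrix (Idx S.nu) (Idx S.nx) ℝ, IsMoorePenrose S.B P ∧ ‖P‖ ≤ L
  ctrb : (ctrbMat S.A S.B d * (ctrbMat S.A S.B d).transpose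
    - σ ^ 2 • (1 : Matrix (Idx S.nx) (Idx S.nx) ℝ)).PosSemidef
  lt_diam : (κ₀ : ℕ∞) < S.G.ediam
  stab : ∀ (i : Fin N) (κ : ℕ), κ₀ ≤ κ →
    Stabilizable L γ (truncMat S.G i κ S.A) (truncMat S.G i κ S.B)

/-- `μ`-strongly convex, `L`-smooth and twice continuously differentiable. -/
structure WellConditioned {E : Type} [NormedAddCommGroup E] [InnerProductSpace ℝ E]
    [CompleteSpace E] (μ L : ℝ) (h : E → ℝ) : Prop where
  strong : StrongConvexOn Set.univ μ h
  smooth : ∀ x y, ‖gradient h x - gradient h y‖ ≤ L * ‖x - y‖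
  contDiff : ContDiff ℝ 2 h

/-- Well-conditioned, nonnegative, and zero at the origin. -/
structure StageCost {E : Type} [NormedAddCommGroup E] [InnerProductSpace ℝ E]
    [CompleteSpace E] (μ L : ℝ) (h : E → ℝ) : Prop extends WellConditioned μ L h where
  nonneg : ∀ x, 0 ≤ h x
  zero : h 0 = 0

/-- Hessian of `h` at `x`, as a linear operator (with the operator norm). -/
def hessian {E : Type} [NormedAddCommGroup E] [InnerProductSpace ℝ E]
    [CompleteSpace E] (h : E → ℝ) (x : E) : E →L[ℝ] E :=
  fderiv ℝ (gradient h) x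

/-- The terminal cost is a well-conditioned K-function: `F x = β ‖x‖` with `β` strictly increasing
and `β 0 = 0`. -/
structure TerminalCost {E : Type} [NormedAddCommGroup E] [InnerProductSpace ℝ E]
    [CompleteSpace E] (μ L : ℝ) (F : E → ℝ) : Prop extends WellConditioned μ L F where
  radial : ∃ β : ℝ → ℝ, StrictMonoOn β (Set.Ici 0) ∧ β 0 = 0 ∧ ∀ x, F x = β ‖x‖

/-- Assumptions on the stage costs and disturbances over the horizon `T`, uniformly over the set
`Θ` of admissible parameters. -/
structure UncertaintyAssumption {N : ℕ} (S : Network N) (Θ : Set (Vec S.nθ)) (T : ℕ)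
    (μ L D : ℝ) : Prop where
  state : ∀ t ≤ T, ∀ θ ∈ Θ, StageCost μ L (S.stateCost t θ)
  control : ∀ t, 1 ≤ t → t ≤ T → ∀ θ ∈ Θ, StageCost μ L (S.controlCost t θ)
  dist_bdd : ∀ t < T, ∀ θ ∈ Θ, ‖S.disturbance t θ‖ ≤ D
  dist_lip : ∀ t < T, ∀ θ ∈ Θ, ∀ θ' ∈ Θ,
    ‖S.disturbance t θ - S.disturbance t θ'‖ ≤ L * ‖θ - θ'‖
  state_hess : ∀ t ≤ T, ∀ θ ∈ Θ, ∀ θ' ∈ Θ, ∀ x,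
    ‖hessian (S.stateCost t θ) x - hessian (S.stateCost t θ') x‖ ≤ L * ‖θ - θ'‖
  control_hess : ∀ t, 1 ≤ t → t ≤ T → ∀ θ ∈ Θ, ∀ θ' ∈ Θ, ∀ u,
    ‖hessian (S.controlCost t θ) u - hessian (S.controlCost t θ') u‖ ≤ L * ‖θ - θ'‖

/-- `p` is subexponential and bounds the number of nodes at each distance from a node. -/
def GrowthBound {N : ℕ} (G : SimpleGraph (Fin N)) (p : ℕ → ℝ) : Prop :=
  Tendsto (fun d : ℕ => Real.log (p d) / d) atTop (𝓝 0) ∧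
  ∀ (i : Fin N) (d : ℕ), (Set.ncard {j | G.edist i j = (d : ℕ∞)} : ℝ) ≤ p d

/-! ## Constants -/

def muJ (L γ : ℝ) : ℝ := (1 - γ) ^ 2 / (L ^ 2 * (1 + L ^ 2))

def LH (L : ℝ) : ℝ := 2 * L + 1

def muH (L γ μ : ℝ) : ℝ :=
  (1 / μ + (1 + 2 * LH L / μ + LH L ^ 2 / μ ^ 2) * (LH L / muJ L γ))⁻¹

def rho (L γ μ : ℝ) : ℝ :=
  Real.sqrt ((LH L ^ 2 - muH L γ μ ^ 2) / (LH L ^ 2 + muH L γ μ ^ 2))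

def alpha (L γ μ : ℝ) : ℝ := LH L / (muH L γ μ ^ 2 * rho L γ μ)

/-- The spatial decay rate. -/
def deltaS (L γ μ : ℝ) : ℝ := (rho L γ μ + 1) / 2

/-- The constant `Γ` of the spatial decay. -/
def Gam (L γ μ : ℝ) (p : ℕ → ℝ) : ℝ :=
  4 * alpha L γ μ ^ 2 * deltaS L γ μ * L / (1 - deltaS L γ μ) ^ 2
    * (⨆ d : ℕ, (rho L γ μ / deltaS L γ μ) ^ d * p d) ^ 2 * p 1

/-- The constant `Υ` of the sensitivity to forecast errors. -/
def Ups (L γ μ D : ℝ) : ℝ :=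
  alpha L γ μ * L * (1 + 2 * alpha L γ μ * D / (1 - rho L γ μ))

/-! ## The distributed algorithm and the offline optimum -/

section Algorithm

variable {N : ℕ} (S : Network N)

/-- Length `min(k, T - t)` of the prediction window at time `t`. -/
def window (k T t : ℕ) : ℕ := min k (T - t)

/-- The forecast error `φ_{s+n|s}`, where `θhat s n` is the forecast `θ_{s+n|s}` made at time `s`
of the true parameter `θstar (s + n)`. -/
def fcErr {S : Network N} (θstar : ℕ → Vec S.nθ) (θhat : ℕ → ℕ → Vec S.nθ) (s n : ℕ) : ℝ :=
  ‖θhat s n - θstar (s + n)‖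

/-- The state and control trajectory `x, u` is generated by the distributed truncated predictive
controller with uncertain forecasts: at every time `t < T` each node `i` solves its
`(i, κ)`-truncated problem, built from the forecasts made at time `t`, over `min(k, T - t)` steps,
with terminal cost `F` when `t < T - k` and the forecast of `f_T` otherwise, and applies its block
of the first control. The system evolves with the true disturbance. -/
def IsUDTPC (T k κ : ℕ) (θstar : ℕ → Vec S.nθ) (θhat : ℕ → ℕ → Vec S.nθ)
    (x : ℕ → Vec S.nx) (u : ℕ → Vec S.nu) : Prop :=
  ∀ t < T,
    x (t + 1) = act S.A (x t) + act S.B (u t) + S.disturbance t (θstar t) ∧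
    ∀ i : Fin N, ∃ (y : ℕ → Vec S.nx) (v : ℕ → Vec S.nu),
      IsSolution (truncMat S.G i κ S.A) (truncMat S.G i κ S.B) (window k T t)
        (fun τ => S.stateCost (t + τ) (θhat t τ))
        (fun τ => S.controlCost (t + τ + 1) (θhat t τ))
        (if t + k < T then S.F else S.stateCost T (θhat t (T - t)))
        (truncVec S.G i κ (x t))
        (fun τ => truncVec S.G i κ (S.disturbance (t + τ) (θhat t τ))) y v ∧
      blk (u t) i = blk (v 0) i

/-- `(y, v)` is the offline optimal trajectory over the remaining times `t, …, T`, started at the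
state `x`, with the true costs, disturbances and final cost `f_T`. -/
def IsOfflineOptimal (T : ℕ) (θstar : ℕ → Vec S.nθ) (t : ℕ) (x : Vec S.nx)
    (y : ℕ → Vec S.nx) (v : ℕ → Vec S.nu) : Prop :=
  IsSolution S.A S.B (T - t)
    (fun τ => S.stateCost (t + τ) (θstar (t + τ)))
    (fun τ => S.controlCost (t + τ + 1) (θstar (t + τ)))
    (S.stateCost T (θstar T)) x (fun τ => S.disturbance (t + τ) (θstar (t + τ))) y v

/-- Temporal perturbation bound, with constants `Ω`, `δT`, for the optimal control problems with
prescribed final state over any window of length `ℓ ≥ d` inside the horizon. -/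
def TemporalDecay (Θ : Set (Vec S.nθ)) (T d : ℕ) (Ω δT : ℝ) : Prop :=
  ∀ (t ℓ : ℕ), d ≤ ℓ → t + ℓ ≤ T → ∀ θ : ℕ → Vec S.nθ, (∀ τ, θ τ ∈ Θ) →
    ∀ (x x' z z' : Vec S.nx) (ζ ζ' : ℕ → Vec S.nx) (y y' : ℕ → Vec S.nx) (v v' : ℕ → Vec S.nu),
      IsTerminalSolution S.A S.B ℓ (fun τ => S.stateCost (t + τ) (θ τ))
        (fun τ => S.controlCost (t + τ + 1) (θ τ)) x ζ z y v →
      IsTerminalSolution S.A S.B ℓ (fun τ => S.stateCost (t + τ) (θ τ))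
        (fun τ => S.controlCost (t + τ + 1) (θ τ)) x' ζ' z' y' v' →
      ∀ m ≤ ℓ, ‖y m - y' m‖ ≤ Ω * (δT ^ m * ‖x - x'‖ + δT ^ (ℓ - m) * ‖z - z'‖
        + ∑ l ∈ Finset.range ℓ, δT ^ ((m : ℤ) - l).natAbs * ‖ζ l - ζ' l‖)

/-- Sums of disturbances over the prediction windows are at most `Dk`, both for the true
parameters and for the forecasts. -/
def WindowBound (T k : ℕ) (θstar : ℕ → Vec S.nθ) (θhat : ℕ → ℕ → Vec S.nθ) (Dk : ℝ) : Prop :=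
  ∀ t < T,
    ∑ τ ∈ Finset.range (window k T t), ‖S.disturbance (t + τ) (θstar (t + τ))‖ ≤ Dk ∧
    ∑ τ ∈ Finset.range (window k T t), ‖S.disturbance (t + τ) (θhat t τ)‖ ≤ Dk

/-- The requirements on the forecast errors. Only errors `φ_{s+n|s}` with `s + n ≤ T` occur. -/
def ForecastCondition {S : Network N} (T k : ℕ) (θstar : ℕ → Vec S.nθ)
    (θhat : ℕ → ℕ → Vec S.nθ) (L C δ ε R : ℝ) : Prop :=
  (∀ t < T, ∑ m ∈ Finset.range (min k (t + 1)),
      ∑ n ∈ Finset.range (window k T (t - m) + 1),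
        fcErr θstar θhat (t - m) n * δ ^ (2 * (n : ℝ) + (m : ℝ) / 2)
      ≤ Real.sqrt δ / (3 * L * C ^ 2)) ∧
  (∀ t < T, ∀ n ≤ window k T t, fcErr θstar θhat t n ≤ R * ((δ + ε) ^ n)⁻¹)

end Algorithm

end NetControl

end

open NetControl

set_option linter.unusedSectionVars false

noncomputable section

namespace NetControl

open scoped InnerProductSpace

/-! ## Euclidean norms of finite sequences -/

/-! Optimality over a finite horizon is a saddle point system: cost gradients plus the adjoint
dynamics of a costate vanish, and the dynamics hold. If the dynamics operator has a right inverse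
bounded uniformly in the horizon and the gradients are strongly monotone and Lipschitz, then states,
controls and costates are bounded by the residuals of this system (`chain_stability`). Multiplying
all unknowns by weights that vary slowly between coupled stages and nodes creates only small
commutators, which can be absorbed (`chain_weighted_stability`). Weights q^|τ-n| yield decay in
time, weights q^(τ+dist(i,j)) decay in time and space. Every perturbation bound below is this
estimate for the difference of an exact and an approximate solution, so no solution is ever
differentiated with respect to the data.

The right inverse comes from a stabilizing feedback. For the full matrices it is glued from
truncations to whole connected components (`ocpRightInverse_of_truncations`); for prescribed final
states it is corrected by steering during the last d steps (`ocpRightInverse_terminal`). The latter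
gives part (a) (`temporalDecay`).

The control error of one step splits into truncation in space (`spatial_decay`, `distributed_error`)
and wrong forecasts together with the cut of the horizon (`forecast_error`). The spatial weights
require separable costs, and the radial terminal cost F is not separable. But the gradient of F at y
is a multiple s of y with s between μ and L, so the solution of node i is also stationary for the
separable terminal cost s/2‖·‖². The multipliers differ from node to node; `norm_sub_le_of_blk_path`
reassembles the blocks at a cost that does not grow with N. Altogether this is `control_error_le`.

Along the closed loop, the offline plans from x_i and x_{i+1} differ by an initial perturbation
B(u_i - v_i), whose influence decays. Telescoping bounds the state by discounted control errors
(`norm_state_le`), and control errors are a gain times the state plus disturbances. The conditions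
on k, κ and the forecasts make the discounted gain small, so that ‖x_t‖ ≤ 2a‖x_0‖ + c·min(2D_k,
D/(1-q)) (`norm_state_le_min`).

The rate q obtained here has 1 - q of order μ_H, while 1 - ρ is of order μ_H². This slack lets Υ, Γ
and Ω absorb the disturbance part of the state bound, so the same error estimate holds with R₀ in
place of ‖x_t‖. The squared bound is then a weighted Cauchy–Schwarz inequality. -/

/-- The 2-norm of the first `n` terms of a sequence. -/
def l2 {E : Type*} [NormedAddCommGroup E] (n : ℕ) (x : ℕ → E) : ℝ :=
  Real.sqrt (∑ τ ∈ Finset.range n, ‖x τ‖ ^ 2)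

section L2

variable {E F : Type*} [NormedAddCommGroup E] [NormedAddCommGroup F] {n : ℕ}

lemma l2_nonneg (x : ℕ → E) : 0 ≤ l2 n x := Real.sqrt_nonneg _

lemma l2_sq (x : ℕ → E) : l2 n x ^ 2 = ∑ τ ∈ Finset.range n, ‖x τ‖ ^ 2 :=
  Real.sq_sqrt (Finset.sum_nonneg fun _ _ => sq_nonneg _)

lemma norm_le_l2 (x : ℕ → E) {τ : ℕ} (h : τ < n) : ‖x τ‖ ≤ l2 n x := by
  apply Real.le_sqrt_of_sq_le
  exact Finset.single_le_sum (f := fun τ => ‖x τ‖ ^ 2) (fun _ _ => sq_nonneg _)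
    (Finset.mem_range.2 h)

lemma l2_le_sum (x : ℕ → E) : l2 n x ≤ ∑ τ ∈ Finset.range n, ‖x τ‖ := by
  apply Real.sqrt_le_iff.2
  refine ⟨Finset.sum_nonneg fun _ _ => norm_nonneg _, ?_⟩
  exact Finset.sum_sq_le_sq_sum_of_nonneg fun _ _ => norm_nonneg _

lemma sum_norm_mul_le (x : ℕ → E) (y : ℕ → F) :
    ∑ τ ∈ Finset.range n, ‖x τ‖ * ‖y τ‖ ≤ l2 n x * l2 n y :=
  Real.sum_mul_le_sqrt_mul_sqrt _ _ _

/-- Minkowski's inequality in the form used for estimates term by term. -/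
lemma l2_le_of_le_add {G : Type*} [NormedAddCommGroup G] {x : ℕ → E} {y : ℕ → F} {z : ℕ → G}
    {a b : ℝ} (ha : 0 ≤ a) (hb : 0 ≤ b) (h : ∀ τ < n, ‖x τ‖ ≤ a * ‖y τ‖ + b * ‖z τ‖) :
    l2 n x ≤ a * l2 n y + b * l2 n z := by
  have hy := l2_nonneg (n := n) y
  have hz := l2_nonneg (n := n) z
  apply abs_le_of_sq_le_sq' _ (by positivity) |>.2
  have h1 : l2 n x ^ 2 ≤ a ^ 2 * l2 n y ^ 2 + b ^ 2 * l2 n z ^ 2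
      + 2 * a * b * ∑ τ ∈ Finset.range n, ‖y τ‖ * ‖z τ‖ := by
    rw [l2_sq, l2_sq, l2_sq, Finset.mul_sum, Finset.mul_sum, Finset.mul_sum,
      ← Finset.sum_add_distrib, ← Finset.sum_add_distrib]
    refine Finset.sum_le_sum fun τ hτ => ?_
    have := pow_le_pow_left₀ (norm_nonneg _) (h τ (Finset.mem_range.1 hτ)) 2
    linarith [this]
  have h2 := sum_norm_mul_le (n := n) y z
  nlinarith [mul_le_mul_of_nonneg_left h2 (mul_nonneg ha hb)]

lemma l2_le_mul {x : ℕ → E} {y : ℕ → F} {a : ℝ} (ha : 0 ≤ a)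
    (h : ∀ τ < n, ‖x τ‖ ≤ a * ‖y τ‖) : l2 n x ≤ a * l2 n y := by
  have := l2_le_of_le_add (x := x) (y := y) (z := y) ha le_rfl (n := n) (fun τ hτ => by
    simpa using h τ hτ)
  simpa using this

lemma l2_add_le (x y : ℕ → E) : l2 n (fun τ => x τ + y τ) ≤ l2 n x + l2 n y := by
  have := l2_le_of_le_add (x := fun τ => x τ + y τ) (y := x) (z := y) zero_le_one zero_le_one
    (n := n) (fun τ _ => by simpa using norm_add_le (x τ) (y τ))
  simpa using this

lemma abs_sum_inner_le [InnerProductSpace ℝ E] (x y : ℕ → E) :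
    |∑ τ ∈ Finset.range n, ⟪x τ, y τ⟫_ℝ| ≤ l2 n x * l2 n y :=
  (Finset.abs_sum_le_sum_abs _ _).trans <|
    (Finset.sum_le_sum fun _ _ => abs_real_inner_le_norm _ _).trans (sum_norm_mul_le x y)

lemma l2_shift_le (x : ℕ → E) :
    l2 (n + 1) (fun τ => if τ < n then x (τ + 1) else 0) ≤ l2 (n + 1) x := by
  apply Real.sqrt_le_sqrt
  rw [Finset.sum_range_succ, Finset.sum_range_succ' (fun τ => ‖x τ‖ ^ 2)]
  refine add_le_add (Finset.sum_le_sum fun τ hτ => ?_) ?_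
  · simp [Finset.mem_range.1 hτ]
  · simp

end L2

/-! ## Saddle point systems over a chain of stages -/

section Chain

variable {E X : Type*} [NormedAddCommGroup E] [InnerProductSpace ℝ E] [CompleteSpace E]
  [NormedAddCommGroup X] [InnerProductSpace ℝ X] [CompleteSpace X]

/-- The constraint sequence `P_0 z_0`, `P_{τ+1} z_{τ+1} - T z_τ`. -/
def chainCons (P : ℕ → E →L[ℝ] X) (T : E →L[ℝ] X) (z : ℕ → E) : ℕ → X
  | 0 => P 0 (z 0)
  | τ + 1 => P (τ + 1) (z (τ + 1)) - T (z τ)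

/-- The adjoint of `chainCons` over stages `0, …, ℓ`. -/
def chainAdj (P : ℕ → E →L[ℝ] X) (T : E →L[ℝ] X) (ℓ : ℕ) (lam : ℕ → X) (τ : ℕ) : E :=
  (P τ).adjoint (lam τ) - if τ < ℓ then T.adjoint (lam (τ + 1)) else 0

/-- Summation by parts. No boundary term remains, because the last stage has no successor and
`chainAdj` drops the coupling there. -/
lemma sum_inner_chainAdj (P : ℕ → E →L[ℝ] X) (T : E →L[ℝ] X) (ℓ : ℕ) (lam : ℕ → X)
    (z : ℕ → E) :
    ∑ τ ∈ Finset.range (ℓ + 1), ⟪chainAdj P T ℓ lam τ, z τ⟫_ℝ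
      = ∑ τ ∈ Finset.range (ℓ + 1), ⟪lam τ, chainCons P T z τ⟫_ℝ := by
  have h1 : ∀ τ ∈ Finset.range ℓ, ⟪chainAdj P T ℓ lam τ, z τ⟫_ℝ
      = ⟪lam τ, P τ (z τ)⟫_ℝ - ⟪lam (τ + 1), T (z τ)⟫_ℝ := fun τ hτ => by
    simp [chainAdj, Finset.mem_range.1 hτ, inner_sub_left, ContinuousLinearMap.adjoint_inner_left]
  have h2 : ⟪chainAdj P T ℓ lam ℓ, z ℓ⟫_ℝ = ⟪lam ℓ, P ℓ (z ℓ)⟫_ℝ := by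
    simp [chainAdj, ContinuousLinearMap.adjoint_inner_left]
  rw [Finset.sum_range_succ, h2, Finset.sum_congr rfl h1, Finset.sum_sub_distrib,
    Finset.sum_range_succ' (fun τ => ⟪lam τ, chainCons P T z τ⟫_ℝ)]
  have h3 : ∑ τ ∈ Finset.range ℓ, ⟪lam τ, P τ (z τ)⟫_ℝ + ⟪lam ℓ, P ℓ (z ℓ)⟫_ℝ
      = ∑ τ ∈ Finset.range ℓ, ⟪lam (τ + 1), P (τ + 1) (z (τ + 1))⟫_ℝ + ⟪lam 0, P 0 (z 0)⟫_ℝ := by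
    rw [← Finset.sum_range_succ (fun τ => ⟪lam τ, P τ (z τ)⟫_ℝ),
      Finset.sum_range_succ' (fun τ => ⟪lam τ, P τ (z τ)⟫_ℝ)]
  simp only [chainCons, inner_sub_right, Finset.sum_sub_distrib]
  linarith

/-- The constraint operator over stages `0, …, ℓ` has a right inverse of norm at most `m`. -/
def ChainRightInverse (P : ℕ → E →L[ℝ] X) (T : E →L[ℝ] X) (ℓ : ℕ) (m : ℝ) : Prop :=
  ∀ b : ℕ → X, ∃ z : ℕ → E, (∀ τ ≤ ℓ, chainCons P T z τ = b τ) ∧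
    l2 (ℓ + 1) z ≤ m * l2 (ℓ + 1) b

lemma chainCons_sub (P : ℕ → E →L[ℝ] X) (T : E →L[ℝ] X) (z z' : ℕ → E) (τ : ℕ) :
    chainCons P T (fun τ => z τ - z' τ) τ = chainCons P T z τ - chainCons P T z' τ := by
  cases τ <;> simp [chainCons]; abel

/-- A bound for the constant in the stability estimate for saddle point systems. -/
def IsSaddleConst (μ L m c : ℝ) : Prop :=
  (1 + m * L) * (3 / 2 / μ) + m ≤ c ∧ (1 + m * L) * (L / μ + 1 / 2) * m ≤ c

/-- Since μpM ≤ ((p + μM)/2)², the larger root of the quadratic in μZ is at most LM + p + (p +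
μM)/2. In the application p is the stationarity residual and M bounds a correction that restores the
constraints. -/
lemma le_of_quadratic_le {μ L p M Z : ℝ} (hμ : 0 < μ) (hL : 0 ≤ L) (hp : 0 ≤ p) (hM : 0 ≤ M)
    (h : μ * Z ^ 2 ≤ (L * M + p) * Z + p * M) :
    Z ≤ 3 / 2 / μ * p + (L / μ + 1 / 2) * M := by
  have h1 : μ * Z ≤ (L * M + p) + (p + μ * M) / 2 := by
    by_contra hcon
    push Not at hcon
    have hLM : 0 ≤ L * M := mul_nonneg hL hM
    have hμM : 0 ≤ μ * M := mul_nonneg hμ.le hM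
    have e1 : (μ * Z) * ((L * M + p) + (p + μ * M) / 2) < (μ * Z) * (μ * Z) :=
      mul_lt_mul_of_pos_left hcon (by linarith)
    have e2 : (p + μ * M) / 2 * ((p + μ * M) / 2) ≤ (p + μ * M) / 2 * (μ * Z) :=
      mul_le_mul_of_nonneg_left (by linarith) (by linarith)
    have e3 : μ * (μ * Z ^ 2) ≤ μ * ((L * M + p) * Z + p * M) := mul_le_mul_of_nonneg_left h hμ.le
    nlinarith [sq_nonneg (p - μ * M)]
  have h2 : Z = (μ * Z) / μ := by field_simp
  rw [h2]
  calc μ * Z / μ ≤ ((L * M + p) + (p + μ * M) / 2) / μ := by gcongr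
    _ = _ := by field_simp; ring

/-- Stability of saddle point systems whose primal part is strongly monotone and Lipschitz. -/
theorem chain_stability {P : ℕ → E →L[ℝ] X} {T : E →L[ℝ] X} {ℓ : ℕ} {m μ L c : ℝ}
    (hR : ChainRightInverse P T ℓ m) (hμ : 0 < μ) (hL : 0 ≤ L) (hm : 0 ≤ m)
    (hc : IsSaddleConst μ L m c) (z g : ℕ → E) (lam : ℕ → X)
    (hmono : ∀ τ ≤ ℓ, μ * ‖z τ‖ ^ 2 ≤ ⟪g τ, z τ⟫_ℝ) (hlip : ∀ τ ≤ ℓ, ‖g τ‖ ≤ L * ‖z τ‖) :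
    l2 (ℓ + 1) z + l2 (ℓ + 1) lam
      ≤ c * (l2 (ℓ + 1) (fun τ => g τ + chainAdj P T ℓ lam τ)
        + l2 (ℓ + 1) (chainCons P T z)) := by
  set p := l2 (ℓ + 1) (fun τ => g τ + chainAdj P T ℓ lam τ) with hp
  set s := l2 (ℓ + 1) (chainCons P T z) with hs
  set Z := l2 (ℓ + 1) z with hZ
  set Y := l2 (ℓ + 1) lam with hY
  have hp0 : 0 ≤ p := l2_nonneg _
  have hs0 : 0 ≤ s := l2_nonneg _
  have hZ0 : 0 ≤ Z := l2_nonneg _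
  have hY0 : 0 ≤ Y := l2_nonneg _
  have hgZ : l2 (ℓ + 1) g ≤ L * Z :=
    l2_le_mul hL fun τ hτ => hlip τ (Nat.lt_succ_iff.1 hτ)
  have key : ∀ z' : ℕ → E, ∑ τ ∈ Finset.range (ℓ + 1), ⟪g τ + chainAdj P T ℓ lam τ, z' τ⟫_ℝ
      = ∑ τ ∈ Finset.range (ℓ + 1), ⟪g τ, z' τ⟫_ℝ
        + ∑ τ ∈ Finset.range (ℓ + 1), ⟪lam τ, chainCons P T z' τ⟫_ℝ := fun z' => by
    rw [← sum_inner_chainAdj, ← Finset.sum_add_distrib]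
    exact Finset.sum_congr rfl fun τ _ => inner_add_left _ _ _
  -- the dual bound
  have hYb : Y ≤ m * (p + L * Z) := by
    -- Testing with a preimage of the multiplier produces its squared norm, and ‖w‖ ≤ m‖lam‖ lets
    -- one factor cancel.
    obtain ⟨w, hw, hwn⟩ := hR lam
    have h1 := key w
    have h2 : ∑ τ ∈ Finset.range (ℓ + 1), ⟪lam τ, chainCons P T w τ⟫_ℝ = Y ^ 2 := by
      rw [hY, l2_sq]
      refine Finset.sum_congr rfl fun τ hτ => ?_
      rw [hw τ (Nat.lt_succ_iff.1 (Finset.mem_range.1 hτ)), real_inner_self_eq_norm_sq]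
    have h3 := (abs_le.1 (abs_sum_inner_le (n := ℓ + 1)
      (fun τ => g τ + chainAdj P T ℓ lam τ) w)).2
    have h4 := (abs_le.1 (abs_sum_inner_le (n := ℓ + 1) g w)).1
    have h5 : Y * Y ≤ (m * (p + L * Z)) * Y := by
      have hw0 := l2_nonneg (n := ℓ + 1) w
      have : Y ^ 2 ≤ (p + L * Z) * l2 (ℓ + 1) w := by
        nlinarith [mul_le_mul_of_nonneg_right hgZ hw0]
      nlinarith [mul_le_mul_of_nonneg_left hwn (by positivity : 0 ≤ p + L * Z)]
    rcases hY0.eq_or_lt with h | h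
    · rw [← h]; positivity
    · exact le_of_mul_le_mul_right h5 h
  -- the primal bound
  have hZb : Z ≤ 3 / 2 / μ * p + (L / μ + 1 / 2) * (m * s) := by
    -- The difference z - w satisfies the homogeneous constraints, so testing with it removes the
    -- multiplier and leaves strong monotonicity.
    obtain ⟨w, hw, hwn⟩ := hR (chainCons P T z)
    have h1 := key fun τ => z τ - w τ
    have h2 : ∑ τ ∈ Finset.range (ℓ + 1), ⟪lam τ, chainCons P T (fun τ => z τ - w τ) τ⟫_ℝ = 0 := by
      refine Finset.sum_eq_zero fun τ hτ => ?_
      rw [chainCons_sub, hw τ (Nat.lt_succ_iff.1 (Finset.mem_range.1 hτ)), sub_self,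
        inner_zero_right]
    have h3 := (abs_le.1 (abs_sum_inner_le (n := ℓ + 1)
      (fun τ => g τ + chainAdj P T ℓ lam τ) (fun τ => z τ - w τ))).2
    have h4 := (abs_le.1 (abs_sum_inner_le (n := ℓ + 1) g w)).2
    have hw0 := l2_nonneg (n := ℓ + 1) w
    have h5 : l2 (ℓ + 1) (fun τ => z τ - w τ) ≤ Z + m * s := by
      have := l2_le_of_le_add (x := fun τ => z τ - w τ) (y := z) (z := w) zero_le_one zero_le_one
        (n := ℓ + 1) (fun τ _ => by simpa using norm_sub_le (z τ) (w τ))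
      linarith
    have h6 : μ * Z ^ 2 ≤ ∑ τ ∈ Finset.range (ℓ + 1), ⟪g τ, z τ⟫_ℝ := by
      rw [hZ, l2_sq, Finset.mul_sum]
      exact Finset.sum_le_sum fun τ hτ => hmono τ (Nat.lt_succ_iff.1 (Finset.mem_range.1 hτ))
    have h7 : ∑ τ ∈ Finset.range (ℓ + 1), ⟪g τ, z τ - w τ⟫_ℝ
        = ∑ τ ∈ Finset.range (ℓ + 1), ⟪g τ, z τ⟫_ℝ
          - ∑ τ ∈ Finset.range (ℓ + 1), ⟪g τ, w τ⟫_ℝ := by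
      simp [inner_sub_right, Finset.sum_sub_distrib]
    set M := m * s with hM
    have hM0 : 0 ≤ M := by positivity
    have h8 : μ * Z ^ 2 ≤ (L * M + p) * Z + p * M := by
      have e1 : l2 (ℓ + 1) g * l2 (ℓ + 1) w ≤ L * Z * M := by gcongr
      have e2 : p * l2 (ℓ + 1) (fun τ => z τ - w τ) ≤ p * (Z + M) := by gcongr
      nlinarith
    exact le_of_quadratic_le hμ hL hp0 hM0 h8
  have h1 : Z + Y ≤ (1 + m * L) * Z + m * p := by linarith
  have h2 : (1 + m * L) * Z ≤ (1 + m * L) * (3 / 2 / μ * p + (L / μ + 1 / 2) * (m * s)) :=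
    mul_le_mul_of_nonneg_left hZb (by positivity)
  have h3 := mul_le_mul_of_nonneg_right hc.1 hp0
  have h4 := mul_le_mul_of_nonneg_right hc.2 hs0
  nlinarith

/-- Weighted stability: the weights `wE`, `wX` almost commute with the coupling `T` between
consecutive stages. -/
theorem chain_weighted_stability {P : ℕ → E →L[ℝ] X} {T : E →L[ℝ] X} {ℓ : ℕ} {m μ L c ε a : ℝ}
    (hR : ChainRightInverse P T ℓ m) (hμ : 0 < μ) (hL : 0 ≤ L) (hm : 0 ≤ m)
    (hc : IsSaddleConst μ L m c) (hc0 : 0 < c) (hε : 0 ≤ ε) (hca : c ≤ a * (1 - c * ε))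
    (ha : 0 ≤ a)
    (wE : ℕ → E →L[ℝ] E) (wX : ℕ → X →L[ℝ] X)
    (hP : ∀ τ z, P τ (wE τ z) = wX τ (P τ z))
    (hP' : ∀ τ x, (P τ).adjoint (wX τ x) = wE τ ((P τ).adjoint x))
    (hT : ∀ τ < ℓ, ∀ z, ‖wX (τ + 1) (T z) - T (wE τ z)‖ ≤ ε * ‖wE τ z‖)
    (hT' : ∀ τ < ℓ, ∀ x, ‖wE τ (T.adjoint x) - T.adjoint (wX (τ + 1) x)‖
      ≤ ε * ‖wX (τ + 1) x‖)
    (z g : ℕ → E) (lam : ℕ → X)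
    (hmono : ∀ τ ≤ ℓ, μ * ‖wE τ (z τ)‖ ^ 2 ≤ ⟪wE τ (g τ), wE τ (z τ)⟫_ℝ)
    (hlip : ∀ τ ≤ ℓ, ‖wE τ (g τ)‖ ≤ L * ‖wE τ (z τ)‖) :
    l2 (ℓ + 1) (fun τ => wE τ (z τ)) + l2 (ℓ + 1) (fun τ => wX τ (lam τ))
      ≤ a * (l2 (ℓ + 1) (fun τ => wE τ (g τ + chainAdj P T ℓ lam τ))
        + l2 (ℓ + 1) (fun τ => wX τ (chainCons P T z τ))) := by
  have h := chain_stability hR hμ hL hm hc (fun τ => wE τ (z τ)) (fun τ => wE τ (g τ))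
    (fun τ => wX τ (lam τ)) hmono hlip
  have h1 : l2 (ℓ + 1) (chainCons P T fun τ => wE τ (z τ))
      ≤ 1 * l2 (ℓ + 1) (fun τ => wX τ (chainCons P T z τ))
        + ε * l2 (ℓ + 1) (fun τ => wE τ (z τ)) := by
    have hpos := l2_shift_le (n := ℓ) (fun τ => ((if τ = 0 then 0 else ‖wE (τ - 1) (z (τ - 1))‖ : ℝ)))
    refine (l2_le_of_le_add (n := ℓ + 1) (x := chainCons P T fun τ => wE τ (z τ))
      (y := fun τ => wX τ (chainCons P T z τ))
      (z := fun τ => (if τ = 0 then 0 else ‖wE (τ - 1) (z (τ - 1))‖ : ℝ)) zero_le_one hε ?_).trans ?_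
    · intro τ hτ
      cases τ with
      | zero => simp [chainCons, hP]
      | succ τ =>
        have := hT τ (by omega) (z τ)
        have e : chainCons P T (fun τ => wE τ (z τ)) (τ + 1)
            = wX (τ + 1) (chainCons P T z (τ + 1)) + (wX (τ + 1) (T (z τ)) - T (wE τ (z τ))) := by
          simp only [chainCons, hP, map_sub]; abel
        rw [e]
        refine (norm_add_le _ _).trans ?_
        simpa using this
    · have : l2 (ℓ + 1) (fun τ => (if τ = 0 then 0 else ‖wE (τ - 1) (z (τ - 1))‖ : ℝ))
          ≤ l2 (ℓ + 1) (fun τ => wE τ (z τ)) := by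
        apply Real.sqrt_le_sqrt
        rw [Finset.sum_range_succ', Finset.sum_range_succ]
        simp
      gcongr
  have h2 : l2 (ℓ + 1) (fun τ => wE τ (g τ) + chainAdj P T ℓ (fun τ => wX τ (lam τ)) τ)
      ≤ 1 * l2 (ℓ + 1) (fun τ => wE τ (g τ + chainAdj P T ℓ lam τ))
        + ε * l2 (ℓ + 1) (fun τ => wX τ (lam τ)) := by
    refine (l2_le_of_le_add (n := ℓ + 1)
      (y := fun τ => wE τ (g τ + chainAdj P T ℓ lam τ))
      (z := fun τ => if τ < ℓ then wX (τ + 1) (lam (τ + 1)) else 0) zero_le_one hε ?_).trans ?_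
    · intro τ hτ
      by_cases hl : τ < ℓ
      · have := hT' τ hl (lam (τ + 1))
        have e : wE τ (g τ) + chainAdj P T ℓ (fun τ => wX τ (lam τ)) τ
            = wE τ (g τ + chainAdj P T ℓ lam τ)
              + (wE τ (T.adjoint (lam (τ + 1))) - T.adjoint (wX (τ + 1) (lam (τ + 1)))) := by
          simp only [chainAdj, if_pos hl, map_sub, map_add, hP']; abel
        rw [e]
        refine (norm_add_le _ _).trans ?_
        simpa [hl] using this
      · have e : wE τ (g τ) + chainAdj P T ℓ (fun τ => wX τ (lam τ)) τ
            = wE τ (g τ + chainAdj P T ℓ lam τ) := by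
          simp [chainAdj, hl, hP']
        rw [e]; simp [hl]
    · gcongr
      exact l2_shift_le (n := ℓ) (fun τ => wX τ (lam τ))
  set A1 := l2 (ℓ + 1) (fun τ => wE τ (z τ))
  set A2 := l2 (ℓ + 1) (fun τ => wX τ (lam τ))
  set B1 := l2 (ℓ + 1) (fun τ => wE τ (g τ + chainAdj P T ℓ lam τ))
  set B2 := l2 (ℓ + 1) (fun τ => wX τ (chainCons P T z τ))
  have hA1 : 0 ≤ A1 := l2_nonneg _
  have hA2 : 0 ≤ A2 := l2_nonneg _
  have hB1 : 0 ≤ B1 := l2_nonneg _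
  have hB2 : 0 ≤ B2 := l2_nonneg _
  -- The commutator terms ε(A1 + A2) are moved to the left side.
  have h3 : (A1 + A2) * (1 - c * ε) ≤ c * (B1 + B2) := by nlinarith
  -- With c > 0 and a ≥ 0 the inequality c ≤ a(1 - cε) already forces cε < 1.
  have h4 : 0 < 1 - c * ε := by
    by_contra hh; push Not at hh; nlinarith
  have h5 : (A1 + A2) * (1 - c * ε) ≤ a * (B1 + B2) * (1 - c * ε) := by nlinarith
  exact le_of_mul_le_mul_right h5 h4

end Chain

/-! ## Stages of a control problem -/

section Stage

variable {X U : Type*} [NormedAddCommGroup X] [InnerProductSpace ℝ X] [CompleteSpace X]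
  [NormedAddCommGroup U] [InnerProductSpace ℝ U] [CompleteSpace U]

/-- The scaled projection of a state-control pair to its state. -/
def stateProj (X U : Type*) [NormedAddCommGroup X] [InnerProductSpace ℝ X]
    [NormedAddCommGroup U] [InnerProductSpace ℝ U] (χ : ℝ) : WithLp 2 (X × U) →L[ℝ] X :=
  χ • WithLp.fstL 2 ℝ X U

/-- The map `(y, v) ↦ A y + B v`. -/
def inputMap (A : X →L[ℝ] X) (B : U →L[ℝ] X) : WithLp 2 (X × U) →L[ℝ] X :=
  A ∘L WithLp.fstL 2 ℝ X U + B ∘L WithLp.sndL 2 ℝ X U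

/-- The block diagonal operator on state-control pairs. -/
def stageDiag (V : X →L[ℝ] X) (W : U →L[ℝ] U) : WithLp 2 (X × U) →L[ℝ] WithLp 2 (X × U) :=
  ((WithLp.prodContinuousLinearEquiv 2 ℝ X U).symm : X × U →L[ℝ] WithLp 2 (X × U)) ∘L
    (V.prodMap W) ∘L
    ((WithLp.prodContinuousLinearEquiv 2 ℝ X U) : WithLp 2 (X × U) →L[ℝ] X × U)

@[simp] lemma stateProj_apply (χ : ℝ) (z : WithLp 2 (X × U)) :
    stateProj X U χ z = χ • z.fst := rfl

@[simp] lemma inputMap_apply (A : X →L[ℝ] X) (B : U →L[ℝ] X) (z : WithLp 2 (X × U)) :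
    inputMap A B z = A z.fst + B z.snd := rfl

@[simp] lemma stageDiag_apply (V : X →L[ℝ] X) (W : U →L[ℝ] U) (z : WithLp 2 (X × U)) :
    stageDiag V W z = WithLp.toLp 2 (V z.fst, W z.snd) := rfl

@[simp] lemma stateProj_adjoint (χ : ℝ) (x : X) :
    (stateProj X U χ).adjoint x = WithLp.toLp 2 (χ • x, 0) := by
  refine ext_inner_right ℝ fun z => ?_
  rw [ContinuousLinearMap.adjoint_inner_left]
  simp [WithLp.prod_inner_apply, inner_smul_left, inner_smul_right]

@[simp] lemma inputMap_adjoint (A : X →L[ℝ] X) (B : U →L[ℝ] X) (x : X) :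
    (inputMap A B).adjoint x = WithLp.toLp 2 (A.adjoint x, B.adjoint x) := by
  refine ext_inner_right ℝ fun z => ?_
  rw [ContinuousLinearMap.adjoint_inner_left]
  simp [WithLp.prod_inner_apply, inner_add_right, ContinuousLinearMap.adjoint_inner_left]

lemma norm_pair_le (y : X) (v : U) : ‖(WithLp.toLp 2 (y, v) : WithLp 2 (X × U))‖ ≤ ‖y‖ + ‖v‖ := by
  have h := WithLp.prod_norm_sq_eq_of_L2 (WithLp.toLp 2 (y, v) : WithLp 2 (X × U))
  simp only [WithLp.toLp_fst, WithLp.toLp_snd] at h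
  nlinarith [norm_nonneg y, norm_nonneg v, norm_nonneg (WithLp.toLp 2 (y, v) : WithLp 2 (X × U))]

lemma norm_fst_le_pair (y : X) (v : U) : ‖y‖ ≤ ‖(WithLp.toLp 2 (y, v) : WithLp 2 (X × U))‖ := by
  have h := WithLp.prod_norm_sq_eq_of_L2 (WithLp.toLp 2 (y, v) : WithLp 2 (X × U))
  simp only [WithLp.toLp_fst, WithLp.toLp_snd] at h
  nlinarith [norm_nonneg y, norm_nonneg v, norm_nonneg (WithLp.toLp 2 (y, v) : WithLp 2 (X × U))]

lemma norm_snd_le_pair (y : X) (v : U) : ‖v‖ ≤ ‖(WithLp.toLp 2 (y, v) : WithLp 2 (X × U))‖ := by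
  have h := WithLp.prod_norm_sq_eq_of_L2 (WithLp.toLp 2 (y, v) : WithLp 2 (X × U))
  simp only [WithLp.toLp_fst, WithLp.toLp_snd] at h
  nlinarith [norm_nonneg y, norm_nonneg v, norm_nonneg (WithLp.toLp 2 (y, v) : WithLp 2 (X × U))]

/-- Right inverse of norm at most `m` for the dynamics over `ℓ` steps; the factors `χ` allow
states to be dropped from the unknowns. -/
def OcpRightInverse (A : X →L[ℝ] X) (B : U →L[ℝ] X) (χ : ℕ → ℝ) (ℓ : ℕ) (m : ℝ) : Prop :=
  ChainRightInverse (fun τ => stateProj X U (χ τ)) (inputMap A B) ℓ m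

/-- The constants of the weighted stability estimate. -/
structure IsDecayConst (μ L m c ε a : ℝ) : Prop where
  mu_pos : 0 < μ
  L_nonneg : 0 ≤ L
  m_nonneg : 0 ≤ m
  saddle : IsSaddleConst μ L m c
  c_pos : 0 < c
  eps_nonneg : 0 ≤ ε
  a_nonneg : 0 ≤ a
  le : c ≤ a * (1 - c * ε)

/-- The residual pair of the stationarity conditions. -/
def statRes (A : X →L[ℝ] X) (B : U →L[ℝ] X) (χ : ℕ → ℝ) (ℓ : ℕ) (gy : ℕ → X) (gv : ℕ → U)
    (lam : ℕ → X) (τ : ℕ) : WithLp 2 (X × U) :=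
  WithLp.toLp 2 (gy τ + χ τ • lam τ - (if τ < ℓ then A.adjoint (lam (τ + 1)) else 0),
    gv τ - (if τ < ℓ then B.adjoint (lam (τ + 1)) else 0))

/-- The residual of the dynamics. -/
def dynRes (A : X →L[ℝ] X) (B : U →L[ℝ] X) (χ : ℕ → ℝ) (y : ℕ → X) (v : ℕ → U) : ℕ → X
  | 0 => χ 0 • y 0
  | τ + 1 => χ (τ + 1) • y (τ + 1) - (A (y τ) + B (v τ))

/-- The chain estimate for stages z = (y, v). The commutators of A and B contribute ε each, which is
why the decay constants are taken at 2 * ε. -/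
theorem ocp_weighted_stability {A : X →L[ℝ] X} {B : U →L[ℝ] X} {χ : ℕ → ℝ} {ℓ : ℕ}
    {m μ L c ε a : ℝ} (hR : OcpRightInverse A B χ ℓ m) (hc : IsDecayConst μ L m c (2 * ε) a)
    (WX : ℕ → X →L[ℝ] X) (WU : ℕ → U →L[ℝ] U)
    (hA : ∀ τ < ℓ, ∀ y, ‖WX (τ + 1) (A y) - A (WX τ y)‖ ≤ ε * ‖WX τ y‖)
    (hB : ∀ τ < ℓ, ∀ v, ‖WX (τ + 1) (B v) - B (WU τ v)‖ ≤ ε * ‖WU τ v‖)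
    (hA' : ∀ τ < ℓ, ∀ x, ‖WX τ (A.adjoint x) - A.adjoint (WX (τ + 1) x)‖ ≤ ε * ‖WX (τ + 1) x‖)
    (hB' : ∀ τ < ℓ, ∀ x, ‖WU τ (B.adjoint x) - B.adjoint (WX (τ + 1) x)‖ ≤ ε * ‖WX (τ + 1) x‖)
    (y gy lam : ℕ → X) (v gv : ℕ → U)
    (hy : ∀ τ ≤ ℓ, μ * ‖WX τ (y τ)‖ ^ 2 ≤ ⟪WX τ (gy τ), WX τ (y τ)⟫_ℝ)
    (hv : ∀ τ ≤ ℓ, μ * ‖WU τ (v τ)‖ ^ 2 ≤ ⟪WU τ (gv τ), WU τ (v τ)⟫_ℝ)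
    (hy' : ∀ τ ≤ ℓ, ‖WX τ (gy τ)‖ ≤ L * ‖WX τ (y τ)‖)
    (hv' : ∀ τ ≤ ℓ, ‖WU τ (gv τ)‖ ≤ L * ‖WU τ (v τ)‖) :
    l2 (ℓ + 1) (fun τ => (WithLp.toLp 2 (WX τ (y τ), WU τ (v τ)) : WithLp 2 (X × U)))
        + l2 (ℓ + 1) (fun τ => WX τ (lam τ))
      ≤ a * (l2 (ℓ + 1) (fun τ => stageDiag (WX τ) (WU τ) (statRes A B χ ℓ gy gv lam τ))
        + l2 (ℓ + 1) (fun τ => WX τ (dynRes A B χ y v τ))) := by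
  have hε : 0 ≤ ε := by have := hc.eps_nonneg; linarith
  have h := chain_weighted_stability (ℓ := ℓ) hR hc.mu_pos hc.L_nonneg hc.m_nonneg hc.saddle hc.c_pos
    hc.eps_nonneg hc.le hc.a_nonneg (fun τ => stageDiag (WX τ) (WU τ)) WX
    (fun τ z => by simp) (fun τ x => by simp)
    (fun τ hτ z => ?_) (fun τ hτ x => ?_)
    (fun τ => WithLp.toLp 2 (y τ, v τ)) (fun τ => WithLp.toLp 2 (gy τ, gv τ)) lam
    (fun τ hτ => ?_) (fun τ hτ => ?_)
  · have e1 : (fun τ => chainCons (fun τ => stateProj X U (χ τ)) (inputMap A B)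
        (fun τ => (WithLp.toLp 2 (y τ, v τ) : WithLp 2 (X × U))) τ) = dynRes A B χ y v := by
      funext τ; cases τ <;> simp [chainCons, dynRes]
    have e2 : (fun τ => (WithLp.toLp 2 (gy τ, gv τ) : WithLp 2 (X × U))
        + chainAdj (fun τ => stateProj X U (χ τ)) (inputMap A B) ℓ lam τ)
        = statRes A B χ ℓ gy gv lam := by
      funext τ
      by_cases hl : τ < ℓ
      · simp only [chainAdj, statRes, hl, if_true, stateProj_adjoint, inputMap_adjoint]
        rw [← WithLp.toLp_sub, ← WithLp.toLp_add, Prod.mk_sub_mk, Prod.mk_add_mk]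
        congr 2 <;> abel
      · simp only [chainAdj, statRes, hl, if_false, stateProj_adjoint, sub_zero]
        rw [← WithLp.toLp_add, Prod.mk_add_mk, add_zero]
    have e1' := fun τ => congrFun e1 τ
    have e2' := fun τ => congrFun e2 τ
    simp only [e1', e2'] at h
    exact h
  · simp only [inputMap_apply, stageDiag_apply, map_add, WithLp.toLp_fst, WithLp.toLp_snd]
    have e : WX (τ + 1) (A z.fst) + WX (τ + 1) (B z.snd) - (A (WX τ z.fst) + B (WU τ z.snd))
        = (WX (τ + 1) (A z.fst) - A (WX τ z.fst)) + (WX (τ + 1) (B z.snd) - B (WU τ z.snd)) := by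
      abel
    rw [e]
    refine (norm_add_le _ _).trans ((add_le_add (hA τ hτ _) (hB τ hτ _)).trans ?_)
    have h1 := norm_fst_le_pair (WX τ z.fst) (WU τ z.snd)
    have h2 := norm_snd_le_pair (WX τ z.fst) (WU τ z.snd)
    nlinarith
  · simp only [inputMap_adjoint, stageDiag_apply]
    rw [← WithLp.toLp_sub]
    refine (norm_pair_le _ _).trans ((add_le_add (hA' τ hτ x) (hB' τ hτ x)).trans ?_)
    linarith
  · have h1 := WithLp.prod_norm_sq_eq_of_L2
      (WithLp.toLp 2 (WX τ (y τ), WU τ (v τ)) : WithLp 2 (X × U))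
    simp only [stageDiag_apply, WithLp.prod_inner_apply, h1, WithLp.toLp_fst, WithLp.toLp_snd]
    have := hy τ hτ
    have := hv τ hτ
    linarith
  · have h1 := WithLp.prod_norm_sq_eq_of_L2
      (WithLp.toLp 2 (WX τ (y τ), WU τ (v τ)) : WithLp 2 (X × U))
    have h2 := WithLp.prod_norm_sq_eq_of_L2
      (WithLp.toLp 2 (WX τ (gy τ), WU τ (gv τ)) : WithLp 2 (X × U))
    simp only [stageDiag_apply]
    simp only [WithLp.toLp_fst, WithLp.toLp_snd] at h1 h2 ⊢
    have hL := hc.L_nonneg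
    apply abs_le_of_sq_le_sq' _ (by positivity) |>.2
    rw [mul_pow, h1, h2]
    have := pow_le_pow_left₀ (norm_nonneg _) (hy' τ hτ) 2
    have := pow_le_pow_left₀ (norm_nonneg _) (hv' τ hτ) 2
    nlinarith

/-- Distance of two times. -/
def tdist (m n : ℕ) : ℕ := ((m : ℤ) - n).natAbs

@[simp] lemma tdist_self (n : ℕ) : tdist n n = 0 := by simp [tdist]

/-- Consecutive weights differ by a factor q or q⁻¹, and 1 - q ≤ q⁻¹ - 1. The dynamics need the
bound relative to the weight at τ, the adjoint relative to the weight at τ + 1. -/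
lemma abs_pow_tdist_sub_le {q : ℝ} (hq : 0 < q) (hq1 : q ≤ 1) (n τ : ℕ) :
    |q ^ tdist (τ + 1) n - q ^ tdist τ n| ≤ (q⁻¹ - 1) * q ^ tdist τ n ∧
    |q ^ tdist (τ + 1) n - q ^ tdist τ n| ≤ (q⁻¹ - 1) * q ^ tdist (τ + 1) n := by
  have hi : 1 ≤ q⁻¹ := (one_le_inv₀ hq).2 hq1
  have h1 : ∀ k : ℕ, |q ^ (k + 1) - q ^ k| ≤ (q⁻¹ - 1) * q ^ k ∧
      |q ^ (k + 1) - q ^ k| ≤ (q⁻¹ - 1) * q ^ (k + 1) := fun k => by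
    have hk : 0 < q ^ k := pow_pos hq k
    have e : |q ^ (k + 1) - q ^ k| = (1 - q) * q ^ k := by
      rw [abs_sub_comm, abs_of_nonneg]
      · rw [pow_succ]; ring
      · rw [pow_succ]; nlinarith
    have e2 : (q⁻¹ - 1) * q ^ (k + 1) = (1 - q) * q ^ k := by
      rw [pow_succ]; field_simp
    refine ⟨?_, by rw [e, e2]⟩
    rw [e]
    refine mul_le_mul_of_nonneg_right ?_ hk.le
    have : q * q⁻¹ = 1 := mul_inv_cancel₀ hq.ne'
    nlinarith
  rcases lt_or_ge τ n with h | h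
  · have e : tdist τ n = tdist (τ + 1) n + 1 := by unfold tdist; omega
    rw [e, abs_sub_comm]
    exact ⟨(h1 _).2, (h1 _).1⟩
  · have e : tdist (τ + 1) n = tdist τ n + 1 := by unfold tdist; omega
    rw [e]
    exact h1 _

lemma norm_smul_map_sub_le {Y Z : Type*} [NormedAddCommGroup Y] [NormedSpace ℝ Y]
    [NormedAddCommGroup Z] [NormedSpace ℝ Z] {M : Y →L[ℝ] Z} {L ε r s t : ℝ} (hM : ‖M‖ ≤ L)
    (hr : 0 ≤ r) (ht : 0 ≤ t) (h : |s - t| ≤ r * t) (hrε : r * L ≤ ε) (x : Y) :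
    ‖s • M x - M (t • x)‖ ≤ ε * ‖t • x‖ := by
  have h1 : ‖M x‖ ≤ L * ‖x‖ := (M.le_opNorm x).trans (by gcongr)
  rw [map_smul, ← sub_smul, norm_smul, norm_smul, Real.norm_eq_abs, Real.norm_eq_abs,
    abs_of_nonneg ht]
  calc _ ≤ (r * t) * (L * ‖x‖) := mul_le_mul h h1 (norm_nonneg _) (mul_nonneg hr ht)
    _ = r * L * (t * ‖x‖) := by ring
    _ ≤ _ := mul_le_mul_of_nonneg_right hrε (mul_nonneg ht (norm_nonneg _))

lemma inner_smul_smul_ge {Y : Type*} [NormedAddCommGroup Y] [InnerProductSpace ℝ Y] {g x : Y}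
    {μ : ℝ} (h : μ * ‖x‖ ^ 2 ≤ ⟪g, x⟫_ℝ) (w : ℝ) : μ * ‖w • x‖ ^ 2 ≤ ⟪w • g, w • x⟫_ℝ := by
  rw [norm_smul, real_inner_smul_left, real_inner_smul_right, mul_pow, Real.norm_eq_abs, sq_abs]
  nlinarith [mul_le_mul_of_nonneg_left h (sq_nonneg w)]

lemma norm_smul_le_mul {Y : Type*} [NormedAddCommGroup Y] [NormedSpace ℝ Y] {g x : Y}
    {L : ℝ} (h : ‖g‖ ≤ L * ‖x‖) (w : ℝ) : ‖w • g‖ ≤ L * ‖w • x‖ := by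
  rw [norm_smul, norm_smul]
  nlinarith [mul_le_mul_of_nonneg_left h (norm_nonneg w)]

lemma stageDiag_smul_id (w : ℝ) (z : WithLp 2 (X × U)) :
    stageDiag (w • ContinuousLinearMap.id ℝ X) (w • ContinuousLinearMap.id ℝ U) z = w • z := rfl

/-- Exponential decay in time of the influence of residuals. -/
theorem ocp_time_decay {A : X →L[ℝ] X} {B : U →L[ℝ] X} {χ : ℕ → ℝ} {ℓ : ℕ}
    {m μ L c ε a q : ℝ} (hR : OcpRightInverse A B χ ℓ m) (hc : IsDecayConst μ L m c (2 * ε) a)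
    (hnA : ‖A‖ ≤ L) (hnB : ‖B‖ ≤ L) (hq : 0 < q) (hq1 : q ≤ 1) (hqε : (q⁻¹ - 1) * L ≤ ε)
    (y gy lam : ℕ → X) (v gv : ℕ → U)
    (hy : ∀ τ ≤ ℓ, μ * ‖y τ‖ ^ 2 ≤ ⟪gy τ, y τ⟫_ℝ)
    (hv : ∀ τ ≤ ℓ, μ * ‖v τ‖ ^ 2 ≤ ⟪gv τ, v τ⟫_ℝ)
    (hy' : ∀ τ ≤ ℓ, ‖gy τ‖ ≤ L * ‖y τ‖) (hv' : ∀ τ ≤ ℓ, ‖gv τ‖ ≤ L * ‖v τ‖) (n : ℕ) :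
    l2 (ℓ + 1) (fun τ => q ^ tdist τ n • (WithLp.toLp 2 (y τ, v τ) : WithLp 2 (X × U)))
        + l2 (ℓ + 1) (fun τ => q ^ tdist τ n • lam τ)
      ≤ a * (l2 (ℓ + 1) (fun τ => q ^ tdist τ n • statRes A B χ ℓ gy gv lam τ)
        + l2 (ℓ + 1) (fun τ => q ^ tdist τ n • dynRes A B χ y v τ)) := by
  have hw : ∀ τ, 0 ≤ q ^ tdist τ n := fun τ => (pow_pos hq _).le
  have hi : 0 ≤ q⁻¹ - 1 := sub_nonneg.2 ((one_le_inv₀ hq).2 hq1)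
  have hA' : ‖A.adjoint‖ ≤ L := by simpa using hnA
  have hB' : ‖B.adjoint‖ ≤ L := by simpa using hnB
  have hs := fun τ => (abs_pow_tdist_sub_le hq hq1 n τ).1
  have hs' : ∀ τ, |q ^ tdist τ n - q ^ tdist (τ + 1) n| ≤ (q⁻¹ - 1) * q ^ tdist (τ + 1) n :=
    fun τ => by rw [abs_sub_comm]; exact (abs_pow_tdist_sub_le hq hq1 n τ).2
  have h := ocp_weighted_stability hR hc
    (fun τ => q ^ tdist τ n • ContinuousLinearMap.id ℝ X)
    (fun τ => q ^ tdist τ n • ContinuousLinearMap.id ℝ U)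
    (fun τ _ x => norm_smul_map_sub_le hnA hi (hw τ) (hs τ) hqε x)
    (fun τ _ x => norm_smul_map_sub_le hnB hi (hw τ) (hs τ) hqε x)
    (fun τ _ x => norm_smul_map_sub_le hA' hi (hw (τ + 1)) (hs' τ) hqε x)
    (fun τ _ x => norm_smul_map_sub_le hB' hi (hw (τ + 1)) (hs' τ) hqε x)
    y gy lam v gv (fun τ hτ => inner_smul_smul_ge (hy τ hτ) _)
    (fun τ hτ => inner_smul_smul_ge (hv τ hτ) _)
    (fun τ hτ => norm_smul_le_mul (hy' τ hτ) _) (fun τ hτ => norm_smul_le_mul (hv' τ hτ) _)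
  simp only [stageDiag_smul_id] at h
  exact h

end Stage

/-! ## First order conditions -/

section KKT

variable {X U : Type*} [NormedAddCommGroup X] [InnerProductSpace ℝ X] [CompleteSpace X]
  [NormedAddCommGroup U] [InnerProductSpace ℝ U] [CompleteSpace U]

/-- First order conditions with costate `lam` for the problem with gradient maps `Gy`, `Gv` of the
stage costs and `Gl` of the terminal cost. -/
structure IsKKT (A : X →L[ℝ] X) (B : U →L[ℝ] X) (ℓ : ℕ) (Gy : ℕ → X → X) (Gv : ℕ → U → U)
    (Gl : X → X) (x : X) (ζ : ℕ → X) (y : ℕ → X) (v : ℕ → U) (lam : ℕ → X) : Prop where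
  init : y 0 = x
  dyn : ∀ τ < ℓ, y (τ + 1) = A (y τ) + B (v τ) + ζ τ
  statX : ∀ τ < ℓ, Gy τ (y τ) + lam τ = A.adjoint (lam (τ + 1))
  statU : ∀ τ < ℓ, Gv τ (v τ) = B.adjoint (lam (τ + 1))
  final : Gl (y ℓ) + lam ℓ = 0

/-- Response of the state to the controls `v`, from the zero state. -/
def response (A : X →L[ℝ] X) (B : U →L[ℝ] X) (v : ℕ → U) : ℕ → X
  | 0 => 0
  | τ + 1 => A (response A B v τ) + B (v τ)

/-- Backward recursion for the costate, started at `-gl`. -/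
def backward (A : X →L[ℝ] X) (gy : ℕ → X) (gl : X) (ℓ : ℕ) : ℕ → X
  | 0 => -gl
  | s + 1 => A.adjoint (backward A gy gl ℓ s) - gy (ℓ - 1 - s)

/-- The backward recursion satisfies the state equation and the end condition for arbitrary data;
only stationarity in the controls uses the vanishing first variation. -/
theorem exists_costate (A : X →L[ℝ] X) (B : U →L[ℝ] X) (ℓ : ℕ) (gy : ℕ → X) (gv : ℕ → U) (gl : X)
    (h : ∀ v : ℕ → U, ∑ τ ∈ Finset.range ℓ, (⟪gy τ, response A B v τ⟫_ℝ + ⟪gv τ, v τ⟫_ℝ)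
      + ⟪gl, response A B v ℓ⟫_ℝ = 0) :
    ∃ lam : ℕ → X, (∀ τ < ℓ, gy τ + lam τ = A.adjoint (lam (τ + 1))) ∧
      (∀ τ < ℓ, gv τ = B.adjoint (lam (τ + 1))) ∧ gl + lam ℓ = 0 := by
  set lam : ℕ → X := fun τ => backward A gy gl ℓ (ℓ - τ) with hlam
  have h1 : ∀ τ < ℓ, gy τ + lam τ = A.adjoint (lam (τ + 1)) := fun τ hτ => by
    have e : ℓ - τ = (ℓ - (τ + 1)) + 1 := by omega
    have e' : ℓ - 1 - (ℓ - (τ + 1)) = τ := by omega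
    simp only [hlam]
    rw [e, backward, e']
    abel
  have h2 : gl + lam ℓ = 0 := by simp [hlam, backward]
  refine ⟨lam, h1, ?_, h2⟩
  -- After summation by parts the first variation in a direction v is the sum of ⟨gv - B*lam, v⟩.
  -- Taking v to be this defect makes it a sum of squares.
  set v : ℕ → U := fun τ => gv τ - B.adjoint (lam (τ + 1)) with hv
  have h3 : ∀ n ≤ ℓ, ∑ τ ∈ Finset.range n, ⟪gy τ, response A B v τ⟫_ℝ
      = ⟪lam n, response A B v n⟫_ℝ
        - ∑ τ ∈ Finset.range n, ⟪B.adjoint (lam (τ + 1)), v τ⟫_ℝ := by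
    intro n
    induction n with
    | zero => intro _; simp [response]
    | succ n ih =>
      intro hn
      rw [Finset.sum_range_succ, Finset.sum_range_succ, ih (by omega)]
      have e : gy n = A.adjoint (lam (n + 1)) - lam n := by rw [← h1 n (by omega)]; abel
      rw [e, inner_sub_left, ContinuousLinearMap.adjoint_inner_left,
        ContinuousLinearMap.adjoint_inner_left, response, inner_add_right]
      ring
  have h4 := h v
  have h5 : gl = -lam ℓ := eq_neg_of_add_eq_zero_left h2
  rw [Finset.sum_add_distrib, h3 ℓ le_rfl, h5, inner_neg_left] at h4
  have h6 : ∑ τ ∈ Finset.range ℓ, ‖v τ‖ ^ 2 = 0 := by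
    have : ∑ τ ∈ Finset.range ℓ, ‖v τ‖ ^ 2 = ∑ τ ∈ Finset.range ℓ, ⟪gv τ, v τ⟫_ℝ
        - ∑ τ ∈ Finset.range ℓ, ⟪B.adjoint (lam (τ + 1)), v τ⟫_ℝ := by
      rw [← Finset.sum_sub_distrib]
      refine Finset.sum_congr rfl fun τ _ => ?_
      rw [← inner_sub_left, ← real_inner_self_eq_norm_sq]
    rw [this]; linarith
  intro τ hτ
  have h7 := (Finset.sum_eq_zero_iff_of_nonneg fun _ _ => sq_nonneg _).1 h6 τ
    (Finset.mem_range.2 hτ)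
  have h8 : v τ = 0 := by simpa using h7
  exact sub_eq_zero.1 h8

lemma response_add (A : X →L[ℝ] X) (B : U →L[ℝ] X) (v w : ℕ → U) (τ : ℕ) :
    response A B (v + w) τ = response A B v τ + response A B w τ := by
  induction τ with
  | zero => simp [response]
  | succ τ ih => simp only [response, ih, map_add, Pi.add_apply]; abel

lemma response_smul (A : X →L[ℝ] X) (B : U →L[ℝ] X) (t : ℝ) (v : ℕ → U) (τ : ℕ) :
    response A B (t • v) τ = t • response A B v τ := by
  induction τ with
  | zero => simp [response]
  | succ τ ih => simp [response, ih]

/-- Multiplier for a prescribed final state. -/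
theorem exists_terminal_multiplier [FiniteDimensional ℝ X] (A : X →L[ℝ] X) (B : U →L[ℝ] X)
    (ℓ : ℕ) (gy : ℕ → X) (gv : ℕ → U)
    (h : ∀ v : ℕ → U, response A B v ℓ = 0 →
      ∑ τ ∈ Finset.range ℓ, (⟪gy τ, response A B v τ⟫_ℝ + ⟪gv τ, v τ⟫_ℝ) = 0) :
    ∃ gl : X, ∀ v : ℕ → U,
      ∑ τ ∈ Finset.range ℓ, (⟪gy τ, response A B v τ⟫_ℝ + ⟪gv τ, v τ⟫_ℝ)
        + ⟪gl, response A B v ℓ⟫_ℝ = 0 := by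
  let R : (ℕ → U) →ₗ[ℝ] X :=
    { toFun := fun v => response A B v ℓ
      map_add' := fun v w => response_add A B v w ℓ
      map_smul' := fun t v => response_smul A B t v ℓ }
  let Φ : (ℕ → U) →ₗ[ℝ] ℝ :=
    { toFun := fun v => ∑ τ ∈ Finset.range ℓ, (⟪gy τ, response A B v τ⟫_ℝ + ⟪gv τ, v τ⟫_ℝ)
      map_add' := fun v w => by
        rw [← Finset.sum_add_distrib]
        refine Finset.sum_congr rfl fun τ _ => ?_
        rw [response_add, Pi.add_apply, inner_add_right, inner_add_right]; ring
      map_smul' := fun t v => by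
        simp only [RingHom.id_apply, smul_eq_mul]
        rw [Finset.mul_sum]
        refine Finset.sum_congr rfl fun τ _ => ?_
        rw [response_smul, Pi.smul_apply, inner_smul_right, inner_smul_right]; ring }
  -- The first variation vanishes on the kernel of the end state map R, so it factors through R; the
  -- factor, with opposite sign, represents the multiplier.
  have hΦ : Φ ∈ R.ker.dualAnnihilator := by
    rw [Submodule.mem_dualAnnihilator]
    exact fun v hv => h v hv
  rw [← LinearMap.range_dualMap_eq_dualAnnihilator_ker] at hΦ
  obtain ⟨ψ, hψ⟩ := hΦ
  refine ⟨-(InnerProductSpace.toDual ℝ X).symm (LinearMap.toContinuousLinearMap ψ), fun v => ?_⟩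
  have h1 : Φ v = ψ (R v) := by rw [← hψ]; rfl
  have h2 : ⟪(InnerProductSpace.toDual ℝ X).symm (LinearMap.toContinuousLinearMap ψ),
      response A B v ℓ⟫_ℝ = ψ (R v) := by
    rw [InnerProductSpace.toDual_symm_apply]; rfl
  rw [inner_neg_left, h2, ← h1]
  exact add_neg_cancel _

lemma hasDerivAt_comp_line {h : X → ℝ} {x g : X} (hh : HasGradientAt h g x) (w : X) :
    HasDerivAt (fun t : ℝ => h (x + t • w)) ⟪g, w⟫_ℝ 0 := by
  have h1 : HasDerivAt (fun t : ℝ => x + t • w) w 0 := by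
    simpa using ((hasDerivAt_id (0 : ℝ)).smul_const w).const_add x
  have h2 : HasFDerivAt h (InnerProductSpace.toDual ℝ X g) (x + (0 : ℝ) • w) := by
    rw [zero_smul, add_zero]; exact hh.hasFDerivAt
  exact h2.comp_hasDerivAt 0 h1

/-- Directional derivative of the total cost at a minimizer along a family of competitors. -/
theorem first_order_condition {ℓ : ℕ} {f : ℕ → X → ℝ} {c : ℕ → U → ℝ} {g : X → ℝ}
    {y y' : ℕ → X} {v v' : ℕ → U} {gy : ℕ → X} {gv : ℕ → U} {gl : X}
    (hf : ∀ τ < ℓ, HasGradientAt (f τ) (gy τ) (y τ))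
    (hc : ∀ τ < ℓ, HasGradientAt (c τ) (gv τ) (v τ)) (hg : HasGradientAt g gl (y ℓ))
    (hmin : ∀ t : ℝ, ∑ τ ∈ Finset.range ℓ, (f τ (y τ) + c τ (v τ)) + g (y ℓ)
      ≤ ∑ τ ∈ Finset.range ℓ, (f τ (y τ + t • y' τ) + c τ (v τ + t • v' τ))
        + g (y ℓ + t • y' ℓ)) :
    ∑ τ ∈ Finset.range ℓ, (⟪gy τ, y' τ⟫_ℝ + ⟪gv τ, v' τ⟫_ℝ) + ⟪gl, y' ℓ⟫_ℝ = 0 := by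
  have hd : HasDerivAt (fun t : ℝ => ∑ τ ∈ Finset.range ℓ,
      (f τ (y τ + t • y' τ) + c τ (v τ + t • v' τ)) + g (y ℓ + t • y' ℓ))
      (∑ τ ∈ Finset.range ℓ, (⟪gy τ, y' τ⟫_ℝ + ⟪gv τ, v' τ⟫_ℝ) + ⟪gl, y' ℓ⟫_ℝ) 0 := by
    refine HasDerivAt.add (HasDerivAt.fun_sum fun τ hτ => ?_) (hasDerivAt_comp_line hg _)
    have hτ' := Finset.mem_range.1 hτ
    exact (hasDerivAt_comp_line (hf τ hτ') _).add (hasDerivAt_comp_line (hc τ hτ') _)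
  refine IsLocalMin.hasDerivAt_eq_zero (Filter.Eventually.of_forall fun t => ?_) hd
  simpa using hmin t

/-- Optimal trajectories with free final state satisfy the first order conditions. -/
theorem exists_isKKT {A : X →L[ℝ] X} {B : U →L[ℝ] X} {ℓ : ℕ} {f : ℕ → X → ℝ} {c : ℕ → U → ℝ}
    {g : X → ℝ} {Gy : ℕ → X → X} {Gv : ℕ → U → U} {Gl : X → X} {x : X} {ζ y : ℕ → X} {v : ℕ → U}
    (hf : ∀ τ < ℓ, ∀ z, HasGradientAt (f τ) (Gy τ z) z)
    (hc : ∀ τ < ℓ, ∀ z, HasGradientAt (c τ) (Gv τ z) z) (hg : HasGradientAt g (Gl (y ℓ)) (y ℓ))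
    (h0 : y 0 = x) (hd : ∀ τ < ℓ, y (τ + 1) = A (y τ) + B (v τ) + ζ τ)
    (hmin : ∀ (y' : ℕ → X) (v' : ℕ → U), y' 0 = x →
      (∀ τ < ℓ, y' (τ + 1) = A (y' τ) + B (v' τ) + ζ τ) →
      ∑ τ ∈ Finset.range ℓ, (f τ (y τ) + c τ (v τ)) + g (y ℓ)
        ≤ ∑ τ ∈ Finset.range ℓ, (f τ (y' τ) + c τ (v' τ)) + g (y' ℓ)) :
    ∃ lam, IsKKT A B ℓ Gy Gv Gl x ζ y v lam := by
  obtain ⟨lam, h1, h2, h3⟩ := exists_costate A B ℓ (fun τ => Gy τ (y τ)) (fun τ => Gv τ (v τ))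
    (Gl (y ℓ)) (fun v' => first_order_condition (fun τ hτ => hf τ hτ _) (fun τ hτ => hc τ hτ _) hg
      fun t => hmin _ (fun τ => v τ + t • v' τ) (by simp [response, h0]) fun τ hτ => by
        simp only [hd τ hτ, response, map_add, map_smul, smul_add]; abel)
  exact ⟨lam, h0, hd, h1, h2, h3⟩

/-- Optimal trajectories with prescribed final state satisfy the first order conditions with some
terminal gradient. -/
theorem exists_isKKT_terminal [FiniteDimensional ℝ X] {A : X →L[ℝ] X} {B : U →L[ℝ] X} {ℓ : ℕ}
    {f : ℕ → X → ℝ} {c : ℕ → U → ℝ} {g : X → ℝ} {Gy : ℕ → X → X} {Gv : ℕ → U → U} {x z : X}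
    {ζ y : ℕ → X} {v : ℕ → U}
    (hf : ∀ τ < ℓ, ∀ z, HasGradientAt (f τ) (Gy τ z) z)
    (hc : ∀ τ < ℓ, ∀ z, HasGradientAt (c τ) (Gv τ z) z)
    (h0 : y 0 = x) (hd : ∀ τ < ℓ, y (τ + 1) = A (y τ) + B (v τ) + ζ τ) (hz : y ℓ = z)
    (hmin : ∀ (y' : ℕ → X) (v' : ℕ → U), y' 0 = x →
      (∀ τ < ℓ, y' (τ + 1) = A (y' τ) + B (v' τ) + ζ τ) → y' ℓ = z →
      ∑ τ ∈ Finset.range ℓ, (f τ (y τ) + c τ (v τ)) + g (y ℓ)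
        ≤ ∑ τ ∈ Finset.range ℓ, (f τ (y' τ) + c τ (v' τ)) + g (y' ℓ)) :
    ∃ lam gl, IsKKT A B ℓ Gy Gv (fun _ => gl) x ζ y v lam := by
  obtain ⟨gl, hgl⟩ := exists_terminal_multiplier A B ℓ (fun τ => Gy τ (y τ)) (fun τ => Gv τ (v τ))
    (fun v' hv' => by
      have := first_order_condition (ℓ := ℓ) (y := y) (v := v) (y' := response A B v') (v' := v')
        (g := fun _ => 0) (gl := 0) (fun τ hτ => hf τ hτ _) (fun τ hτ => hc τ hτ _)
        (hasGradientAt_const _ _)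
        (fun t => by
          have := hmin (fun τ => y τ + t • response A B v' τ) (fun τ => v τ + t • v' τ)
            (by simp [response, h0]) (fun τ hτ => by
              simp only [hd τ hτ, response, map_add, map_smul, smul_add]; abel)
            (by simp [hv', hz])
          simpa [hv'] using this)
      simpa using this)
  obtain ⟨lam, h1, h2, h3⟩ := exists_costate A B ℓ _ _ gl hgl
  exact ⟨lam, gl, h0, hd, h1, h2, h3⟩

/-- The trajectory from `x` under the controls `v` and disturbances `ζ`. -/
def rollout (A : X →L[ℝ] X) (B : U →L[ℝ] X) (x : X) (ζ : ℕ → X) (v : ℕ → U) : ℕ → X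
  | 0 => x
  | τ + 1 => A (rollout A B x ζ v τ) + B (v τ) + ζ τ

/-- Existence of optimal trajectories. -/
theorem exists_optimal [FiniteDimensional ℝ U] (A : X →L[ℝ] X) (B : U →L[ℝ] X) (ℓ : ℕ)
    {f : ℕ → X → ℝ} {c : ℕ → U → ℝ} {g : X → ℝ} (x : X) (ζ : ℕ → X) {r : ℝ} (hr : 0 < r)
    (hf : ∀ τ < ℓ, Continuous (f τ)) (hc : ∀ τ < ℓ, Continuous (c τ)) (hg : Continuous g)
    (hf0 : ∀ τ < ℓ, ∀ z, 0 ≤ f τ z) (hc0 : ∀ τ < ℓ, ∀ w, r * ‖w‖ ^ 2 ≤ c τ w)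
    (hg0 : ∀ z, 0 ≤ g z) :
    ∃ (y : ℕ → X) (v : ℕ → U), y 0 = x ∧ (∀ τ < ℓ, y (τ + 1) = A (y τ) + B (v τ) + ζ τ) ∧
      ∀ (y' : ℕ → X) (v' : ℕ → U), y' 0 = x →
        (∀ τ < ℓ, y' (τ + 1) = A (y' τ) + B (v' τ) + ζ τ) →
        ∑ τ ∈ Finset.range ℓ, (f τ (y τ) + c τ (v τ)) + g (y ℓ)
          ≤ ∑ τ ∈ Finset.range ℓ, (f τ (y' τ) + c τ (v' τ)) + g (y' ℓ) := by
  let ext : (Fin ℓ → U) → ℕ → U := fun w τ => if h : τ < ℓ then w ⟨τ, h⟩ else 0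
  have hext : ∀ τ, Continuous fun w => ext w τ := fun τ => by
    by_cases h : τ < ℓ
    · simp only [ext, h, dif_pos]; exact continuous_apply _
    · simp only [ext, h, dif_neg, not_false_eq_true]; exact continuous_const
  have hroll : ∀ τ, Continuous fun w => rollout A B x ζ (ext w) τ := fun τ => by
    induction τ with
    | zero => exact continuous_const
    | succ τ ih =>
      exact ((A.continuous.comp ih).add (B.continuous.comp (hext τ))).add continuous_const
  -- With the states eliminated, the cost is a continuous coercive function of finitely many
  -- controls.
  let φ : (Fin ℓ → U) → ℝ := fun w =>
    ∑ τ ∈ Finset.range ℓ, (f τ (rollout A B x ζ (ext w) τ) + c τ (ext w τ))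
      + g (rollout A B x ζ (ext w) ℓ)
  have hφ : Continuous φ :=
    (continuous_finsetSum _ fun τ hτ =>
      ((hf τ (Finset.mem_range.1 hτ)).comp (hroll τ)).add
        ((hc τ (Finset.mem_range.1 hτ)).comp (hext τ))).add (hg.comp (hroll ℓ))
  have hlow : ∀ w, r * ‖w‖ ^ 2 ≤ φ w := by
    intro w
    have h1 : ∀ τ ∈ Finset.range ℓ, 0 ≤ f τ (rollout A B x ζ (ext w) τ) + c τ (ext w τ) :=
      fun τ hτ => add_nonneg (hf0 τ (Finset.mem_range.1 hτ) _)
        ((by positivity : (0 : ℝ) ≤ r * ‖ext w τ‖ ^ 2).trans (hc0 τ (Finset.mem_range.1 hτ) _))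
    have h2 : ∀ i : Fin ℓ, r * ‖w i‖ ^ 2 ≤ φ w := fun i => by
      have e : w i = ext w i := by simp [ext]
      have h3 := Finset.single_le_sum h1 (Finset.mem_range.2 i.2)
      have h4 := hc0 i i.2 (ext w i)
      have h5 := hf0 i i.2 (rollout A B x ζ (ext w) i)
      have h6 := hg0 (rollout A B x ζ (ext w) ℓ)
      rw [e]
      simp only [φ]
      linarith
    have h0 : 0 ≤ φ w := add_nonneg (Finset.sum_nonneg h1) (hg0 _)
    have h7 : ‖w‖ ≤ Real.sqrt (φ w / r) := by
      refine (pi_norm_le_iff_of_nonneg (Real.sqrt_nonneg _)).2 fun i => ?_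
      apply Real.le_sqrt_of_sq_le
      rw [le_div_iff₀ hr, mul_comm]
      exact h2 i
    have h8 := pow_le_pow_left₀ (norm_nonneg _) h7 2
    rw [Real.sq_sqrt (div_nonneg h0 hr.le), le_div_iff₀ hr] at h8
    linarith
  have hlim : Tendsto φ (cocompact (Fin ℓ → U)) atTop := by
    refine tendsto_atTop_mono hlow ?_
    exact ((tendsto_pow_atTop two_ne_zero).comp (tendsto_norm_cocompact_atTop)).const_mul_atTop hr
  obtain ⟨w, hw⟩ := hφ.exists_forall_le hlim
  refine ⟨rollout A B x ζ (ext w), ext w, rfl, fun τ _ => rfl, fun y' v' h0 hd => ?_⟩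
  have h1 := hw fun i => v' i
  have h2 : ∀ τ < ℓ, ext (fun i => v' i) τ = v' τ := fun τ hτ => by simp [ext, hτ]
  have h3 : ∀ τ ≤ ℓ, rollout A B x ζ (ext fun i => v' i) τ = y' τ := by
    intro τ
    induction τ with
    | zero => intro _; simp [rollout, h0]
    | succ τ ih =>
      intro hτ
      rw [rollout, ih (by omega), h2 τ (by omega), hd τ (by omega)]
  refine h1.trans (le_of_eq ?_)
  simp only [φ]
  rw [h3 ℓ le_rfl]
  congr 1
  refine Finset.sum_congr rfl fun τ hτ => ?_
  have hτ' := Finset.mem_range.1 hτ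
  rw [h3 τ hτ'.le, h2 τ hτ']

end KKT

/-! ## Perturbation bounds in time -/

section Perturb

variable {X U : Type*} [NormedAddCommGroup X] [InnerProductSpace ℝ X] [CompleteSpace X]
  [NormedAddCommGroup U] [InnerProductSpace ℝ U] [CompleteSpace U]

/-- `G` is `μ`-strongly monotone and `L`-Lipschitz. -/
def MonoLip (μ L : ℝ) (G : X → X) : Prop :=
  ∀ x x', μ * ‖x - x'‖ ^ 2 ≤ ⟪G x - G x', x - x'⟫_ℝ ∧ ‖G x - G x'‖ ≤ L * ‖x - x'‖

lemma l2_smul_le_sum {E : Type*} [NormedAddCommGroup E] [NormedSpace ℝ E] {n : ℕ} {w : ℕ → ℝ}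
    {x : ℕ → E} {b : ℕ → ℝ} (hw : ∀ τ, 0 ≤ w τ) (h : ∀ τ < n, ‖x τ‖ ≤ b τ) :
    l2 n (fun τ => w τ • x τ) ≤ ∑ τ ∈ Finset.range n, w τ * b τ := by
  refine (l2_le_sum _).trans (Finset.sum_le_sum fun τ hτ => ?_)
  rw [norm_smul, Real.norm_eq_abs, abs_of_nonneg (hw τ)]
  exact mul_le_mul_of_nonneg_left (h τ (Finset.mem_range.1 hτ)) (hw τ)

/-- Comparison of a solution of the first order conditions with an approximate solution. -/
theorem IsKKT.perturb {A : X →L[ℝ] X} {B : U →L[ℝ] X} {ℓ : ℕ} {m μ L c ε a q : ℝ}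
    (hR : OcpRightInverse A B (fun _ => 1) ℓ m) (hc : IsDecayConst μ L m c (2 * ε) a)
    (hnA : ‖A‖ ≤ L) (hnB : ‖B‖ ≤ L) (hq : 0 < q) (hq1 : q ≤ 1) (hqε : (q⁻¹ - 1) * L ≤ ε)
    {Gy : ℕ → X → X} {Gv : ℕ → U → U} {Gl : X → X} {x : X} {ζ y : ℕ → X} {v : ℕ → U} {lam : ℕ → X}
    (hGy : ∀ τ < ℓ, MonoLip μ L (Gy τ)) (hGv : ∀ τ < ℓ, MonoLip μ L (Gv τ)) (hGl : MonoLip μ L Gl)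
    (hK : IsKKT A B ℓ Gy Gv Gl x ζ y v lam) {y' lam' : ℕ → X} {v' : ℕ → U} {r b : ℕ → ℝ}
    (hr : ∀ τ < ℓ, ‖Gy τ (y' τ) + lam' τ - A.adjoint (lam' (τ + 1))‖
      + ‖Gv τ (v' τ) - B.adjoint (lam' (τ + 1))‖ ≤ r τ)
    (hrl : ‖Gl (y' ℓ) + lam' ℓ‖ ≤ r ℓ) (hb0 : ‖y' 0 - x‖ ≤ b 0)
    (hb : ∀ τ < ℓ, ‖y' (τ + 1) - (A (y' τ) + B (v' τ) + ζ τ)‖ ≤ b (τ + 1)) {n : ℕ} (hn : n ≤ ℓ) :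
    ‖y n - y' n‖ ≤ a * ∑ τ ∈ Finset.range (ℓ + 1), q ^ tdist τ n * (r τ + b τ) ∧
    ‖lam n - lam' n‖ ≤ a * ∑ τ ∈ Finset.range (ℓ + 1), q ^ tdist τ n * (r τ + b τ) ∧
    (n < ℓ → ‖v n - v' n‖ ≤ a * ∑ τ ∈ Finset.range (ℓ + 1), q ^ tdist τ n * (r τ + b τ)) := by
  have h := ocp_time_decay hR hc hnA hnB hq hq1 hqε
    -- Stage ℓ carries the terminal gradient and no control, so a dummy control difference 0 is
    -- inserted there.
    (fun τ => y τ - y' τ) (fun τ => if τ < ℓ then Gy τ (y τ) - Gy τ (y' τ) else Gl (y τ) - Gl (y' τ))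
    (fun τ => lam τ - lam' τ) (fun τ => if τ < ℓ then v τ - v' τ else 0)
    (fun τ => if τ < ℓ then Gv τ (v τ) - Gv τ (v' τ) else 0)
    (fun τ hτ => by by_cases hl : τ < ℓ <;> simp only [hl, if_true, if_false]
                    exacts [(hGy τ hl _ _).1, (hGl _ _).1])
    (fun τ hτ => by by_cases hl : τ < ℓ <;> simp only [hl, if_true, if_false]
                    exacts [(hGv τ hl _ _).1, by simp])
    (fun τ hτ => by by_cases hl : τ < ℓ <;> simp only [hl, if_true, if_false]
                    exacts [(hGy τ hl _ _).2, (hGl _ _).2])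
    (fun τ hτ => by by_cases hl : τ < ℓ <;> simp only [hl, if_true, if_false]
                    exacts [(hGv τ hl _ _).2, by simp]) n
  have hw : ∀ τ, 0 ≤ q ^ tdist τ n := fun τ => (pow_pos hq _).le
  have e1 := l2_smul_le_sum (n := ℓ + 1) (b := r) hw (x := statRes A B (fun _ => 1) ℓ
    (fun τ => if τ < ℓ then Gy τ (y τ) - Gy τ (y' τ) else Gl (y τ) - Gl (y' τ))
    (fun τ => if τ < ℓ then Gv τ (v τ) - Gv τ (v' τ) else 0) (fun τ => lam τ - lam' τ))
    (fun τ hτ => by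
      rcases (Nat.lt_succ_iff.1 hτ).lt_or_eq with hl | hl
      · refine (norm_pair_le _ _).trans (le_trans (add_le_add ?_ ?_) (hr τ hl))
        · simp only [hl, if_true, one_smul, map_sub]
          rw [← norm_neg]
          apply le_of_eq
          congr 1
          rw [← hK.statX τ hl]; abel
        · simp only [hl, if_true, map_sub]
          rw [← norm_neg]
          apply le_of_eq
          congr 1
          rw [← hK.statU τ hl]; abel
      · subst hl
        refine (norm_pair_le _ _).trans (le_trans (le_of_eq ?_) hrl)
        simp only [lt_irrefl, if_false, one_smul, sub_zero, norm_zero, add_zero]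
        rw [← norm_neg]
        congr 1
        rw [eq_neg_of_add_eq_zero_right hK.final]; abel)
  have e2 := l2_smul_le_sum (n := ℓ + 1) (b := b) hw (x := dynRes A B (fun _ => 1)
    (fun τ => y τ - y' τ) (fun τ => if τ < ℓ then v τ - v' τ else 0))
    (fun τ hτ => by
      cases τ with
      | zero => simp only [dynRes, one_smul, hK.init]; rwa [norm_sub_rev]
      | succ τ =>
        have hl : τ < ℓ := by omega
        refine le_trans (le_of_eq ?_) (hb τ hl)
        simp only [dynRes, one_smul, hl, if_true, map_sub]
        rw [← norm_neg]
        congr 1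
        rw [hK.dyn τ hl]; abel)
  have e3 : l2 (ℓ + 1) (fun τ => q ^ tdist τ n •
      (WithLp.toLp 2 (y τ - y' τ, if τ < ℓ then v τ - v' τ else 0) : WithLp 2 (X × U)))
      + l2 (ℓ + 1) (fun τ => q ^ tdist τ n • (lam τ - lam' τ))
      ≤ a * ∑ τ ∈ Finset.range (ℓ + 1), q ^ tdist τ n * (r τ + b τ) := by
    refine h.trans (mul_le_mul_of_nonneg_left ?_ hc.a_nonneg)
    simp only [mul_add, Finset.sum_add_distrib]
    exact add_le_add e1 e2
  have f1 := norm_le_l2 (n := ℓ + 1) (fun τ => q ^ tdist τ n •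
      (WithLp.toLp 2 (y τ - y' τ, if τ < ℓ then v τ - v' τ else 0) : WithLp 2 (X × U)))
      (Nat.lt_succ_of_le hn)
  have f2 := norm_le_l2 (n := ℓ + 1) (fun τ => q ^ tdist τ n • (lam τ - lam' τ))
      (Nat.lt_succ_of_le hn)
  have g1 := l2_nonneg (n := ℓ + 1) (fun τ => q ^ tdist τ n •
      (WithLp.toLp 2 (y τ - y' τ, if τ < ℓ then v τ - v' τ else 0) : WithLp 2 (X × U)))
  have g2 := l2_nonneg (n := ℓ + 1) (fun τ => q ^ tdist τ n • (lam τ - lam' τ))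
  simp only [tdist_self, pow_zero, one_smul] at f1 f2
  refine ⟨?_, by linarith, fun hl => ?_⟩
  · have := norm_fst_le_pair (y n - y' n) (if n < ℓ then v n - v' n else 0)
    linarith
  · have := norm_snd_le_pair (y n - y' n) (if n < ℓ then v n - v' n else 0)
    rw [if_pos hl] at this f1
    linarith

/-- Perturbation bound for problems with prescribed final states. -/
theorem IsKKT.perturb_terminal {A : X →L[ℝ] X} {B : U →L[ℝ] X} {ℓ : ℕ} {m μ L c ε a q : ℝ}
    (hR : OcpRightInverse A B (fun τ => if τ < ℓ then 1 else 0) ℓ m)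
    (hc : IsDecayConst μ L m c (2 * ε) a)
    (hnA : ‖A‖ ≤ L) (hnB : ‖B‖ ≤ L) (hq : 0 < q) (hq1 : q ≤ 1) (hqε : (q⁻¹ - 1) * L ≤ ε)
    {Gy : ℕ → X → X} {Gv : ℕ → U → U} {Gl Gl' : X → X} {x x' : X} {ζ ζ' y y' : ℕ → X}
    {v v' : ℕ → U} {lam lam' : ℕ → X}
    (hGy : ∀ τ < ℓ, MonoLip μ L (Gy τ)) (hGv : ∀ τ < ℓ, MonoLip μ L (Gv τ))
    (hK : IsKKT A B ℓ Gy Gv Gl x ζ y v lam) (hK' : IsKKT A B ℓ Gy Gv Gl' x' ζ' y' v' lam')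
    {n : ℕ} (hn : n < ℓ) :
    ‖y n - y' n‖ ≤ a * (q ^ n * ‖x - x'‖ + q ^ (ℓ - n) * ‖y ℓ - y' ℓ‖
      + ∑ τ ∈ Finset.range ℓ, q ^ tdist (τ + 1) n * ‖ζ τ - ζ' τ‖) := by
  have h := ocp_time_decay hR hc hnA hnB hq hq1 hqε
    -- The state at stage ℓ is no longer an unknown: its factor χ and its difference are 0, hence
    -- the terminal gradients `Gl` and `Gl'` never enter.
    (fun τ => if τ < ℓ then y τ - y' τ else 0) (fun τ => if τ < ℓ then Gy τ (y τ) - Gy τ (y' τ) else 0)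
    (fun τ => lam τ - lam' τ) (fun τ => if τ < ℓ then v τ - v' τ else 0)
    (fun τ => if τ < ℓ then Gv τ (v τ) - Gv τ (v' τ) else 0)
    (fun τ hτ => by by_cases hl : τ < ℓ <;> simp only [hl, if_true, if_false]
                    exacts [(hGy τ hl _ _).1, by simp])
    (fun τ hτ => by by_cases hl : τ < ℓ <;> simp only [hl, if_true, if_false]
                    exacts [(hGv τ hl _ _).1, by simp])
    (fun τ hτ => by by_cases hl : τ < ℓ <;> simp only [hl, if_true, if_false]
                    exacts [(hGy τ hl _ _).2, by simp])
    (fun τ hτ => by by_cases hl : τ < ℓ <;> simp only [hl, if_true, if_false]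
                    exacts [(hGv τ hl _ _).2, by simp]) n
  have hw : ∀ τ, 0 ≤ q ^ tdist τ n := fun τ => (pow_pos hq _).le
  have e1 := l2_smul_le_sum (n := ℓ + 1) (b := fun _ => 0) hw
    (x := statRes A B (fun τ => if τ < ℓ then 1 else 0) ℓ
    (fun τ => if τ < ℓ then Gy τ (y τ) - Gy τ (y' τ) else 0)
    (fun τ => if τ < ℓ then Gv τ (v τ) - Gv τ (v' τ) else 0) (fun τ => lam τ - lam' τ))
    (fun τ hτ => by
      refine (norm_pair_le _ _).trans (le_of_eq ?_)
      by_cases hl : τ < ℓ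
      · simp only [hl, if_true, one_smul, map_sub]
        rw [← hK.statX τ hl, ← hK'.statX τ hl, ← hK.statU τ hl, ← hK'.statU τ hl]
        have e : Gy τ (y τ) - Gy τ (y' τ) + (lam τ - lam' τ)
          - (Gy τ (y τ) + lam τ - (Gy τ (y' τ) + lam' τ)) = 0 := by abel
        rw [e, sub_self, norm_zero, norm_zero, add_zero]
      · simp [hl])
  have e2 := l2_smul_le_sum (n := ℓ + 1) hw
    -- The last dynamics equation now expresses A Δy + B Δv as Δy_ℓ - Δζ, so the difference of the
    -- final states acts as data at stage ℓ.
    (b := fun τ => (if τ = 0 then ‖x - x'‖ else ‖ζ (τ - 1) - ζ' (τ - 1)‖)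
      + if τ = ℓ then ‖y ℓ - y' ℓ‖ else 0)
    (x := dynRes A B (fun τ => if τ < ℓ then 1 else 0)
    (fun τ => if τ < ℓ then y τ - y' τ else 0) (fun τ => if τ < ℓ then v τ - v' τ else 0))
    (fun τ hτ => by
      cases τ with
      | zero =>
        have : ¬ 0 = ℓ := by omega
        simp [dynRes, (by omega : 0 < ℓ), hK.init, hK'.init, this]
      | succ τ =>
        have hl : τ < ℓ := by omega
        have e : y (τ + 1) - y' (τ + 1)
            = A (y τ - y' τ) + B (v τ - v' τ) + (ζ τ - ζ' τ) := by
          rw [hK.dyn τ hl, hK'.dyn τ hl, map_sub, map_sub]; abel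
        simp only [dynRes, hl, if_true, Nat.add_sub_cancel, Nat.succ_ne_zero, if_false]
        by_cases hl' : τ + 1 < ℓ
        · simp only [hl', if_true, one_smul, hl'.ne, if_false, add_zero]
          rw [e]
          apply le_of_eq
          congr 1
          abel
        · have e' : τ + 1 = ℓ := by omega
          rw [if_neg hl', zero_smul, zero_sub, norm_neg, if_pos e']
          have e'' : A (y τ - y' τ) + B (v τ - v' τ) = (y ℓ - y' ℓ) - (ζ τ - ζ' τ) := by
            rw [← e', e]; abel
          rw [e'', add_comm]
          exact norm_sub_le _ _)
  have f1 := norm_le_l2 (n := ℓ + 1) (fun τ => q ^ tdist τ n •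
      (WithLp.toLp 2 (if τ < ℓ then y τ - y' τ else 0, if τ < ℓ then v τ - v' τ else 0)
        : WithLp 2 (X × U))) (by omega : n < ℓ + 1)
  have g2 := l2_nonneg (n := ℓ + 1) (fun τ => q ^ tdist τ n • (lam τ - lam' τ))
  simp only [tdist_self, pow_zero, one_smul, hn, if_true] at f1
  have := norm_fst_le_pair (y n - y' n) (v n - v' n)
  have h2 : ‖y n - y' n‖ ≤ a * _ :=
    (by linarith : ‖y n - y' n‖ ≤ _).trans (mul_le_mul_of_nonneg_left (add_le_add e1 e2) hc.a_nonneg)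
  refine h2.trans (mul_le_mul_of_nonneg_left (le_of_eq ?_) hc.a_nonneg)
  have e5 : ∑ τ ∈ Finset.range (ℓ + 1), q ^ tdist τ n * (if τ = ℓ then ‖y ℓ - y' ℓ‖ else 0)
      = q ^ (ℓ - n) * ‖y ℓ - y' ℓ‖ := by
    have : tdist ℓ n = ℓ - n := by unfold tdist; omega
    rw [Finset.sum_eq_single ℓ]
    · simp [this]
    · intro τ _ hτ; simp [hτ]
    · simp
  have e6 : tdist 0 n = n := by unfold tdist; omega
  simp only [mul_add, Finset.sum_add_distrib]
  rw [e5, Finset.sum_range_succ' (fun τ => q ^ tdist τ n *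
    (if τ = 0 then ‖x - x'‖ else ‖ζ (τ - 1) - ζ' (τ - 1)‖))]
  simp [e6]
  ring

end Perturb

/-! ## Right inverses of the dynamics -/

section RightInverse

variable {X U : Type*} [NormedAddCommGroup X] [InnerProductSpace ℝ X] [CompleteSpace X]
  [NormedAddCommGroup U] [InnerProductSpace ℝ U] [CompleteSpace U]

/-- Convolution of a sequence with a geometric kernel. -/
def geoConv (γ : ℝ) (b : ℕ → ℝ) : ℕ → ℝ
  | 0 => b 0
  | τ + 1 => γ * geoConv γ b τ + b (τ + 1)

/-- Young's inequality for a kernel of total mass at most (1 - γ)⁻¹. The induction carries the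
additional term γ times the square of the last value, which pays for the next step. -/
lemma l2_geoConv_le {γ : ℝ} (h0 : 0 ≤ γ) (h1 : γ < 1) (b : ℕ → ℝ) (n : ℕ) :
    l2 (n + 1) (geoConv γ b) ≤ (1 - γ)⁻¹ * l2 (n + 1) b := by
  have hγ : 0 < 1 - γ := by linarith
  have key : ∀ n, (1 - γ) * ∑ τ ∈ Finset.range (n + 1), geoConv γ b τ ^ 2 + γ * geoConv γ b n ^ 2
      ≤ (1 - γ)⁻¹ * ∑ τ ∈ Finset.range (n + 1), b τ ^ 2 := by
    intro n
    induction n with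
    | zero =>
      have : 1 ≤ (1 - γ)⁻¹ := (one_le_inv₀ hγ).2 (by linarith)
      simp only [zero_add, Finset.sum_range_one, geoConv]
      nlinarith [sq_nonneg (b 0)]
    | succ n ih =>
      rw [Finset.sum_range_succ, Finset.sum_range_succ (fun τ => b τ ^ 2)]
      have e : geoConv γ b (n + 1) ^ 2 ≤ γ * geoConv γ b n ^ 2 + (1 - γ)⁻¹ * b (n + 1) ^ 2 := by
        simp only [geoConv]
        set p := geoConv γ b n
        set s := b (n + 1)
        have e1 : γ * p ^ 2 + (1 - γ)⁻¹ * s ^ 2 - (γ * p + s) ^ 2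
            = γ * (1 - γ)⁻¹ * ((1 - γ) * p - s) ^ 2 := by field_simp; ring
        have : 0 ≤ γ * (1 - γ)⁻¹ * ((1 - γ) * p - s) ^ 2 := by positivity
        linarith
      nlinarith
  apply abs_le_of_sq_le_sq' _ (mul_nonneg (by positivity) (l2_nonneg _)) |>.2
  rw [mul_pow, l2_sq, l2_sq]
  simp only [Real.norm_eq_abs, sq_abs]
  have h2 := key n
  have h3 : 0 ≤ γ * geoConv γ b n ^ 2 := by positivity
  have h4 : (1 - γ) * ∑ τ ∈ Finset.range (n + 1), geoConv γ b τ ^ 2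
      ≤ (1 - γ)⁻¹ * ∑ τ ∈ Finset.range (n + 1), b τ ^ 2 := by linarith
  calc ∑ τ ∈ Finset.range (n + 1), geoConv γ b τ ^ 2
      = (1 - γ)⁻¹ * ((1 - γ) * ∑ τ ∈ Finset.range (n + 1), geoConv γ b τ ^ 2) := by
        field_simp
    _ ≤ (1 - γ)⁻¹ * ((1 - γ)⁻¹ * ∑ τ ∈ Finset.range (n + 1), b τ ^ 2) :=
        mul_le_mul_of_nonneg_left h4 (by positivity)
    _ = _ := by ring

/-- The trajectory of the linear system `M` excited by `b`. -/
def excited (M : X →L[ℝ] X) (b : ℕ → X) : ℕ → X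
  | 0 => b 0
  | τ + 1 => M (excited M b τ) + b (τ + 1)

lemma excited_eq_sum (M : X →L[ℝ] X) (b : ℕ → X) (τ : ℕ) :
    excited M b τ = ∑ s ∈ Finset.range (τ + 1), (M ^ (τ - s)) (b s) := by
  induction τ with
  | zero => simp [excited]
  | succ τ ih =>
    rw [excited, ih, Finset.sum_range_succ _ (τ + 1), map_sum]
    congr 1
    · refine Finset.sum_congr rfl fun s hs => ?_
      have : s < τ + 1 := Finset.mem_range.1 hs
      rw [Nat.succ_sub (by omega), pow_succ']
      rfl
    · simp

lemma geoConv_eq_sum (γ : ℝ) (b : ℕ → ℝ) (τ : ℕ) :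
    geoConv γ b τ = ∑ s ∈ Finset.range (τ + 1), γ ^ (τ - s) * b s := by
  induction τ with
  | zero => simp [geoConv]
  | succ τ ih =>
    rw [geoConv, ih, Finset.sum_range_succ _ (τ + 1), Finset.mul_sum]
    congr 1
    · refine Finset.sum_congr rfl fun s hs => ?_
      have : s < τ + 1 := Finset.mem_range.1 hs
      rw [Nat.succ_sub (by omega), pow_succ']
      ring
    · simp

lemma l2_excited_le {M : X →L[ℝ] X} {L γ : ℝ} (hL : 0 ≤ L) (h0 : 0 ≤ γ) (h1 : γ < 1)
    (hM : ∀ s : ℕ, ‖M ^ s‖ ≤ L * γ ^ s) (b : ℕ → X) (n : ℕ) :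
    l2 (n + 1) (excited M b) ≤ L * (1 - γ)⁻¹ * l2 (n + 1) b := by
  have h2 : l2 (n + 1) (excited M b) ≤ L * l2 (n + 1) (geoConv γ fun τ => ‖b τ‖) := by
    refine l2_le_mul hL fun τ _ => ?_
    rw [excited_eq_sum, geoConv_eq_sum]
    refine (norm_sum_le _ _).trans ?_
    have : 0 ≤ ∑ s ∈ Finset.range (τ + 1), γ ^ (τ - s) * ‖b s‖ :=
      Finset.sum_nonneg fun s _ => by positivity
    rw [Real.norm_eq_abs, abs_of_nonneg this, Finset.mul_sum]
    refine Finset.sum_le_sum fun s _ => ?_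
    rw [← mul_assoc]
    exact ((M ^ (τ - s)).le_opNorm _).trans
      (mul_le_mul_of_nonneg_right (hM _) (norm_nonneg _))
  have h3 := l2_geoConv_le h0 h1 (fun τ => ‖b τ‖) n
  have h4 : l2 (n + 1) (fun τ => ‖b τ‖) = l2 (n + 1) b := by simp [l2]
  rw [h4] at h3
  calc _ ≤ _ := h2
    _ ≤ L * ((1 - γ)⁻¹ * l2 (n + 1) b) := by gcongr
    _ = _ := by ring

/-- The norm bound for the right inverse built from a stabilizing feedback. -/
def invConst (L γ : ℝ) : ℝ := Real.sqrt (1 + L ^ 2) * (L * (1 - γ)⁻¹)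

/-- With v = -K y the constraints become the recursion y_{τ+1} = (A - BK) y_τ + b_{τ+1}, whose
solution is dominated by a geometric convolution of b. -/
lemma ocpRightInverse_of_feedback {A : X →L[ℝ] X} {B : U →L[ℝ] X} {K : X →L[ℝ] U} {L γ : ℝ}
    (hL : 0 ≤ L) (h0 : 0 ≤ γ) (h1 : γ < 1) (hK : ‖K‖ ≤ L)
    (hM : ∀ s : ℕ, ‖(A - B ∘L K) ^ s‖ ≤ L * γ ^ s) (ℓ : ℕ) :
    OcpRightInverse A B (fun _ => 1) ℓ (invConst L γ) := by
  intro b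
  set y := excited (A - B ∘L K) b with hy
  refine ⟨fun τ => WithLp.toLp 2 (y τ, -K (y τ)), fun τ _ => ?_, ?_⟩
  · cases τ with
    | zero => simp [chainCons, hy, excited]
    | succ τ => simp [chainCons, hy, excited]; abel
  · have e : l2 (ℓ + 1) (fun τ => (WithLp.toLp 2 (y τ, -K (y τ)) : WithLp 2 (X × U)))
        ≤ Real.sqrt (1 + L ^ 2) * l2 (ℓ + 1) y := by
      refine l2_le_mul (Real.sqrt_nonneg _) fun τ _ => ?_
      apply abs_le_of_sq_le_sq' _ (by positivity) |>.2
      rw [WithLp.prod_norm_sq_eq_of_L2, mul_pow, Real.sq_sqrt (by positivity)]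
      simp only [WithLp.toLp_fst, WithLp.toLp_snd, norm_neg]
      have h2 : ‖K (y τ)‖ ≤ L * ‖y τ‖ := (K.le_opNorm _).trans (by gcongr)
      have := pow_le_pow_left₀ (norm_nonneg _) h2 2
      nlinarith
    have e2 := l2_excited_le hL h0 h1 hM b ℓ
    calc _ ≤ _ := e
      _ ≤ Real.sqrt (1 + L ^ 2) * (L * (1 - γ)⁻¹ * l2 (ℓ + 1) b) := by gcongr
      _ = _ := by rw [invConst]; ring

/-- Every state is reached in `d` steps with controls of comparable size. -/
def Steerable (A : X →L[ℝ] X) (B : U →L[ℝ] X) (d : ℕ) (s : ℝ) : Prop :=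
  ∀ e : X, ∃ w : ℕ → U, response A B w d = e ∧ (∀ i, ‖w i‖ ≤ s * ‖e‖)

lemma norm_response_le {A : X →L[ℝ] X} {B : U →L[ℝ] X} {L : ℝ} (hL : 1 ≤ L) (hA : ‖A‖ ≤ L)
    (hB : ‖B‖ ≤ L) {w : ℕ → U} {V : ℝ} (hV : 0 ≤ V) (hw : ∀ i, ‖w i‖ ≤ V) (i : ℕ) :
    ‖response A B w i‖ ≤ i * L ^ i * V := by
  induction i with
  | zero => simp [response]
  | succ i ih =>
    have hL0 : 0 ≤ L := by linarith
    have h1 : ‖A (response A B w i)‖ ≤ L * (i * L ^ i * V) := (A.le_opNorm _).trans (by gcongr)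
    have h2 : ‖B (w i)‖ ≤ L * V := (B.le_opNorm _).trans (by gcongr; exact hw i)
    have h3 : L * V ≤ L ^ (i + 1) * V := by
      gcongr
      exact le_self_pow₀ hL (by omega)
    calc _ ≤ ‖A (response A B w i)‖ + ‖B (w i)‖ := norm_add_le _ _
      _ ≤ L * (i * L ^ i * V) + L ^ (i + 1) * V := by linarith
      _ = _ := by push_cast; ring

/-- The norm bound for the right inverse with prescribed final state. -/
def terminalConst (L m s : ℝ) (d : ℕ) : ℝ := m + (d + 1) * ((d * L ^ d + 1) * s) * m

/-- With χ = 0 at stage ℓ the last constraint is -(A y + B v) = b_ℓ, which is the usual one for a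
trajectory ending at 0. The end state of an ordinary preimage `z` is cancelled by a homogeneous
trajectory `η` that starts d steps before the end. -/
lemma ocpRightInverse_terminal {A : X →L[ℝ] X} {B : U →L[ℝ] X} {L m s : ℝ} {d ℓ : ℕ}
    (hL : 1 ≤ L) (hA : ‖A‖ ≤ L) (hB : ‖B‖ ≤ L) (hs : 0 ≤ s)
    (hS : Steerable A B d s) (hR : OcpRightInverse A B (fun _ => 1) ℓ m) (hd : d ≤ ℓ)
    (hℓ : 0 < ℓ) :
    OcpRightInverse A B (fun τ => if τ < ℓ then 1 else 0) ℓ (terminalConst L m s d) := by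
  intro b
  obtain ⟨z, hz, hzn⟩ := hR b
  obtain ⟨w, hw, hwn⟩ := hS (-(z ℓ).fst)
  set k := ℓ - d with hk
  have hkd : k + d = ℓ := by omega
  set η : ℕ → WithLp 2 (X × U) := fun τ =>
    if k ≤ τ then WithLp.toLp 2 (response A B w (τ - k), w (τ - k)) else 0 with hη
  have hηdyn : ∀ τ, (η (τ + 1)).fst = A (η τ).fst + B (η τ).snd := by
    intro τ
    by_cases h1 : k ≤ τ
    · have : τ + 1 - k = (τ - k) + 1 := by omega
      simp [hη, h1, (by omega : k ≤ τ + 1), this, response]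
    · by_cases h2 : k ≤ τ + 1
      · have : τ + 1 - k = 0 := by omega
        simp [hη, h1, h2, this, response]
      · simp [hη, h1, h2]
  have hη0 : (η 0).fst = 0 := by
    by_cases h1 : k ≤ 0
    · simp [hη, h1, response]
    · simp [hη, h1]
  have hηℓ : (η ℓ).fst = -(z ℓ).fst := by
    have : ℓ - k = d := by omega
    simp [hη, (by omega : k ≤ ℓ), this, hw]
  have hdyn : ∀ τ < ℓ, (z (τ + 1)).fst = A (z τ).fst + B (z τ).snd + b (τ + 1) := by
    intro τ hτ
    have := hz (τ + 1) (by omega)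
    simp only [chainCons, stateProj_apply, one_smul, inputMap_apply] at this
    rw [← this]; abel
  refine ⟨fun τ => z τ + η τ, fun τ hτ => ?_, ?_⟩
  · cases τ with
    | zero =>
      have := hz 0 (by omega)
      simp only [chainCons, stateProj_apply, one_smul] at this
      simp [chainCons, hℓ, hη0, this]
    | succ τ =>
      simp only [chainCons, stateProj_apply, inputMap_apply, map_add]
      have e1 := hdyn τ (by omega)
      have e2 := hηdyn τ
      by_cases h1 : τ + 1 < ℓ
      · rw [if_pos h1]; simp only [one_smul]; rw [e1, e2]; abel
      · have h2 : τ + 1 = ℓ := by omega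
        rw [h2, hηℓ] at e2
        rw [h2] at e1
        rw [if_neg h1]
        simp only [zero_smul, add_zero, zero_sub]
        rw [← e2, e1, h2]; abel
  · have hL0 : 0 ≤ L := by linarith
    have hzℓ : ‖(z ℓ).fst‖ ≤ m * l2 (ℓ + 1) b := by
      have h1 := norm_le_l2 z (Nat.lt_succ_self ℓ)
      have h2 := norm_fst_le_pair (z ℓ).fst (z ℓ).snd
      exact h2.trans (h1.trans hzn)
    have hbn := l2_nonneg (n := ℓ + 1) b
    set V := s * ‖(z ℓ).fst‖ with hV
    have hV0 : 0 ≤ V := by positivity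
    have hwn' : ∀ i, ‖w i‖ ≤ V := fun i => by have := hwn i; rwa [norm_neg] at this
    have hη1 : l2 (ℓ + 1) η ≤ (d + 1) * ((d * L ^ d + 1) * V) := by
      refine (l2_le_sum η).trans ?_
      have e : ℓ + 1 = k + (d + 1) := by omega
      rw [e, Finset.sum_range_add]
      have e1 : ∑ τ ∈ Finset.range k, ‖η τ‖ = 0 := Finset.sum_eq_zero fun τ hτ => by
        have := Finset.mem_range.1 hτ
        simp only [hη, if_neg (by omega : ¬ k ≤ τ), norm_zero]
      have e2 : ∀ i ∈ Finset.range (d + 1), ‖η (k + i)‖ ≤ (d * L ^ d + 1) * V := by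
        intro i hi
        have hi' : i ≤ d := Nat.lt_succ_iff.1 (Finset.mem_range.1 hi)
        simp only [hη, Nat.le_add_right, if_true, Nat.add_sub_cancel_left]
        refine (norm_pair_le _ _).trans ?_
        have h1 := norm_response_le hL hA hB hV0 hwn' i
        have h2 : (i : ℝ) * L ^ i * V ≤ d * L ^ d * V := by gcongr
        have h3 := hwn' i
        linarith
      rw [e1, zero_add]
      refine (Finset.sum_le_card_nsmul _ _ _ e2).trans (le_of_eq ?_)
      simp
    refine (l2_add_le z η).trans ?_
    have hV1 : V ≤ s * (m * l2 (ℓ + 1) b) := by rw [hV]; gcongr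
    calc _ ≤ m * l2 (ℓ + 1) b + (d + 1) * ((d * L ^ d + 1) * V) := add_le_add hzn hη1
      _ ≤ m * l2 (ℓ + 1) b + (d + 1) * ((d * L ^ d + 1) * (s * (m * l2 (ℓ + 1) b))) := by gcongr
      _ = _ := by rw [terminalConst]; ring

lemma response_eq_sum (A : X →L[ℝ] X) (B : U →L[ℝ] X) (w : ℕ → U) (n : ℕ) :
    response A B w n = ∑ j ∈ Finset.range n, (A ^ (n - 1 - j)) (B (w j)) := by
  induction n with
  | zero => simp [response]
  | succ n ih =>
    rw [response, ih, Finset.sum_range_succ, map_sum]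
    congr 1
    · refine Finset.sum_congr rfl fun j hj => ?_
      have := Finset.mem_range.1 hj
      have e : n + 1 - 1 - j = (n - 1 - j) + 1 := by omega
      rw [e, pow_succ']
      rfl
    · simp

/-- The Gramian W = ∑ A^j B B* A*^j is bounded below by σ², hence bijective. For e = W x the
controls B* A*^(d-1-j) x steer 0 to e, and ‖x‖ ≤ ‖e‖/σ². -/
lemma steerable_of_gramian [FiniteDimensional ℝ X] {A : X →L[ℝ] X} {B : U →L[ℝ] X} {L σ : ℝ}
    {d : ℕ} (hL : 1 ≤ L) (hA : ‖A‖ ≤ L) (hB : ‖B‖ ≤ L) (hσ : 0 < σ)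
    (h : ∀ x, σ ^ 2 * ‖x‖ ^ 2 ≤ ∑ j ∈ Finset.range d, ‖B.adjoint ((A.adjoint ^ j) x)‖ ^ 2) :
    Steerable A B d (L ^ d / σ ^ 2) := by
  have hL0 : 0 ≤ L := by linarith
  let W : X →ₗ[ℝ] X := ∑ j ∈ Finset.range d,
    ((A ^ j) ∘L B ∘L B.adjoint ∘L (A.adjoint ^ j) : X →L[ℝ] X).toLinearMap
  have hW : ∀ x, W x = ∑ j ∈ Finset.range d, (A ^ j) (B (B.adjoint ((A.adjoint ^ j) x))) := by
    intro x; simp only [W, LinearMap.sum_apply]; rfl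
  have hadj : ∀ j, A.adjoint ^ j = (A ^ j).adjoint := by
    intro j
    induction j with
    | zero =>
      refine ContinuousLinearMap.ext fun x => ext_inner_right ℝ fun y => ?_
      rw [ContinuousLinearMap.adjoint_inner_left]
      simp
    | succ j ih =>
      refine ContinuousLinearMap.ext fun x => ext_inner_right ℝ fun y => ?_
      rw [ContinuousLinearMap.adjoint_inner_left, pow_succ', ih, pow_succ]
      change ⟪A.adjoint ((A ^ j).adjoint x), y⟫_ℝ = ⟪x, (A ^ j) (A y)⟫_ℝ
      rw [ContinuousLinearMap.adjoint_inner_left, ContinuousLinearMap.adjoint_inner_left]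
  have hWx : ∀ x, σ ^ 2 * ‖x‖ ^ 2 ≤ ⟪W x, x⟫_ℝ := by
    intro x
    refine (h x).trans (le_of_eq ?_)
    rw [hW, sum_inner]
    refine Finset.sum_congr rfl fun j _ => ?_
    rw [← real_inner_self_eq_norm_sq, ContinuousLinearMap.adjoint_inner_left, hadj,
      ContinuousLinearMap.adjoint_inner_left, real_inner_comm]
  have hWn : ∀ x, σ ^ 2 * ‖x‖ ≤ ‖W x‖ := by
    intro x
    rcases eq_or_ne x 0 with rfl | hx
    · simp
    · have h1 : σ ^ 2 * ‖x‖ ^ 2 ≤ ‖W x‖ * ‖x‖ := (hWx x).trans (real_inner_le_norm _ _)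
      have hx' : 0 < ‖x‖ := norm_pos_iff.2 hx
      nlinarith
  have hinj : Function.Injective W := by
    rw [injective_iff_map_eq_zero]
    intro x hx
    have := hWn x
    rw [hx, norm_zero] at this
    have h2 : ‖x‖ ≤ 0 := by
      by_contra hc; push Not at hc
      have : 0 < σ ^ 2 * ‖x‖ := by positivity
      linarith
    exact norm_le_zero_iff.1 h2
  have hsurj : Function.Surjective W := LinearMap.injective_iff_surjective.1 hinj
  intro e
  obtain ⟨x, hx⟩ := hsurj e
  have hxn : ‖x‖ ≤ ‖e‖ / σ ^ 2 := by
    rw [le_div_iff₀ (by positivity), ← hx, mul_comm]; exact hWn x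
  refine ⟨fun j => if j < d then B.adjoint ((A.adjoint ^ (d - 1 - j)) x) else 0, ?_, fun i => ?_⟩
  · rw [response_eq_sum, ← hx, hW, ← Finset.sum_range_reflect]
    refine Finset.sum_congr rfl fun j hj => ?_
    have hj' := Finset.mem_range.1 hj
    have e1 : d - 1 - (d - 1 - j) = j := by omega
    simp [(by omega : d - 1 - j < d), e1]
  · by_cases hi : i < d
    · simp only [hi, if_true]
      have hpow : ∀ j, ‖(A.adjoint ^ j) x‖ ≤ L ^ j * ‖x‖ := by
        intro j
        induction j with
        | zero => simp
        | succ j ih =>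
          rw [pow_succ', pow_succ', mul_assoc]
          exact (A.adjoint.le_opNorm _).trans
            (mul_le_mul (by simpa using hA) ih (norm_nonneg _) hL0)
      have h1 : ‖B.adjoint ((A.adjoint ^ (d - 1 - i)) x)‖ ≤ L * (L ^ (d - 1 - i) * ‖x‖) :=
        (B.adjoint.le_opNorm _).trans
          (mul_le_mul (by simpa using hB) (hpow _) (norm_nonneg _) hL0)
      have h2 : L * L ^ (d - 1 - i) ≤ L ^ d := by
        rw [← pow_succ']; exact pow_le_pow_right₀ hL (by omega)
      calc _ ≤ L * L ^ (d - 1 - i) * ‖x‖ := by rw [mul_assoc]; exact h1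
        _ ≤ L ^ d * (‖e‖ / σ ^ 2) := by gcongr
        _ = _ := by ring
    · simp only [hi, if_false, norm_zero]; positivity

end RightInverse

/-! ## Matrices over the nodes as operators -/

section Net

variable {N : ℕ} {n m k : Fin N → ℕ}

/-- The operator of a matrix on stacked vectors. -/
def actL (M : Matrix (Idx n) (Idx m) ℝ) : Vec m →L[ℝ] Vec n :=
  LinearMap.toContinuousLinearMap (Matrix.toEuclideanLin M)

lemma act_eq_actL (M : Matrix (Idx n) (Idx m) ℝ) (x : Vec m) : act M x = actL M x := rfl

lemma actL_apply (M : Matrix (Idx n) (Idx m) ℝ) (x : Vec m) (a : Idx n) :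
    actL M x a = ∑ b, M a b * x b := rfl

lemma actL_mul (M : Matrix (Idx n) (Idx m) ℝ) (M' : Matrix (Idx m) (Idx k) ℝ) :
    actL (M * M') = actL M ∘L actL M' := by
  ext x a
  simp only [ContinuousLinearMap.comp_apply, actL_apply, Matrix.mul_apply, Finset.sum_mul,
    Finset.mul_sum]
  rw [Finset.sum_comm]
  simp only [mul_assoc]

lemma actL_sub (M M' : Matrix (Idx n) (Idx m) ℝ) : actL (M - M') = actL M - actL M' := by
  ext x a
  simp [actL_apply, sub_mul, Finset.sum_sub_distrib]

lemma actL_pow (M : Matrix (Idx n) (Idx n) ℝ) (s : ℕ) : actL (M ^ s) = actL M ^ s := by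
  induction s with
  | zero =>
    ext x a
    simp [actL_apply, Matrix.one_apply]
  | succ s ih => rw [pow_succ, pow_succ, actL_mul, ih]; rfl

lemma vec_inner (x y : Vec n) : ⟪x, y⟫_ℝ = ∑ a, x a * y a := by
  simp [PiLp.inner_apply, mul_comm]

lemma vec_norm_sq (x : Vec n) : ‖x‖ ^ 2 = ∑ a, x a ^ 2 := EuclideanSpace.real_norm_sq_eq x

lemma actL_adjoint (M : Matrix (Idx n) (Idx m) ℝ) : (actL M).adjoint = actL M.transpose := by
  refine ContinuousLinearMap.ext fun x => ext_inner_right ℝ fun y => ?_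
  rw [ContinuousLinearMap.adjoint_inner_left, vec_inner, vec_inner]
  simp only [actL_apply, Matrix.transpose_apply, Finset.mul_sum, Finset.sum_mul]
  rw [Finset.sum_comm]
  refine Finset.sum_congr rfl fun a _ => Finset.sum_congr rfl fun b _ => by ring

/-- Multiplication of the block at node `i` by `w i`. -/
def nodeDiag (w : Fin N → ℝ) : Vec n →L[ℝ] Vec n :=
  LinearMap.toContinuousLinearMap
    { toFun := fun x => WithLp.toLp 2 fun a => w a.1 * x a
      map_add' := fun x y => by ext a; simp [mul_add]
      map_smul' := fun t x => by ext a; simp; ring }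

@[simp] lemma nodeDiag_apply (w : Fin N → ℝ) (x : Vec n) (a : Idx n) :
    nodeDiag w x a = w a.1 * x a := rfl

lemma norm_le_norm_of_abs_le {x y : Vec n} {r : ℝ} (hr : 0 ≤ r) (h : ∀ a, |x a| ≤ r * |y a|) :
    ‖x‖ ≤ r * ‖y‖ := by
  apply abs_le_of_sq_le_sq' _ (by positivity) |>.2
  rw [mul_pow, vec_norm_sq, vec_norm_sq, Finset.mul_sum]
  refine Finset.sum_le_sum fun a _ => ?_
  have := pow_le_pow_left₀ (abs_nonneg _) (h a) 2
  rwa [mul_pow, sq_abs, sq_abs] at this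

lemma norm_nodeDiag_le {w : Fin N → ℝ} {r : ℝ} (hr : 0 ≤ r) (hw : ∀ i, |w i| ≤ r) (x : Vec n) :
    ‖nodeDiag w x‖ ≤ r * ‖x‖ :=
  norm_le_norm_of_abs_le hr fun a => by
    rw [nodeDiag_apply, abs_mul]; exact mul_le_mul_of_nonneg_right (hw _) (abs_nonneg _)

lemma norm_blk_le (x : Vec n) (i : Fin N) : ‖blk x i‖ ≤ ‖x‖ := by
  apply abs_le_of_sq_le_sq' _ (norm_nonneg _) |>.2
  rw [vec_norm_sq, EuclideanSpace.real_norm_sq_eq, Fintype.sum_sigma]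
  exact Finset.single_le_sum (f := fun i => ∑ a, x ⟨i, a⟩ ^ 2)
    (fun i _ => Finset.sum_nonneg fun _ _ => sq_nonneg _) (Finset.mem_univ i)

lemma norm_sq_eq_sum_blk (x : Vec n) : ‖x‖ ^ 2 = ∑ i, ‖blk x i‖ ^ 2 := by
  rw [vec_norm_sq, Fintype.sum_sigma]
  refine Finset.sum_congr rfl fun i _ => ?_
  rw [EuclideanSpace.real_norm_sq_eq]; rfl

lemma norm_le_sum_blk (x : Vec n) : ‖x‖ ≤ ∑ i, ‖blk x i‖ := by
  apply abs_le_of_sq_le_sq' _ (Finset.sum_nonneg fun _ _ => norm_nonneg _) |>.2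
  rw [norm_sq_eq_sum_blk]
  exact Finset.sum_sq_le_sq_sum_of_nonneg fun _ _ => norm_nonneg _

lemma blk_sub (x y : Vec n) (i : Fin N) : blk (x - y) i = blk x i - blk y i := rfl

open Classical in
/-- The indicator of the `κ`-hop neighbourhood of `i`. -/
def nbhd (G : SimpleGraph (Fin N)) (i : Fin N) (κ : ℕ) (j : Fin N) : ℝ :=
  if G.edist i j ≤ (κ : ℕ∞) then 1 else 0

lemma truncVec_eq (G : SimpleGraph (Fin N)) (i : Fin N) (κ : ℕ) (x : Vec n) :
    truncVec G i κ x = nodeDiag (nbhd G i κ) x := by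
  ext a
  by_cases h : G.edist i a.1 ≤ (κ : ℕ∞) <;> simp [truncVec, nbhd, h]

lemma actL_truncMat (G : SimpleGraph (Fin N)) (i : Fin N) (κ : ℕ) (M : Matrix (Idx n) (Idx m) ℝ)
    (x : Vec m) : actL (truncMat G i κ M) x = nodeDiag (nbhd G i κ) (actL M x) := by
  ext a
  rw [nodeDiag_apply, actL_apply, actL_apply]
  by_cases h : G.edist i a.1 ≤ (κ : ℕ∞) <;> simp [truncMat, nbhd, h]

lemma norm_nbhd_le (G : SimpleGraph (Fin N)) (i : Fin N) (κ : ℕ) (x : Vec n) :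
    ‖nodeDiag (nbhd G i κ) x‖ ≤ ‖x‖ := by
  have := norm_nodeDiag_le (w := nbhd G i κ) zero_le_one
    (fun j => by unfold nbhd; split_ifs <;> simp) x
  simpa using this

lemma norm_truncMat_le (G : SimpleGraph (Fin N)) (i : Fin N) (κ : ℕ)
    (M : Matrix (Idx n) (Idx m) ℝ) : ‖actL (truncMat G i κ M)‖ ≤ ‖actL M‖ :=
  ContinuousLinearMap.opNorm_le_bound _ (norm_nonneg _) fun x => by
    rw [actL_truncMat]
    exact (norm_nbhd_le G i κ _).trans ((actL M).le_opNorm x)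

lemma ocpRightInverse_of_stabilizable {nx nu : Fin N → ℕ} {A : Matrix (Idx nx) (Idx nx) ℝ}
    {B : Matrix (Idx nx) (Idx nu) ℝ} {L γ : ℝ} (h : Stabilizable L γ A B) (ℓ : ℕ) :
    OcpRightInverse (actL A) (actL B) (fun _ => 1) ℓ (invConst L γ) := by
  obtain ⟨hL, h0, h1, K, hK, hs⟩ := h
  refine ocpRightInverse_of_feedback (K := actL K) (by linarith) h0.le h1 hK (fun s => ?_) ℓ
  rw [← actL_mul, ← actL_sub, ← actL_pow]
  exact hs s

/-- Blocks of `M` between distinct non-adjacent nodes vanish. -/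
def Sparse (G : SimpleGraph (Fin N)) (M : Matrix (Idx n) (Idx m) ℝ) : Prop :=
  ∀ a b, a.1 ≠ b.1 → ¬ G.Adj a.1 b.1 → M a b = 0

lemma Sparse.transpose {G : SimpleGraph (Fin N)} {M : Matrix (Idx n) (Idx m) ℝ}
    (h : Sparse G M) : Sparse G M.transpose := fun a b hab hadj =>
  h b a (Ne.symm hab) fun h' => hadj h'.symm

lemma Sparse.eq_or_adj {G : SimpleGraph (Fin N)} {M : Matrix (Idx n) (Idx m) ℝ}
    (h : Sparse G M) {a : Idx n} {b : Idx m} (hab : M a b ≠ 0) : a.1 = b.1 ∨ G.Adj a.1 b.1 := by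
  by_contra hc
  push Not at hc
  exact hab (h a b hc.1 hc.2)

lemma Sparse.reachable {G : SimpleGraph (Fin N)} {M : Matrix (Idx n) (Idx m) ℝ}
    (h : Sparse G M) {a : Idx n} {b : Idx m} (hab : M a b ≠ 0) : G.Reachable a.1 b.1 := by
  rcases h.eq_or_adj hab with e | e
  · rw [e]
  · exact e.reachable

/-- A radius beyond which neighbourhoods are connected components. -/
lemma exists_radius (G : SimpleGraph (Fin N)) (κ₀ : ℕ) :
    ∃ κ, κ₀ ≤ κ ∧ ∀ i j, G.Reachable i j → G.edist i j ≤ (κ : ℕ∞) := by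
  -- The sum of all finite distances dominates each of them; infinite distances contribute 0.
  refine ⟨κ₀ + ∑ i, ∑ j, (G.edist i j).toNat, by omega, fun i j h => ?_⟩
  have h1 : G.edist i j ≠ ⊤ := SimpleGraph.edist_ne_top_iff_reachable.2 h
  rw [← ENat.natCast_toNat h1]
  have h2 : (G.edist i j).toNat ≤ ∑ j, (G.edist i j).toNat :=
    Finset.single_le_sum (f := fun j => (G.edist i j).toNat) (fun _ _ => Nat.zero_le _)
      (Finset.mem_univ j)
  have h3 : ∑ j, (G.edist i j).toNat ≤ ∑ i, ∑ j, (G.edist i j).toNat :=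
    Finset.single_le_sum (f := fun i => ∑ j, (G.edist i j).toNat) (fun _ _ => Nat.zero_le _)
      (Finset.mem_univ i)
  exact_mod_cast (by omega : (G.edist i j).toNat ≤ κ₀ + ∑ i, ∑ j, (G.edist i j).toNat)

/-- Right inverses for truncations to large neighbourhoods glue over connected components. -/
lemma ocpRightInverse_of_truncations {nx nu : Fin N → ℕ} {G : SimpleGraph (Fin N)}
    {A : Matrix (Idx nx) (Idx nx) ℝ} {B : Matrix (Idx nx) (Idx nu) ℝ} (hA : Sparse G A)
    (hB : Sparse G B) {κ₀ ℓ : ℕ} {c : ℝ} (hc : 0 ≤ c)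
    (h : ∀ i κ, κ₀ ≤ κ → OcpRightInverse (actL (truncMat G i κ A)) (actL (truncMat G i κ B))
      (fun _ => 1) ℓ c) :
    OcpRightInverse (actL A) (actL B) (fun _ => 1) ℓ c := by
  classical
  obtain ⟨κ, hκ, hreach⟩ := exists_radius G κ₀
  have hnb : ∀ i j, G.Reachable i j → nbhd G i κ j = 1 := fun i j hij => by
    simp [nbhd, hreach i j hij]
  -- One node per component is selected. On its component the system truncated around it coincides
  -- with the full one.
  let rep : Fin N → Fin N := fun j => Quot.out (G.connectedComponentMk j)
  have hrep : ∀ j, G.Reachable (rep j) j := fun j =>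
    SimpleGraph.ConnectedComponent.exact (Quot.out_eq (G.connectedComponentMk j))
  have hrep' : ∀ i j, G.Reachable i j → rep i = rep j := fun i j hij => by
    simp only [rep]; rw [SimpleGraph.ConnectedComponent.sound hij]
  intro b
  -- The data are split by components. The squared norms of the parts add up to that of `b`, so
  -- gluing does not enlarge the constant.
  choose z hz hzn using fun i => h i κ hκ (fun τ => nodeDiag (fun j => if rep j = i then 1 else 0) (b τ))
  refine ⟨fun τ => WithLp.toLp 2 (WithLp.toLp 2 fun a => (z (rep a.1) τ).fst a,
    WithLp.toLp 2 fun a => (z (rep a.1) τ).snd a), fun τ hτ => ?_, ?_⟩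
  · ext a
    have h1 := congrArg (fun x : Vec nx => x a) (hz (rep a.1) τ hτ)
    have h2 : ∀ {k : Fin N → ℕ} {M : Matrix (Idx nx) (Idx k) ℝ} (_ : Sparse G M)
        (x : Fin N → Vec k), actL (truncMat G (rep a.1) κ M) (x (rep a.1)) a
          = actL M (WithLp.toLp 2 fun b => x (rep b.1) b) a := by
      intro k M hM x
      rw [actL_truncMat, nodeDiag_apply, hnb _ _ (hrep a.1), one_mul, actL_apply, actL_apply]
      refine Finset.sum_congr rfl fun b _ => ?_
      by_cases hab : M a b = 0
      · simp [hab]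
      · rw [hrep' _ _ (hM.reachable hab)]
    cases τ with
    | zero =>
      simpa [chainCons] using h1
    | succ τ =>
      simp only [chainCons, stateProj_apply, inputMap_apply, one_smul, nodeDiag_apply, if_true,
        one_mul, PiLp.sub_apply, PiLp.add_apply] at h1 ⊢
      rw [h2 hA (fun i => (z i τ).fst), h2 hB (fun i => (z i τ).snd)] at h1
      exact h1
  · have hle : ∀ {k : Fin N → ℕ} (x : Fin N → Vec k),
        ‖(WithLp.toLp 2 fun a => x (rep a.1) a : Vec k)‖ ^ 2 ≤ ∑ i, ‖x i‖ ^ 2 := by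
      intro k x
      simp only [vec_norm_sq]
      rw [Finset.sum_comm]
      exact Finset.sum_le_sum fun a _ => Finset.single_le_sum (f := fun i => x i a ^ 2)
        (fun _ _ => sq_nonneg _) (Finset.mem_univ (rep a.1))
    apply abs_le_of_sq_le_sq' _ (mul_nonneg hc (l2_nonneg _)) |>.2
    rw [l2_sq, mul_pow, l2_sq]
    have e1 : ∑ i, l2 (ℓ + 1) (fun τ => nodeDiag (fun j => if rep j = i then 1 else 0) (b τ)) ^ 2
        = ∑ τ ∈ Finset.range (ℓ + 1), ‖b τ‖ ^ 2 := by
      simp only [l2_sq]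
      rw [Finset.sum_comm]
      refine Finset.sum_congr rfl fun τ _ => ?_
      simp only [vec_norm_sq, nodeDiag_apply, mul_pow]
      rw [Finset.sum_comm]
      refine Finset.sum_congr rfl fun a _ => ?_
      rw [← Finset.sum_mul]
      simp
    have e2 : ∀ i, l2 (ℓ + 1) (z i) ^ 2
        ≤ c ^ 2 * l2 (ℓ + 1) (fun τ => nodeDiag (fun j => if rep j = i then 1 else 0) (b τ)) ^ 2 :=
      fun i => by
        rw [← mul_pow]; exact pow_le_pow_left₀ (l2_nonneg _) (hzn i) 2
    rw [← e1, Finset.mul_sum]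
    refine le_trans ?_ (Finset.sum_le_sum fun i _ => e2 i)
    simp only [l2_sq]
    rw [Finset.sum_comm]
    refine Finset.sum_le_sum fun τ _ => ?_
    simp only [WithLp.prod_norm_sq_eq_of_L2, Finset.sum_add_distrib]
    exact add_le_add (hle fun i => (z i τ).fst) (hle fun i => (z i τ).snd)

lemma steerable_of_ctrb {nx nu : Fin N → ℕ} {A : Matrix (Idx nx) (Idx nx) ℝ}
    {B : Matrix (Idx nx) (Idx nu) ℝ} {L σ : ℝ} {d : ℕ} (hL : 1 ≤ L) (hA : ‖A‖ ≤ L) (hB : ‖B‖ ≤ L)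
    (hσ : 0 < σ)
    (h : (ctrbMat A B d * (ctrbMat A B d).transpose
      - σ ^ 2 • (1 : Matrix (Idx nx) (Idx nx) ℝ)).PosSemidef) :
    Steerable (actL A) (actL B) d (L ^ d / σ ^ 2) := by
  refine steerable_of_gramian hL hA hB hσ fun x => ?_
  have h1 := h.dotProduct_mulVec_nonneg (fun a => x a)
  simp only [star_trivial, Matrix.sub_mulVec, Matrix.smul_mulVec, Matrix.one_mulVec,
    dotProduct_sub, dotProduct_smul] at h1
  have h2 : (fun a => x a) ⬝ᵥ (fun a => x a) = ‖x‖ ^ 2 := by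
    rw [vec_norm_sq]; simp [dotProduct, sq]
  have h3 : (fun a => x a) ⬝ᵥ ((ctrbMat A B d * (ctrbMat A B d).transpose).mulVec fun a => x a)
      = ∑ j ∈ Finset.range d, ‖(actL B).adjoint (((actL A).adjoint ^ j) x)‖ ^ 2 := by
    rw [← Matrix.mulVec_mulVec, Matrix.dotProduct_mulVec, ← Matrix.mulVec_transpose]
    simp only [dotProduct, ← sq]
    rw [Fintype.sum_prod_type, ← Fin.sum_univ_eq_sum_range
      (fun j => ‖(actL B).adjoint (((actL A).adjoint ^ j) x)‖ ^ 2)]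
    refine Finset.sum_congr rfl fun j _ => ?_
    have e : (actL B).adjoint (((actL A).adjoint ^ (j : ℕ)) x)
        = actL (A ^ (j : ℕ) * B).transpose x := by
      rw [actL_adjoint, actL_adjoint, ← actL_pow, ← ContinuousLinearMap.comp_apply, ← actL_mul,
        Matrix.transpose_mul, Matrix.transpose_pow]
    rw [e, vec_norm_sq]
    refine Finset.sum_congr rfl fun b _ => ?_
    rw [actL_apply]
    rfl
  rw [h2, h3, smul_eq_mul] at h1
  linarith

end Net

/-! ## Gradients of well-conditioned costs -/

section Grad

variable {E : Type} [NormedAddCommGroup E] [InnerProductSpace ℝ E] [CompleteSpace E] {μ L : ℝ}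
  {h : E → ℝ}

lemma WellConditioned.hasGradientAt (hw : WellConditioned μ L h) (x : E) :
    HasGradientAt h (gradient h x) x :=
  ((hw.contDiff.differentiable (by norm_num)) x).hasGradientAt

/-- Strong convexity on the segment bounds the slope of t ↦ h(y + t(x - y)) by h x - h y - (1 -
t)μ/2‖x - y‖²; then t tends to 0. -/
lemma WellConditioned.inner_le (hw : WellConditioned μ L h) (x y : E) :
    ⟪gradient h y, x - y⟫_ℝ ≤ h x - h y - μ / 2 * ‖x - y‖ ^ 2 := by
  have hd := hasDerivAt_comp_line (hw.hasGradientAt y) (x - y)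
  have hd' : HasDerivWithinAt (fun t : ℝ => h (y + t • (x - y))) ⟪gradient h y, x - y⟫_ℝ
      (Set.Ioi 0) 0 := hd.hasDerivWithinAt
  have ht := (hasDerivWithinAt_iff_tendsto_slope' (by simp)).1 hd'
  have hlim : Tendsto (fun t : ℝ => h x - h y - (1 - t) * (μ / 2 * ‖x - y‖ ^ 2))
      (𝓝[>] (0 : ℝ)) (𝓝 (h x - h y - (1 - 0) * (μ / 2 * ‖x - y‖ ^ 2))) := by
    refine (Continuous.tendsto ?_ 0).mono_left nhdsWithin_le_nhds
    fun_prop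
  rw [sub_zero, one_mul] at hlim
  refine le_of_tendsto_of_tendsto ht hlim ?_
  filter_upwards [Ioo_mem_nhdsGT (zero_lt_one' ℝ)] with t ht'
  have h1 := hw.strong.2 (Set.mem_univ x) (Set.mem_univ y) ht'.1.le
    (sub_nonneg.2 ht'.2.le) (by ring : t + (1 - t) = 1)
  have e : t • x + (1 - t) • y = y + t • (x - y) := by
    rw [smul_sub, sub_smul, one_smul]; abel
  rw [e] at h1
  simp only [slope_def_field, zero_smul, add_zero, sub_zero]
  rw [div_le_iff₀ ht'.1]
  simp only [smul_eq_mul] at h1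
  nlinarith

lemma WellConditioned.monoLip (hw : WellConditioned μ L h) : MonoLip μ L (gradient h) := by
  intro x y
  refine ⟨?_, hw.smooth x y⟩
  have h1 := hw.inner_le x y
  have h2 := hw.inner_le y x
  rw [← neg_sub x y, inner_neg_right, norm_neg] at h2
  rw [inner_sub_left]
  linarith

/-- The factor ‖x‖ keeps the inequality valid on a trivial space, where μ ≤ L cannot be deduced. -/
lemma MonoLip.mu_mul_le {G : E → E} (hG : MonoLip μ L G) (x : E) : μ * ‖x‖ ≤ L * ‖x‖ := by
  rcases eq_or_ne x 0 with rfl | hx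
  · simp
  · have hx' : 0 < ‖x‖ := norm_pos_iff.2 hx
    obtain ⟨h1, h2⟩ := hG x 0
    rw [sub_zero] at h1 h2
    have h3 := (real_inner_le_norm (G x - G 0) x)
    have h4 := mul_le_mul_of_nonneg_right h2 hx'.le
    nlinarith

lemma StageCost.gradient_zero (hs : StageCost μ L h) : gradient h 0 = 0 := by
  have hmin : IsLocalMin h 0 := Filter.Eventually.of_forall fun x => by
    rw [hs.zero]; exact hs.nonneg x
  have h1 := hmin.fderiv_eq_zero
  have h2 : gradient h 0 = (InnerProductSpace.toDual ℝ E).symm (fderiv ℝ h 0) := rfl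
  rw [h2, h1, map_zero]

lemma StageCost.quadratic_le (hs : StageCost μ L h) (x : E) : μ / 2 * ‖x‖ ^ 2 ≤ h x := by
  have h1 := hs.toWellConditioned.inner_le x 0
  simp only [hs.gradient_zero, hs.zero, inner_zero_left, sub_zero] at h1
  linarith

/-- Gradients of stage costs depend Lipschitz continuously on parameters, relative to the state. -/
lemma norm_gradient_sub_le {h' : E → ℝ} (hs : StageCost μ L h) (hs' : StageCost μ L h') {M : ℝ}
    (hH : ∀ x, ‖hessian h x - hessian h' x‖ ≤ M) (x : E) :
    ‖gradient h x - gradient h' x‖ ≤ M * ‖x‖ := by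
  have hdiff : ∀ {k : E → ℝ}, StageCost μ L k → Differentiable ℝ (gradient k) := by
    intro k hk
    have h1 : ContDiff ℝ 1 (fderiv ℝ k) := hk.contDiff.fderiv_right (by norm_num)
    have h2 : ContDiff ℝ 1 (gradient k) :=
      (InnerProductSpace.toDual ℝ E).symm.toContinuousLinearEquiv.contDiff.comp h1
    exact h2.differentiable (by norm_num)
  have hd : ∀ z ∈ Set.univ, HasFDerivWithinAt (fun z => gradient h z - gradient h' z)
      (hessian h z - hessian h' z) Set.univ z := fun z _ =>
    ((hdiff hs z).hasFDerivAt.sub (hdiff hs' z).hasFDerivAt).hasFDerivWithinAt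
  -- Both gradients vanish at 0, so the mean value inequality from 0 to x gives a bound proportional
  -- to ‖x‖.
  have := convex_univ.norm_image_sub_le_of_norm_hasFDerivWithin_le hd (fun z _ => hH z)
    (Set.mem_univ (0 : E)) (Set.mem_univ x)
  simpa [hs.gradient_zero, hs'.gradient_zero] using this

/-- The gradient of a radial cost is a multiple of the state. -/
lemma TerminalCost.exists_gradient_eq (hF : TerminalCost μ L h) (y : E) :
    ∃ s, μ ≤ s ∧ (∀ x : E, s * ‖x‖ ≤ L * ‖x‖) ∧ gradient h y = s • y := by
  obtain ⟨β, -, -, hβ⟩ := hF.radial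
  -- A radial function is invariant under linear isometries, so an isometry that fixes z also fixes
  -- the gradient at z. The map -1 then gives gradient zero at 0, and the reflection in the line
  -- through y puts the gradient at y on that line.
  have hiso : ∀ R : E ≃ₗᵢ[ℝ] E, ∀ z, R z = z → R (gradient h z) = gradient h z := by
    intro R z hz
    have h1 : HasGradientAt h (R.symm (gradient h z)) z := by
      have h2 : HasFDerivAt h (InnerProductSpace.toDual ℝ E (gradient h z)) (R z) := by
        rw [hz]; exact (hF.hasGradientAt z).hasFDerivAt
      have h3 := h2.comp z R.toContinuousLinearEquiv.hasFDerivAt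
      have e : h ∘ R = h := by
        funext x; simp [hβ]
      change HasFDerivAt (h ∘ R) _ z at h3
      rw [e] at h3
      rw [hasGradientAt_iff_hasFDerivAt]
      refine h3.congr_fderiv (ContinuousLinearMap.ext fun x => ?_)
      change ⟪gradient h z, R x⟫_ℝ = ⟪R.symm (gradient h z), x⟫_ℝ
      have := R.inner_map_map (R.symm (gradient h z)) x
      rw [R.apply_symm_apply] at this
      exact this
    have h4 := h1.unique (hF.hasGradientAt z)
    rw [LinearIsometryEquiv.symm_apply_eq] at h4
    exact h4.symm
  have hzero : gradient h 0 = 0 := by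
    have := hiso (LinearIsometryEquiv.neg ℝ) 0 (by simp)
    simp only [LinearIsometryEquiv.coe_neg] at this
    have h2 : (2 : ℝ) • gradient h 0 = 0 := by
      rw [two_smul]; nth_rewrite 1 [← this]; simp
    simpa using h2
  have hml := hF.monoLip
  rcases eq_or_ne y 0 with rfl | hy
  · exact ⟨μ, le_rfl, hml.mu_mul_le, by simp [hzero]⟩
  · have hy' : 0 < ‖y‖ := norm_pos_iff.2 hy
    have hmem : gradient h y ∈ (ℝ ∙ y) := by
      rw [← Submodule.reflection_eq_self_iff]
      exact hiso _ y ((Submodule.reflection_eq_self_iff y).2 (Submodule.mem_span_singleton_self y))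
    obtain ⟨s, hs⟩ := Submodule.mem_span_singleton.1 hmem
    obtain ⟨h1, h2⟩ := hml y 0
    rw [hzero, sub_zero, sub_zero, ← hs] at h1 h2
    rw [real_inner_smul_left, real_inner_self_eq_norm_sq] at h1
    rw [norm_smul, Real.norm_eq_abs] at h2
    have h3 : μ ≤ s := le_of_mul_le_mul_right h1 (by positivity)
    have h4 : s ≤ L := (le_abs_self s).trans (le_of_mul_le_mul_right h2 hy')
    exact ⟨s, h3, fun x => mul_le_mul_of_nonneg_right h4 (norm_nonneg x), hs.symm⟩

end Grad

/-! ### Monotonicity of separable costs in node-weighted inner products -/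

section Node

variable {N : ℕ} {n : Fin N → ℕ} {μ L : ℝ}

/-- Strong monotonicity and Lipschitz continuity in all node-weighted inner products. -/
def NodeMono (μ L : ℝ) (G : Vec n → Vec n) : Prop :=
  ∀ (w : Fin N → ℝ) (x x' : Vec n),
    μ * ‖nodeDiag w (x - x')‖ ^ 2 ≤ ⟪nodeDiag w (G x - G x'), nodeDiag w (x - x')⟫_ℝ ∧
    ‖nodeDiag w (G x - G x')‖ ≤ L * ‖nodeDiag w (x - x')‖

lemma nodeDiag_one (x : Vec n) : nodeDiag (fun _ => (1 : ℝ)) x = x := by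
  ext a; simp

lemma NodeMono.monoLip {G : Vec n → Vec n} (hG : NodeMono μ L G) : MonoLip μ L G := by
  intro x x'
  have := hG (fun _ => 1) x x'
  simpa only [nodeDiag_one] using this

lemma nodeMono_smul {s : ℝ} (h1 : μ ≤ s) (hμ : 0 ≤ μ) (h2 : ∀ x : Vec n, s * ‖x‖ ≤ L * ‖x‖) :
    NodeMono μ L (fun y : Vec n => s • y) := by
  intro w x x'
  rw [← smul_sub, map_smul, norm_smul, Real.norm_eq_abs, abs_of_nonneg (hμ.trans h1)]
  refine ⟨?_, h2 _⟩
  rw [real_inner_smul_left, real_inner_self_eq_norm_sq]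
  exact mul_le_mul_of_nonneg_right h1 (sq_nonneg _)

/-- The gradient of a sum of node costs is computed node by node. -/
lemma gradient_apply_eq_of_blk_eq {h : Vec n → ℝ} {φ : (i : Fin N) → EuclideanSpace ℝ (Fin (n i)) → ℝ}
    (hφ : ∀ x, h x = ∑ i, φ i (blk x i)) {x x' g g' : Vec n} (hg : HasGradientAt h g x)
    (hg' : HasGradientAt h g' x') {a : Idx n} (ha : blk x a.1 = blk x' a.1) : g a = g' a := by
  set e : Vec n := EuclideanSpace.single a 1 with he
  have h1 := (hasDerivAt_comp_line hg e).sub (hasDerivAt_comp_line hg' e)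
  -- Along `e` only the block containing `a` moves, and x and x' agree in it, so the difference of
  -- the costs is constant in t.
  have h2 : ((fun t : ℝ => h (x + t • e)) - fun t : ℝ => h (x' + t • e))
      = fun _ => h x - h x' := by
    funext t
    simp only [Pi.sub_apply, hφ]
    rw [← Finset.sum_sub_distrib, ← Finset.sum_sub_distrib]
    refine Finset.sum_congr rfl fun i _ => ?_
    by_cases hi : i = a.1
    · subst hi
      have : ∀ z : Vec n, blk (z + t • e) a.1 = blk z a.1 + t • blk e a.1 := fun z => rfl
      rw [this, this, ha]
      ring
    · have h3 : blk e i = 0 := by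
        ext b
        have : (⟨i, b⟩ : Idx n) ≠ a := fun hc => hi (by rw [← hc])
        simp [blk, he, this]
      have : ∀ z : Vec n, blk (z + t • e) i = blk z i := fun z => by
        have : blk (z + t • e) i = blk z i + t • blk e i := rfl
        rw [this, h3, smul_zero, add_zero]
      rw [this, this]
  rw [h2] at h1
  have h3 := h1.unique (hasDerivAt_const _ _)
  have h4 : ∀ z : Vec n, ⟪z, e⟫_ℝ = z a := fun z => by
    rw [vec_inner, Finset.sum_eq_single a]
    · simp [he]
    · intro b _ hb; simp [he, hb]
    · simp
  rw [h4, h4] at h3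
  linarith

lemma inner_eq_sum_blk (x y : Vec n) : ⟪x, y⟫_ℝ = ∑ i, ⟪blk x i, blk y i⟫_ℝ := by
  rw [vec_inner, Fintype.sum_sigma]
  refine Finset.sum_congr rfl fun i _ => ?_
  simp [PiLp.inner_apply, blk, mul_comm]

/-- For a separable cost both bounds hold block by block and therefore survive any weighting of the
blocks. The bound for block i comes from comparing x' with x' + p, where p is the part of x - x' at
node i. -/
lemma WellConditioned.nodeMono {h : Vec n → ℝ} (hw : WellConditioned μ L h) (hL : 0 ≤ L)
    {φ : (i : Fin N) → EuclideanSpace ℝ (Fin (n i)) → ℝ} (hφ : ∀ x, h x = ∑ i, φ i (blk x i)) :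
    NodeMono μ L (gradient h) := by
  intro w x x'
  set g := gradient h x - gradient h x' with hg
  have key : ∀ i, μ * ‖blk (x - x') i‖ ^ 2 ≤ ⟪blk g i, blk (x - x') i⟫_ℝ ∧
      ‖blk g i‖ ≤ L * ‖blk (x - x') i‖ := by
    intro i
    set p : Vec n := nodeDiag (fun j => if j = i then 1 else 0) (x - x') with hp
    have hpb : blk p i = blk (x - x') i := by ext b; simp [hp, blk]
    have hpb' : ∀ j, j ≠ i → blk p j = 0 := fun j hj => by ext b; simp [hp, blk, hj]
    have hpn : ‖p‖ ^ 2 = ‖blk (x - x') i‖ ^ 2 := by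
      rw [norm_sq_eq_sum_blk, Finset.sum_eq_single i, hpb]
      · intro j _ hj; rw [hpb' j hj]; simp
      · simp
    have hpn' : ‖p‖ = ‖blk (x - x') i‖ :=
      (pow_left_inj₀ (norm_nonneg _) (norm_nonneg _) two_ne_zero).1 hpn
    have hgb : blk (gradient h (x' + p) - gradient h x') i = blk g i := by
      ext b
      have e : blk (x' + p) i = blk x i := by
        have : blk (x' + p) i = blk x' i + blk p i := rfl
        rw [this, hpb, blk_sub]; abel
      have := gradient_apply_eq_of_blk_eq hφ (hw.hasGradientAt (x' + p)) (hw.hasGradientAt x)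
        (a := ⟨i, b⟩) e
      simp only [blk, hg, PiLp.sub_apply, this]
    obtain ⟨h1, h2⟩ := hw.monoLip (x' + p) x'
    rw [add_sub_cancel_left] at h1 h2
    constructor
    · rw [inner_eq_sum_blk, Finset.sum_eq_single i, hgb, hpb, hpn] at h1
      · exact h1
      · intro j _ hj; rw [hpb' j hj, inner_zero_right]
      · simp
    · rw [← hgb, ← hpn']
      exact (norm_blk_le _ i).trans h2
  have hblk : ∀ (z : Vec n) i, blk (nodeDiag w z) i = w i • blk z i := fun z i => rfl
  constructor
  · rw [norm_sq_eq_sum_blk, inner_eq_sum_blk, Finset.mul_sum]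
    refine Finset.sum_le_sum fun i _ => ?_
    rw [hblk, hblk]
    exact inner_smul_smul_ge (key i).1 (w i)
  · apply abs_le_of_sq_le_sq' _ (by positivity) |>.2
    rw [mul_pow, norm_sq_eq_sum_blk, norm_sq_eq_sum_blk, Finset.mul_sum]
    refine Finset.sum_le_sum fun i _ => ?_
    rw [hblk, hblk, ← mul_pow]
    exact pow_le_pow_left₀ (norm_nonneg _) (norm_smul_le_mul (key i).2 (w i)) 2

end Node

/-! ## Constants -/

section Constants

variable {L γ μ : ℝ}

/-- The temporal decay rate coming from the weighted stability estimate. -/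
def timeRate (L γ μ : ℝ) : ℝ := (1 + muH L γ μ / (2 * L))⁻¹

/-- The joint rate of decay in space and time. -/
def spaceRate (L γ μ : ℝ) : ℝ := (1 + muH L γ μ / (28 * L))⁻¹

/-- The constant of the weighted stability estimate. -/
def decayConst (L γ μ : ℝ) : ℝ := (muH L γ μ)⁻¹ / 2

lemma invConst_sq (hL : 1 < L) (hγ : γ < 1) : invConst L γ ^ 2 = (muJ L γ)⁻¹ := by
  have : (1 - γ) ≠ 0 := by linarith
  unfold invConst muJ
  rw [mul_pow, Real.sq_sqrt (by positivity)]
  field_simp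

lemma invConst_pos (hL : 1 < L) (hγ : γ < 1) : 0 < invConst L γ := by
  have : 0 < 1 - γ := by linarith
  unfold invConst; positivity

lemma two_mul_sq_le_invConst_sq (hL : 1 < L) (hγ0 : 0 < γ) (hγ : γ < 1) :
    2 * L ^ 2 ≤ invConst L γ ^ 2 := by
  rw [invConst_sq hL hγ, muJ, inv_div]
  have : 0 < 1 - γ := by linarith
  rw [le_div_iff₀ (by positivity)]
  have h1 : (1 - γ) ^ 2 ≤ 1 := by nlinarith
  have h2 : 2 ≤ 1 + L ^ 2 := by nlinarith
  nlinarith [mul_le_mul_of_nonneg_left h1 (by positivity : 0 ≤ 2 * L ^ 2), sq_nonneg L,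
    mul_le_mul_of_nonneg_left h2 (sq_nonneg L)]

/-- Exhibits μ_H in terms of the right inverse bound: 1/μ_J is its square, and the polynomial in
L_H/μ is a perfect square. -/
lemma inv_muH (hL : 1 < L) (hγ : γ < 1) :
    (muH L γ μ)⁻¹ = 1 / μ + (1 + LH L / μ) ^ 2 * (LH L * invConst L γ ^ 2) := by
  rw [muH, inv_inv, invConst_sq hL hγ]; ring

lemma LH_mul_invConst_sq_le (hL : 1 < L) (hγ : γ < 1) (hμ : 0 < μ) :
    LH L * invConst L γ ^ 2 ≤ (muH L γ μ)⁻¹ := by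
  rw [inv_muH hL hγ]
  have h0 : 0 < LH L := by unfold LH; linarith
  have h1 : 1 ≤ (1 + LH L / μ) ^ 2 := by
    have : 0 ≤ LH L / μ := by positivity
    nlinarith
  have h2 : 0 ≤ LH L * invConst L γ ^ 2 := by positivity
  have h3 : 0 ≤ 1 / μ := by positivity
  nlinarith

lemma six_le_inv_muH (hL : 1 < L) (hγ0 : 0 < γ) (hγ : γ < 1) (hμ : 0 < μ) :
    6 ≤ (muH L γ μ)⁻¹ := by
  have h1 := LH_mul_invConst_sq_le hL hγ hμ
  have h2 := two_mul_sq_le_invConst_sq hL hγ0 hγ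
  have h3 : 3 ≤ LH L := by unfold LH; linarith
  have h4 : 2 ≤ invConst L γ ^ 2 := by nlinarith
  nlinarith

lemma muH_pos (hL : 1 < L) (hγ0 : 0 < γ) (hγ : γ < 1) (hμ : 0 < μ) : 0 < muH L γ μ :=
  inv_pos.1 (by linarith [six_le_inv_muH hL hγ0 hγ hμ])

lemma muH_le (hL : 1 < L) (hγ0 : 0 < γ) (hγ : γ < 1) (hμ : 0 < μ) : muH L γ μ ≤ 1 / 6 := by
  have h := six_le_inv_muH hL hγ0 hγ hμ
  have := inv_anti₀ (by norm_num) h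
  rw [inv_inv] at this
  linarith

/-- The saddle constant c = 1/(3μ_H) is admissible. With commutators of total size μ_H one has cμ_H
= 1/3, whence a = c/(1 - 1/3) = 1/(2μ_H). -/
lemma isDecayConst (hL : 1 < L) (hγ0 : 0 < γ) (hγ : γ < 1) (hμ : 0 < μ) :
    IsDecayConst μ L (invConst L γ) ((muH L γ μ)⁻¹ / 3) (2 * (muH L γ μ / 2))
      (decayConst L γ μ) := by
  have hH := muH_pos hL hγ0 hγ hμ
  have hm := invConst_pos hL hγ
  have hm2 := two_mul_sq_le_invConst_sq hL hγ0 hγ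
  have e := inv_muH (μ := μ) hL hγ
  set m := invConst L γ with hmdef
  have hm1 : 7 / 5 ≤ m := by nlinarith
  have e2 : (muH L γ μ)⁻¹ = 1 / μ + LH L * m ^ 2 + 2 * LH L ^ 2 * m ^ 2 * (1 / μ)
      + LH L ^ 3 * m ^ 2 * (1 / μ) ^ 2 := by rw [e]; ring
  have hi : 0 < 1 / μ := by positivity
  have hLH : LH L = 2 * L + 1 := rfl
  have h3 : 0 ≤ LH L ^ 3 * m ^ 2 * (1 / μ) ^ 2 := by
    have : 0 < LH L := by rw [hLH]; linarith
    positivity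
  have hmm : m * (7 / 5) ≤ m ^ 2 := by nlinarith
  refine ⟨hμ, by linarith, hm.le, ⟨?_, ?_⟩, by positivity, by positivity,
    by unfold decayConst; positivity, ?_⟩
  · have e3 : (1 + m * L) * (3 / 2 / μ) + m = (3 / 2 + 3 / 2 * (m * L)) * (1 / μ) + m := by ring
    rw [e3, e2]
    have k1 : 3 * m ≤ LH L * m ^ 2 := by rw [hLH]; nlinarith
    have k2 : 9 / 2 + 9 / 2 * (m * L) ≤ 2 * LH L ^ 2 * m ^ 2 := by
      have : 9 ≤ LH L ^ 2 := by rw [hLH]; nlinarith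
      have : 6 * L ≤ LH L ^ 2 := by rw [hLH]; nlinarith
      have : m * L ≤ m ^ 2 * L := mul_le_mul_of_nonneg_right (by nlinarith) (by linarith)
      nlinarith
    have k3 := mul_le_mul_of_nonneg_right k2 hi.le
    linarith
  · have e3 : (1 + m * L) * (L / μ + 1 / 2) * m
        = (m * L + m ^ 2 * L ^ 2) * (1 / μ) + (m / 2 + m ^ 2 * L / 2) := by ring
    rw [e3, e2]
    have k1 : 3 * (m / 2 + m ^ 2 * L / 2) ≤ LH L * m ^ 2 := by rw [hLH]; nlinarith
    have k2 : 3 * (m * L + m ^ 2 * L ^ 2) ≤ 2 * LH L ^ 2 * m ^ 2 := by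
      have : m * L ≤ m ^ 2 * L := mul_le_mul_of_nonneg_right (by nlinarith) (by linarith)
      rw [hLH]; nlinarith [sq_nonneg m, sq_nonneg (m * L)]
    have k3 := mul_le_mul_of_nonneg_right k2 hi.le
    linarith
  · apply le_of_eq
    unfold decayConst
    field_simp
    norm_num

lemma timeRate_pos (hL : 1 < L) (hγ0 : 0 < γ) (hγ : γ < 1) (hμ : 0 < μ) : 0 < timeRate L γ μ := by
  have := muH_pos hL hγ0 hγ hμ
  unfold timeRate; positivity

lemma timeRate_lt_one (hL : 1 < L) (hγ0 : 0 < γ) (hγ : γ < 1) (hμ : 0 < μ) :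
    timeRate L γ μ < 1 := by
  have := muH_pos hL hγ0 hγ hμ
  have h2 : 0 < muH L γ μ / (2 * L) := by positivity
  exact inv_lt_one_of_one_lt₀ (by linarith)

/-- The rate is defined so that A and B each contribute a commutator of size μ_H/2. -/
lemma inv_timeRate_sub_one_mul (hL : 1 < L) : ((timeRate L γ μ)⁻¹ - 1) * L = muH L γ μ / 2 := by
  rw [timeRate, inv_inv]; field_simp; ring

lemma inv_one_sub_timeRate (hL : 1 < L) (hγ0 : 0 < γ) (hγ : γ < 1) (hμ : 0 < μ) :
    (1 - timeRate L γ μ)⁻¹ = 1 + 2 * L * (muH L γ μ)⁻¹ := by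
  have := muH_pos hL hγ0 hγ hμ
  have e : 1 - timeRate L γ μ = muH L γ μ / (2 * L + muH L γ μ) := by
    unfold timeRate; field_simp; ring
  rw [e]; field_simp; ring

lemma spaceRate_pos (hL : 1 < L) (hγ0 : 0 < γ) (hγ : γ < 1) (hμ : 0 < μ) :
    0 < spaceRate L γ μ := by
  have := muH_pos hL hγ0 hγ hμ
  unfold spaceRate; positivity

lemma spaceRate_lt_one (hL : 1 < L) (hγ0 : 0 < γ) (hγ : γ < 1) (hμ : 0 < μ) :
    spaceRate L γ μ < 1 := by
  have := muH_pos hL hγ0 hγ hμ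
  have h2 : 0 < muH L γ μ / (28 * L) := by positivity
  exact inv_lt_one_of_one_lt₀ (by linarith)

lemma inv_spaceRate_sub_one_mul (hL : 1 < L) :
    14 * ((spaceRate L γ μ)⁻¹ - 1) * L = muH L γ μ / 2 := by
  rw [spaceRate, inv_inv]; field_simp; ring

lemma inv_spaceRate_le_two (hL : 1 < L) (hγ0 : 0 < γ) (hγ : γ < 1) (hμ : 0 < μ) :
    (spaceRate L γ μ)⁻¹ ≤ 2 := by
  have h1 := muH_pos hL hγ0 hγ hμ
  have h2 := muH_le hL hγ0 hγ hμ
  rw [spaceRate, inv_inv]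
  have : muH L γ μ / (28 * L) ≤ 1 := by rw [div_le_one (by positivity)]; linarith
  linarith

lemma inv_one_sub_spaceRate (hL : 1 < L) (hγ0 : 0 < γ) (hγ : γ < 1) (hμ : 0 < μ) :
    (1 - spaceRate L γ μ)⁻¹ = 1 + 28 * L * (muH L γ μ)⁻¹ := by
  have := muH_pos hL hγ0 hγ hμ
  have e : 1 - spaceRate L γ μ = muH L γ μ / (28 * L + muH L γ μ) := by
    unfold spaceRate; field_simp; ring
  rw [e]; field_simp; ring

/-- As ρ² ≤ ρ, one has 1 - ρ ≤ 1 - ρ² ≤ 2μ_H²/L_H². The gap of ρ is thus quadratic in μ_H, whereas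
those of `timeRate` and `spaceRate` are linear; all later comparisons of constants live on this
slack. -/
lemma rho_facts (hL : 1 < L) (hγ0 : 0 < γ) (hγ : γ < 1) (hμ : 0 < μ) :
    0 < rho L γ μ ∧ rho L γ μ < 1 ∧ LH L ^ 2 * (muH L γ μ)⁻¹ ^ 2 / 2 ≤ (1 - rho L γ μ)⁻¹ := by
  have h1 := muH_pos hL hγ0 hγ hμ
  have h2 := muH_le hL hγ0 hγ hμ
  have h3 : 3 < LH L := by unfold LH; linarith
  set H := muH L γ μ
  have hden : 0 < LH L ^ 2 + H ^ 2 := by positivity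
  have hnum : 0 < LH L ^ 2 - H ^ 2 := by nlinarith
  set v := (LH L ^ 2 - H ^ 2) / (LH L ^ 2 + H ^ 2) with hv
  have hv0 : 0 < v := div_pos hnum hden
  have hv1 : v < 1 := by rw [hv, div_lt_one hden]; nlinarith
  have hr : rho L γ μ = Real.sqrt v := rfl
  have r0 : 0 < Real.sqrt v := Real.sqrt_pos.2 hv0
  have r1 : Real.sqrt v < 1 := by rw [Real.sqrt_lt' one_pos]; simpa using hv1
  have r2 : v ≤ Real.sqrt v := by
    nlinarith [Real.sq_sqrt hv0.le]
  rw [hr]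
  refine ⟨r0, r1, ?_⟩
  rw [le_inv_comm₀ (by positivity) (by linarith)]
  have : 1 - v ≤ 2 * H ^ 2 / LH L ^ 2 := by
    rw [hv, le_div_iff₀ (by positivity), sub_mul, div_mul_eq_mul_div, one_mul, sub_le_iff_le_add,
      ← sub_le_iff_le_add', le_div_iff₀ hden]
    nlinarith [sq_nonneg (H ^ 2)]
  have e : (LH L ^ 2 * H⁻¹ ^ 2 / 2)⁻¹ = 2 * H ^ 2 / LH L ^ 2 := by field_simp
  rw [e]; linarith

lemma large_facts (hL : 1 < L) (hγ0 : 0 < γ) (hγ : γ < 1) (hμ : 0 < μ) :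
    36 * (L * (muH L γ μ)⁻¹) ≤ LH L ^ 2 * (muH L γ μ)⁻¹ ^ 2 := by
  have h := six_le_inv_muH hL hγ0 hγ hμ
  have h3 : 3 ≤ LH L := by unfold LH; linarith
  have h4 : 2 * L ≤ LH L := by unfold LH; linarith
  calc 36 * (L * (muH L γ μ)⁻¹) = (2 * L * (muH L γ μ)⁻¹) * (3 * 6) := by ring
    _ ≤ (LH L * (muH L γ μ)⁻¹) * (LH L * (muH L γ μ)⁻¹) := by
      gcongr
    _ = _ := by ring

lemma timeRate_le_rho (hL : 1 < L) (hγ0 : 0 < γ) (hγ : γ < 1) (hμ : 0 < μ) :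
    timeRate L γ μ ≤ rho L γ μ := by
  obtain ⟨r0, r1, r2⟩ := rho_facts hL hγ0 hγ hμ
  have h1 := inv_one_sub_timeRate hL hγ0 hγ hμ
  have h2 := large_facts hL hγ0 hγ hμ
  have h3 := six_le_inv_muH hL hγ0 hγ hμ
  have h4 : (1 - timeRate L γ μ)⁻¹ ≤ (1 - rho L γ μ)⁻¹ := by rw [h1]; nlinarith
  have := (inv_le_inv₀ (by linarith [timeRate_lt_one hL hγ0 hγ hμ]) (by linarith)).1 h4
  linarith

lemma deltaS_facts (hL : 1 < L) (hγ0 : 0 < γ) (hγ : γ < 1) (hμ : 0 < μ) :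
    1 / 2 < deltaS L γ μ ∧ deltaS L γ μ < 1 ∧ rho L γ μ < deltaS L γ μ ∧
      LH L ^ 2 * (muH L γ μ)⁻¹ ^ 2 ≤ (1 - deltaS L γ μ)⁻¹ := by
  obtain ⟨r0, r1, r2⟩ := rho_facts hL hγ0 hγ hμ
  unfold deltaS
  refine ⟨by linarith, by linarith, by linarith, ?_⟩
  have e : (1 - (rho L γ μ + 1) / 2)⁻¹ = 2 * (1 - rho L γ μ)⁻¹ := by
    have : (1 - rho L γ μ) ≠ 0 := by linarith
    rw [show 1 - (rho L γ μ + 1) / 2 = (1 - rho L γ μ) / 2 by ring, inv_div]; ring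
  rw [e]; linarith

lemma spaceRate_le_deltaS (hL : 1 < L) (hγ0 : 0 < γ) (hγ : γ < 1) (hμ : 0 < μ) :
    spaceRate L γ μ ≤ deltaS L γ μ := by
  obtain ⟨r0, r1, r2, r3⟩ := deltaS_facts hL hγ0 hγ hμ
  have h1 := inv_one_sub_spaceRate hL hγ0 hγ hμ
  have h2 := large_facts hL hγ0 hγ hμ
  have h3 := six_le_inv_muH hL hγ0 hγ hμ
  have h4 : (1 - spaceRate L γ μ)⁻¹ ≤ (1 - deltaS L γ μ)⁻¹ := by rw [h1]; nlinarith
  have := (inv_le_inv₀ (by linarith [spaceRate_lt_one hL hγ0 hγ hμ]) (by linarith)).1 h4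
  linarith

lemma le_alpha (hL : 1 < L) (hγ0 : 0 < γ) (hγ : γ < 1) (hμ : 0 < μ) :
    LH L * (muH L γ μ)⁻¹ ^ 2 ≤ alpha L γ μ := by
  obtain ⟨r0, r1, -⟩ := rho_facts hL hγ0 hγ hμ
  have h1 := muH_pos hL hγ0 hγ hμ
  have h3 : 0 < LH L := by unfold LH; linarith
  have h4 : 1 ≤ (rho L γ μ)⁻¹ := (one_le_inv₀ r0).2 r1.le
  have e : alpha L γ μ = LH L * (muH L γ μ)⁻¹ ^ 2 * (rho L γ μ)⁻¹ := by
    unfold alpha; field_simp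
  rw [e]
  exact le_mul_of_one_le_right (by positivity) h4

end Constants

/-! ## Exponential decay over the network -/

section Spatial

variable {N : ℕ} {n m : Fin N → ℕ} {G : SimpleGraph (Fin N)}

/-- Keeping only the entries between classes of equal labels does not increase the norm. -/
lemma norm_actL_label_le {ι : Type*} [DecidableEq ι] (α : Idx n → ι) (β : Idx m → ι)
    (M : Matrix (Idx n) (Idx m) ℝ) {L : ℝ} (hL : 0 ≤ L) (hM : ‖actL M‖ ≤ L) (z : Vec m) :
    ‖actL (Matrix.of fun a b => if α a = β b then M a b else 0) z‖ ≤ L * ‖z‖ := by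
  -- Row `a` sees only the part of z with label `α a`, so the restricted matrix is block diagonal
  -- with respect to the labels and orthogonality gives the norm bound.
  set part : ι → Vec m := fun l => WithLp.toLp 2 fun b => if β b = l then z b else 0 with hpart
  set T := Finset.univ.image α
  apply abs_le_of_sq_le_sq' _ (by positivity) |>.2
  rw [mul_pow, vec_norm_sq]
  have e : ∀ a, actL (Matrix.of fun a b => if α a = β b then M a b else 0) z a
      = actL M (part (α a)) a := by
    intro a
    rw [actL_apply, actL_apply]
    refine Finset.sum_congr rfl fun b _ => ?_
    by_cases h : α a = β b
    · simp [hpart, h]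
    · simp [hpart, h, Ne.symm h]
  calc ∑ a, (actL (Matrix.of fun a b => if α a = β b then M a b else 0) z a) ^ 2
      ≤ ∑ a, ∑ l ∈ T, (actL M (part l) a) ^ 2 := by
        refine Finset.sum_le_sum fun a _ => ?_
        rw [e a]
        exact Finset.single_le_sum (f := fun l => (actL M (part l) a) ^ 2)
          (fun _ _ => sq_nonneg _) (Finset.mem_image_of_mem α (Finset.mem_univ a))
    _ = ∑ l ∈ T, ‖actL M (part l)‖ ^ 2 := by
        rw [Finset.sum_comm]; simp only [vec_norm_sq]
    _ ≤ ∑ l ∈ T, L ^ 2 * ‖part l‖ ^ 2 := by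
        refine Finset.sum_le_sum fun l _ => ?_
        rw [← mul_pow]
        exact pow_le_pow_left₀ (norm_nonneg _) (((actL M).le_opNorm _).trans (by gcongr)) 2
    _ ≤ L ^ 2 * ‖z‖ ^ 2 := by
        rw [← Finset.mul_sum]
        refine mul_le_mul_of_nonneg_left ?_ (sq_nonneg L)
        simp only [vec_norm_sq]
        rw [Finset.sum_comm]
        refine Finset.sum_le_sum fun b _ => ?_
        have : ∀ l, (part l b) ^ 2 = if β b = l then z b ^ 2 else 0 := fun l => by
          by_cases h : β b = l <;> simp [hpart, h]
        simp only [this, Finset.sum_ite_eq]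
        split_ifs
        · exact le_rfl
        · exact sq_nonneg _

open Classical in
/-- Weight decaying exponentially with the distance to `i`, zero outside the component of `i`. -/
def spatialWeight (G : SimpleGraph (Fin N)) (i : Fin N) (q : ℝ) (j : Fin N) : ℝ :=
  if G.edist i j = ⊤ then 0 else q ^ (G.edist i j).toNat

lemma spatialWeight_self (i : Fin N) (q : ℝ) : spatialWeight G i q i = 1 := by
  simp [spatialWeight]

lemma spatialWeight_nonneg {q : ℝ} (hq : 0 ≤ q) (i j : Fin N) : 0 ≤ spatialWeight G i q j := by
  unfold spatialWeight; split_ifs <;> positivity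

lemma edist_le_add_one {i j k : Fin N} (h : j = k ∨ G.Adj j k) : G.edist i j ≤ G.edist i k + 1 := by
  rcases h with rfl | h
  · exact le_self_add
  · refine (SimpleGraph.edist_triangle (v := k)).trans (add_le_add le_rfl ?_)
    exact (SimpleGraph.edist_eq_one_iff_adj.2 h.symm).le

-- Distances to i change by at most one across an edge, so the weight changes by a factor q, 1 or
-- q⁻¹, or vanishes at both ends. The indicators make it possible to split the commutator by
-- distance layers.
open Classical in
lemma spatialWeight_sub {q : ℝ} (hq : 0 < q) (i : Fin N) {j k : Fin N} (h : j = k ∨ G.Adj j k) :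
    spatialWeight G i q j - spatialWeight G i q k
      = ((q - 1) * (if G.edist i j = G.edist i k + 1 then 1 else 0)
        + (q⁻¹ - 1) * (if G.edist i j + 1 = G.edist i k then 1 else 0)) * spatialWeight G i q k := by
  have h1 := edist_le_add_one (i := i) h
  have h2 := edist_le_add_one (i := i) (h.imp Eq.symm fun h => h.symm)
  unfold spatialWeight
  generalize G.edist i j = e at *
  generalize G.edist i k = f at *
  induction e using ENat.recTopCoe with
  | top =>
    have : f = ⊤ := by
      by_contra hf
      lift f to ℕ using hf
      exact absurd h1 (by rw [not_le]; exact_mod_cast ENat.natCast_lt_top (f + 1))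
    simp [this]
  | coe a =>
    induction f using ENat.recTopCoe with
    | top => exact absurd h2 (by rw [not_le]; exact_mod_cast ENat.natCast_lt_top (a + 1))
    | coe b =>
      have g1 : a ≤ b + 1 := by exact_mod_cast h1
      have g2 : b ≤ a + 1 := by exact_mod_cast h2
      have c1 : ((a : ℕ∞) = (b : ℕ∞) + 1) ↔ a = b + 1 := by exact_mod_cast Iff.rfl
      have c2 : ((a : ℕ∞) + 1 = (b : ℕ∞)) ↔ a + 1 = b := by exact_mod_cast Iff.rfl
      simp only [ENat.natCast_ne_top, if_false, ENat.toNat_natCast, c1, c2]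
      rcases (by omega : a = b + 1 ∨ a = b ∨ a + 1 = b) with rfl | rfl | rfl
      · simp [pow_succ, show ¬ b + 1 + 1 = b by omega]; ring
      · simp
      · simp [pow_succ, show ¬ a = a + 1 + 1 by omega]; field_simp

/-- Commutator of a network matrix with the spatial weight. -/
lemma norm_spatialWeight_comm_le {M : Matrix (Idx n) (Idx m) ℝ} (hS : Sparse G M) {L q : ℝ}
    (hL : 0 ≤ L) (hM : ‖actL M‖ ≤ L) (hq : 0 < q) (hq1 : q ≤ 1) (i : Fin N) (x : Vec m) :
    ‖nodeDiag (spatialWeight G i q) (actL M x) - actL M (nodeDiag (spatialWeight G i q) x)‖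
      ≤ 2 * (q⁻¹ - 1) * L * ‖nodeDiag (spatialWeight G i q) x‖ := by
  classical
  set z := nodeDiag (spatialWeight G i q) x with hz
  have hi : 1 ≤ q⁻¹ := (one_le_inv₀ hq).2 hq1
  have h1 := norm_actL_label_le (fun a : Idx n => G.edist i a.1) (fun b : Idx m => G.edist i b.1 + 1)
    M hL hM z
  have h2 := norm_actL_label_le (fun a : Idx n => G.edist i a.1 + 1) (fun b : Idx m => G.edist i b.1)
    M hL hM z
  -- Only entries between consecutive distance layers survive. Each of the two parts is a label
  -- restriction of `M`, so its norm is at most L and no growth constant of the graph appears.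
  have e : nodeDiag (spatialWeight G i q) (actL M x) - actL M z
      = (q - 1) • actL (Matrix.of fun a b =>
          if G.edist i a.1 = G.edist i b.1 + 1 then M a b else 0) z
        + (q⁻¹ - 1) • actL (Matrix.of fun a b =>
          if G.edist i a.1 + 1 = G.edist i b.1 then M a b else 0) z := by
    ext a
    simp only [PiLp.sub_apply, PiLp.add_apply, PiLp.smul_apply, nodeDiag_apply, actL_apply,
      smul_eq_mul, Finset.mul_sum, ← Finset.sum_sub_distrib, ← Finset.sum_add_distrib, hz,
      Matrix.of_apply]
    refine Finset.sum_congr rfl fun b _ => ?_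
    by_cases hab : M a b = 0
    · simp [hab]
    · have := spatialWeight_sub hq i (hS.eq_or_adj hab)
      have e1 : ∀ (p : Prop) [Decidable p], (if p then M a b else 0) = (if p then 1 else 0) * M a b :=
        fun p _ => by split_ifs <;> simp
      rw [e1, e1]
      linear_combination (M a b * x b) * this
  rw [e]
  refine (norm_add_le _ _).trans ?_
  rw [norm_smul, norm_smul, Real.norm_eq_abs, Real.norm_eq_abs, abs_of_nonneg (sub_nonneg.2 hi),
    abs_of_nonpos (by linarith : q - 1 ≤ 0)]
  have h3 : -(q - 1) ≤ q⁻¹ - 1 := by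
    have : q * q⁻¹ = 1 := mul_inv_cancel₀ hq.ne'
    nlinarith
  have h4 := mul_le_mul h3 h1 (norm_nonneg _) (by linarith)
  have h5 := mul_le_mul_of_nonneg_left h2 (sub_nonneg.2 hi)
  linarith

lemma nodeDiag_mul_left (t : ℝ) (w : Fin N → ℝ) (x : Vec n) :
    nodeDiag (fun j => t * w j) x = t • nodeDiag w x := by
  ext a; simp [mul_assoc]

/-- Commutators with weights decaying in time and space. -/
lemma norm_weight_comm_le {M : Matrix (Idx n) (Idx m) ℝ} (hS : Sparse G M) {L q : ℝ}
    (hL : 0 ≤ L) (hM : ‖actL M‖ ≤ L) (hq : 0 < q) (hq1 : q ≤ 1) (hq2 : q⁻¹ ≤ 2) (i : Fin N)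
    (τ : ℕ) (x : Vec m) :
    ‖nodeDiag (fun j => q ^ (τ + 1) * spatialWeight G i q j) (actL M x)
        - actL M (nodeDiag (fun j => q ^ τ * spatialWeight G i q j) x)‖
      ≤ 14 * (q⁻¹ - 1) * L * ‖nodeDiag (fun j => q ^ τ * spatialWeight G i q j) x‖ ∧
    ‖nodeDiag (fun j => q ^ τ * spatialWeight G i q j) (actL M x)
        - actL M (nodeDiag (fun j => q ^ (τ + 1) * spatialWeight G i q j) x)‖
      ≤ 14 * (q⁻¹ - 1) * L * ‖nodeDiag (fun j => q ^ (τ + 1) * spatialWeight G i q j) x‖ := by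
  have h := norm_spatialWeight_comm_le hS hL hM hq hq1 i x
  simp only [nodeDiag_mul_left, map_smul]
  set D : Vec n := nodeDiag (spatialWeight G i q) (actL M x)
  set z : Vec m := nodeDiag (spatialWeight G i q) x
  have hz : ‖actL M z‖ ≤ L * ‖z‖ := ((actL M).le_opNorm z).trans (by gcongr)
  have hi : 1 ≤ q⁻¹ := (one_le_inv₀ hq).2 hq1
  have hqi : q * q⁻¹ = 1 := mul_inv_cancel₀ hq.ne'
  have h3 : 1 - q ≤ q⁻¹ - 1 := by nlinarith
  have hp : 0 ≤ q ^ τ := by positivity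
  have hLz : 0 ≤ L * ‖z‖ := by positivity
  have k1 := mul_le_mul h3 hz (norm_nonneg _) (by linarith)
  constructor
  · have e : q ^ (τ + 1) • D - q ^ τ • actL M z
        = q ^ τ • (q • (D - actL M z) - (1 - q) • actL M z) := by
      rw [pow_succ]; module
    have h4 : ‖q • (D - actL M z) - (1 - q) • actL M z‖ ≤ 14 * (q⁻¹ - 1) * L * ‖z‖ := by
      refine (norm_sub_le _ _).trans ?_
      rw [norm_smul, norm_smul, Real.norm_eq_abs, Real.norm_eq_abs, abs_of_pos hq,
        abs_of_nonneg (by linarith : 0 ≤ 1 - q)]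
      have k2 := mul_le_mul hq1 h (norm_nonneg _) zero_le_one
      nlinarith [mul_nonneg (sub_nonneg.2 hi) hLz]
    rw [e, norm_smul, norm_smul, Real.norm_eq_abs, abs_of_nonneg hp]
    nlinarith [mul_le_mul_of_nonneg_left h4 hp]
  · have e : q ^ τ • D - q ^ (τ + 1) • actL M z
        = q ^ τ • ((D - actL M z) + (1 - q) • actL M z) := by
      rw [pow_succ]; module
    -- The direct bound is 3(q⁻¹ - 1)L‖z‖; passing to the smaller weight q^(τ+1) costs a factor q⁻¹
    -- ≤ 2, and 14 leaves room.
    have h4 : ‖(D - actL M z) + (1 - q) • actL M z‖ ≤ 14 * (q⁻¹ - 1) * L * (q * ‖z‖) := by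
      refine (norm_add_le _ _).trans ?_
      rw [norm_smul, Real.norm_eq_abs, abs_of_nonneg (by linarith : 0 ≤ 1 - q)]
      have hq' : 1 / 2 ≤ q := by nlinarith
      have k2 : (q⁻¹ - 1) * (L * ‖z‖) * (1 / 2) ≤ (q⁻¹ - 1) * (L * ‖z‖) * q :=
        mul_le_mul_of_nonneg_left hq' (mul_nonneg (sub_nonneg.2 hi) hLz)
      nlinarith [mul_nonneg (sub_nonneg.2 hi) hLz]
    rw [e, norm_smul, norm_smul, Real.norm_eq_abs, abs_of_nonneg hp, Real.norm_eq_abs,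
      abs_of_nonneg (by positivity : 0 ≤ q ^ (τ + 1)), pow_succ]
    nlinarith [mul_le_mul_of_nonneg_left h4 hp]

/-- Rows and columns outside a neighbourhood carry small weight. -/
lemma norm_nodeDiag_trunc_le {M : Matrix (Idx n) (Idx m) ℝ} (hS : Sparse G M) {L η : ℝ}
    (hL : 0 ≤ L) (hM : ‖actL M‖ ≤ L) (hη : 0 ≤ η) {i : Fin N} {κ : ℕ} {w : Fin N → ℝ}
    (hw0 : ∀ j, 0 ≤ w j)
    (hw : ∀ j k, j = k ∨ G.Adj j k → ¬ G.edist i k ≤ (κ : ℕ∞) → w j ≤ η) (x : Vec m) :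
    ‖nodeDiag w (actL M (x - nodeDiag (nbhd G i κ) x))‖ ≤ η * (L * ‖x‖) := by
  classical
  -- A node of weight above η is neither equal nor adjacent to a node outside the neighbourhood. Its
  -- row therefore vanishes on the truncated-away part, and the weight may be cut off at η.
  set w' : Fin N → ℝ := fun j => if w j ≤ η then w j else 0 with hw'
  have e : nodeDiag w (actL M (x - nodeDiag (nbhd G i κ) x))
      = nodeDiag w' (actL M (x - nodeDiag (nbhd G i κ) x)) := by
    ext a
    simp only [nodeDiag_apply, hw']
    split_ifs with h
    · rfl
    · rw [zero_mul]
      apply mul_eq_zero_of_right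
      rw [actL_apply]
      refine Finset.sum_eq_zero fun b _ => ?_
      by_cases hab : M a b = 0
      · simp [hab]
      · have h1 : G.edist i b.1 ≤ (κ : ℕ∞) := by
          by_contra hc
          exact h (hw _ _ (hS.eq_or_adj hab) hc)
        simp [nbhd, h1]
  have h1 : ‖x - nodeDiag (nbhd G i κ) x‖ ≤ 1 * ‖x‖ := by
    refine norm_le_norm_of_abs_le zero_le_one fun a => ?_
    by_cases h1 : G.edist i a.1 ≤ (κ : ℕ∞) <;> simp [nbhd, h1]
  rw [e]
  refine (norm_nodeDiag_le hη (fun j => ?_) _).trans (mul_le_mul_of_nonneg_left ?_ hη)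
  · simp only [hw']
    split_ifs with h
    · rwa [abs_of_nonneg (hw0 j)]
    · simpa using hη
  · rw [one_mul] at h1
    exact ((actL M).le_opNorm _).trans (mul_le_mul hM h1 (norm_nonneg _) hL)

lemma norm_nodeDiag_sub_nbhd_le {η : ℝ} (hη : 0 ≤ η) {i : Fin N} {κ : ℕ} {w : Fin N → ℝ}
    (hw0 : ∀ j, 0 ≤ w j) (hw : ∀ k, ¬ G.edist i k ≤ (κ : ℕ∞) → w k ≤ η) (x : Vec n) :
    ‖nodeDiag w (x - nodeDiag (nbhd G i κ) x)‖ ≤ η * ‖x‖ := by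
  refine norm_le_norm_of_abs_le hη fun a => ?_
  by_cases h1 : G.edist i a.1 ≤ (κ : ℕ∞)
  · simp [nbhd, h1]; positivity
  · simp only [nodeDiag_apply, PiLp.sub_apply, nbhd, h1, if_false, zero_mul, sub_zero, abs_mul,
      abs_of_nonneg (hw0 _)]
    exact mul_le_mul_of_nonneg_right (hw _ h1) (abs_nonneg _)

/-- Truncation is a projection after `M`, so in the adjoint it acts first, on the costate. -/
lemma adjoint_truncMat (i : Fin N) (κ : ℕ) (M : Matrix (Idx n) (Idx m) ℝ) (x : Vec n) :
    (actL (truncMat G i κ M)).adjoint x = (actL M).adjoint (nodeDiag (nbhd G i κ) x) := by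
  refine ext_inner_right ℝ fun y => ?_
  rw [ContinuousLinearMap.adjoint_inner_left, ContinuousLinearMap.adjoint_inner_left, actL_truncMat,
    vec_inner, vec_inner]
  refine Finset.sum_congr rfl fun a _ => ?_
  simp only [nodeDiag_apply]; ring

end Spatial

/-! ## Comparison of truncated and full problems -/

section Compare

lemma l2_shift_back_le {E : Type*} [NormedAddCommGroup E] {n : ℕ} (x : ℕ → E) :
    l2 (n + 1) (fun τ => if τ = 0 then 0 else x (τ - 1)) ≤ l2 (n + 1) x := by
  apply Real.sqrt_le_sqrt
  rw [Finset.sum_range_succ', Finset.sum_range_succ]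
  simp

variable {X U : Type*} [NormedAddCommGroup X] [InnerProductSpace ℝ X] [CompleteSpace X]
  [NormedAddCommGroup U] [InnerProductSpace ℝ U] [CompleteSpace U]

lemma MonoLip.at_zero {G : X → X} {μ L : ℝ} (hG : MonoLip μ L G) (h0 : G 0 = 0) (z : X) :
    μ * ‖z‖ ^ 2 ≤ ⟪G z, z⟫_ℝ ∧ ‖G z‖ ≤ L * ‖z‖ := by
  have := hG z 0
  simpa [h0] using this

/-- Decaying bound for a solution of the first order conditions with gradients vanishing at `0`. -/
theorem IsKKT.l2_le {A : X →L[ℝ] X} {B : U →L[ℝ] X} {ℓ : ℕ} {m μ L c ε a q : ℝ}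
    (hR : OcpRightInverse A B (fun _ => 1) ℓ m) (hc : IsDecayConst μ L m c (2 * ε) a)
    (hnA : ‖A‖ ≤ L) (hnB : ‖B‖ ≤ L) (hq : 0 < q) (hq1 : q ≤ 1) (hqε : (q⁻¹ - 1) * L ≤ ε)
    {Gy : ℕ → X → X} {Gv : ℕ → U → U} {Gl : X → X} {x : X} {ζ y : ℕ → X} {v : ℕ → U} {lam : ℕ → X}
    (hGy : ∀ τ < ℓ, MonoLip μ L (Gy τ)) (hGv : ∀ τ < ℓ, MonoLip μ L (Gv τ)) (hGl : MonoLip μ L Gl)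
    (hGy0 : ∀ τ < ℓ, Gy τ 0 = 0) (hGv0 : ∀ τ < ℓ, Gv τ 0 = 0) (hGl0 : Gl 0 = 0)
    (hK : IsKKT A B ℓ Gy Gv Gl x ζ y v lam) :
    l2 (ℓ + 1) (fun τ => q ^ τ • (WithLp.toLp 2 (y τ, if τ < ℓ then v τ else 0) : WithLp 2 (X × U)))
        + l2 (ℓ + 1) (fun τ => q ^ τ • lam τ)
      ≤ a * (‖x‖ + ∑ τ ∈ Finset.range ℓ, q ^ (τ + 1) * ‖ζ τ‖) := by
  have h := ocp_time_decay hR hc hnA hnB hq hq1 hqε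
    y (fun τ => if τ < ℓ then Gy τ (y τ) else Gl (y τ))
    lam (fun τ => if τ < ℓ then v τ else 0)
    (fun τ => if τ < ℓ then Gv τ (v τ) else 0)
    (fun τ hτ => by by_cases hl : τ < ℓ <;> simp only [hl, if_true, if_false]
                    exacts [((hGy τ hl).at_zero (hGy0 τ hl) _).1, (hGl.at_zero hGl0 _).1])
    (fun τ hτ => by by_cases hl : τ < ℓ <;> simp only [hl, if_true, if_false]
                    exacts [((hGv τ hl).at_zero (hGv0 τ hl) _).1, by simp])
    (fun τ hτ => by by_cases hl : τ < ℓ <;> simp only [hl, if_true, if_false]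
                    exacts [((hGy τ hl).at_zero (hGy0 τ hl) _).2, (hGl.at_zero hGl0 _).2])
    (fun τ hτ => by by_cases hl : τ < ℓ <;> simp only [hl, if_true, if_false]
                    exacts [((hGv τ hl).at_zero (hGv0 τ hl) _).2, by simp]) 0
  have ht : ∀ τ, tdist τ 0 = τ := fun τ => by unfold tdist; omega
  simp only [ht] at h
  have hw : ∀ τ : ℕ, 0 ≤ q ^ τ := fun τ => (pow_pos hq _).le
  have e1 := l2_smul_le_sum (n := ℓ + 1) (b := fun _ => 0) hw (x := statRes A B (fun _ => 1) ℓ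
    (fun τ => if τ < ℓ then Gy τ (y τ) else Gl (y τ))
    (fun τ => if τ < ℓ then Gv τ (v τ) else 0) lam)
    (fun τ hτ => by
      refine (norm_pair_le _ _).trans (le_of_eq ?_)
      rcases (Nat.lt_succ_iff.1 hτ).lt_or_eq with hl | hl
      · simp [hl, hK.statX τ hl, hK.statU τ hl]
      · subst hl
        simp [hK.final])
  have e2 := l2_smul_le_sum (n := ℓ + 1) (b := fun τ => if τ = 0 then ‖x‖ else ‖ζ (τ - 1)‖) hw
    (x := dynRes A B (fun _ => 1) y (fun τ => if τ < ℓ then v τ else 0))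
    (fun τ hτ => by
      cases τ with
      | zero => simp [dynRes, hK.init]
      | succ τ =>
        have hl : τ < ℓ := by omega
        simp [dynRes, hl, hK.dyn τ hl])
  refine h.trans (mul_le_mul_of_nonneg_left ?_ hc.a_nonneg)
  refine (add_le_add e1 e2).trans (le_of_eq ?_)
  rw [Finset.sum_range_succ' (fun τ => q ^ τ * (if τ = 0 then ‖x‖ else ‖ζ (τ - 1)‖))]
  simp [add_comm]

variable {N : ℕ} {nx nu : Fin N → ℕ} {G : SimpleGraph (Fin N)}

lemma norm_nodeDiag_dyn_le {A : Matrix (Idx nx) (Idx nx) ℝ} {B : Matrix (Idx nx) (Idx nu) ℝ}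
    {L η : ℝ} (hL : 0 ≤ L) (hnA : ‖actL A‖ ≤ L) (hnB : ‖actL B‖ ≤ L) (hη : 0 ≤ η) {i : Fin N} {κ : ℕ}
    {w : Fin N → ℝ} (hw0 : ∀ j, 0 ≤ w j) (hw : ∀ k, ¬ G.edist i k ≤ (κ : ℕ∞) → w k ≤ η)
    (ζ y : Vec nx) (v : Vec nu) :
    ‖nodeDiag w ((ζ - nodeDiag (nbhd G i κ) ζ)
      + ((actL A y - nodeDiag (nbhd G i κ) (actL A y))
        + (actL B v - nodeDiag (nbhd G i κ) (actL B v))))‖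
      ≤ η * ‖ζ‖ + 2 * L * η * ‖(WithLp.toLp 2 (y, v) : WithLp 2 (Vec nx × Vec nu))‖ := by
  have f1 := norm_nodeDiag_sub_nbhd_le hη hw0 hw ζ
  have f2 := norm_nodeDiag_sub_nbhd_le hη hw0 hw (actL A y)
  have f3 := norm_nodeDiag_sub_nbhd_le hη hw0 hw (actL B v)
  have g2 : ‖actL A y‖ ≤ L * ‖(WithLp.toLp 2 (y, v) : WithLp 2 (Vec nx × Vec nu))‖ :=
    ((actL A).le_opNorm _).trans (mul_le_mul hnA (norm_fst_le_pair _ _) (norm_nonneg _) hL)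
  have g3 : ‖actL B v‖ ≤ L * ‖(WithLp.toLp 2 (y, v) : WithLp 2 (Vec nx × Vec nu))‖ :=
    ((actL B).le_opNorm _).trans (mul_le_mul hnB (norm_snd_le_pair _ _) (norm_nonneg _) hL)
  have f4 := f2.trans (mul_le_mul_of_nonneg_left g2 hη)
  have f5 := f3.trans (mul_le_mul_of_nonneg_left g3 hη)
  rw [map_add, map_add]
  refine (norm_add_le _ _).trans ((add_le_add f1 ((norm_add_le _ _).trans
    (add_le_add f4 f5))).trans (le_of_eq ?_))
  ring

set_option maxHeartbeats 800000 in
/-- The block at node `i` of the first control of the full problem is approximated by that of the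
truncated problem. -/
theorem spatial_decay {A : Matrix (Idx nx) (Idx nx) ℝ} {B : Matrix (Idx nx) (Idx nu) ℝ}
    (hSA : Sparse G A) (hSB : Sparse G B) {i : Fin N} {κ ℓ : ℕ} {m μ L c ε a q η : ℝ}
    (hR : OcpRightInverse (actL A) (actL B) (fun _ => 1) ℓ m)
    (hR' : OcpRightInverse (actL (truncMat G i κ A)) (actL (truncMat G i κ B)) (fun _ => 1) ℓ m)
    (hc : IsDecayConst μ L m c (2 * ε) a)
    (hnA : ‖actL A‖ ≤ L) (hnB : ‖actL B‖ ≤ L) (hq : 0 < q) (hq1 : q ≤ 1) (hq2 : q⁻¹ ≤ 2)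
    (hqε : 14 * (q⁻¹ - 1) * L ≤ ε) (hη : 0 ≤ η)
    (hw : ∀ j k, j = k ∨ G.Adj j k → ¬ G.edist i k ≤ (κ : ℕ∞) → spatialWeight G i q j ≤ η)
    {Gy : ℕ → Vec nx → Vec nx} {Gv : ℕ → Vec nu → Vec nu} {Gl : Vec nx → Vec nx}
    (hGy : ∀ τ < ℓ, NodeMono μ L (Gy τ)) (hGv : ∀ τ < ℓ, NodeMono μ L (Gv τ)) (hGl : NodeMono μ L Gl)
    (hGy0 : ∀ τ < ℓ, Gy τ 0 = 0) (hGv0 : ∀ τ < ℓ, Gv τ 0 = 0) (hGl0 : Gl 0 = 0)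
    {x : Vec nx} {ζ y y' : ℕ → Vec nx} {v v' : ℕ → Vec nu} {lam lam' : ℕ → Vec nx}
    (hK : IsKKT (actL A) (actL B) ℓ Gy Gv Gl x ζ y v lam)
    (hK' : IsKKT (actL (truncMat G i κ A)) (actL (truncMat G i κ B)) ℓ Gy Gv Gl
      (truncVec G i κ x) (fun τ => truncVec G i κ (ζ τ)) y' v' lam') (hℓ : 0 < ℓ) :
    ‖blk (v' 0) i - blk (v 0) i‖
      ≤ a * (4 * L * a + 1) * η * (‖x‖ + ∑ τ ∈ Finset.range ℓ, q ^ (τ + 1) * ‖ζ τ‖) := by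
  have hL := hc.L_nonneg
  have ha := hc.a_nonneg
  have hi : 1 ≤ q⁻¹ := (one_le_inv₀ hq).2 hq1
  have hqi : q * q⁻¹ = 1 := mul_inv_cancel₀ hq.ne'
  set Z := ‖x‖ + ∑ τ ∈ Finset.range ℓ, q ^ (τ + 1) * ‖ζ τ‖ with hZ
  have hZ' : ‖truncVec G i κ x‖ + ∑ τ ∈ Finset.range ℓ, q ^ (τ + 1) * ‖truncVec G i κ (ζ τ)‖ ≤ Z := by
    refine add_le_add ?_ (Finset.sum_le_sum fun τ _ => mul_le_mul_of_nonneg_left ?_ (by positivity))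
    · rw [truncVec_eq]; exact norm_nbhd_le G i κ _
    · rw [truncVec_eq]; exact norm_nbhd_le G i κ _
  set v₀ : ℕ → Vec nu := fun τ => if τ < ℓ then v' τ else 0 with hv₀
  set zz : ℕ → WithLp 2 (Vec nx × Vec nu) := fun τ => q ^ τ • WithLp.toLp 2 (y' τ, v₀ τ) with hzz
  set ll : ℕ → Vec nx := fun τ => q ^ τ • lam' τ with hll
  -- The truncated solution is treated as an approximate solution of the full problem. Its own size,
  -- bounded here, controls the residuals.
  have hdec : l2 (ℓ + 1) zz + l2 (ℓ + 1) ll ≤ a * Z :=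
    (IsKKT.l2_le hR' hc ((norm_truncMat_le G i κ A).trans hnA)
      ((norm_truncMat_le G i κ B).trans hnB) hq hq1
      (by nlinarith [mul_nonneg (sub_nonneg.2 hi) hL]) (fun τ h => (hGy τ h).monoLip)
      (fun τ h => (hGv τ h).monoLip) hGl.monoLip hGy0 hGv0 hGl0 hK').trans
      (mul_le_mul_of_nonneg_left hZ' ha)
  set w := spatialWeight G i q with hwdef
  have hw0 : ∀ j, 0 ≤ w j := fun j => spatialWeight_nonneg hq.le i j
  have hcomm := fun (τ : ℕ) (y : Vec nx) => norm_weight_comm_le hSA hL hnA hq hq1 hq2 i τ y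
  have hcommB := fun (τ : ℕ) (y : Vec nu) => norm_weight_comm_le hSB hL hnB hq hq1 hq2 i τ y
  have hAt : ‖actL A.transpose‖ ≤ L := by rw [← actL_adjoint]; simpa using hnA
  have hBt : ‖actL B.transpose‖ ≤ L := by rw [← actL_adjoint]; simpa using hnB
  have hcomm' := fun (τ : ℕ) (y : Vec nx) => norm_weight_comm_le hSA.transpose hL hAt hq hq1 hq2 i τ y
  have hcommB' := fun (τ : ℕ) (y : Vec nx) => norm_weight_comm_le hSB.transpose hL hBt hq hq1 hq2 i τ y
  have hmain := ocp_weighted_stability hR hc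
    (fun τ => nodeDiag (fun j => q ^ τ * w j)) (fun τ => nodeDiag (fun j => q ^ τ * w j))
    (fun τ _ x => (hcomm τ x).1.trans (mul_le_mul_of_nonneg_right hqε (norm_nonneg _)))
    (fun τ _ x => (hcommB τ x).1.trans (mul_le_mul_of_nonneg_right hqε (norm_nonneg _)))
    (fun τ _ x => by
      rw [actL_adjoint]
      exact (hcomm' τ x).2.trans (mul_le_mul_of_nonneg_right hqε (norm_nonneg _)))
    (fun τ _ x => by
      rw [actL_adjoint]
      exact (hcommB' τ x).2.trans (mul_le_mul_of_nonneg_right hqε (norm_nonneg _)))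
    (fun τ => y τ - y' τ) (fun τ => if τ < ℓ then Gy τ (y τ) - Gy τ (y' τ) else Gl (y τ) - Gl (y' τ))
    (fun τ => lam τ - lam' τ) (fun τ => if τ < ℓ then v τ - v' τ else 0)
    (fun τ => if τ < ℓ then Gv τ (v τ) - Gv τ (v' τ) else 0)
    (fun τ hτ => by by_cases hl : τ < ℓ <;> simp only [hl, if_true, if_false]
                    exacts [(hGy τ hl _ _ _).1, (hGl _ _ _).1])
    (fun τ hτ => by by_cases hl : τ < ℓ <;> simp only [hl, if_true, if_false]
                    exacts [(hGv τ hl _ _ _).1, by simp])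
    (fun τ hτ => by by_cases hl : τ < ℓ <;> simp only [hl, if_true, if_false]
                    exacts [(hGy τ hl _ _ _).2, (hGl _ _ _).2])
    (fun τ hτ => by by_cases hl : τ < ℓ <;> simp only [hl, if_true, if_false]
                    exacts [(hGv τ hl _ _ _).2, by simp])
  have hwη : ∀ k, ¬ G.edist i k ≤ (κ : ℕ∞) → w k ≤ η := fun k hk => hw k k (Or.inl rfl) hk
  -- the stationarity residual
  have s1 : l2 (ℓ + 1) (fun τ => stageDiag (nodeDiag (fun j => q ^ τ * w j))
      (nodeDiag (fun j => q ^ τ * w j)) (statRes (actL A) (actL B) (fun _ => 1) ℓ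
        (fun τ => if τ < ℓ then Gy τ (y τ) - Gy τ (y' τ) else Gl (y τ) - Gl (y' τ))
        (fun τ => if τ < ℓ then Gv τ (v τ) - Gv τ (v' τ) else 0) (fun τ => lam τ - lam' τ) τ))
      ≤ 4 * L * η * l2 (ℓ + 1) ll := by
    refine (l2_le_mul (by positivity) (fun τ hτ => ?_)).trans
      (mul_le_mul_of_nonneg_left (l2_shift_le ll) (by positivity))
    simp only [stageDiag_apply, statRes]
    refine (norm_pair_le _ _).trans ?_
    rcases (Nat.lt_succ_iff.1 hτ).lt_or_eq with hl | hl
    · simp only [hl, if_true, one_smul, nodeDiag_mul_left, norm_smul, Real.norm_eq_abs, abs_pow,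
        abs_of_pos hq, hll, WithLp.toLp_fst, WithLp.toLp_snd]
      -- The defect is the adjoint applied to the part of the costate outside the neighbourhood,
      -- which reaches at most one hop inside.
      have e1 : Gy τ (y τ) - Gy τ (y' τ) + (lam τ - lam' τ)
          - (actL A).adjoint (lam (τ + 1) - lam' (τ + 1))
          = actL A.transpose (lam' (τ + 1) - nodeDiag (nbhd G i κ) (lam' (τ + 1))) := by
        have h1 := hK.statX τ hl
        have h2 := hK'.statX τ hl
        rw [adjoint_truncMat] at h2
        rw [← actL_adjoint, map_sub, map_sub, ← h1, ← h2]
        abel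
      have e2 : Gv τ (v τ) - Gv τ (v' τ) - (actL B).adjoint (lam (τ + 1) - lam' (τ + 1))
          = actL B.transpose (lam' (τ + 1) - nodeDiag (nbhd G i κ) (lam' (τ + 1))) := by
        have h1 := hK.statU τ hl
        have h2 := hK'.statU τ hl
        rw [adjoint_truncMat] at h2
        rw [← actL_adjoint, map_sub, map_sub, ← h1, ← h2]
        abel
      rw [e1, e2]
      have f1 := norm_nodeDiag_trunc_le hSA.transpose hL hAt hη hw0 hw (lam' (τ + 1))
      have f2 := norm_nodeDiag_trunc_le hSB.transpose hL hBt hη hw0 hw (lam' (τ + 1))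
      have hp : 0 ≤ q ^ τ := by positivity
      have f3 := mul_le_mul_of_nonneg_left (add_le_add f1 f2) hp
      -- The weight q^τ meets a costate stored with q^(τ+1); the factor q⁻¹ ≤ 2 turns the two
      -- contributions into the constant 4.
      have hq' : 1 / 2 ≤ q := by nlinarith
      have f4 : 0 ≤ q ^ τ * (η * (L * ‖lam' (τ + 1)‖)) := by positivity
      have f5 := mul_le_mul_of_nonneg_right hq' f4
      rw [mul_add] at f3
      refine f3.trans ?_
      rw [pow_succ]
      linarith
    · subst hl
      have e1 : Gl (y τ) - Gl (y' τ) + (lam τ - lam' τ) = 0 := by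
        have h1 := hK.final
        have h2 := hK'.final
        calc _ = (Gl (y τ) + lam τ) - (Gl (y' τ) + lam' τ) := by abel
          _ = 0 := by rw [h1, h2, sub_zero]
      simp [e1]
  -- the residual of the dynamics
  have s2 : l2 (ℓ + 1) (fun τ => nodeDiag (fun j => q ^ τ * w j)
      (dynRes (actL A) (actL B) (fun _ => 1) (fun τ => y τ - y' τ)
        (fun τ => if τ < ℓ then v τ - v' τ else 0) τ))
      ≤ η * Z + 2 * L * η * l2 (ℓ + 1) zz := by
    set bb : ℕ → ℝ := fun τ => q ^ τ • if τ = 0 then ‖x‖ else ‖ζ (τ - 1)‖ with hbb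
    have hbZ : l2 (ℓ + 1) bb ≤ Z := by
      refine (l2_smul_le_sum (fun τ => by positivity)
        (b := fun τ => if τ = 0 then ‖x‖ else ‖ζ (τ - 1)‖) (fun τ _ => ?_)).trans (le_of_eq ?_)
      · split_ifs <;> simp
      · rw [Finset.sum_range_succ']
        simp [hZ, add_comm]
    refine (l2_le_of_le_add (y := bb) (z := fun τ => if τ = 0 then 0 else zz (τ - 1)) hη
      (by positivity : 0 ≤ 2 * L * η) (fun τ hτ => ?_)).trans
      (add_le_add (mul_le_mul_of_nonneg_left hbZ hη)
        (mul_le_mul_of_nonneg_left (l2_shift_back_le zz) (by positivity)))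
    cases τ with
    | zero =>
      simp only [dynRes, pow_zero, one_mul, one_smul, hbb, if_true, norm_zero, mul_zero, add_zero,
        hK.init, hK'.init, norm_norm]
      rw [truncVec_eq]
      exact norm_nodeDiag_sub_nbhd_le hη hw0 hwη x
    | succ τ =>
      have hl : τ < ℓ := by omega
      simp only [dynRes, one_smul, hl, if_true, hbb, Nat.succ_ne_zero, if_false,
        Nat.add_sub_cancel, nodeDiag_mul_left, norm_smul, Real.norm_eq_abs, abs_pow, abs_of_pos hq,
        hzz, hv₀, abs_norm]
      have e1 : y (τ + 1) - y' (τ + 1) - (actL A (y τ - y' τ) + actL B (v τ - v' τ))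
          = (ζ τ - nodeDiag (nbhd G i κ) (ζ τ))
            + ((actL A (y' τ) - nodeDiag (nbhd G i κ) (actL A (y' τ)))
            + (actL B (v' τ) - nodeDiag (nbhd G i κ) (actL B (v' τ)))) := by
        rw [hK.dyn τ hl, hK'.dyn τ hl, actL_truncMat, actL_truncMat, truncVec_eq, map_sub, map_sub]
        abel
      rw [e1]
      have f1 := norm_nodeDiag_dyn_le hL hnA hnB hη hw0 hwη (ζ τ) (y' τ) (v' τ)
      set p := ‖(WithLp.toLp 2 (y' τ, v' τ) : WithLp 2 (Vec nx × Vec nu))‖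
      have hp : 0 ≤ q ^ (τ + 1) := by positivity
      have hp' : q ^ (τ + 1) ≤ q ^ τ := pow_le_pow_of_le_one hq.le hq1 (Nat.le_succ τ)
      have hLp : 0 ≤ 2 * L * η * p := by positivity
      have f7 := mul_le_mul_of_nonneg_left f1 hp
      have f8 := mul_le_mul_of_nonneg_right hp' hLp
      rw [mul_add] at f7
      refine f7.trans ((add_le_add le_rfl f8).trans (le_of_eq ?_))
      ring
  have f1 := norm_le_l2 (n := ℓ + 1) (fun τ =>
      (WithLp.toLp 2 (nodeDiag (fun j => q ^ τ * w j) (y τ - y' τ),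
        nodeDiag (fun j => q ^ τ * w j) (if τ < ℓ then v τ - v' τ else 0))
        : WithLp 2 (Vec nx × Vec nu))) (by omega : 0 < ℓ + 1)
  have g2 := l2_nonneg (n := ℓ + 1)
    (fun τ => nodeDiag (fun j => q ^ τ * w j) (lam τ - lam' τ))
  have f2 := norm_snd_le_pair (nodeDiag (fun j => q ^ 0 * w j) (y 0 - y' 0))
    (nodeDiag (fun j => q ^ 0 * w j) (if 0 < ℓ then v 0 - v' 0 else 0))
  have f3 := norm_blk_le (nodeDiag (fun j => q ^ 0 * w j) (if 0 < ℓ then v 0 - v' 0 else 0)) i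
  -- At time 0 and node i the weight equals 1, so the weighted estimate bounds this block itself.
  have f4 : blk (nodeDiag (fun j => q ^ 0 * w j) (if 0 < ℓ then v 0 - v' 0 else 0)) i
      = blk (v 0) i - blk (v' 0) i := by
    ext b
    simp [blk, hℓ, hwdef, spatialWeight_self]
  rw [f4, norm_sub_rev] at f3
  have h1 := mul_le_mul_of_nonneg_left (add_le_add s1 s2) ha
  have h2 : ‖blk (v' 0) i - blk (v 0) i‖
      ≤ a * (4 * L * η * l2 (ℓ + 1) ll + (η * Z + 2 * L * η * l2 (ℓ + 1) zz)) := by linarith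
  refine h2.trans ?_
  have h3 : 4 * L * η * l2 (ℓ + 1) ll + (η * Z + 2 * L * η * l2 (ℓ + 1) zz)
      ≤ (4 * L * a + 1) * η * Z := by
    have hz0 := l2_nonneg (n := ℓ + 1) zz
    have hLη : 0 ≤ L * η := by positivity
    nlinarith [mul_le_mul_of_nonneg_left hdec hLη, mul_nonneg hLη hz0]
  have := mul_le_mul_of_nonneg_left h3 ha
  linarith

end Compare

/-! ## Problems over the network -/

section Generic

variable {N : ℕ} {nx nu : Fin N → ℕ} {n : Fin N → ℕ}

/-- A vector assembled blockwise from points of a Lipschitz path is close to the start of the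
path, without loss in the number of blocks. -/
lemma norm_sub_le_of_blk_path {φ : ℝ → Vec n} {lo hi K : ℝ}
    (hφ : ∀ s s', lo ≤ s → s ≤ s' → s' ≤ hi → ‖φ s' - φ s‖ ≤ K * (s' - s)) {s : Fin N → ℝ}
    (hs : ∀ i, lo ≤ s i ∧ s i ≤ hi) (hlo : lo ≤ hi) {u : Vec n}
    (hu : ∀ i, blk u i = blk (φ (s i)) i) : ‖u - φ lo‖ ≤ K * (hi - lo) := by
  classical
  -- Induction by the smallest parameter in `I`: moving t up to `s j` changes the vector by at most
  -- K(s j - t), and the remaining deviation is that of `J` from `s j`. The increments telescope to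
  -- K(hi - t), independently of the number of blocks.
  have key : ∀ I : Finset (Fin N), ∀ t, lo ≤ t → t ≤ hi → (∀ i ∈ I, t ≤ s i) →
      ‖(WithLp.toLp 2 fun a : Idx n => if a.1 ∈ I then φ (s a.1) a else φ t a : Vec n) - φ t‖
        ≤ K * (hi - t) := by
    intro I
    induction I using Finset.induction_on_min_value s with
    | empty =>
      intro t h1 h2 _
      have := hφ t hi h1 h2 le_rfl
      have e : (WithLp.toLp 2 fun a : Idx n => if a.1 ∈ (∅ : Finset (Fin N)) then φ (s a.1) a
          else φ t a : Vec n) - φ t = 0 := by ext a; simp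
      rw [e, norm_zero]
      exact (norm_nonneg _).trans this
    | insert j J hj hmin ih =>
      intro t h1 h2 h3
      have ht : t ≤ s j := h3 j (Finset.mem_insert_self j J)
      have h4 := ih (s j) (hs j).1 (hs j).2 hmin
      have h5 := hφ t (s j) h1 ht (hs j).2
      set z : Vec n := WithLp.toLp 2 fun a : Idx n => if a.1 ∈ J then φ (s a.1) a else φ (s j) a
        with hz
      have h6 : ‖(WithLp.toLp 2 fun a : Idx n => if a.1 ∈ insert j J then φ (s a.1) a else φ t a
          : Vec n) - φ t‖ ≤ 1 * ‖z - φ t‖ := by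
        refine norm_le_norm_of_abs_le zero_le_one fun a => ?_
        by_cases ha : a.1 ∈ insert j J
        · have : z a = φ (s a.1) a := by
            simp only [hz]
            split_ifs with hJ
            · rfl
            · rw [(Finset.mem_insert.1 ha).resolve_right hJ]
          simp only [PiLp.sub_apply, ha, if_true, this, one_mul, le_refl]
        · simp only [PiLp.sub_apply, ha, if_false, sub_self, abs_zero, one_mul, abs_nonneg]
      have h7 : z - φ t = (z - φ (s j)) + (φ (s j) - φ t) := by abel
      have h8 := norm_add_le (z - φ (s j)) (φ (s j) - φ t)
      rw [← h7] at h8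
      linarith
  have h := key Finset.univ lo le_rfl hlo (fun i _ => (hs i).1)
  have e : (WithLp.toLp 2 fun a : Idx n => if a.1 ∈ (Finset.univ : Finset (Fin N))
      then φ (s a.1) a else φ lo a : Vec n) = u := by
    ext a
    have := congrArg (fun z : EuclideanSpace ℝ (Fin (n a.1)) => z a.2) (hu a.1)
    simp only [blk] at this
    simp [this]
  rwa [e] at h

/-- The constants and properties of a networked system used for perturbation bounds. -/
structure Regular (G : SimpleGraph (Fin N)) (A : Matrix (Idx nx) (Idx nx) ℝ)
    (B : Matrix (Idx nx) (Idx nu) ℝ) (κ₀ : ℕ) (μ L m c ε a q qs : ℝ) : Prop where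
  const : IsDecayConst μ L m c (2 * ε) a
  sparseA : Sparse G A
  sparseB : Sparse G B
  normA : ‖actL A‖ ≤ L
  normB : ‖actL B‖ ≤ L
  inverse : ∀ ℓ, OcpRightInverse (actL A) (actL B) (fun _ => 1) ℓ m
  inverse_trunc : ∀ i κ, κ₀ ≤ κ → ∀ ℓ,
    OcpRightInverse (actL (truncMat G i κ A)) (actL (truncMat G i κ B)) (fun _ => 1) ℓ m
  q_pos : 0 < q
  q_lt : q < 1
  q_le : (q⁻¹ - 1) * L ≤ ε
  qs_pos : 0 < qs
  qs_lt : qs < 1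
  inv_qs_le : qs⁻¹ ≤ 2
  qs_le : 14 * (qs⁻¹ - 1) * L ≤ ε

lemma IsSolution.exists_isKKT {A : Matrix (Idx nx) (Idx nx) ℝ} {B : Matrix (Idx nx) (Idx nu) ℝ}
    {ℓ : ℕ} {f : ℕ → Vec nx → ℝ} {c : ℕ → Vec nu → ℝ} {g : Vec nx → ℝ} {x : Vec nx}
    {ζ y : ℕ → Vec nx} {v : ℕ → Vec nu} {μ L : ℝ} {Gl : Vec nx → Vec nx}
    (h : IsSolution A B ℓ f c g x ζ y v) (hf : ∀ τ < ℓ, WellConditioned μ L (f τ))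
    (hc : ∀ τ < ℓ, WellConditioned μ L (c τ)) (hg : HasGradientAt g (Gl (y ℓ)) (y ℓ)) :
    ∃ lam, IsKKT (actL A) (actL B) ℓ (fun τ => gradient (f τ)) (fun τ => gradient (c τ)) Gl x ζ
      y v lam :=
  NetControl.exists_isKKT (fun τ hτ z => (hf τ hτ).hasGradientAt z)
    (fun τ hτ z => (hc τ hτ).hasGradientAt z) hg h.1.1 h.1.2
    (fun y' v' h0 hd => h.2 y' v' ⟨h0, hd⟩)

lemma exists_isSolution (A : Matrix (Idx nx) (Idx nx) ℝ) (B : Matrix (Idx nx) (Idx nu) ℝ)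
    (ℓ : ℕ) {f : ℕ → Vec nx → ℝ} {c : ℕ → Vec nu → ℝ} {g : Vec nx → ℝ} (x : Vec nx)
    (ζ : ℕ → Vec nx) {μ L : ℝ} (hμ : 0 < μ) (hf : ∀ τ < ℓ, StageCost μ L (f τ))
    (hc : ∀ τ < ℓ, StageCost μ L (c τ)) (hg : Continuous g) (hg0 : ∀ z, 0 ≤ g z) :
    ∃ y v, IsSolution A B ℓ f c g x ζ y v := by
  obtain ⟨y, v, h0, hd, hmin⟩ := exists_optimal (actL A) (actL B) ℓ (g := g) x ζ (half_pos hμ)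
    (fun τ hτ => (hf τ hτ).contDiff.continuous) (fun τ hτ => (hc τ hτ).contDiff.continuous) hg
    (fun τ hτ => (hf τ hτ).nonneg) (fun τ hτ => (hc τ hτ).quadratic_le) hg0
  exact ⟨y, v, ⟨h0, hd⟩, fun y' v' h => hmin y' v' h.1 h.2⟩

lemma hasGradientAt_quadratic (s : ℝ) (y : Vec nx) :
    HasGradientAt (fun z : Vec nx => s / 2 * ‖z‖ ^ 2) (s • y) y := by
  rw [hasGradientAt_iff_hasFDerivAt]
  have h := ((hasStrictFDerivAt_norm_sq y).hasFDerivAt).const_mul (s / 2)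
  refine h.congr_fderiv (ContinuousLinearMap.ext fun x => ?_)
  simp
  ring

/-- Provides the untruncated counterpart of the problem of one node, whose terminal gradient has
been replaced by s times the state. -/
lemma exists_isKKT_quadratic (A : Matrix (Idx nx) (Idx nx) ℝ) (B : Matrix (Idx nx) (Idx nu) ℝ)
    (ℓ : ℕ) {f : ℕ → Vec nx → ℝ} {c : ℕ → Vec nu → ℝ} (x : Vec nx)
    (ζ : ℕ → Vec nx) {μ L s : ℝ} (hμ : 0 < μ) (hf : ∀ τ < ℓ, StageCost μ L (f τ))
    (hc : ∀ τ < ℓ, StageCost μ L (c τ)) (hs : 0 ≤ s) :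
    ∃ y v lam, IsKKT (actL A) (actL B) ℓ (fun τ => gradient (f τ)) (fun τ => gradient (c τ))
      (fun z => s • z) x ζ y v lam := by
  obtain ⟨y, v, h⟩ := exists_isSolution A B ℓ (g := fun z => s / 2 * ‖z‖ ^ 2) x ζ hμ hf hc
    (by fun_prop) (fun z => by positivity)
  obtain ⟨lam, hlam⟩ := h.exists_isKKT (fun τ hτ => (hf τ hτ).toWellConditioned)
    (fun τ hτ => (hc τ hτ).toWellConditioned) (hasGradientAt_quadratic s (y ℓ))
  exact ⟨y, v, lam, hlam⟩

/-- The upper end is `max μ L` so that the interval of multipliers is nonempty also when the state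
space is trivial. -/
lemma TerminalCost.exists_gradient_eq_le {μ L : ℝ} {F : Vec nx → ℝ}
    (hF : TerminalCost μ L F) (y : Vec nx) :
    ∃ s, μ ≤ s ∧ s ≤ max μ L ∧ gradient F y = s • y := by
  obtain ⟨s, h1, h2, h3⟩ := hF.exists_gradient_eq y
  rcases eq_or_ne y 0 with rfl | hy
  · exact ⟨μ, le_rfl, le_max_left _ _, by simp [h3]⟩
  · exact ⟨s, h1, le_max_of_le_right (le_of_mul_le_mul_right (h2 y) (norm_pos_iff.2 hy)), h3⟩

lemma mul_norm_le_of_le_max {μ L s : ℝ} {F : Vec nx → ℝ} (hF : WellConditioned μ L F)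
    (hs : s ≤ max μ L) (x : Vec nx) : s * ‖x‖ ≤ L * ‖x‖ := by
  rcases le_max_iff.1 hs with h | h
  · exact (mul_le_mul_of_nonneg_right h (norm_nonneg x)).trans (hF.monoLip.mu_mul_le x)
  · exact mul_le_mul_of_nonneg_right h (norm_nonneg x)

/-! ### Size of solutions and their sensitivity to the terminal condition -/

section Bounds

variable {X U : Type*} [NormedAddCommGroup X] [InnerProductSpace ℝ X] [CompleteSpace X]
  [NormedAddCommGroup U] [InnerProductSpace ℝ U] [CompleteSpace U]

/-- Decay of solutions of the first order conditions with gradients vanishing at `0`. -/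
theorem IsKKT.norm_le {A : X →L[ℝ] X} {B : U →L[ℝ] X} {ℓ : ℕ} {m μ L c ε a q : ℝ}
    (hR : OcpRightInverse A B (fun _ => 1) ℓ m) (hc : IsDecayConst μ L m c (2 * ε) a)
    (hnA : ‖A‖ ≤ L) (hnB : ‖B‖ ≤ L) (hq : 0 < q) (hq1 : q ≤ 1) (hqε : (q⁻¹ - 1) * L ≤ ε)
    {Gy : ℕ → X → X} {Gv : ℕ → U → U} {Gl : X → X} {x : X} {ζ y : ℕ → X} {v : ℕ → U} {lam : ℕ → X}
    (hGy : ∀ τ < ℓ, MonoLip μ L (Gy τ)) (hGv : ∀ τ < ℓ, MonoLip μ L (Gv τ)) (hGl : MonoLip μ L Gl)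
    (hGy0 : ∀ τ < ℓ, Gy τ 0 = 0) (hGv0 : ∀ τ < ℓ, Gv τ 0 = 0) (hGl0 : Gl 0 = 0)
    (hK : IsKKT A B ℓ Gy Gv Gl x ζ y v lam) {n : ℕ} (hn : n ≤ ℓ) :
    ‖y n‖ ≤ a * (q ^ n * ‖x‖ + ∑ τ ∈ Finset.range ℓ, q ^ tdist (τ + 1) n * ‖ζ τ‖) ∧
    ‖lam n‖ ≤ a * (q ^ n * ‖x‖ + ∑ τ ∈ Finset.range ℓ, q ^ tdist (τ + 1) n * ‖ζ τ‖) ∧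
    (n < ℓ → ‖v n‖ ≤ a * (q ^ n * ‖x‖ + ∑ τ ∈ Finset.range ℓ, q ^ tdist (τ + 1) n * ‖ζ τ‖)) := by
  -- The zero trajectory is an approximate solution whose residuals are the initial state and the
  -- disturbances.
  have h := hK.perturb hR hc hnA hnB hq hq1 hqε hGy hGv hGl (y' := fun _ => 0) (v' := fun _ => 0)
    (lam' := fun _ => 0) (r := fun _ => 0) (b := fun τ => if τ = 0 then ‖x‖ else ‖ζ (τ - 1)‖)
    (fun τ hτ => by simp [hGy0 τ hτ, hGv0 τ hτ]) (by simp [hGl0]) (by simp)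
    (fun τ hτ => by simp) hn
  have e : ∑ τ ∈ Finset.range (ℓ + 1), q ^ tdist τ n * (0 + if τ = 0 then ‖x‖ else ‖ζ (τ - 1)‖)
      = q ^ n * ‖x‖ + ∑ τ ∈ Finset.range ℓ, q ^ tdist (τ + 1) n * ‖ζ τ‖ := by
    have e6 : tdist 0 n = n := by unfold tdist; omega
    rw [Finset.sum_range_succ']
    simp [e6, add_comm]
  simp only [e, sub_zero] at h
  exact h

/-- Influence of the terminal condition on the initial control. -/
theorem IsKKT.norm_sub_le_terminal {A : X →L[ℝ] X} {B : U →L[ℝ] X} {ℓ : ℕ} {m μ L c ε a q : ℝ}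
    (hR : OcpRightInverse A B (fun _ => 1) ℓ m) (hc : IsDecayConst μ L m c (2 * ε) a)
    (hnA : ‖A‖ ≤ L) (hnB : ‖B‖ ≤ L) (hq : 0 < q) (hq1 : q ≤ 1) (hqε : (q⁻¹ - 1) * L ≤ ε)
    {Gy : ℕ → X → X} {Gv : ℕ → U → U} {Gl Gl' : X → X} {x : X} {ζ y y' : ℕ → X} {v v' : ℕ → U}
    {lam lam' : ℕ → X}
    (hGy : ∀ τ < ℓ, MonoLip μ L (Gy τ)) (hGv : ∀ τ < ℓ, MonoLip μ L (Gv τ)) (hGl : MonoLip μ L Gl)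
    (hK : IsKKT A B ℓ Gy Gv Gl x ζ y v lam) (hK' : IsKKT A B ℓ Gy Gv Gl' x ζ y' v' lam')
    (hℓ : 0 < ℓ) : ‖v 0 - v' 0‖ ≤ a * (q ^ ℓ * ‖Gl (y' ℓ) - Gl' (y' ℓ)‖) := by
  -- The second solution satisfies the conditions of the first except at stage ℓ, at temporal
  -- distance ℓ from the control in question.
  have h := (hK.perturb hR hc hnA hnB hq hq1 hqε hGy hGv hGl (y' := y') (v' := v')
    (lam' := lam') (r := fun τ => if τ = ℓ then ‖Gl (y' ℓ) - Gl' (y' ℓ)‖ else 0) (b := fun τ => 0)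
    (fun τ hτ => by simp [hτ.ne, hK'.statX τ hτ, hK'.statU τ hτ])
    (by rw [eq_neg_of_add_eq_zero_right hK'.final]; simp [sub_eq_add_neg])
    (by simp [hK'.init]) (fun τ hτ => by simp [hK'.dyn τ hτ]) (Nat.zero_le ℓ)).2.2 hℓ
  refine h.trans (le_of_eq ?_)
  have e6 : tdist ℓ 0 = ℓ := by unfold tdist; omega
  congr 1
  rw [Finset.sum_eq_single ℓ]
  · simp [e6]
  · intro τ _ hτ; simp [hτ]
  · simp

end Bounds

end Generic

/-! ## The control error at one time step -/

section StepError

variable {N : ℕ} {nx nu : Fin N → ℕ} {G : SimpleGraph (Fin N)} {A : Matrix (Idx nx) (Idx nx) ℝ}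
  {B : Matrix (Idx nx) (Idx nu) ℝ} {κ₀ : ℕ} {μ L m c ε a q qs : ℝ}

lemma Regular.L_nonneg (h : Regular G A B κ₀ μ L m c ε a q qs) : 0 ≤ L := h.const.L_nonneg

lemma Regular.a_nonneg (h : Regular G A B κ₀ μ L m c ε a q qs) : 0 ≤ a := h.const.a_nonneg

lemma norm_sub_le_of_blk_le {n : Fin N → ℕ} {u u' : Vec n} {E : ℝ}
    (h : ∀ i, ‖blk u i - blk u' i‖ ≤ E) : ‖u - u'‖ ≤ N * E := by
  refine (norm_le_sum_blk _).trans ?_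
  calc ∑ i, ‖blk (u - u') i‖ ≤ ∑ _i : Fin N, E := Finset.sum_le_sum fun i _ => h i
    _ = N * E := by simp

/-- Distributed controls with a separable terminal cost approximate the control of the full
problem. -/
theorem distributed_error (hreg : Regular G A B κ₀ μ L m c ε a q qs) {κ : ℕ} (hκ : κ₀ ≤ κ) {η : ℝ}
    (hη : 0 ≤ η)
    (hw : ∀ i j k, j = k ∨ G.Adj j k → ¬ G.edist i k ≤ (κ : ℕ∞) → spatialWeight G i qs j ≤ η)
    {ℓ : ℕ} (hℓ : 0 < ℓ) {Gy : ℕ → Vec nx → Vec nx} {Gv : ℕ → Vec nu → Vec nu}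
    {Gl : Fin N → Vec nx → Vec nx}
    (hGy : ∀ τ < ℓ, NodeMono μ L (Gy τ)) (hGv : ∀ τ < ℓ, NodeMono μ L (Gv τ))
    (hGl : ∀ i, NodeMono μ L (Gl i))
    (hGy0 : ∀ τ < ℓ, Gy τ 0 = 0) (hGv0 : ∀ τ < ℓ, Gv τ 0 = 0) (hGl0 : ∀ i, Gl i 0 = 0)
    {x : Vec nx} {ζ : ℕ → Vec nx} {y y' : Fin N → ℕ → Vec nx} {v v' : Fin N → ℕ → Vec nu}
    {lam lam' : Fin N → ℕ → Vec nx} {u w : Vec nu} {S₂ : ℝ}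
    (hK : ∀ i, IsKKT (actL A) (actL B) ℓ Gy Gv (Gl i) x ζ (y i) (v i) (lam i))
    (hK' : ∀ i, IsKKT (actL (truncMat G i κ A)) (actL (truncMat G i κ B)) ℓ Gy Gv (Gl i)
      (truncVec G i κ x) (fun τ => truncVec G i κ (ζ τ)) (y' i) (v' i) (lam' i))
    (hu : ∀ i, blk u i = blk (v' i 0) i) (hw' : ∀ i, blk w i = blk (v i 0) i)
    (hS₂ : ∑ τ ∈ Finset.range ℓ, qs ^ (τ + 1) * ‖ζ τ‖ ≤ S₂) :
    ‖u - w‖ ≤ N * (a * (4 * L * a + 1) * η * (‖x‖ + S₂)) := by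
  refine norm_sub_le_of_blk_le fun i => ?_
  rw [hu i, hw' i]
  have hL := hreg.L_nonneg
  have ha := hreg.a_nonneg
  refine (spatial_decay hreg.sparseA hreg.sparseB (hreg.inverse ℓ) (hreg.inverse_trunc i κ hκ ℓ)
    hreg.const hreg.normA hreg.normB hreg.qs_pos hreg.qs_lt.le hreg.inv_qs_le hreg.qs_le hη (hw i)
    hGy hGv (hGl i) hGy0 hGv0 (hGl0 i) (hK i) (hK' i) hℓ).trans ?_
  gcongr

/-- Comparison of the full problem with forecasts and a trajectory that is optimal for the true
parameters over a longer horizon. -/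
theorem forecast_error (hreg : Regular G A B κ₀ μ L m c ε a q qs) {ℓ : ℕ} (hℓ : 0 < ℓ)
    {Gy Gy' : ℕ → Vec nx → Vec nx} {Gv Gv' : ℕ → Vec nu → Vec nu} {Gl : Vec nx → Vec nx}
    (hGy : ∀ τ < ℓ, MonoLip μ L (Gy τ)) (hGv : ∀ τ < ℓ, MonoLip μ L (Gv τ)) (hGl : MonoLip μ L Gl)
    {x : Vec nx} {ζ ζ' y y' lam lam' : ℕ → Vec nx} {v v' : ℕ → Vec nu} {φ M : ℕ → ℝ} {r : ℝ}
    (hK : IsKKT (actL A) (actL B) ℓ Gy Gv Gl x ζ y v lam)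
    (h0 : y' 0 = x) (hdyn : ∀ τ < ℓ, y' (τ + 1) = actL A (y' τ) + actL B (v' τ) + ζ' τ)
    (hstatX : ∀ τ < ℓ, Gy' τ (y' τ) + lam' τ = (actL A).adjoint (lam' (τ + 1)))
    (hstatU : ∀ τ < ℓ, Gv' τ (v' τ) = (actL B).adjoint (lam' (τ + 1)))
    (hφ : ∀ τ, 0 ≤ φ τ)
    (hGyd : ∀ τ < ℓ, ∀ z, ‖Gy τ z - Gy' τ z‖ ≤ L * φ τ * ‖z‖)
    (hGvd : ∀ τ < ℓ, ∀ z, ‖Gv τ z - Gv' τ z‖ ≤ L * φ τ * ‖z‖)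
    (hy : ∀ τ < ℓ, ‖y' τ‖ ≤ M τ) (hv : ∀ τ < ℓ, ‖v' τ‖ ≤ M τ) (hr : ‖Gl (y' ℓ) + lam' ℓ‖ ≤ r) :
    ‖v 0 - v' 0‖ ≤ a * (∑ τ ∈ Finset.range ℓ, q ^ τ * (L * φ τ * (2 * M τ)) + q ^ ℓ * r
      + ∑ τ ∈ Finset.range ℓ, q ^ (τ + 1) * ‖ζ' τ - ζ τ‖) := by
  have hL := hreg.L_nonneg
  have h := (hK.perturb (hreg.inverse ℓ) hreg.const hreg.normA hreg.normB hreg.q_pos hreg.q_lt.le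
    hreg.q_le hGy hGv hGl (y' := y') (v' := v') (lam' := lam')
    -- State and control gradients contribute L φ M each, hence the factor 2.
    (r := fun τ => if τ < ℓ then L * φ τ * (2 * M τ) else r)
    (b := fun τ => if τ = 0 then 0 else ‖ζ' (τ - 1) - ζ (τ - 1)‖)
    (fun τ hτ => by
      rw [← hstatX τ hτ, ← hstatU τ hτ, if_pos hτ, add_sub_add_right_eq_sub]
      have hc : 0 ≤ L * φ τ := mul_nonneg hL (hφ τ)
      have h1 := (hGyd τ hτ (y' τ)).trans (mul_le_mul_of_nonneg_left (hy τ hτ) hc)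
      have h2 := (hGvd τ hτ (v' τ)).trans (mul_le_mul_of_nonneg_left (hv τ hτ) hc)
      linarith)
    (by simpa using hr) (by simp [h0])
    (fun τ hτ => by simp [hdyn τ hτ]) (Nat.zero_le ℓ)).2.2 hℓ
  refine h.trans (mul_le_mul_of_nonneg_left (le_of_eq ?_) hreg.a_nonneg)
  have ht : ∀ τ, tdist τ 0 = τ := fun τ => by unfold tdist; omega
  simp only [ht, mul_add, Finset.sum_add_distrib]
  congr 1
  · rw [Finset.sum_range_succ]
    simp only [lt_irrefl, if_false]
    congr 1
    exact Finset.sum_congr rfl fun τ hτ => by simp [Finset.mem_range.1 hτ]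
  · rw [Finset.sum_range_succ']
    simp

end StepError

/-! ### One step of the distributed controller against the offline optimum -/

section NetworkStep

variable {N : ℕ} {S : Network N} {Θ : Set (Vec S.nθ)} {T κ₀ : ℕ} {μ L D m c ε a q qs : ℝ}

lemma UncertaintyAssumption.nodeMono_state (hU : UncertaintyAssumption S Θ T μ L D) (hL : 0 ≤ L)
    {t : ℕ} (ht : t ≤ T) {θ : Vec S.nθ} (hθ : θ ∈ Θ) :
    NodeMono μ L (gradient (S.stateCost t θ)) :=
  (hU.state t ht θ hθ).toWellConditioned.nodeMono hL (φ := fun i z => S.f t i z (blk θ i))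
    fun _ => rfl

lemma UncertaintyAssumption.nodeMono_control (hU : UncertaintyAssumption S Θ T μ L D) (hL : 0 ≤ L)
    {t : ℕ} (ht1 : 1 ≤ t) (ht : t ≤ T) {θ : Vec S.nθ} (hθ : θ ∈ Θ) :
    NodeMono μ L (gradient (S.controlCost t θ)) :=
  (hU.control t ht1 ht θ hθ).toWellConditioned.nodeMono hL (φ := fun i z => S.c t i z (blk θ i))
    fun _ => rfl

/-- First order conditions of the offline optimum from time `t`. -/
def OfflineKKT (S : Network N) (T : ℕ) (θstar : ℕ → Vec S.nθ) (t : ℕ) (x : Vec S.nx)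
    (y : ℕ → Vec S.nx) (v : ℕ → Vec S.nu) (lam : ℕ → Vec S.nx) : Prop :=
  IsKKT (actL S.A) (actL S.B) (T - t)
    (fun τ => gradient (S.stateCost (t + τ) (θstar (t + τ))))
    (fun τ => gradient (S.controlCost (t + τ + 1) (θstar (t + τ))))
    (gradient (S.stateCost T (θstar T))) x (fun τ => S.disturbance (t + τ) (θstar (t + τ))) y v lam

lemma IsOfflineOptimal.exists_offlineKKT (hU : UncertaintyAssumption S Θ T μ L D)
    {θstar : ℕ → Vec S.nθ} (hθ : ∀ t ≤ T, θstar t ∈ Θ) {t : ℕ} {x : Vec S.nx} {y : ℕ → Vec S.nx}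
    {v : ℕ → Vec S.nu} (h : IsOfflineOptimal S T θstar t x y v) :
    ∃ lam, OfflineKKT S T θstar t x y v lam :=
  IsSolution.exists_isKKT h
    (fun τ hτ => (hU.state _ (by omega) _ (hθ _ (by omega))).toWellConditioned)
    (fun τ hτ => (hU.control _ (by omega) (by omega) _ (hθ _ (by omega))).toWellConditioned)
    ((hU.state T le_rfl _ (hθ T le_rfl)).toWellConditioned.hasGradientAt _)

lemma exists_offlineKKT (hμ : 0 < μ) (hU : UncertaintyAssumption S Θ T μ L D)
    {θstar : ℕ → Vec S.nθ} (hθ : ∀ t ≤ T, θstar t ∈ Θ) (t : ℕ) (x : Vec S.nx) :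
    ∃ y v lam, OfflineKKT S T θstar t x y v lam := by
  have hT := hU.state T le_rfl _ (hθ T le_rfl)
  obtain ⟨y, v, h⟩ := exists_isSolution S.A S.B (T - t)
    (f := fun τ => S.stateCost (t + τ) (θstar (t + τ)))
    (c := fun τ => S.controlCost (t + τ + 1) (θstar (t + τ)))
    (g := S.stateCost T (θstar T)) x (fun τ => S.disturbance (t + τ) (θstar (t + τ))) hμ
    (fun τ hτ => hU.state _ (by omega) _ (hθ _ (by omega)))
    (fun τ hτ => hU.control _ (by omega) (by omega) _ (hθ _ (by omega)))
    hT.contDiff.continuous hT.nonneg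
  obtain ⟨lam, hlam⟩ := IsOfflineOptimal.exists_offlineKKT hU hθ h
  exact ⟨y, v, lam, hlam⟩

lemma OfflineKKT.norm_le (hreg : Regular S.G S.A S.B κ₀ μ L m c ε a q qs)
    (hU : UncertaintyAssumption S Θ T μ L D)
    {θstar : ℕ → Vec S.nθ} (hθ : ∀ t ≤ T, θstar t ∈ Θ) {t : ℕ} {x : Vec S.nx} {y : ℕ → Vec S.nx}
    {v : ℕ → Vec S.nu} {lam : ℕ → Vec S.nx} (h : OfflineKKT S T θstar t x y v lam) {n : ℕ}
    (hn : n ≤ T - t) {S₁ : ℝ} (hS₁ : ∑ τ ∈ Finset.range (T - t), q ^ tdist (τ + 1) n *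
      ‖S.disturbance (t + τ) (θstar (t + τ))‖ ≤ S₁) :
    ‖y n‖ ≤ a * (q ^ n * ‖x‖ + S₁) ∧ ‖lam n‖ ≤ a * (q ^ n * ‖x‖ + S₁) ∧
      (n < T - t → ‖v n‖ ≤ a * (q ^ n * ‖x‖ + S₁)) := by
  have hs := fun τ (hτ : τ < T - t) => hU.state (t + τ) (by omega) _ (hθ (t + τ) (by omega))
  have hc := fun τ (hτ : τ < T - t) =>
    hU.control (t + τ + 1) (by omega) (by omega) _ (hθ (t + τ) (by omega))
  have hT := hU.state T le_rfl _ (hθ T le_rfl)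
  have key := IsKKT.norm_le (hreg.inverse (T - t)) hreg.const hreg.normA hreg.normB hreg.q_pos
    hreg.q_lt.le hreg.q_le (fun τ hτ => (hs τ hτ).toWellConditioned.monoLip)
    (fun τ hτ => (hc τ hτ).toWellConditioned.monoLip) hT.toWellConditioned.monoLip
    (fun τ hτ => (hs τ hτ).gradient_zero) (fun τ hτ => (hc τ hτ).gradient_zero) hT.gradient_zero
    h hn
  have ha := hreg.a_nonneg
  have hle := mul_le_mul_of_nonneg_left (add_le_add_right hS₁ (q ^ n * ‖x‖)) ha
  exact ⟨key.1.trans hle, key.2.1.trans hle, fun hl => (key.2.2 hl).trans hle⟩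

/-- The control of one time step of the distributed controller. -/
def IsDistributedControl (S : Network N) (T k κ : ℕ) (θhat : ℕ → ℕ → Vec S.nθ) (t : ℕ)
    (x : Vec S.nx) (u : Vec S.nu) : Prop :=
  ∀ i : Fin N, ∃ (y : ℕ → Vec S.nx) (v : ℕ → Vec S.nu),
    IsSolution (truncMat S.G i κ S.A) (truncMat S.G i κ S.B) (window k T t)
      (fun τ => S.stateCost (t + τ) (θhat t τ))
      (fun τ => S.controlCost (t + τ + 1) (θhat t τ))
      (if t + k < T then S.F else S.stateCost T (θhat t (T - t)))
      (truncVec S.G i κ x)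
      (fun τ => truncVec S.G i κ (S.disturbance (t + τ) (θhat t τ))) y v ∧
    blk u i = blk (v 0) i

/-- The three summands come from truncation in space, from the forecasts and from the cut at k. For
t + k < T the comparison runs from u to `ub`, whose block i solves the full forecast problem with
multiplier `s i`, then to `V₀ μ` with the common multiplier μ, and then to the offline control. -/
theorem control_error_le (hF : TerminalCost μ L S.F) (hU : UncertaintyAssumption S Θ T μ L D)
    (hreg : Regular S.G S.A S.B κ₀ μ L m c ε a q qs) {k κ : ℕ} (hκ : κ₀ ≤ κ) {η : ℝ} (hη : 0 ≤ η)
    (hw : ∀ i j l, j = l ∨ S.G.Adj j l → ¬ S.G.edist i l ≤ (κ : ℕ∞) →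
      spatialWeight S.G i qs j ≤ η)
    {θstar : ℕ → Vec S.nθ} (hθ : ∀ t ≤ T, θstar t ∈ Θ) {θhat : ℕ → ℕ → Vec S.nθ} {t : ℕ}
    (ht : t < T) (hk : 0 < k) (hθh : ∀ n ≤ window k T t, θhat t n ∈ Θ) {x : Vec S.nx} {u : Vec S.nu}
    (hu : IsDistributedControl S T k κ θhat t x u) {y : ℕ → Vec S.nx} {v : ℕ → Vec S.nu}
    {lam : ℕ → Vec S.nx} (hK : OfflineKKT S T θstar t x y v lam) {S₁ S₂ : ℝ}
    (hS₁ : ∀ n ≤ T - t, ∑ τ ∈ Finset.range (T - t), q ^ tdist (τ + 1) n *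
      ‖S.disturbance (t + τ) (θstar (t + τ))‖ ≤ S₁)
    (hS₁' : ∑ τ ∈ Finset.range (window k T t), q ^ tdist (τ + 1) (window k T t) *
      ‖S.disturbance (t + τ) (θhat t τ)‖ ≤ S₁)
    (hS₂ : ∑ τ ∈ Finset.range (window k T t), qs ^ (τ + 1) *
      ‖S.disturbance (t + τ) (θhat t τ)‖ ≤ S₂) :
    ‖u - v 0‖ ≤ N * (a * (4 * L * a + 1) * η * (‖x‖ + S₂))
      + a * (∑ n ∈ Finset.range (window k T t + 1), q ^ n * (L * fcErr θstar θhat t n *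
          (2 * (a * (q ^ n * ‖x‖ + S₁))))
        + ∑ n ∈ Finset.range (window k T t), q ^ (n + 1) *
          ‖S.disturbance (t + n) (θstar (t + n)) - S.disturbance (t + n) (θhat t n)‖)
      + a ^ 2 * (2 * L + 1) * q ^ k * (q ^ k * ‖x‖ + S₁) := by
  have hL := hreg.L_nonneg
  have ha := hreg.a_nonneg
  have hμ := hreg.const.mu_pos
  have hq := hreg.q_pos
  set ℓ := window k T t with hℓdef
  have hℓT : ℓ ≤ T - t := min_le_right _ _
  have hℓ : 0 < ℓ := lt_min hk (by omega)
  have hS₁0 : 0 ≤ S₁ := (Finset.sum_nonneg fun τ _ => by positivity).trans hS₁'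
  have hs := fun τ (hτ : τ < ℓ) => hU.state (t + τ) (by omega) _ (hθh τ hτ.le)
  have hc := fun τ (hτ : τ < ℓ) => hU.control (t + τ + 1) (by omega) (by omega) _ (hθh τ hτ.le)
  have hsn := fun τ (hτ : τ < ℓ) => hU.nodeMono_state hL (by omega : t + τ ≤ T) (hθh τ hτ.le)
  have hcn := fun τ (hτ : τ < ℓ) =>
    hU.nodeMono_control hL (by omega : 1 ≤ t + τ + 1) (by omega) (hθh τ hτ.le)
  have hφ : ∀ n, 0 ≤ fcErr θstar θhat t n := fun n => norm_nonneg _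
  have hGyd : ∀ τ < ℓ, ∀ z, ‖gradient (S.stateCost (t + τ) (θhat t τ)) z
      - gradient (S.stateCost (t + τ) (θstar (t + τ))) z‖ ≤ L * fcErr θstar θhat t τ * ‖z‖ :=
    fun τ hτ z => norm_gradient_sub_le (hs τ hτ) (hU.state _ (by omega) _ (hθ _ (by omega)))
      (fun w => hU.state_hess _ (by omega) _ (hθh τ hτ.le) _ (hθ _ (by omega)) w) z
  have hGvd : ∀ τ < ℓ, ∀ z, ‖gradient (S.controlCost (t + τ + 1) (θhat t τ)) z
      - gradient (S.controlCost (t + τ + 1) (θstar (t + τ))) z‖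
      ≤ L * fcErr θstar θhat t τ * ‖z‖ :=
    fun τ hτ z => norm_gradient_sub_le (hc τ hτ)
      (hU.control _ (by omega) (by omega) _ (hθ _ (by omega)))
      (fun w => hU.control_hess _ (by omega) (by omega) _ (hθh τ hτ.le) _ (hθ _ (by omega)) w) z
  have hnorm := fun n (hn : n ≤ T - t) => hK.norm_le hreg hU hθ hn (hS₁ n hn)
  choose yi vi hsol hblk using hu
  have hsum_le : ∑ n ∈ Finset.range ℓ, q ^ n * (L * fcErr θstar θhat t n *
      (2 * (a * (q ^ n * ‖x‖ + S₁)))) + q ^ ℓ * (L * fcErr θstar θhat t ℓ *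
      (2 * (a * (q ^ ℓ * ‖x‖ + S₁)))) = ∑ n ∈ Finset.range (ℓ + 1), q ^ n *
      (L * fcErr θstar θhat t n * (2 * (a * (q ^ n * ‖x‖ + S₁)))) :=
    (Finset.sum_range_succ _ _).symm
  by_cases hcase : t + k < T
  · have hℓk : ℓ = k := by simp only [hℓdef, window]; omega
    simp only [hcase, if_true] at hsol
    -- At the final state reached by node i the gradient of F is `s i` times the state, so the same
    -- trajectory is stationary for a separable quadratic terminal cost.
    choose s hs1 hs2 hs3 using fun i => hF.exists_gradient_eq_le (yi i ℓ)
    have hsmul : ∀ r, μ ≤ r → r ≤ max μ L → NodeMono μ L (fun z : Vec S.nx => r • z) :=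
      fun r h1 h2 => nodeMono_smul h1 hμ.le (mul_norm_le_of_le_max hF.toWellConditioned h2)
    have hKi : ∀ i, ∃ lam, IsKKT (actL (truncMat S.G i κ S.A)) (actL (truncMat S.G i κ S.B)) ℓ _ _
        (fun z => s i • z) _ _ (yi i) (vi i) lam := fun i =>
      (hsol i).exists_isKKT (fun τ hτ => (hs τ hτ).toWellConditioned)
        (fun τ hτ => (hc τ hτ).toWellConditioned)
        (by rw [← hs3 i]; exact hF.toWellConditioned.hasGradientAt _)
    choose li hli using hKi
    choose Y V Lam hV using fun r (hr : 0 ≤ r) => exists_isKKT_quadratic S.A S.B ℓ x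
      (fun τ => S.disturbance (t + τ) (θhat t τ)) hμ hs hc hr
    have hr0 : ∀ {r}, μ ≤ r → 0 ≤ r := fun h => hμ.le.trans h
    set V₀ : ℝ → Vec S.nu := fun r => if hr : 0 ≤ r then V r hr 0 else 0 with hV₀
    have hV₀' : ∀ r (hr : μ ≤ r), V₀ r = V r (hr0 hr) 0 := fun r hr => by
      simp [hV₀, hr0 hr]
    set ub : Vec S.nu := WithLp.toLp 2 fun b => V₀ (s b.1) b with hub
    have hubb : ∀ i, blk ub i = blk (V (s i) (hr0 (hs1 i)) 0) i := fun i => by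
      ext b; simp [blk, hub, hV₀' _ (hs1 i)]
    have e1 : ‖u - ub‖ ≤ N * (a * (4 * L * a + 1) * η * (‖x‖ + S₂)) :=
      distributed_error hreg hκ hη hw hℓ hsn hcn (fun i => hsmul (s i) (hs1 i) (hs2 i))
        (fun τ hτ => (hs τ hτ).gradient_zero) (fun τ hτ => (hc τ hτ).gradient_zero)
        (fun i => smul_zero _) (fun i => hV (s i) (hr0 (hs1 i))) hli hblk hubb hS₂
    -- The first control is Lipschitz in the multiplier, with a constant of order q^ℓ times the size
    -- of the final state.
    have e2 : ‖ub - V₀ μ‖ ≤ a * (q ^ ℓ * (a * (q ^ ℓ * ‖x‖ + S₁))) * (max μ L - μ) := by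
      refine norm_sub_le_of_blk_path (s := s) (fun r r' h1 h2 h3 => ?_)
        (fun i => ⟨hs1 i, hs2 i⟩) (le_max_left _ _) (fun i => by rw [hubb, hV₀' _ (hs1 i)])
      rw [hV₀' r h1, hV₀' r' (h1.trans h2)]
      have h4 := (hV r' (hr0 (h1.trans h2))).norm_sub_le_terminal (hreg.inverse ℓ) hreg.const
        hreg.normA hreg.normB hq hreg.q_lt.le hreg.q_le (fun τ hτ => (hsn τ hτ).monoLip)
        (fun τ hτ => (hcn τ hτ).monoLip) (hsmul r' (h1.trans h2) h3).monoLip (hV r (hr0 h1)) hℓ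
      have h5 := (IsKKT.norm_le (hreg.inverse ℓ) hreg.const hreg.normA hreg.normB hq hreg.q_lt.le
        hreg.q_le (fun τ hτ => (hsn τ hτ).monoLip) (fun τ hτ => (hcn τ hτ).monoLip)
        (hsmul r h1 (h2.trans h3)).monoLip (fun τ hτ => (hs τ hτ).gradient_zero)
        (fun τ hτ => (hc τ hτ).gradient_zero) (smul_zero _) (hV r (hr0 h1)) le_rfl).1
      rw [← sub_smul, norm_smul, Real.norm_eq_abs, abs_of_nonneg (sub_nonneg.2 h2)] at h4
      have h6 := h5.trans (mul_le_mul_of_nonneg_left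
        (add_le_add_right hS₁' (q ^ ℓ * ‖x‖)) ha)
      refine h4.trans ?_
      have hd : 0 ≤ r' - r := sub_nonneg.2 h2
      calc a * (q ^ ℓ * ((r' - r) * ‖Y r (hr0 h1) ℓ‖))
          ≤ a * (q ^ ℓ * ((r' - r) * (a * (q ^ ℓ * ‖x‖ + S₁)))) := by gcongr
        _ = _ := by ring
    have e3 : ‖V₀ μ - v 0‖ ≤ a * (∑ τ ∈ Finset.range ℓ, q ^ τ * (L * fcErr θstar θhat t τ *
        (2 * (a * (q ^ τ * ‖x‖ + S₁)))) + q ^ ℓ * ((L + 1) * (a * (q ^ ℓ * ‖x‖ + S₁)))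
        + ∑ τ ∈ Finset.range ℓ, q ^ (τ + 1) *
          ‖S.disturbance (t + τ) (θstar (t + τ)) - S.disturbance (t + τ) (θhat t τ)‖) := by
      rw [hV₀' μ le_rfl]
      refine forecast_error hreg hℓ (fun τ hτ => (hsn τ hτ).monoLip)
        (fun τ hτ => (hcn τ hτ).monoLip) (hsmul μ le_rfl (le_max_left _ _)).monoLip
        (hV μ (hr0 le_rfl)) hK.init (fun τ hτ => hK.dyn τ (by omega))
        (fun τ hτ => hK.statX τ (by omega)) (fun τ hτ => hK.statU τ (by omega)) hφ hGyd hGvd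
        (fun τ hτ => (hnorm τ (by omega)).1) (fun τ hτ => (hnorm τ (by omega)).2.2 (by omega)) ?_
      -- The offline trajectory cut at ℓ leaves the terminal residual μ y_ℓ + λ_ℓ, of size at most
      -- (L + 1) times the bound of state and costate. The change of multiplier adds another L,
      -- which makes 2L + 1.
      have h1 := hnorm ℓ hℓT
      refine (norm_add_le _ _).trans ?_
      rw [norm_smul, Real.norm_eq_abs, abs_of_pos hμ]
      have h2 := (mul_norm_le_of_le_max hF.toWellConditioned (le_max_left μ L) (y ℓ)).trans
        (mul_le_mul_of_nonneg_left h1.1 hL)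
      linarith [h1.2.1]
    have e4 : max μ L - μ ≤ L := by
      rcases max_cases μ L with h | h <;> linarith
    have e5 := e2.trans (mul_le_mul_of_nonneg_left e4 (by positivity))
    have e6 : 0 ≤ a * (q ^ ℓ * (L * fcErr θstar θhat t ℓ * (2 * (a * (q ^ ℓ * ‖x‖ + S₁))))) := by
      have := hφ ℓ
      positivity
    have e7 : u - v 0 = (u - ub) + (ub - V₀ μ) + (V₀ μ - v 0) := by abel
    rw [e7, ← hsum_le]
    refine (norm_add_le _ _).trans ((add_le_add (norm_add_le _ _) e3).trans ?_)
    rw [← hℓk]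
    linarith
  · have hℓT' : ℓ = T - t := by simp only [hℓdef, window]; omega
    simp only [hcase, if_false] at hsol
    have hgT : S.stateCost T (θhat t (T - t)) = S.stateCost T (θhat t ℓ) := by rw [hℓT']
    rw [hgT] at hsol
    have hsT := hU.state T le_rfl _ (hθh ℓ le_rfl)
    have hsTn := hU.nodeMono_state hL (le_refl T) (hθh ℓ le_rfl)
    have hKi : ∀ i, ∃ lam, IsKKT (actL (truncMat S.G i κ S.A)) (actL (truncMat S.G i κ S.B)) ℓ _ _
        (gradient (S.stateCost T (θhat t ℓ))) _ _ (yi i) (vi i) lam := fun i =>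
      (hsol i).exists_isKKT (fun τ hτ => (hs τ hτ).toWellConditioned)
        (fun τ hτ => (hc τ hτ).toWellConditioned) (hsT.toWellConditioned.hasGradientAt _)
    choose li hli using hKi
    obtain ⟨Y, V, hYV⟩ := exists_isSolution S.A S.B ℓ x
      (fun τ => S.disturbance (t + τ) (θhat t τ)) hμ hs hc hsT.contDiff.continuous hsT.nonneg
    obtain ⟨Lam, hV⟩ := hYV.exists_isKKT (fun τ hτ => (hs τ hτ).toWellConditioned)
        (fun τ hτ => (hc τ hτ).toWellConditioned) (hsT.toWellConditioned.hasGradientAt _)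
    have e1 : ‖u - V 0‖ ≤ N * (a * (4 * L * a + 1) * η * (‖x‖ + S₂)) :=
      distributed_error hreg hκ hη hw hℓ hsn hcn (fun _ => hsTn)
        (fun τ hτ => (hs τ hτ).gradient_zero) (fun τ hτ => (hc τ hτ).gradient_zero)
        (fun i => hsT.gradient_zero) (fun i => hV) hli hblk (fun i => rfl) hS₂
    have e3 : ‖V 0 - v 0‖ ≤ a * (∑ τ ∈ Finset.range ℓ, q ^ τ * (L * fcErr θstar θhat t τ *
        (2 * (a * (q ^ τ * ‖x‖ + S₁)))) + q ^ ℓ * (L * fcErr θstar θhat t ℓ *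
          (a * (q ^ ℓ * ‖x‖ + S₁)))
        + ∑ τ ∈ Finset.range ℓ, q ^ (τ + 1) *
          ‖S.disturbance (t + τ) (θstar (t + τ)) - S.disturbance (t + τ) (θhat t τ)‖) := by
      refine forecast_error hreg hℓ (fun τ hτ => (hsn τ hτ).monoLip)
        (fun τ hτ => (hcn τ hτ).monoLip) hsTn.monoLip
        hV hK.init (fun τ hτ => hK.dyn τ (by omega))
        (fun τ hτ => hK.statX τ (by omega)) (fun τ hτ => hK.statU τ (by omega)) hφ hGyd hGvd
        (fun τ hτ => (hnorm τ (by omega)).1) (fun τ hτ => (hnorm τ (by omega)).2.2 (by omega)) ?_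
      -- Now the window reaches T, and the terminal residual is a difference of gradients of f_T. It
      -- supplies the summand n = ℓ.
      have h1 := hnorm ℓ hℓT
      have h2 := hK.final
      rw [← hℓT'] at h2
      rw [eq_neg_of_add_eq_zero_right h2, ← sub_eq_add_neg]
      refine (norm_gradient_sub_le (M := L * fcErr θstar θhat t ℓ) hsT
        (hU.state T le_rfl _ (hθ T le_rfl)) (fun w => ?_) _).trans
        (mul_le_mul_of_nonneg_left h1.1 (mul_nonneg hL (hφ ℓ)))
      have h3 := hU.state_hess T le_rfl _ (hθh ℓ le_rfl) _ (hθ T le_rfl) w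
      have h4 : fcErr θstar θhat t ℓ = ‖θhat t ℓ - θstar T‖ := by
        unfold fcErr; rw [show t + ℓ = T by omega]
      rwa [h4]
    have e6 : 0 ≤ a * (q ^ ℓ * (L * fcErr θstar θhat t ℓ * (a * (q ^ ℓ * ‖x‖ + S₁)))) := by
      have := hφ ℓ
      positivity
    have e8 : 0 ≤ a ^ 2 * (2 * L + 1) * q ^ k * (q ^ k * ‖x‖ + S₁) := by positivity
    have e7 : u - v 0 = (u - V 0) + (V 0 - v 0) := by abel
    rw [e7, ← hsum_le]
    refine (norm_add_le _ _).trans ((add_le_add e1 e3).trans ?_)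
    linarith

end NetworkStep

/-! ## Discounted sums -/

section Discount

variable {f : ℕ → ℝ} {q β : ℝ} {k T : ℕ}

lemma geom_sum_le_inv (hq : 0 ≤ q) (hq1 : q < 1) (n : ℕ) :
    ∑ j ∈ Finset.range n, q ^ j ≤ (1 - q)⁻¹ := by
  rw [← one_div, le_div_iff₀ (by linarith), geom_sum_mul_neg]
  linarith [pow_nonneg hq n]

lemma sum_pow_mul_le_of_le {D : ℝ} (hq : 0 ≤ q) (hq1 : q < 1) (hD : 0 ≤ D) {n : ℕ}
    (h : ∀ j < n, f j ≤ D) : ∑ j ∈ Finset.range n, q ^ j * f j ≤ D / (1 - q) := by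
  calc ∑ j ∈ Finset.range n, q ^ j * f j ≤ ∑ j ∈ Finset.range n, q ^ j * D :=
        Finset.sum_le_sum fun j hj =>
          mul_le_mul_of_nonneg_left (h j (Finset.mem_range.1 hj)) (by positivity)
    _ = (∑ j ∈ Finset.range n, q ^ j) * D := by rw [Finset.sum_mul]
    _ ≤ (1 - q)⁻¹ * D := mul_le_mul_of_nonneg_right (geom_sum_le_inv hq hq1 n) hD
    _ = D / (1 - q) := by rw [div_eq_inv_mul]

/-- The past is cut into windows of length k. Each older window is discounted by a further q^k ≤
1/2, so the total is at most twice the bound for one window. -/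
lemma sum_backward_le (hf : ∀ j, 0 ≤ f j) (hq : 0 ≤ q) (hk : 0 < k) (hqk : q ^ k ≤ 1 / 2)
    (hβ : 0 ≤ β)
    (h : ∀ t < T, ∑ j ∈ Finset.range (min k (t + 1)), q ^ j * f (t - j) ≤ β) :
    ∀ t < T, ∑ j ∈ Finset.range (t + 1), q ^ j * f (t - j) ≤ 2 * β := by
  intro t
  induction t using Nat.strong_induction_on with
  | _ t ih =>
    intro ht
    have h1 := h t ht
    rcases le_or_gt (t + 1) k with hle | hlt
    · rw [min_eq_right hle] at h1
      linarith
    · rw [min_eq_left hlt.le] at h1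
      have e : t + 1 = k + (t - k + 1) := by omega
      rw [e, Finset.sum_range_add]
      have h2 := ih (t - k) (by omega) (by omega)
      have e2 : ∑ j ∈ Finset.range (t - k + 1), q ^ (k + j) * f (t - (k + j))
          = q ^ k * ∑ j ∈ Finset.range (t - k + 1), q ^ j * f (t - k - j) := by
        rw [Finset.mul_sum]
        refine Finset.sum_congr rfl fun j _ => ?_
        rw [pow_add, mul_assoc, Nat.sub_sub]
      have h0 : 0 ≤ ∑ j ∈ Finset.range (t - k + 1), q ^ j * f (t - k - j) :=
        Finset.sum_nonneg fun j _ => mul_nonneg (pow_nonneg hq j) (hf _)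
      have h3 := mul_le_mul hqk h2 h0 (by norm_num)
      rw [e2]
      linarith

/-- The same halving from one window to the next, towards the future. -/
lemma sum_forward_le (hf : ∀ j, 0 ≤ f j) (hq : 0 ≤ q) (hq1 : q ≤ 1) (hk : 0 < k)
    (hqk : q ^ k ≤ 1 / 2) (h : ∀ s, ∑ j ∈ Finset.range k, f (s + j) ≤ β) (n : ℕ) :
    ∀ s, ∑ j ∈ Finset.range n, q ^ j * f (s + j) ≤ 2 * β := by
  induction n using Nat.strong_induction_on with
  | _ n ih =>
    intro s
    have hle : ∀ i, ∑ j ∈ Finset.range i, q ^ j * f (s + j) ≤ ∑ j ∈ Finset.range i, f (s + j) :=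
      fun i => Finset.sum_le_sum fun j _ => mul_le_of_le_one_left (hf _) (pow_le_one₀ hq hq1)
    have hβ : 0 ≤ β := (Finset.sum_nonneg fun j _ => hf _).trans (h s)
    rcases le_or_gt n k with hn | hn
    · have h1 := Finset.sum_le_sum_of_subset_of_nonneg (Finset.range_mono hn)
        (f := fun j => f (s + j)) (fun j _ _ => hf _)
      linarith [hle n, h s]
    · obtain ⟨i, rfl⟩ := Nat.exists_eq_add_of_lt hn
      rw [show k + i + 1 = k + (i + 1) by ring, Finset.sum_range_add]
      have h2 := ih (i + 1) (by omega) (s + k)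
      have e2 : ∑ j ∈ Finset.range (i + 1), q ^ (k + j) * f (s + (k + j))
          = q ^ k * ∑ j ∈ Finset.range (i + 1), q ^ j * f (s + k + j) := by
        rw [Finset.mul_sum]
        refine Finset.sum_congr rfl fun j _ => ?_
        rw [pow_add, mul_assoc, Nat.add_assoc]
      have h0 : 0 ≤ ∑ j ∈ Finset.range (i + 1), q ^ j * f (s + k + j) :=
        Finset.sum_nonneg fun j _ => mul_nonneg (pow_nonneg hq j) (hf _)
      have h3 := mul_le_mul hqk h2 h0 (by norm_num)
      rw [e2]
      linarith [hle k, h s]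

/-- The disturbance at τ first acts on the state at τ + 1; therefore the past starts at n - 1 with
weight 1. -/
lemma sum_tdist_le (hf : ∀ j, 0 ≤ f j) (hq : 0 ≤ q) (hq1 : q ≤ 1) (J n : ℕ) :
    ∑ τ ∈ Finset.range J, q ^ tdist (τ + 1) n * f τ
      ≤ ∑ j ∈ Finset.range n, q ^ j * f (n - 1 - j) + ∑ j ∈ Finset.range J, q ^ j * f (n + j) := by
  have h1 := Finset.sum_le_sum_of_subset_of_nonneg (Finset.range_mono (Nat.le_add_left J n))
    (f := fun τ => q ^ tdist (τ + 1) n * f τ) (fun τ _ _ => mul_nonneg (pow_nonneg hq _) (hf _))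
  refine h1.trans ?_
  rw [Finset.sum_range_add]
  refine add_le_add (le_of_eq ?_) (Finset.sum_le_sum fun j _ => ?_)
  · rw [← Finset.sum_range_reflect]
    refine Finset.sum_congr rfl fun j hj => ?_
    have := Finset.mem_range.1 hj
    congr 2
    unfold tdist; omega
  · have e : tdist (n + j + 1) n = j + 1 := by unfold tdist; omega
    rw [e]
    exact mul_le_mul_of_nonneg_right (pow_le_pow_of_le_one hq hq1 (Nat.le_succ j)) (hf _)

lemma sum_tdist_le_of_le {D : ℝ} (hf : ∀ j, 0 ≤ f j) (hq : 0 ≤ q) (hq1 : q < 1) (h : ∀ j, f j ≤ D)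
    (J n : ℕ) : ∑ τ ∈ Finset.range J, q ^ tdist (τ + 1) n * f τ ≤ 2 * (D / (1 - q)) := by
  have hD : 0 ≤ D := (hf 0).trans (h 0)
  have h1 := sum_tdist_le hf hq hq1.le J n
  have h2 := sum_pow_mul_le_of_le (f := fun j => f (n - 1 - j)) hq hq1 hD (n := n) fun j _ => h _
  have h3 := sum_pow_mul_le_of_le (f := fun j => f (n + j)) hq hq1 hD (n := J) fun j _ => h _
  linarith

lemma sum_tdist_le_of_window (hf : ∀ j, 0 ≤ f j) (hq : 0 ≤ q) (hq1 : q ≤ 1) (hk : 0 < k)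
    (hqk : q ^ k ≤ 1 / 2) (h : ∀ s, ∑ j ∈ Finset.range k, f (s + j) ≤ β) (J n : ℕ) :
    ∑ τ ∈ Finset.range J, q ^ tdist (τ + 1) n * f τ ≤ 4 * β := by
  have hβ : 0 ≤ β := (Finset.sum_nonneg fun j _ => hf _).trans (h 0)
  have h1 := sum_tdist_le hf hq hq1 J n
  have h3 := sum_forward_le hf hq hq1 hk hqk h J n
  have h2 : ∑ j ∈ Finset.range n, q ^ j * f (n - 1 - j) ≤ 2 * β := by
    cases n with
    | zero => simpa using hβ
    | succ n =>
      refine sum_backward_le hf hq hk hqk hβ (T := n + 1) (fun t _ => ?_) n (Nat.lt_succ_self n)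
      set i := min k (t + 1) with hi
      have hi1 : i ≤ t + 1 := min_le_right _ _
      calc ∑ j ∈ Finset.range i, q ^ j * f (t - j) ≤ ∑ j ∈ Finset.range i, f (t - j) :=
            Finset.sum_le_sum fun j _ => mul_le_of_le_one_left (hf _) (pow_le_one₀ hq hq1)
        _ = ∑ j ∈ Finset.range i, f (t + 1 - i + j) := by
            rw [← Finset.sum_range_reflect]
            refine Finset.sum_congr rfl fun j hj => ?_
            have := Finset.mem_range.1 hj
            congr 1; omega
        _ ≤ ∑ j ∈ Finset.range k, f (t + 1 - i + j) :=
            Finset.sum_le_sum_of_subset_of_nonneg (Finset.range_mono (min_le_left _ _))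
              fun j _ _ => hf _
        _ ≤ β := h _
  linarith

/-- A discounted recursion with a contractive kernel stays bounded. -/
lemma le_of_discounted_recursion {X α b : ℕ → ℝ} {w : ℕ → ℕ → ℝ} {c₀ c₁ : ℝ}
    (hw : ∀ t m, 0 ≤ w t m) (hα : ∀ m, 0 ≤ α m) (hc : 0 ≤ c₀ + c₁)
    (hX : ∀ t < T, X t ≤ c₀ + ∑ m ∈ Finset.range t, w t m * (α m * X m + b m))
    (h1 : ∀ t < T, ∑ m ∈ Finset.range t, w t m * α m ≤ 1 / 2)
    (h2 : ∀ t < T, ∑ m ∈ Finset.range t, w t m * b m ≤ c₁) :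
    ∀ t < T, X t ≤ 2 * (c₀ + c₁) := by
  intro t
  induction t using Nat.strong_induction_on with
  | _ t ih =>
    intro ht
    have h3 : ∑ m ∈ Finset.range t, w t m * (α m * X m + b m)
        ≤ (∑ m ∈ Finset.range t, w t m * α m) * (2 * (c₀ + c₁))
          + ∑ m ∈ Finset.range t, w t m * b m := by
      rw [Finset.sum_mul, ← Finset.sum_add_distrib]
      refine Finset.sum_le_sum fun m hm => ?_
      have := Finset.mem_range.1 hm
      have h4 := mul_le_mul_of_nonneg_left (ih m this (by omega))
        (mul_nonneg (hw t m) (hα m))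
      linarith
    have h5 := mul_le_mul_of_nonneg_right (h1 t ht) (by linarith : 0 ≤ 2 * (c₀ + c₁))
    linarith [hX t ht, h2 t ht]

end Discount

/-! ## Stability of the controlled trajectory -/

section Stability

variable {N : ℕ} {S : Network N} {Θ : Set (Vec S.nθ)} {T κ₀ : ℕ} {μ L D m c ε a q qs : ℝ}

/-- The state along a trajectory, in terms of the control errors. -/
theorem norm_state_le (hU : UncertaintyAssumption S Θ T μ L D)
    (hreg : Regular S.G S.A S.B κ₀ μ L m c ε a q qs) {θstar : ℕ → Vec S.nθ}
    (hθ : ∀ t ≤ T, θstar t ∈ Θ) {x : ℕ → Vec S.nx} {u : ℕ → Vec S.nu}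
    (hx : ∀ t < T, x (t + 1) = act S.A (x t) + act S.B (u t) + S.disturbance t (θstar t))
    {y : ℕ → ℕ → Vec S.nx} {v : ℕ → ℕ → Vec S.nu} {lam : ℕ → ℕ → Vec S.nx}
    (hK : ∀ t, OfflineKKT S T θstar t (x t) (y t) (v t) (lam t)) {S₁ : ℝ}
    (hS₁ : ∀ n ≤ T, ∑ τ ∈ Finset.range T, q ^ tdist (τ + 1) n *
      ‖S.disturbance τ (θstar τ)‖ ≤ S₁) {t : ℕ} (ht : t < T) :
    ‖x t‖ ≤ a * (‖x 0‖ + S₁)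
      + ∑ j ∈ Finset.range t, a * L * q ^ (t - 1 - j) * ‖u j - v j 0‖ := by
  have hL := hreg.L_nonneg
  have ha := hreg.a_nonneg
  have hq := hreg.q_pos
  -- Telescoping over the offline plans: plan i predicts the state at time t as `y i (t - i)`. Plan
  -- 0 is bounded directly, and plan t predicts `x t` itself.
  have key : ∀ i ≤ t, ‖y i (t - i)‖ ≤ a * (‖x 0‖ + S₁)
      + ∑ j ∈ Finset.range i, a * L * q ^ (t - 1 - j) * ‖u j - v j 0‖ := by
    intro i
    induction i with
    | zero =>
      intro _
      have h1 := ((hK 0).norm_le hreg hU hθ (n := t) (by omega) (S₁ := S₁)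
        (by simpa using hS₁ t ht.le)).1
      have h2 : q ^ t * ‖x 0‖ ≤ ‖x 0‖ :=
        mul_le_of_le_one_left (norm_nonneg _) (pow_le_one₀ hq.le hreg.q_lt.le)
      have h3 := mul_le_mul_of_nonneg_left (add_le_add_left h2 S₁) ha
      simpa using h1.trans h3
    | succ i ih =>
      intro hi
      have h0 := ih (by omega)
      have hiT : 0 < T - i := by omega
      have hp := ((hK (i + 1)).perturb (hreg.inverse _) hreg.const hreg.normA hreg.normB hq
        hreg.q_lt.le hreg.q_le
        (fun τ hτ => (hU.state _ (by omega) _ (hθ _ (by omega))).toWellConditioned.monoLip)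
        (fun τ hτ => (hU.control _ (by omega) (by omega) _
          (hθ _ (by omega))).toWellConditioned.monoLip)
        (hU.state T le_rfl _ (hθ T le_rfl)).toWellConditioned.monoLip
        -- Principle of optimality: the tail of plan i satisfies the conditions of plan i + 1,
        -- except that its initial state differs by B(v i 0 - u i).
        (y' := fun τ => y i (τ + 1)) (v' := fun τ => v i (τ + 1)) (lam' := fun τ => lam i (τ + 1))
        (r := fun _ => 0) (b := fun τ => if τ = 0 then L * ‖u i - v i 0‖ else 0)
        (fun τ hτ => by
          have e : i + 1 + τ = i + (τ + 1) := by ring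
          have h1 := (hK i).statX (τ + 1) (by omega)
          have h2 := (hK i).statU (τ + 1) (by omega)
          simp only [e]
          rw [h1, h2, sub_self, sub_self, norm_zero, norm_zero, add_zero])
        (by
          have e : T - (i + 1) + 1 = T - i := by omega
          simp only [e]
          rw [(hK i).final, norm_zero])
        (by
          have h1 := (hK i).dyn 0 hiT
          simp only [zero_add, if_true]
          rw [h1, hx i (by omega), (hK i).init]
          simp only [act_eq_actL, add_zero]
          have e : actL S.A (x i) + actL S.B (v i 0) + S.disturbance i (θstar i)
              - (actL S.A (x i) + actL S.B (u i) + S.disturbance i (θstar i))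
              = actL S.B (v i 0 - u i) := by rw [map_sub]; abel
          rw [e, norm_sub_rev (u i)]
          exact ((actL S.B).le_opNorm _).trans
            (mul_le_mul_of_nonneg_right hreg.normB (norm_nonneg _)))
        (fun τ hτ => by
          have e : i + 1 + τ = i + (τ + 1) := by ring
          have h1 := (hK i).dyn (τ + 1) (by omega)
          simp only [e]
          rw [h1, sub_self, norm_zero]; simp)
        (n := t - (i + 1)) (by omega)).1
      have e1 : t - (i + 1) + 1 = t - i := by omega
      have e2 : ∑ τ ∈ Finset.range (T - (i + 1) + 1), q ^ tdist τ (t - (i + 1))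
          * (0 + if τ = 0 then L * ‖u i - v i 0‖ else 0)
          = q ^ (t - 1 - i) * (L * ‖u i - v i 0‖) := by
        have e3 : tdist 0 (t - (i + 1)) = t - 1 - i := by unfold tdist; omega
        rw [Finset.sum_range_succ']
        simp [e3]
      simp only [e1] at hp
      rw [e2] at hp
      have h4 : ‖y (i + 1) (t - (i + 1))‖ ≤ ‖y i (t - i)‖
          + ‖y (i + 1) (t - (i + 1)) - y i (t - i)‖ := by
        have := norm_add_le (y i (t - i)) (y (i + 1) (t - (i + 1)) - y i (t - i))
        rwa [add_sub_cancel] at this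
      rw [Finset.sum_range_succ]
      linarith
  have := key t le_rfl
  rwa [Nat.sub_self, (hK t).init] at this

/-- Boundedness of the controlled trajectory. -/
theorem norm_state_le_of_small (hF : TerminalCost μ L S.F) (hU : UncertaintyAssumption S Θ T μ L D)
    (hreg : Regular S.G S.A S.B κ₀ μ L m c ε a q qs) {k κ : ℕ} (hκ : κ₀ ≤ κ) {η : ℝ} (hη : 0 ≤ η)
    (hw : ∀ i j l, j = l ∨ S.G.Adj j l → ¬ S.G.edist i l ≤ (κ : ℕ∞) →
      spatialWeight S.G i qs j ≤ η)
    {θstar : ℕ → Vec S.nθ} (hθ : ∀ t ≤ T, θstar t ∈ Θ) {θhat : ℕ → ℕ → Vec S.nθ}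
    (hk : 0 < k) (hθh : ∀ t < T, ∀ n ≤ window k T t, θhat t n ∈ Θ)
    {x : ℕ → Vec S.nx} {u : ℕ → Vec S.nu} (hctl : IsUDTPC S T k κ θstar θhat x u) {s : ℝ}
    (hs0 : 0 ≤ s)
    (hs1 : ∀ t, ∀ n ≤ T - t, ∑ τ ∈ Finset.range (T - t), q ^ tdist (τ + 1) n *
      ‖S.disturbance (t + τ) (θstar (t + τ))‖ ≤ 2 * s)
    (hs1' : ∀ t < T, ∑ τ ∈ Finset.range (window k T t), q ^ tdist (τ + 1) (window k T t) *
      ‖S.disturbance (t + τ) (θhat t τ)‖ ≤ 2 * s)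
    (hs2 : ∀ t < T, ∑ τ ∈ Finset.range (window k T t), q ^ (τ + 1) *
      (‖S.disturbance (t + τ) (θstar (t + τ))‖ + ‖S.disturbance (t + τ) (θhat t τ)‖) ≤ 2 * s)
    (hs3 : ∀ t < T, ∑ τ ∈ Finset.range (window k T t), qs ^ (τ + 1) *
      ‖S.disturbance (t + τ) (θhat t τ)‖ ≤ 14 * s)
    (hsmall : ∀ t < T, ∑ j ∈ Finset.range t, a * L * q ^ (t - 1 - j) *
      (N * (a * (4 * L * a + 1) * η) + 2 * a ^ 2 * L * ∑ n ∈ Finset.range (window k T j + 1),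
        q ^ n * fcErr θstar θhat j n + a ^ 2 * (2 * L + 1) * q ^ k) ≤ 1 / 28)
    {t : ℕ} (ht : t < T) :
    ‖x t‖ ≤ 2 * a * ‖x 0‖ + (4 * a + 1 + 4 * a ^ 2 * L / (1 - q)) * s := by
  have hL := hreg.L_nonneg
  have ha := hreg.a_nonneg
  have hq := hreg.q_pos
  have hq1 := hreg.q_lt
  choose y v lam hK using fun t => exists_offlineKKT hreg.const.mu_pos hU hθ t (x t)
  set α : ℕ → ℝ := fun j => N * (a * (4 * L * a + 1) * η) + 2 * a ^ 2 * L *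
    ∑ n ∈ Finset.range (window k T j + 1), q ^ n * fcErr θstar θhat j n
      + a ^ 2 * (2 * L + 1) * q ^ k with hα
  have hα0 : ∀ j, 0 ≤ α j := fun j => by
    have : 0 ≤ ∑ n ∈ Finset.range (window k T j + 1), q ^ n * fcErr θstar θhat j n :=
      Finset.sum_nonneg fun n _ => mul_nonneg (by positivity) (norm_nonneg _)
    simp only [hα]
    positivity
  -- `α j` is the gain from state to control error. The size 14 s dominates all disturbance sums
  -- multiplied by the gain; the difference of true and forecast disturbances enters separately as
  -- 2as.
  have herr : ∀ j < T, ‖u j - v j 0‖ ≤ α j * ‖x j‖ + (14 * s * α j + 2 * a * s) := by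
    intro j hj
    have h := control_error_le hF hU hreg hκ hη hw hθ hj hk (hθh j hj) (hctl j hj).2 (hK j)
      (hs1 j) (hs1' j hj) (hs3 j hj)
    have h1 : ∑ n ∈ Finset.range (window k T j + 1), q ^ n * (L * fcErr θstar θhat j n *
        (2 * (a * (q ^ n * ‖x j‖ + 2 * s)))) ≤ 2 * a * L * (∑ n ∈ Finset.range (window k T j + 1),
          q ^ n * fcErr θstar θhat j n) * (‖x j‖ + 14 * s) := by
      rw [Finset.mul_sum, Finset.sum_mul]
      refine Finset.sum_le_sum fun n _ => ?_
      have hφ : 0 ≤ fcErr θstar θhat j n := norm_nonneg _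
      have h2 : q ^ n * ‖x j‖ + 2 * s ≤ ‖x j‖ + 14 * s := by
        have : q ^ n * ‖x j‖ ≤ ‖x j‖ :=
          mul_le_of_le_one_left (norm_nonneg _) (pow_le_one₀ hq.le hq1.le)
        linarith
      calc _ = 2 * a * L * (q ^ n * fcErr θstar θhat j n) * (q ^ n * ‖x j‖ + 2 * s) := by ring
        _ ≤ _ := mul_le_mul_of_nonneg_left h2 (by positivity)
    have h2 : ∑ n ∈ Finset.range (window k T j), q ^ (n + 1) *
        ‖S.disturbance (j + n) (θstar (j + n)) - S.disturbance (j + n) (θhat j n)‖ ≤ 2 * s :=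
      (Finset.sum_le_sum fun n _ => mul_le_mul_of_nonneg_left (norm_sub_le _ _)
        (by positivity)).trans (hs2 j hj)
    have h3 : q ^ k * (q ^ k * ‖x j‖ + 2 * s) ≤ q ^ k * (‖x j‖ + 14 * s) := by
      have : q ^ k * ‖x j‖ ≤ ‖x j‖ :=
        mul_le_of_le_one_left (norm_nonneg _) (pow_le_one₀ hq.le hq1.le)
      exact mul_le_mul_of_nonneg_left (by linarith) (by positivity)
    have h4 := mul_le_mul_of_nonneg_left (add_le_add h1 h2) ha
    have h5 := mul_le_mul_of_nonneg_left h3 (by positivity : 0 ≤ a ^ 2 * (2 * L + 1))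
    refine h.trans ?_
    simp only [hα]
    nlinarith
  have hw0 : ∀ t j, 0 ≤ a * L * q ^ (t - 1 - j) := fun t j => by positivity
  have hgeo : ∀ t, ∑ j ∈ Finset.range t, q ^ (t - 1 - j) ≤ (1 - q)⁻¹ := fun t => by
    rw [Finset.sum_range_reflect (fun j => q ^ j) t]
    exact geom_sum_le_inv hq.le hq1 t
  have h := le_of_discounted_recursion (X := fun t => ‖x t‖) (α := α)
    (b := fun j => 14 * s * α j + 2 * a * s) (c₀ := a * (‖x 0‖ + 2 * s))
    (c₁ := s / 2 + 2 * a ^ 2 * L / (1 - q) * s) hw0 hα0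
    (by have : 0 < 1 - q := by linarith
        positivity)
    (fun t ht => (norm_state_le hU hreg hθ (fun t ht => (hctl t ht).1) hK
      (fun n hn => by simpa using hs1 0 n (by simpa using hn)) ht).trans
        (add_le_add le_rfl (Finset.sum_le_sum fun j hj =>
          mul_le_mul_of_nonneg_left (herr j ((Finset.mem_range.1 hj).trans ht)) (hw0 t j))))
    -- A discounted gain of 1/2 suffices for the contraction; the stronger 1/28 turns the forcing 14
    -- s into s / 2.
    (fun t ht => (hsmall t ht).trans (by norm_num))
    (fun t ht => by
      have e : ∑ j ∈ Finset.range t, a * L * q ^ (t - 1 - j) * (14 * s * α j + 2 * a * s)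
          = 14 * s * (∑ j ∈ Finset.range t, a * L * q ^ (t - 1 - j) * α j)
            + 2 * a ^ 2 * L * s * ∑ j ∈ Finset.range t, q ^ (t - 1 - j) := by
        rw [Finset.mul_sum, Finset.mul_sum, ← Finset.sum_add_distrib]
        exact Finset.sum_congr rfl fun j _ => by ring
      rw [e]
      have h0 : ∑ j ∈ Finset.range t, a * L * q ^ (t - 1 - j) * α j ≤ 1 / 28 := hsmall t ht
      have h1 := mul_le_mul_of_nonneg_left h0 (by positivity : 0 ≤ 14 * s)
      have h2 := mul_le_mul_of_nonneg_left (hgeo t) (by positivity : 0 ≤ 2 * a ^ 2 * L * s)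
      rw [div_eq_mul_inv (2 * a ^ 2 * L)]
      linarith) t ht
  refine h.trans (le_of_eq ?_)
  rw [div_eq_mul_inv, div_eq_mul_inv]
  ring

end Stability

/-! ## Verification of the hypotheses for the networked system -/

section System

variable {N : ℕ} {S : Network N} {Θ : Set (Vec S.nθ)} {T κ₀ d : ℕ} {L γ σ μ D : ℝ}

lemma SystemAssumption.inverse_trunc (hS : SystemAssumption S L γ σ d κ₀) (i : Fin N) (κ : ℕ)
    (hκ : κ₀ ≤ κ) (ℓ : ℕ) :
    OcpRightInverse (actL (truncMat S.G i κ S.A)) (actL (truncMat S.G i κ S.B)) (fun _ => 1) ℓ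
      (invConst L γ) :=
  ocpRightInverse_of_stabilizable (hS.stab i κ hκ) ℓ

lemma SystemAssumption.inverse (hN : S.Networked) (hS : SystemAssumption S L γ σ d κ₀) (hL : 1 < L)
    (hγ : γ < 1) (ℓ : ℕ) :
    OcpRightInverse (actL S.A) (actL S.B) (fun _ => 1) ℓ (invConst L γ) :=
  ocpRightInverse_of_truncations hN.1 hN.2 (invConst_pos hL hγ).le
    fun i κ hκ => hS.inverse_trunc i κ hκ ℓ

lemma SystemAssumption.regular (hN : S.Networked) (hS : SystemAssumption S L γ σ d κ₀) (hL : 1 < L)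
    (hγ0 : 0 < γ) (hγ : γ < 1) (hμ : 0 < μ) :
    Regular S.G S.A S.B κ₀ μ L (invConst L γ) ((muH L γ μ)⁻¹ / 3) (muH L γ μ / 2)
      (decayConst L γ μ) (timeRate L γ μ) (spaceRate L γ μ) where
  const := isDecayConst hL hγ0 hγ hμ
  sparseA := hN.1
  sparseB := hN.2
  normA := hS.norm_A
  normB := hS.norm_B
  inverse := hS.inverse hN hL hγ
  inverse_trunc := hS.inverse_trunc
  q_pos := timeRate_pos hL hγ0 hγ hμ
  q_lt := timeRate_lt_one hL hγ0 hγ hμ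
  q_le := (inv_timeRate_sub_one_mul hL).le
  qs_pos := spaceRate_pos hL hγ0 hγ hμ
  qs_lt := spaceRate_lt_one hL hγ0 hγ hμ
  inv_qs_le := inv_spaceRate_le_two hL hγ0 hγ hμ
  qs_le := (inv_spaceRate_sub_one_mul hL).le

/-- The right inverse constant for problems with prescribed final state. -/
def fixedEndConst (L γ σ : ℝ) (d : ℕ) : ℝ := terminalConst L (invConst L γ) (L ^ d / σ ^ 2) d

/-- A saddle constant for problems with prescribed final state. -/
def fixedEndSaddle (L γ σ μ : ℝ) (d : ℕ) : ℝ :=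
  (1 + fixedEndConst L γ σ d * L) * (3 / 2 / μ) + fixedEndConst L γ σ d
    + (1 + fixedEndConst L γ σ d * L) * (L / μ + 1 / 2) * fixedEndConst L γ σ d

/-- The decay rate for problems with prescribed final state. -/
def fixedEndRate (L γ σ μ : ℝ) (d : ℕ) : ℝ := (1 + 1 / (4 * fixedEndSaddle L γ σ μ d * L))⁻¹

lemma fixedEndConst_pos (hL : 1 < L) (hγ : γ < 1) (hσ : 0 < σ) : 0 < fixedEndConst L γ σ d := by
  have := invConst_pos hL hγ
  unfold fixedEndConst terminalConst
  positivity

lemma fixedEndSaddle_pos (hL : 1 < L) (hγ : γ < 1) (hσ : 0 < σ) (hμ : 0 < μ) :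
    0 < fixedEndSaddle L γ σ μ d := by
  have := fixedEndConst_pos (d := d) hL hγ hσ
  unfold fixedEndSaddle
  positivity

lemma fixedEndRate_pos (hL : 1 < L) (hγ : γ < 1) (hσ : 0 < σ) (hμ : 0 < μ) :
    0 < fixedEndRate L γ σ μ d := by
  have := fixedEndSaddle_pos (d := d) hL hγ hσ hμ
  unfold fixedEndRate
  positivity

lemma fixedEndRate_lt_one (hL : 1 < L) (hγ : γ < 1) (hσ : 0 < σ) (hμ : 0 < μ) :
    fixedEndRate L γ σ μ d < 1 := by
  have := fixedEndSaddle_pos (d := d) hL hγ hσ hμ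
  have h2 : 0 < 1 / (4 * fixedEndSaddle L γ σ μ d * L) := by positivity
  exact inv_lt_one_of_one_lt₀ (by linarith)

/-- The commutators total 1/(2c), so half of the saddle estimate is absorbed and the constant
doubles to 2c. -/
lemma isDecayConst_fixedEnd (hL : 1 < L) (hγ : γ < 1) (hσ : 0 < σ) (hμ : 0 < μ) :
    IsDecayConst μ L (fixedEndConst L γ σ d) (fixedEndSaddle L γ σ μ d)
      (2 * (1 / (4 * fixedEndSaddle L γ σ μ d))) (2 * fixedEndSaddle L γ σ μ d) := by
  have h1 := fixedEndConst_pos (d := d) hL hγ hσ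
  have h2 := fixedEndSaddle_pos (d := d) hL hγ hσ hμ
  refine ⟨hμ, by linarith, h1.le, ⟨?_, ?_⟩, h2, by positivity, by positivity, ?_⟩
  · unfold fixedEndSaddle
    exact le_add_of_nonneg_right (by positivity)
  · unfold fixedEndSaddle
    exact le_add_of_nonneg_left (by positivity)
  · apply le_of_eq; field_simp; ring

/-- The temporal perturbation bound for problems with prescribed final state. -/
theorem temporalDecay (hN : S.Networked) (hS : SystemAssumption S L γ σ d κ₀) (hL : 1 < L)
    (hγ : γ < 1) (hσ : 0 < σ) (hμ : 0 < μ) (hU : UncertaintyAssumption S Θ T μ L D) {Ω δ : ℝ}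
    (hδ : fixedEndRate L γ σ μ d ≤ δ) (hΩ1 : 1 ≤ Ω)
    (hΩ : 2 * fixedEndSaddle L γ σ μ d * (fixedEndRate L γ σ μ d)⁻¹ ≤ Ω) :
    TemporalDecay S Θ T d Ω δ := by
  intro t ℓ hd hℓT θ hθ x x' z z' ζ ζ' y y' v v' h h' n hn
  set q := fixedEndRate L γ σ μ d with hq
  set c := fixedEndSaddle L γ σ μ d with hc
  have hq0 : 0 < q := fixedEndRate_pos hL hγ hσ hμ
  have hq1 : q < 1 := fixedEndRate_lt_one hL hγ hσ hμ
  have hc0 : 0 < c := fixedEndSaddle_pos hL hγ hσ hμ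
  have hδ0 : 0 < δ := hq0.trans_le hδ
  have hsum0 : 0 ≤ ∑ l ∈ Finset.range ℓ, δ ^ ((n : ℤ) - l).natAbs * ‖ζ l - ζ' l‖ :=
    Finset.sum_nonneg fun _ _ => by positivity
  rcases hn.lt_or_eq with hn | rfl
  · have hs := fun τ (hτ : τ < ℓ) => hU.state (t + τ) (by omega) _ (hθ τ)
    have hcc := fun τ (hτ : τ < ℓ) => hU.control (t + τ + 1) (by omega) (by omega) _ (hθ τ)
    have hKKT : ∀ {x z : Vec S.nx} {ζ y : ℕ → Vec S.nx} {v : ℕ → Vec S.nu},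
        IsTerminalSolution S.A S.B ℓ (fun τ => S.stateCost (t + τ) (θ τ))
          (fun τ => S.controlCost (t + τ + 1) (θ τ)) x ζ z y v →
        ∃ lam gl, IsKKT (actL S.A) (actL S.B) ℓ
          (fun τ => gradient (S.stateCost (t + τ) (θ τ)))
          (fun τ => gradient (S.controlCost (t + τ + 1) (θ τ))) (fun _ => gl) x ζ y v lam :=
      fun hsol => exists_isKKT_terminal
        (fun τ hτ z => (hs τ hτ).toWellConditioned.hasGradientAt z)
        (fun τ hτ z => (hcc τ hτ).toWellConditioned.hasGradientAt z) hsol.1.1 hsol.1.2 hsol.2.1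
        (fun y' v' h0 hdyn hend => hsol.2.2 y' v' ⟨h0, hdyn⟩ hend)
    obtain ⟨lam, gl, hK⟩ := hKKT h
    obtain ⟨lam', gl', hK'⟩ := hKKT h'
    have hsteer := steerable_of_ctrb hL.le hS.norm_A hS.norm_B hσ hS.ctrb
    have hR := ocpRightInverse_terminal hL.le (A := actL S.A) (B := actL S.B) hS.norm_A hS.norm_B
      (by positivity) hsteer (hS.inverse hN hL hγ ℓ) hd (by omega)
    have hb := hK.perturb_terminal hR (isDecayConst_fixedEnd hL hγ hσ hμ) hS.norm_A hS.norm_B hq0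
      hq1.le (by
        have e : q⁻¹ = 1 + 1 / (4 * c * L) := by rw [hq, fixedEndRate, inv_inv]
        rw [← hc, e]
        apply le_of_eq
        have : L ≠ 0 := by linarith
        field_simp
        ring)
      (fun τ hτ => (hs τ hτ).toWellConditioned.monoLip)
      (fun τ hτ => (hcc τ hτ).toWellConditioned.monoLip) hK' hn
    refine hb.trans ?_
    rw [h.2.1, h'.2.1]
    have hqi : 1 ≤ q⁻¹ := (one_le_inv₀ hq0).2 hq1.le
    have k1 : q ^ n * ‖x - x'‖ ≤ q⁻¹ * (δ ^ n * ‖x - x'‖) := by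
      have : q ^ n * ‖x - x'‖ ≤ δ ^ n * ‖x - x'‖ := by gcongr
      exact this.trans (le_mul_of_one_le_left (by positivity) hqi)
    have k2 : q ^ (ℓ - n) * ‖z - z'‖ ≤ q⁻¹ * (δ ^ (ℓ - n) * ‖z - z'‖) := by
      have : q ^ (ℓ - n) * ‖z - z'‖ ≤ δ ^ (ℓ - n) * ‖z - z'‖ := by gcongr
      exact this.trans (le_mul_of_one_le_left (by positivity) hqi)
    -- Passing from the distance |l + 1 - n| to |l - n| costs at most one factor q⁻¹, which is part
    -- of Ω.
    have k3 : ∑ τ ∈ Finset.range ℓ, q ^ tdist (τ + 1) n * ‖ζ τ - ζ' τ‖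
        ≤ q⁻¹ * ∑ l ∈ Finset.range ℓ, δ ^ ((n : ℤ) - l).natAbs * ‖ζ l - ζ' l‖ := by
      rw [Finset.mul_sum]
      refine Finset.sum_le_sum fun l _ => ?_
      rw [← mul_assoc]
      refine mul_le_mul_of_nonneg_right ?_ (norm_nonneg _)
      have e : ((n : ℤ) - l).natAbs ≤ tdist (l + 1) n + 1 := by unfold tdist; omega
      have e1 : q ^ (tdist (l + 1) n + 1) ≤ q ^ ((n : ℤ) - l).natAbs :=
        pow_le_pow_of_le_one hq0.le hq1.le e
      have e2 : q ^ ((n : ℤ) - l).natAbs ≤ δ ^ ((n : ℤ) - l).natAbs :=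
        pow_le_pow_left₀ hq0.le hδ _
      calc q ^ tdist (l + 1) n = q⁻¹ * q ^ (tdist (l + 1) n + 1) := by
            rw [pow_succ]; field_simp
        _ ≤ _ := mul_le_mul_of_nonneg_left (e1.trans e2) (by positivity)
    calc 2 * c * (q ^ n * ‖x - x'‖ + q ^ (ℓ - n) * ‖z - z'‖
          + ∑ τ ∈ Finset.range ℓ, q ^ tdist (τ + 1) n * ‖ζ τ - ζ' τ‖)
        ≤ 2 * c * (q⁻¹ * (δ ^ n * ‖x - x'‖) + q⁻¹ * (δ ^ (ℓ - n) * ‖z - z'‖)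
          + q⁻¹ * ∑ l ∈ Finset.range ℓ, δ ^ ((n : ℤ) - l).natAbs * ‖ζ l - ζ' l‖) := by gcongr
      _ = 2 * c * q⁻¹ * (δ ^ n * ‖x - x'‖ + δ ^ (ℓ - n) * ‖z - z'‖
          + ∑ l ∈ Finset.range ℓ, δ ^ ((n : ℤ) - l).natAbs * ‖ζ l - ζ' l‖) := by ring
      _ ≤ _ := mul_le_mul_of_nonneg_right hΩ (by positivity)
  -- At m = ℓ the states are prescribed and Ω ≥ 1 is enough.
  · rw [h.2.1, h'.2.1, Nat.sub_self, pow_zero, one_mul]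
    have : ‖z - z'‖ ≤ δ ^ n * ‖x - x'‖ + ‖z - z'‖
        + ∑ l ∈ Finset.range n, δ ^ ((n : ℤ) - l).natAbs * ‖ζ l - ζ' l‖ := by
      have : 0 ≤ δ ^ n * ‖x - x'‖ := by positivity
      linarith
    exact this.trans (le_mul_of_one_le_left (by positivity) hΩ1)

end System

/-! ## Comparison of constants -/

section Numeric

variable {L γ μ : ℝ}

/-- The factor of the disturbances in the bound of the controlled states. -/
def driftConst (L γ μ : ℝ) : ℝ :=
  4 * decayConst L γ μ + 1 + 4 * decayConst L γ μ ^ 2 * L / (1 - timeRate L γ μ)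

lemma decayConst_pos (hL : 1 < L) (hγ0 : 0 < γ) (hγ : γ < 1) (hμ : 0 < μ) :
    0 < decayConst L γ μ := by
  have := muH_pos hL hγ0 hγ hμ
  unfold decayConst; positivity

lemma driftConst_pos (hL : 1 < L) (hγ0 : 0 < γ) (hγ : γ < 1) (hμ : 0 < μ) :
    0 < driftConst L γ μ := by
  have := decayConst_pos hL hγ0 hγ hμ
  have h2 : 0 < 1 - timeRate L γ μ := by linarith [timeRate_lt_one hL hγ0 hγ hμ]
  unfold driftConst; positivity

/-- With h = 1/μ_H the drift is of order L²h³, because a = h/2 and (1 - q)⁻¹ = 1 + 2Lh. -/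
lemma two_mul_driftConst_add_le (hL : 1 < L) (hγ0 : 0 < γ) (hγ : γ < 1) (hμ : 0 < μ) :
    2 * driftConst L γ μ + 4 ≤ 7 * (L ^ 2 * (muH L γ μ)⁻¹ ^ 3) := by
  have h6 := six_le_inv_muH hL hγ0 hγ hμ
  have e := inv_one_sub_timeRate hL hγ0 hγ hμ
  rw [driftConst, div_eq_mul_inv, e, decayConst]
  generalize (muH L γ μ)⁻¹ = h at h6
  have hL2 : 1 ≤ L ^ 2 := by nlinarith
  have e1 : 36 * h ≤ h ^ 3 := by nlinarith [mul_nonneg (by linarith : 0 ≤ h) (by nlinarith : 0 ≤ h ^ 2 - 36)]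
  have e2 : h ^ 3 ≤ L ^ 2 * h ^ 3 := le_mul_of_one_le_left (by positivity) hL2
  have e3 : 6 * (L * h ^ 2) ≤ L ^ 2 * h ^ 3 := by
    have h1 : L * h ^ 2 ≤ L ^ 2 * h ^ 2 := by
      have : L ≤ L ^ 2 := by nlinarith
      gcongr
    have h2 : 6 * (L ^ 2 * h ^ 2) ≤ h * (L ^ 2 * h ^ 2) := by gcongr
    nlinarith
  nlinarith

lemma alpha_pos (hL : 1 < L) (hγ0 : 0 < γ) (hγ : γ < 1) (hμ : 0 < μ) : 0 < alpha L γ μ := by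
  have h6 := six_le_inv_muH hL hγ0 hγ hμ
  have h3 : 3 ≤ LH L := by unfold LH; linarith
  exact lt_of_lt_of_le (by positivity) (le_alpha hL hγ0 hγ hμ)

lemma two_mul_decayConst_sq_le (hL : 1 < L) (hγ0 : 0 < γ) (hγ : γ < 1) (hμ : 0 < μ) :
    2 * decayConst L γ μ ^ 2 ≤ alpha L γ μ ∧ decayConst L γ μ ≤ alpha L γ μ := by
  have h6 := six_le_inv_muH hL hγ0 hγ hμ
  have h3 : 3 ≤ LH L := by unfold LH; linarith
  have h1 := le_alpha hL hγ0 hγ hμ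
  unfold decayConst
  generalize (muH L γ μ)⁻¹ = h at h6 h1
  have h4 : 3 * h ^ 2 ≤ LH L * h ^ 2 := by gcongr
  constructor <;> nlinarith

/-- The left side has order L³h⁶ with h = 1/μ_H. The right side is at least L_H⁴h⁶, by α ≥ L_H h²
and (1 - ρ)⁻¹ ≥ L_H²h²/2. So the summand 2αD/(1 - ρ) of Υ has room for the disturbance part of the
state bound. -/
lemma drift_absorb_time (hL : 1 < L) (hγ0 : 0 < γ) (hγ : γ < 1) (hμ : 0 < μ) :
    decayConst L γ μ ^ 2 * (2 * driftConst L γ μ + 4) * (1 - timeRate L γ μ)⁻¹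
      ≤ alpha L γ μ * (2 * alpha L γ μ * (1 - rho L γ μ)⁻¹) := by
  have h6 := six_le_inv_muH hL hγ0 hγ hμ
  have h1 := two_mul_driftConst_add_le hL hγ0 hγ hμ
  have h2 := le_alpha hL hγ0 hγ hμ
  obtain ⟨r0, r1, h3⟩ := rho_facts hL hγ0 hγ hμ
  have hα := (alpha_pos hL hγ0 hγ hμ).le
  have hLH : 2 * L ≤ LH L := by unfold LH; linarith
  rw [inv_one_sub_timeRate hL hγ0 hγ hμ, decayConst]
  generalize (muH L γ μ)⁻¹ = h at *
  have e1 : 1 + 2 * L * h ≤ 3 * (L * h) := by nlinarith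
  calc (h / 2) ^ 2 * (2 * driftConst L γ μ + 4) * (1 + 2 * L * h)
      ≤ (h / 2) ^ 2 * (7 * (L ^ 2 * h ^ 3)) * (3 * (L * h)) := by gcongr
    _ = 21 / 4 * (L ^ 3 * h ^ 6) := by ring
    _ ≤ (2 * L) ^ 4 * h ^ 6 := by
        have : L ^ 3 ≤ L ^ 4 := pow_le_pow_right₀ hL.le (by norm_num)
        have h5 : 0 ≤ h ^ 6 := by positivity
        have : L ^ 3 * h ^ 6 ≤ L ^ 4 * h ^ 6 := by gcongr
        nlinarith [pow_pos (by linarith : 0 < L) 3]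
    _ ≤ LH L ^ 4 * h ^ 6 := by gcongr
    _ = (LH L * h ^ 2) * (2 * (LH L * h ^ 2) * (LH L ^ 2 * h ^ 2 / 2)) := by ring
    _ ≤ _ := by
        have : 0 < LH L := by linarith
        gcongr

/-- The analogue for Γ: order L³h⁵ against at least L⁷h⁸, where the surplus comes from α² and (1 -
δ_S)⁻². -/
lemma drift_absorb_space (hL : 1 < L) (hγ0 : 0 < γ) (hγ : γ < 1) (hμ : 0 < μ) :
    decayConst L γ μ * (4 * L * decayConst L γ μ + 1) * (2 * driftConst L γ μ + 1)
      ≤ 4 * alpha L γ μ ^ 2 * deltaS L γ μ * L / (1 - deltaS L γ μ) ^ 2 := by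
  have h6 := six_le_inv_muH hL hγ0 hγ hμ
  have h1 := two_mul_driftConst_add_le hL hγ0 hγ hμ
  have h0 := driftConst_pos hL hγ0 hγ hμ
  have h2 := le_alpha hL hγ0 hγ hμ
  obtain ⟨r0, r1, -, h3⟩ := deltaS_facts hL hγ0 hγ hμ
  have hLH : 2 * L ≤ LH L := by unfold LH; linarith
  rw [div_eq_mul_inv, ← inv_pow, decayConst]
  generalize (muH L γ μ)⁻¹ = h at *
  have hL0 : 0 < L := by linarith
  have hLHp : 0 < LH L := by linarith
  have e1 : 4 * L * (h / 2) + 1 ≤ 3 * (L * h) := by nlinarith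
  calc h / 2 * (4 * L * (h / 2) + 1) * (2 * driftConst L γ μ + 1)
      ≤ h / 2 * (3 * (L * h)) * (7 * (L ^ 2 * h ^ 3)) := by
        have : 2 * driftConst L γ μ + 1 ≤ 7 * (L ^ 2 * h ^ 3) := by linarith
        gcongr
    _ = 21 / 2 * (L ^ 3 * h ^ 5) := by ring
    _ ≤ 128 * (L ^ 7 * h ^ 8) := by
        have : L ^ 3 ≤ L ^ 7 := pow_le_pow_right₀ hL.le (by norm_num)
        have : h ^ 5 ≤ h ^ 8 := pow_le_pow_right₀ (by linarith) (by norm_num)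
        have : L ^ 3 * h ^ 5 ≤ L ^ 7 * h ^ 8 := by gcongr
        have : 0 ≤ L ^ 3 * h ^ 5 := by positivity
        linarith
    _ = 4 * (2 * L * h ^ 2) ^ 2 * (1 / 2) * L * ((2 * L) ^ 2 * h ^ 2) ^ 2 := by ring
    _ ≤ 4 * (LH L * h ^ 2) ^ 2 * (1 / 2) * L * (LH L ^ 2 * h ^ 2) ^ 2 := by gcongr
    _ ≤ _ := by gcongr

end Numeric

/-! ## Growth of the graph -/

section Growth

variable {N : ℕ} {G : SimpleGraph (Fin N)} {p : ℕ → ℝ}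

/-- Subexponential growth gives p d ≤ r^(-d) eventually. Boundedness has to be known because the
supremum of an unbounded set of reals is 0 by convention, which would make Γ vanish. -/
lemma bddAbove_pow_mul_of_tendsto_log {r : ℝ} (hr : 0 < r) (hr1 : r < 1)
    (hp : Tendsto (fun d : ℕ => Real.log (p d) / d) atTop (𝓝 0)) :
    BddAbove (Set.range fun d : ℕ => r ^ d * p d) := by
  refine Filter.IsBoundedUnder.bddAbove_range (isBoundedUnder_of_eventually_le (a := 1) ?_)
  have hlog : 0 < -Real.log r := by linarith [Real.log_neg hr hr1]
  filter_upwards [hp.eventually_lt_const hlog, eventually_gt_atTop 0] with d hd hd0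
  have hd1 : (0 : ℝ) < d := by exact_mod_cast hd0
  rw [div_lt_iff₀ hd1] at hd
  have h1 : p d ≤ Real.exp (-Real.log r * d) :=
    (Real.le_exp_log _).trans (Real.exp_le_exp.2 hd.le)
  have h2 : r ^ d = Real.exp (Real.log r * d) := by
    rw [← Real.rpow_def_of_pos hr, Real.rpow_natCast]
  calc r ^ d * p d ≤ Real.exp (Real.log r * d) * Real.exp (-Real.log r * d) := by
        rw [h2]; exact mul_le_mul_of_nonneg_left h1 (Real.exp_pos _).le
    _ = 1 := by rw [← Real.exp_add]; simp

lemma GrowthBound.nonneg (hp : GrowthBound G p) (hN : 0 < N) (d : ℕ) : 0 ≤ p d :=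
  (Nat.cast_nonneg _).trans (hp.2 ⟨0, hN⟩ d)

lemma GrowthBound.one_le_zero (hp : GrowthBound G p) (hN : 0 < N) : 1 ≤ p 0 := by
  have h := hp.2 ⟨0, hN⟩ 0
  have e : {j | G.edist ⟨0, hN⟩ j = ((0 : ℕ) : ℕ∞)} = {⟨0, hN⟩} := by
    ext j
    simp only [Set.mem_ofPred_eq, Nat.cast_zero, SimpleGraph.edist_eq_zero_iff]
    exact eq_comm
  rw [e, Set.ncard_singleton] at h
  exact_mod_cast h

lemma GrowthBound.one_le_iSup (hp : GrowthBound G p) (hN : 0 < N) {r : ℝ} (hr : 0 < r)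
    (hr1 : r < 1) : 1 ≤ ⨆ d : ℕ, r ^ d * p d := by
  refine (hp.one_le_zero hN).trans ?_
  have := le_ciSup (bddAbove_pow_mul_of_tendsto_log hr hr1 hp.1) 0
  simpa using this

lemma GrowthBound.not_adj (hp : GrowthBound G p) (h1 : p 1 < 1) (i j : Fin N) : ¬ G.Adj i j := by
  intro hij
  have h := (hp.2 i 1).trans_lt h1
  have h0 : Set.ncard {j | G.edist i j = ((1 : ℕ) : ℕ∞)} = 0 := by
    have : Set.ncard {j | G.edist i j = ((1 : ℕ) : ℕ∞)} < 1 := by exact_mod_cast h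
    omega
  rw [Set.ncard_eq_zero] at h0
  have hm : j ∈ {j | G.edist i j = ((1 : ℕ) : ℕ∞)} := by
    simpa using SimpleGraph.edist_eq_one_iff_adj.2 hij
  rw [h0] at hm
  exact hm

lemma spatialWeight_le_pow {q : ℝ} (hq : 0 ≤ q) (hq1 : q ≤ 1) {i j l : Fin N} {κ : ℕ}
    (h : j = l ∨ G.Adj j l) (hl : ¬ G.edist i l ≤ (κ : ℕ∞)) : spatialWeight G i q j ≤ q ^ κ := by
  unfold spatialWeight
  split_ifs with ht
  · positivity
  · refine pow_le_pow_of_le_one hq hq1 ?_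
    have h1 : G.edist i l ≤ G.edist i j + 1 :=
      edist_le_add_one (h.elim (fun h => Or.inl h.symm) fun h => Or.inr h.symm)
    have h2 : (κ : ℕ∞) < G.edist i j + 1 := (not_le.1 hl).trans_le h1
    lift G.edist i j to ℕ using ht with n
    have : κ < n + 1 := by exact_mod_cast h2
    simpa using Nat.lt_succ_iff.1 this

lemma spatialWeight_eq_zero_of_no_adj {q : ℝ} {i j l : Fin N} {κ : ℕ} (hG : ∀ i j, ¬ G.Adj i j)
    (h : j = l ∨ G.Adj j l) (hl : ¬ G.edist i l ≤ (κ : ℕ∞)) : spatialWeight G i q j = 0 := by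
  obtain rfl : j = l := h.resolve_right (hG _ _)
  have ht : G.edist i j = ⊤ := by
    by_contra hne
    obtain ⟨w, -⟩ := (SimpleGraph.reachable_of_edist_ne_top hne).exists_walk_length_eq_edist
    cases w with
    | nil => simp at hl
    | cons h _ => exact hG _ _ h
  simp [spatialWeight, ht]

variable {L γ μ : ℝ}

lemma Gam_nonneg (hp : GrowthBound G p) (hN : 0 < N) (hL : 1 < L) (hγ0 : 0 < γ) (hγ : γ < 1)
    (hμ : 0 < μ) : 0 ≤ Gam L γ μ p := by
  have h1 := hp.nonneg hN 1
  have h2 := (deltaS_facts hL hγ0 hγ hμ).1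
  unfold Gam
  positivity

lemma le_Gam (hp : GrowthBound G p) (hN : 0 < N) (h1 : 1 ≤ p 1) (hL : 1 < L) (hγ0 : 0 < γ)
    (hγ : γ < 1) (hμ : 0 < μ) :
    4 * alpha L γ μ ^ 2 * deltaS L γ μ * L / (1 - deltaS L γ μ) ^ 2 ≤ Gam L γ μ p := by
  obtain ⟨h2, -, h3, -⟩ := deltaS_facts hL hγ0 hγ hμ
  have h4 := (rho_facts hL hγ0 hγ hμ).1
  have h5 : 0 < deltaS L γ μ := by linarith
  have hsup := hp.one_le_iSup hN (div_pos h4 h5) ((div_lt_one h5).2 h3)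
  unfold Gam
  rw [mul_assoc _ _ (p 1)]
  refine le_mul_of_one_le_right (by positivity) ?_
  exact one_le_mul_of_one_le_of_one_le (one_le_pow₀ hsup) h1

/-- Outside the `κ`-neighbourhood the spatial weights are at most `η`. -/
lemma GrowthBound.exists_weight_bound (hp : GrowthBound G p) (hN : 0 < N) (hL : 1 < L) (hγ0 : 0 < γ)
    (hγ : γ < 1) (hμ : 0 < μ) (κ : ℕ) :
    ∃ η : ℝ, 0 ≤ η ∧ η ≤ deltaS L γ μ ^ κ ∧
      (∀ i j l, j = l ∨ G.Adj j l → ¬ G.edist i l ≤ (κ : ℕ∞) →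
        spatialWeight G i (spaceRate L γ μ) j ≤ η) ∧
      decayConst L γ μ * (4 * L * decayConst L γ μ + 1) * (2 * driftConst L γ μ + 1) * η
        ≤ Gam L γ μ p * deltaS L γ μ ^ κ := by
  have hqs := spaceRate_pos hL hγ0 hγ hμ
  have hle := pow_le_pow_left₀ hqs.le (spaceRate_le_deltaS hL hγ0 hγ hμ) κ
  have hδ : 0 < deltaS L γ μ := by linarith [(deltaS_facts hL hγ0 hγ hμ).1]
  have hG := Gam_nonneg hp hN hL hγ0 hγ hμ
  -- If p 1 < 1 there are no edges and Γ may be 0, but then the weights outside the neighbourhood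
  -- vanish and η = 0 works. Otherwise p 1 and the supremum in Γ are both at least 1.
  rcases lt_or_ge (p 1) 1 with h1 | h1
  · exact ⟨0, le_rfl, by positivity, fun i j l h hl =>
      (spatialWeight_eq_zero_of_no_adj (hp.not_adj h1) h hl).le, by
        rw [mul_zero]; positivity⟩
  · refine ⟨spaceRate L γ μ ^ κ, by positivity, hle, fun i j l h hl =>
      spatialWeight_le_pow hqs.le (spaceRate_lt_one hL hγ0 hγ hμ).le h hl, ?_⟩
    exact mul_le_mul ((drift_absorb_space hL hγ0 hγ hμ).trans (le_Gam hp hN h1 hL hγ0 hγ hμ)) hle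
      (by positivity) hG

end Growth

/-! ## Sums of disturbances -/

section Disturbance

variable {N : ℕ} {S : Network N} {Θ : Set (Vec S.nθ)} {T k : ℕ} {L μ D Dk q qs : ℝ}

lemma UncertaintyAssumption.bound_nonneg (hU : UncertaintyAssumption S Θ T μ L D)
    {θstar : ℕ → Vec S.nθ} (hθ : ∀ t ≤ T, θstar t ∈ Θ) (hT : 0 < T) : 0 ≤ D :=
  (norm_nonneg _).trans (hU.dist_bdd 0 hT _ (hθ 0 hT.le))

lemma WindowBound.nonneg {θstar : ℕ → Vec S.nθ} {θhat : ℕ → ℕ → Vec S.nθ}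
    (hW : WindowBound S T k θstar θhat Dk) (hT : 0 < T) : 0 ≤ Dk :=
  (Finset.sum_nonneg fun _ _ => norm_nonneg _).trans (hW 0 hT).1

lemma sum_forecast_le (hU : UncertaintyAssumption S Θ T μ L D) {θhat : ℕ → ℕ → Vec S.nθ}
    (hθh : ∀ t < T, ∀ n ≤ window k T t, θhat t n ∈ Θ) (hq : 0 ≤ q) (hq1 : q < 1) (hD : 0 ≤ D)
    {t : ℕ} (ht : t < T) :
    ∑ τ ∈ Finset.range (window k T t), q ^ τ * ‖S.disturbance (t + τ) (θhat t τ)‖ ≤ D / (1 - q) :=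
  sum_pow_mul_le_of_le hq hq1 hD fun τ hτ =>
    hU.dist_bdd _ (by unfold window at hτ; omega) _ (hθh t ht τ hτ.le)

lemma sum_pow_mul_le_sum {f : ℕ → ℝ} (hf : ∀ j, 0 ≤ f j) (hq : 0 ≤ q) (hq1 : q ≤ 1) (e : ℕ → ℕ)
    (n : ℕ) : ∑ j ∈ Finset.range n, q ^ e j * f j ≤ ∑ j ∈ Finset.range n, f j :=
  Finset.sum_le_sum fun j _ => mul_le_of_le_one_left (hf j) (pow_le_one₀ hq hq1)

lemma sum_pow_succ_mul_le {f : ℕ → ℝ} (hf : ∀ j, 0 ≤ f j) (hq : 0 ≤ q) (hq1 : q ≤ 1) (n : ℕ) :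
    ∑ j ∈ Finset.range n, q ^ (j + 1) * f j ≤ ∑ j ∈ Finset.range n, q ^ j * f j :=
  Finset.sum_le_sum fun j _ =>
    mul_le_mul_of_nonneg_right (pow_le_pow_of_le_one hq hq1 (Nat.le_succ j)) (hf j)

/-- Discounted sums of disturbances are controlled both by their sums over windows and by their
suprema. -/
lemma sum_disturbance_le (hU : UncertaintyAssumption S Θ T μ L D) {θstar : ℕ → Vec S.nθ}
    (hθ : ∀ t ≤ T, θstar t ∈ Θ) {θhat : ℕ → ℕ → Vec S.nθ}
    (hθh : ∀ t < T, ∀ n ≤ window k T t, θhat t n ∈ Θ) (hW : WindowBound S T k θstar θhat Dk)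
    (hT : 0 < T) (hk : 0 < k) (hq : 0 < q) (hq1 : q < 1) (hqk : q ^ k ≤ 1 / 2) (hqs : 0 < qs)
    (hqs1 : qs < 1) (hqqs : (1 - qs)⁻¹ ≤ 14 * (1 - q)⁻¹) {s : ℝ}
    (hs : s = min (2 * Dk) (D / (1 - q))) :
    (∀ t, ∀ n, ∑ τ ∈ Finset.range (T - t), q ^ tdist (τ + 1) n *
      ‖S.disturbance (t + τ) (θstar (t + τ))‖ ≤ 2 * s) ∧
    (∀ t < T, ∑ τ ∈ Finset.range (window k T t), q ^ tdist (τ + 1) (window k T t) *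
      ‖S.disturbance (t + τ) (θhat t τ)‖ ≤ 2 * s) ∧
    (∀ t < T, ∑ τ ∈ Finset.range (window k T t), q ^ (τ + 1) *
      (‖S.disturbance (t + τ) (θstar (t + τ))‖ + ‖S.disturbance (t + τ) (θhat t τ)‖) ≤ 2 * s) ∧
    (∀ t < T, ∑ τ ∈ Finset.range (window k T t), qs ^ (τ + 1) *
      ‖S.disturbance (t + τ) (θhat t τ)‖ ≤ 14 * s) := by
  have hD := hU.bound_nonneg hθ hT
  have hDk := hW.nonneg hT
  -- Each sum is estimated twice, by window sums and by suprema. The first estimate serves the terms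
  -- with D_k, the second those with D.
  have hmin : ∀ (c z : ℝ), 0 ≤ c → z ≤ c * (2 * Dk) → z ≤ c * (D / (1 - q)) → z ≤ c * s := by
    intro c z hc h1 h2
    rw [hs, mul_min_of_nonneg _ _ hc]
    exact le_min h1 h2
  have hwin : ∀ t < T, window k T t ≤ T - t := fun t _ => min_le_right _ _
  have h1q : 0 < 1 - q := by linarith
  refine ⟨fun t n => ?_, fun t ht => ?_, fun t ht => ?_, fun t ht => ?_⟩
  · set b : ℕ → ℝ := fun j => if j < T then ‖S.disturbance j (θstar j)‖ else 0 with hb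
    have hb0 : ∀ j, 0 ≤ b j := fun j => by simp only [hb]; split_ifs <;> positivity
    have hbD : ∀ j, b j ≤ D := fun j => by
      simp only [hb]; split_ifs with h
      · exact hU.dist_bdd j h _ (hθ j h.le)
      · exact hD
    have hbw : ∀ s, ∑ j ∈ Finset.range k, b (s + j) ≤ Dk := by
      intro s
      rcases lt_or_ge s T with h | h
      · refine le_trans ?_ (hW s h).1
        rw [← Finset.sum_subset (Finset.range_mono (min_le_left k (T - s)))]
        · refine le_of_eq (Finset.sum_congr rfl fun j hj => ?_)
          have := lt_min_iff.1 (Finset.mem_range.1 hj)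
          simp only [hb]
          rw [if_pos (by omega)]
        · intro j hj hj'
          simp only [Finset.mem_range] at hj hj'
          simp only [hb]
          rw [if_neg (by omega)]
      · refine le_trans (le_of_eq (Finset.sum_eq_zero fun j _ => ?_)) hDk
        simp only [hb]
        rw [if_neg (by omega)]
    have e : ∑ τ ∈ Finset.range (T - t), q ^ tdist (τ + 1) n *
        ‖S.disturbance (t + τ) (θstar (t + τ))‖
        = ∑ τ ∈ Finset.range (T - t), q ^ tdist (τ + 1) n * b (t + τ) := by
      refine Finset.sum_congr rfl fun τ hτ => ?_
      have := Finset.mem_range.1 hτ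
      simp only [hb]
      rw [if_pos (by omega)]
    rw [e]
    refine hmin 2 _ (by norm_num) ?_ ?_
    · refine (sum_tdist_le_of_window (f := fun τ => b (t + τ)) (fun j => hb0 _) hq.le hq1.le hk hqk
        (β := Dk) (fun s => ?_) _ n).trans (by linarith)
      simpa only [add_assoc] using hbw (t + s)
    · exact sum_tdist_le_of_le (f := fun τ => b (t + τ)) (fun j => hb0 _) hq.le hq1
        (fun j => hbD _) _ n
  · refine hmin 2 _ (by norm_num) ?_ ?_
    · exact (sum_pow_mul_le_sum (f := fun τ => ‖S.disturbance (t + τ) (θhat t τ)‖)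
        (fun _ => norm_nonneg _) hq.le hq1.le _ _).trans (by linarith [(hW t ht).2])
    · set M := window k T t with hM
      set b : ℕ → ℝ := fun τ => if τ < M then ‖S.disturbance (t + τ) (θhat t τ)‖ else 0 with hb
      have hb0 : ∀ j, 0 ≤ b j := fun j => by simp only [hb]; split_ifs <;> positivity
      have hbD : ∀ j, b j ≤ D := fun j => by
        simp only [hb]; split_ifs with h
        · have := hwin t ht
          exact hU.dist_bdd _ (by omega) _ (hθh t ht j h.le)
        · exact hD
      refine le_trans (le_of_eq (Finset.sum_congr rfl fun τ hτ => ?_))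
        (sum_tdist_le_of_le hb0 hq.le hq1 hbD M M)
      simp only [hb]
      rw [if_pos (Finset.mem_range.1 hτ)]
  · simp only [mul_add, Finset.sum_add_distrib]
    refine hmin 2 _ (by norm_num) ?_ ?_
    · have h1 := sum_pow_mul_le_sum (f := fun τ => ‖S.disturbance (t + τ) (θstar (t + τ))‖)
        (fun _ => norm_nonneg _) hq.le hq1.le (fun τ => τ + 1) (window k T t)
      have h2 := sum_pow_mul_le_sum (f := fun τ => ‖S.disturbance (t + τ) (θhat t τ)‖)
        (fun _ => norm_nonneg _) hq.le hq1.le (fun τ => τ + 1) (window k T t)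
      linarith [(hW t ht).1, (hW t ht).2]
    · have h1 := sum_pow_succ_mul_le (f := fun τ => ‖S.disturbance (t + τ) (θstar (t + τ))‖)
        (fun _ => norm_nonneg _) hq.le hq1.le (window k T t)
      have h2 := sum_pow_succ_mul_le (f := fun τ => ‖S.disturbance (t + τ) (θhat t τ)‖)
        (fun _ => norm_nonneg _) hq.le hq1.le (window k T t)
      have h3 := sum_forecast_le hU hθh hq.le hq1 hD ht
      have h4 := sum_pow_mul_le_of_le (f := fun τ => ‖S.disturbance (t + τ) (θstar (t + τ))‖)
        hq.le hq1 hD (n := window k T t) fun τ hτ => by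
          have := hwin t ht
          exact hU.dist_bdd _ (by omega) _ (hθ _ (by omega))
      linarith
  · refine hmin 14 _ (by norm_num) ?_ ?_
    · exact (sum_pow_mul_le_sum (f := fun τ => ‖S.disturbance (t + τ) (θhat t τ)‖)
        (fun _ => norm_nonneg _) hqs.le hqs1.le _ _).trans (by linarith [(hW t ht).2])
    · have h2 := sum_pow_succ_mul_le (f := fun τ => ‖S.disturbance (t + τ) (θhat t τ)‖)
        (fun _ => norm_nonneg _) hqs.le hqs1.le (window k T t)
      have h3 := sum_forecast_le hU hθh hqs.le hqs1 hD ht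
      have h4 := mul_le_mul_of_nonneg_left hqqs hD
      rw [div_eq_mul_inv] at h3 ⊢
      linarith

end Disturbance

/-! ## Consequences of the conditions on the window, the radius and the forecasts -/

section Conditions

lemma pow_le_of_log_div_le {δ y c : ℝ} {k : ℕ} (hδ : 0 < δ) (hδ1 : δ < 1) (hy : 0 < y)
    (h : c * Real.log y / Real.log δ ≤ k) : δ ^ k ≤ y ^ c := by
  have hlog := Real.log_neg hδ hδ1
  rw [div_le_iff_of_neg hlog] at h
  rw [Real.rpow_def_of_pos hy, ← Real.rpow_natCast, Real.rpow_def_of_pos hδ]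
  exact Real.exp_le_exp.2 (by linarith)

/-- The hypothesis says δ^k ≤ y² with y = δ(1 - δ)/(6C³). As Cy ≤ 1/6, it follows that Cδ^k ≤ (Cy)²
≤ 1/36, which also excludes k = 0. -/
lemma window_condition {δ C : ℝ} {k : ℕ} (hδ : 0 < δ) (hδ1 : δ < 1) (hC : 1 ≤ C)
    (h : 2 * Real.log (δ * (1 - δ) / (6 * C ^ 3)) / Real.log δ ≤ k) :
    0 < k ∧ C * δ ^ k ≤ 1 / 36 := by
  have h1δ : 0 < 1 - δ := by linarith
  have hC3 : 1 ≤ C ^ 3 := one_le_pow₀ hC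
  have hy : 0 < δ * (1 - δ) / (6 * C ^ 3) := by positivity
  have hy6 : C * (δ * (1 - δ) / (6 * C ^ 3)) ≤ 1 / 6 := by
    rw [← mul_div_assoc, div_le_iff₀ (by positivity)]
    have : C * (δ * (1 - δ)) ≤ C * 1 := by
      have : δ * (1 - δ) ≤ 1 := by nlinarith
      gcongr
    have : C ≤ C ^ 3 := le_self_pow₀ hC (by norm_num)
    linarith
  have hk := pow_le_of_log_div_le hδ hδ1 hy h
  have h36 : C * δ ^ k ≤ 1 / 36 := by
    rw [Real.rpow_two] at hk
    generalize δ * (1 - δ) / (6 * C ^ 3) = y at *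
    have h1 : C * δ ^ k ≤ C * y ^ 2 := by gcongr
    have h2 : C * y ^ 2 ≤ (C * y) ^ 2 := by
      rw [mul_pow]
      have : C ≤ C ^ 2 := le_self_pow₀ hC (by norm_num)
      gcongr
    have h3 : (C * y) ^ 2 ≤ (1 / 6) ^ 2 := by gcongr
    linarith
  refine ⟨Nat.pos_of_ne_zero ?_, h36⟩
  rintro rfl
  rw [pow_zero] at h36
  linarith

/-- The bound √δ(1 - √δ) ≤ 1/4, divided by 3, gives 1/12. -/
lemma radius_condition {δ C : ℝ} {N κ : ℕ} (hδ : 0 < δ) (hδ1 : δ < 1) (hC : 1 ≤ C) (hN : 0 < N)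
    (h : Real.log (√δ * (1 - √δ) / (3 * C ^ 2 * N)) / Real.log δ ≤ κ) :
    C * (N * δ ^ κ) ≤ 1 / 12 := by
  have hs : 0 < √δ := Real.sqrt_pos.2 hδ
  have hs1 : √δ < 1 := by rwa [Real.sqrt_lt' one_pos, one_pow]
  have h1s : 0 < 1 - √δ := by linarith
  have hN' : (0 : ℝ) < N := by exact_mod_cast hN
  have hC2 : 1 ≤ C ^ 2 := one_le_pow₀ hC
  have hk := pow_le_of_log_div_le (c := 1) (y := √δ * (1 - √δ) / (3 * C ^ 2 * N)) hδ hδ1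
    (by positivity) (by rwa [one_mul])
  rw [Real.rpow_one, le_div_iff₀ (by positivity)] at hk
  have h4 : √δ * (1 - √δ) ≤ 1 / 4 := by nlinarith [sq_nonneg (√δ - 1 / 2)]
  have h5 : N * δ ^ κ * C ≤ N * δ ^ κ * C ^ 2 := by
    have : C ≤ C ^ 2 := le_self_pow₀ hC (by norm_num)
    gcongr
  linarith

/-- The exponent of the forecast condition factors as (δ²)^n (√δ)^m, and q ≤ δ² ≤ √δ. This is the
reason why `deltaT` is at least the square root of `timeRate`. -/
lemma pow_mul_pow_le_rpow {q δ : ℝ} (hq : 0 ≤ q) (hδ : 0 < δ) (hδ1 : δ < 1) (hqδ : q ≤ δ ^ 2)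
    (n m : ℕ) : q ^ m * q ^ n ≤ δ ^ (2 * (n : ℝ) + (m : ℝ) / 2) := by
  have h1 : δ ^ 2 ≤ √δ := by
    apply Real.le_sqrt_of_sq_le
    rw [← pow_mul]
    exact pow_le_of_le_one hδ.le hδ1.le (by norm_num)
  have e : δ ^ (2 * (n : ℝ) + (m : ℝ) / 2) = √δ ^ m * (δ ^ 2) ^ n := by
    rw [Real.rpow_add hδ, mul_comm, Real.sqrt_eq_rpow, ← Real.rpow_mul_natCast hδ.le, ← pow_mul,
      ← Real.rpow_natCast δ (2 * n)]
    push_cast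
    ring_nf
  rw [e]
  exact mul_le_mul (pow_le_pow_left₀ hq (hqδ.trans h1) m) (pow_le_pow_left₀ hq hqδ n)
    (by positivity) (by positivity)

variable {N : ℕ} {S : Network N} {T k : ℕ} {L C δ ε R q : ℝ}

/-- Discounted sums of past forecast errors. -/
lemma ForecastCondition.sum_le {θstar : ℕ → Vec S.nθ} {θhat : ℕ → ℕ → Vec S.nθ}
    (h : ForecastCondition T k θstar θhat L C δ ε R) (hL : 0 < L) (hq : 0 ≤ q) (hk : 0 < k)
    (hqk : q ^ k ≤ 1 / 2) (hδ : 0 < δ) (hδ1 : δ < 1) (hqδ : q ≤ δ ^ 2) {t : ℕ} (ht : t < T) :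
    ∑ j ∈ Finset.range t, q ^ (t - 1 - j) *
      ∑ n ∈ Finset.range (window k T j + 1), q ^ n * fcErr θstar θhat j n
      ≤ 2 * (√δ / (3 * L * C ^ 2)) := by
  set f : ℕ → ℝ := fun j =>
    ∑ n ∈ Finset.range (window k T j + 1), q ^ n * fcErr θstar θhat j n with hf
  have hφ : ∀ j n, 0 ≤ fcErr θstar θhat j n := fun j n => norm_nonneg _
  have hf0 : ∀ j, 0 ≤ f j := fun j => Finset.sum_nonneg fun n _ => mul_nonneg (by positivity) (hφ _ _)
  have hβ : 0 ≤ √δ / (3 * L * C ^ 2) := by positivity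
  cases t with
  | zero => simpa using hβ
  | succ t =>
    rw [← Finset.sum_range_reflect]
    have := sum_backward_le hf0 hq hk hqk hβ (T := T) (fun t ht => ?_) t (by omega)
    · refine le_trans (le_of_eq (Finset.sum_congr rfl fun j hj => ?_)) this
      have := Finset.mem_range.1 hj
      have e1 : t + 1 - 1 - (t + 1 - 1 - j) = j := by omega
      have e2 : t + 1 - 1 - j = t - j := by omega
      rw [e1, e2]
    · refine le_trans (Finset.sum_le_sum fun m _ => ?_) (h.1 t ht)
      simp only [hf]
      rw [Finset.mul_sum]
      refine Finset.sum_le_sum fun n _ => ?_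
      rw [← mul_assoc, mul_comm (fcErr _ _ _ _)]
      exact mul_le_mul_of_nonneg_right (pow_mul_pow_le_rpow hq hδ hδ1 hqδ n m) (hφ _ _)

/-- The gain of the control errors along the closed loop is small. -/
lemma sum_gain_le {θstar : ℕ → Vec S.nθ} {θhat : ℕ → ℕ → Vec S.nθ}
    (h : ForecastCondition T k θstar θhat L C δ ε R) (hL : 1 ≤ L) (hq : 0 ≤ q) (hq1 : q < 1)
    (hk : 0 < k) (hqk : C * q ^ k ≤ 1 / 36) (hδ : 0 < δ) (hδ1 : δ < 1) (hqδ : q ≤ δ ^ 2) {a b η : ℝ}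
    (ha : 0 ≤ a) (hb : 0 ≤ b) (hη : 0 ≤ η) (hNη : C * (N * η) ≤ 1 / 12)
    (hC1 : 28 * (a * L * (b / (1 - q) + 4 * a ^ 2 * L + a ^ 2 * (2 * L + 1) / (1 - q))) ≤ C)
    (hC : 1 ≤ C) {t : ℕ} (ht : t < T) :
    ∑ j ∈ Finset.range t, a * L * q ^ (t - 1 - j) *
      (N * (b * η) + 2 * a ^ 2 * L * ∑ n ∈ Finset.range (window k T j + 1),
        q ^ n * fcErr θstar θhat j n + a ^ 2 * (2 * L + 1) * q ^ k) ≤ 1 / 28 := by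
  have h1q : 0 < 1 - q := by linarith
  have hqk' : q ^ k ≤ 1 / 2 := by
    have : q ^ k ≤ C * q ^ k := le_mul_of_one_le_left (by positivity) hC
    linarith
  have hgeo : ∑ j ∈ Finset.range t, q ^ (t - 1 - j) ≤ (1 - q)⁻¹ := by
    rw [Finset.sum_range_reflect (fun j => q ^ j) t]
    exact geom_sum_le_inv hq hq1 t
  have hβ := h.sum_le (by linarith) hq hk hqk' hδ hδ1 hqδ ht
  have hβ' : √δ / (3 * L * C ^ 2) ≤ 1 / (3 * C) := by
    have h1 : √δ ≤ 1 := Real.sqrt_le_one.2 hδ1.le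
    have h2 : 3 * C ≤ 3 * L * C ^ 2 := by
      have : C ≤ C ^ 2 := le_self_pow₀ hC (by norm_num)
      have : 1 * C ≤ L * C ^ 2 := by gcongr
      linarith
    gcongr
  set Φ := fun j => ∑ n ∈ Finset.range (window k T j + 1), q ^ n * fcErr θstar θhat j n with hΦ
  have e : ∑ j ∈ Finset.range t, a * L * q ^ (t - 1 - j) *
      (N * (b * η) + 2 * a ^ 2 * L * Φ j + a ^ 2 * (2 * L + 1) * q ^ k)
      = (a * L * (b * (N * η)) + a * L * (a ^ 2 * (2 * L + 1) * q ^ k))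
          * ∑ j ∈ Finset.range t, q ^ (t - 1 - j)
        + a * L * (2 * a ^ 2 * L) * ∑ j ∈ Finset.range t, q ^ (t - 1 - j) * Φ j := by
    rw [Finset.mul_sum, Finset.mul_sum, ← Finset.sum_add_distrib]
    exact Finset.sum_congr rfl fun j _ => by ring
  rw [e]
  rw [div_eq_mul_inv b, div_eq_mul_inv (a ^ 2 * _)] at hC1
  set r := (1 - q)⁻¹ with hr
  have hr0 : 0 < r := inv_pos.2 h1q
  have h1 : (a * L * (b * (N * η)) + a * L * (a ^ 2 * (2 * L + 1) * q ^ k))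
      * ∑ j ∈ Finset.range t, q ^ (t - 1 - j)
      ≤ (a * L * (b * r)) * (N * η) + (a * L * (a ^ 2 * (2 * L + 1) * r)) * q ^ k := by
    refine (mul_le_mul_of_nonneg_left hgeo (by positivity)).trans (le_of_eq (by ring))
  have h2 : a * L * (2 * a ^ 2 * L) * ∑ j ∈ Finset.range t, q ^ (t - 1 - j) * Φ j
      ≤ a * L * (4 * a ^ 2 * L) * (1 / (3 * C)) := by
    refine (mul_le_mul_of_nonneg_left (hβ.trans (mul_le_mul_of_nonneg_left hβ' zero_le_two))
      (by positivity)).trans (le_of_eq (by ring))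
  have p1 : 0 ≤ a * L * (b * r) := by positivity
  have p2 : 0 ≤ a * L * (4 * a ^ 2 * L) := by positivity
  have p3 : 0 ≤ a * L * (a ^ 2 * (2 * L + 1) * r) := by positivity
  have m1 : a * L * (b * r) ≤ C / 28 := by linarith
  have m2 : a * L * (4 * a ^ 2 * L) ≤ C / 28 := by linarith
  have m3 : a * L * (a ^ 2 * (2 * L + 1) * r) ≤ C / 28 := by linarith
  have n1 := mul_le_mul_of_nonneg_right m1 (by positivity : 0 ≤ N * η)
  have n2 := mul_le_mul_of_nonneg_right m2 (by positivity : 0 ≤ 1 / (3 * C))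
  have n3 := mul_le_mul_of_nonneg_right m3 (by positivity : 0 ≤ q ^ k)
  -- Truncation, forecasts and horizon contribute at most 1/336, 1/84 and 1/1008.
  have e2 : C / 28 * (1 / (3 * C)) = 1 / 84 := by field_simp; norm_num
  linarith

end Conditions

/-- A weighted Cauchy–Schwarz inequality. -/
lemma sq_le_of_le_weighted_sum {ι : Type*} (s : Finset ι) {p φ : ι → ℝ} {P c₁ c₂ A B e : ℝ}
    (hp : ∀ i ∈ s, 0 ≤ p i) (hφ : ∀ i ∈ s, 0 ≤ φ i) (hP : ∑ i ∈ s, p i ≤ P) (hc₁ : 0 ≤ c₁)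
    (hc₂ : 0 ≤ c₂) (hA : 0 ≤ A) (hB : 0 ≤ B) (he : 0 ≤ e)
    (h : e ≤ ∑ i ∈ s, p i * φ i + c₁ * A + c₂ * B) :
    e ^ 2 ≤ (P + c₁ + c₂) * (∑ i ∈ s, p i * φ i ^ 2 + c₁ * A ^ 2 + c₂ * B ^ 2) := by
  have hQ : 0 ≤ ∑ i ∈ s, p i * φ i ^ 2 :=
    Finset.sum_nonneg fun i hi => mul_nonneg (hp i hi) (sq_nonneg _)
  have hP0 : 0 ≤ ∑ i ∈ s, p i := Finset.sum_nonneg hp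
  have hX : 0 ≤ ∑ i ∈ s, p i * φ i :=
    Finset.sum_nonneg fun i hi => mul_nonneg (hp i hi) (hφ i hi)
  have hcs : (∑ i ∈ s, p i * φ i) ^ 2 ≤ (∑ i ∈ s, p i) * ∑ i ∈ s, p i * φ i ^ 2 :=
    Finset.sum_sq_le_sum_mul_sum_of_sq_le_mul s hp
      (fun i hi => mul_nonneg (hp i hi) (sq_nonneg _)) fun i _ => le_of_eq (by ring)
  have hcs' := hcs.trans (mul_le_mul_of_nonneg_right hP hQ)
  have hPP := hP0.trans hP
  -- AM–GM after Cauchy–Schwarz in the form (∑ pφ)² ≤ P ∑ pφ²; it handles the products of the sum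
  -- with A and B.
  have hcross : ∀ z, 0 ≤ z → 2 * (∑ i ∈ s, p i * φ i) * z
      ≤ P * z ^ 2 + ∑ i ∈ s, p i * φ i ^ 2 := by
    intro z hz
    refine abs_le_of_sq_le_sq' ?_ (by positivity) |>.2
    have h2 := mul_le_mul_of_nonneg_right hcs' (by positivity : 0 ≤ 4 * z ^ 2)
    nlinarith [sq_nonneg (P * z ^ 2 - ∑ i ∈ s, p i * φ i ^ 2)]
  have h1 := hcross A hA
  have h2 := hcross B hB
  have h3 := mul_le_mul_of_nonneg_left h1 hc₁
  have h4 := mul_le_mul_of_nonneg_left h2 hc₂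
  have h5 : 0 ≤ c₁ * c₂ * (A - B) ^ 2 := by positivity
  calc e ^ 2 ≤ (∑ i ∈ s, p i * φ i + c₁ * A + c₂ * B) ^ 2 := by gcongr
    _ ≤ _ := by nlinarith

lemma sum_weights_le {ρ R₀ : ℝ} (hρ : 0 ≤ ρ) (hρ1 : ρ < 1) (hR : 0 ≤ R₀) (n : ℕ) :
    ∑ i ∈ Finset.range n, (1 + R₀ * ρ ^ i) * ρ ^ i ≤ 1 / (1 - ρ) + R₀ / (1 - ρ ^ 2) := by
  have h1 := geom_sum_le_inv hρ hρ1 n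
  have h2 := geom_sum_le_inv (sq_nonneg ρ) (by nlinarith : ρ ^ 2 < 1) n
  have e : ∑ i ∈ Finset.range n, (1 + R₀ * ρ ^ i) * ρ ^ i
      = ∑ i ∈ Finset.range n, ρ ^ i + R₀ * ∑ i ∈ Finset.range n, (ρ ^ 2) ^ i := by
    rw [Finset.mul_sum, ← Finset.sum_add_distrib]
    refine Finset.sum_congr rfl fun i _ => ?_
    rw [← pow_mul]; ring
  rw [e, one_div, div_eq_mul_inv R₀]
  exact add_le_add h1 (mul_le_mul_of_nonneg_left h2 hR)

/-! ## The control error -/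

section Final

variable {L γ σ μ D : ℝ} {d : ℕ}

/-- The temporal decay rate. -/
def deltaT (L γ σ μ : ℝ) (d : ℕ) : ℝ := max (√(timeRate L γ μ)) (fixedEndRate L γ σ μ d)

/-- The constant of the temporal decay. -/
def omega (L γ σ μ : ℝ) (d : ℕ) : ℝ :=
  1 + 2 * fixedEndSaddle L γ σ μ d * (fixedEndRate L γ σ μ d)⁻¹ + 2 * decayConst L γ μ
    + decayConst L γ μ ^ 2 * (2 * L + 1) * (driftConst L γ μ + 2)
    + 28 * (decayConst L γ μ * L *
      (decayConst L γ μ * (4 * L * decayConst L γ μ + 1) / (1 - timeRate L γ μ)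
        + 4 * decayConst L γ μ ^ 2 * L
        + decayConst L γ μ ^ 2 * (2 * L + 1) / (1 - timeRate L γ μ)))

lemma deltaT_facts (hL : 1 < L) (hγ0 : 0 < γ) (hγ : γ < 1) (hσ : 0 < σ) (hμ : 0 < μ) :
    0 < deltaT L γ σ μ d ∧ deltaT L γ σ μ d < 1 ∧ timeRate L γ μ ≤ deltaT L γ σ μ d ^ 2 ∧
      fixedEndRate L γ σ μ d ≤ deltaT L γ σ μ d := by
  have hq := timeRate_pos hL hγ0 hγ hμ
  refine ⟨lt_max_of_lt_right (fixedEndRate_pos hL hγ hσ hμ), max_lt ?_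
    (fixedEndRate_lt_one hL hγ hσ hμ), ?_, le_max_right _ _⟩
  · rw [Real.sqrt_lt' one_pos, one_pow]
    exact timeRate_lt_one hL hγ0 hγ hμ
  · exact Real.sqrt_le_iff.1 (le_max_left _ _) |>.2

lemma omega_facts (hL : 1 < L) (hγ0 : 0 < γ) (hγ : γ < 1) (hσ : 0 < σ) (hμ : 0 < μ) :
    1 ≤ omega L γ σ μ d ∧
    2 * fixedEndSaddle L γ σ μ d * (fixedEndRate L γ σ μ d)⁻¹ ≤ omega L γ σ μ d ∧
    2 * decayConst L γ μ ≤ omega L γ σ μ d ∧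
    decayConst L γ μ ^ 2 * (2 * L + 1) * (driftConst L γ μ + 2) ≤ omega L γ σ μ d ∧
    28 * (decayConst L γ μ * L *
      (decayConst L γ μ * (4 * L * decayConst L γ μ + 1) / (1 - timeRate L γ μ)
        + 4 * decayConst L γ μ ^ 2 * L
        + decayConst L γ μ ^ 2 * (2 * L + 1) / (1 - timeRate L γ μ))) ≤ omega L γ σ μ d := by
  have h1 := fixedEndSaddle_pos (d := d) hL hγ hσ hμ
  have h2 := fixedEndRate_pos (d := d) hL hγ hσ hμ
  have h3 := decayConst_pos hL hγ0 hγ hμ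
  have h4 := driftConst_pos hL hγ0 hγ hμ
  have h5 : 0 < 1 - timeRate L γ μ := by linarith [timeRate_lt_one hL hγ0 hγ hμ]
  have p1 : 0 ≤ 2 * fixedEndSaddle L γ σ μ d * (fixedEndRate L γ σ μ d)⁻¹ := by positivity
  have p2 : 0 ≤ decayConst L γ μ ^ 2 * (2 * L + 1) * (driftConst L γ μ + 2) := by positivity
  have p3 : 0 ≤ 28 * (decayConst L γ μ * L *
      (decayConst L γ μ * (4 * L * decayConst L γ μ + 1) / (1 - timeRate L γ μ)
        + 4 * decayConst L γ μ ^ 2 * L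
        + decayConst L γ μ ^ 2 * (2 * L + 1) / (1 - timeRate L γ μ))) := by positivity
  unfold omega
  refine ⟨?_, ?_, ?_, ?_, ?_⟩ <;> linarith

/-- One forecast summand, for a state bounded by Y plus drift. The drift carries no second power of
ρ^n and goes into Υ through `drift_absorb_time`, while Y keeps it. The lemma serves both for Y =
‖x_t‖ and for Y = R₀. -/
lemma forecast_term_le (hL : 1 < L) (hγ0 : 0 < γ) (hγ : γ < 1) (hμ : 0 < μ) (hD : 0 ≤ D)
    {X Y : ℝ} (hX : 0 ≤ X) (hY : 0 ≤ Y)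
    (hXY : X ≤ Y + driftConst L γ μ * (D / (1 - timeRate L γ μ))) (n : ℕ) :
    decayConst L γ μ * L * timeRate L γ μ ^ n * (1 + 4 * decayConst L γ μ *
      (D / (1 - timeRate L γ μ)) + 2 * decayConst L γ μ * (timeRate L γ μ ^ n * X))
      ≤ Ups L γ μ D * (rho L γ μ ^ n * (1 + rho L γ μ ^ n * Y)) := by
  have hq0 := timeRate_pos hL hγ0 hγ hμ
  have hq1 := timeRate_lt_one hL hγ0 hγ hμ
  have ha := decayConst_pos hL hγ0 hγ hμ
  have hc := driftConst_pos hL hγ0 hγ hμ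
  obtain ⟨hρ0, hρ1, -⟩ := rho_facts hL hγ0 hγ hμ
  obtain ⟨hα2, hα1⟩ := two_mul_decayConst_sq_le hL hγ0 hγ hμ
  have hα := alpha_pos hL hγ0 hγ hμ
  have hd := drift_absorb_time hL hγ0 hγ hμ
  have hqn : timeRate L γ μ ^ n ≤ rho L γ μ ^ n :=
    pow_le_pow_left₀ hq0.le (timeRate_le_rho hL hγ0 hγ hμ) n
  have hqn1 : timeRate L γ μ ^ n ≤ 1 := pow_le_one₀ hq0.le hq1.le
  have h1q : 0 < 1 - timeRate L γ μ := by linarith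
  have h1ρ : 0 < 1 - rho L γ μ := by linarith
  unfold Ups
  rw [div_eq_mul_inv] at *
  rw [div_eq_mul_inv (2 * _ * D)]
  have hq0' := pow_pos hq0 n
  generalize timeRate L γ μ ^ n = Q at *
  generalize rho L γ μ ^ n = P at *
  have hi : 0 < (1 - timeRate L γ μ)⁻¹ := inv_pos.2 h1q
  have hi' : 0 < (1 - rho L γ μ)⁻¹ := inv_pos.2 h1ρ
  generalize (1 - timeRate L γ μ)⁻¹ = r at *
  generalize (1 - rho L γ μ)⁻¹ = r' at *
  generalize decayConst L γ μ = a at *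
  generalize driftConst L γ μ = c at *
  generalize alpha L γ μ = α at *
  have hP : 0 < P := hq0'.trans_le hqn
  have k1 : Q * X ≤ P * Y + c * (D * r) := by
    calc Q * X ≤ Q * (Y + c * (D * r)) := by gcongr
      _ = Q * Y + Q * (c * (D * r)) := by ring
      _ ≤ P * Y + 1 * (c * (D * r)) := by gcongr
      _ = _ := by ring
  calc a * L * Q * (1 + 4 * a * (D * r) + 2 * a * (Q * X))
      ≤ a * L * P * (1 + 4 * a * (D * r) + 2 * a * (P * Y + c * (D * r))) := by gcongr
    _ = P * (L * (a + (a ^ 2 * (2 * c + 4) * r) * D) + 2 * a ^ 2 * L * (P * Y)) := by ring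
    _ ≤ P * (L * (α + α * (2 * α * r') * D) + α * L * (P * Y)) := by gcongr
    _ ≤ P * (L * (α + α * (2 * α * r') * D) + (α * L * (1 + 2 * α * D * r')) * (P * Y)) := by
        have : α * L ≤ α * L * (1 + 2 * α * D * r') :=
          le_mul_of_one_le_right (by positivity) (le_add_of_nonneg_right (by positivity))
        gcongr
    _ = _ := by ring

/-- One factor Ω absorbs a²(2L + 1) times drift constant plus 2; the form 2Ω² follows from Ω ≥ 1. -/
lemma tail_term_le (hL : 1 < L) (hγ0 : 0 < γ) (hγ : γ < 1) (hσ : 0 < σ) (hμ : 0 < μ) (hD : 0 ≤ D)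
    {X Y : ℝ} (hX : 0 ≤ X) (hY : 0 ≤ Y)
    (hXY : X ≤ Y + driftConst L γ μ * (D / (1 - timeRate L γ μ))) (k : ℕ) :
    decayConst L γ μ ^ 2 * (2 * L + 1) * timeRate L γ μ ^ k *
      (timeRate L γ μ ^ k * X + 2 * (D / (1 - timeRate L γ μ)))
      ≤ 2 * omega L γ σ μ d ^ 2 * deltaT L γ σ μ d ^ k *
        (deltaT L γ σ μ d ^ k * Y + 2 * D / (1 - deltaT L γ σ μ d)) := by
  have hq0 := timeRate_pos hL hγ0 hγ hμ
  have hq1 := timeRate_lt_one hL hγ0 hγ hμ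
  have ha := decayConst_pos hL hγ0 hγ hμ
  have hc := driftConst_pos hL hγ0 hγ hμ
  obtain ⟨hδ0, hδ1, hqδ, -⟩ := deltaT_facts (d := d) hL hγ0 hγ hσ hμ
  obtain ⟨hΩ1, -, -, hΩ, -⟩ := omega_facts (d := d) hL hγ0 hγ hσ hμ
  have hqδ' : timeRate L γ μ ≤ deltaT L γ σ μ d :=
    hqδ.trans (pow_le_of_le_one hδ0.le hδ1.le two_ne_zero)
  have hqn : timeRate L γ μ ^ k ≤ deltaT L γ σ μ d ^ k := pow_le_pow_left₀ hq0.le hqδ' k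
  have hqn1 : timeRate L γ μ ^ k ≤ 1 := pow_le_one₀ hq0.le hq1.le
  have hq0' := pow_pos hq0 k
  have h1q : 0 < 1 - timeRate L γ μ := by linarith
  have h1δ : 0 < 1 - deltaT L γ σ μ d := by linarith
  have hE : D / (1 - timeRate L γ μ) ≤ D / (1 - deltaT L γ σ μ d) := by gcongr
  have hE0 : 0 ≤ D / (1 - timeRate L γ μ) := by positivity
  rw [mul_div_assoc 2 D]
  generalize D / (1 - timeRate L γ μ) = E at *
  generalize D / (1 - deltaT L γ σ μ d) = E' at *
  generalize timeRate L γ μ ^ k = Q at *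
  generalize deltaT L γ σ μ d ^ k = P at *
  generalize decayConst L γ μ = a at *
  generalize driftConst L γ μ = c at *
  generalize omega L γ σ μ d = Ω at *
  have hP : 0 < P := hq0'.trans_le hqn
  have hE0' : 0 ≤ E' := hE0.trans hE
  have k1 : Q * X + 2 * E ≤ P * Y + (c + 2) * E' := by
    calc Q * X + 2 * E ≤ Q * (Y + c * E) + 2 * E := by gcongr
      _ = Q * Y + Q * (c * E) + 2 * E := by ring
      _ ≤ P * Y + 1 * (c * E') + 2 * E' := by gcongr
      _ = _ := by ring
  calc a ^ 2 * (2 * L + 1) * Q * (Q * X + 2 * E)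
      ≤ a ^ 2 * (2 * L + 1) * P * (P * Y + (c + 2) * E') := by gcongr
    _ ≤ a ^ 2 * (2 * L + 1) * P * ((c + 2) * (P * Y + E')) := by
        have : P * Y ≤ (c + 2) * (P * Y) := le_mul_of_one_le_left (by positivity) (by linarith)
        gcongr
        linarith
    _ = P * ((a ^ 2 * (2 * L + 1) * (c + 2)) * (P * Y + E')) := by ring
    _ ≤ P * (Ω * (P * Y + E')) := by gcongr
    _ ≤ P * ((2 * Ω ^ 2) * (P * Y + 2 * E')) := by
        have : Ω ≤ 2 * Ω ^ 2 := by nlinarith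
        have : P * Y + E' ≤ P * Y + 2 * E' := by linarith
        gcongr
    _ = _ := by ring

/-- Here the drift is measured by 2D_k, so that X + D_k ≤ (2c + 1)(Y + D_k); the factor 2c + 1 is
already included in the hypothesis on Γ. -/
lemma spatial_term_le {N g c η Γ P X Y Dk : ℝ} (hN : 0 ≤ N) (hg : 0 ≤ g) (hη : 0 ≤ η) (hc : 0 ≤ c)
    (hY : 0 ≤ Y) (hDk : 0 ≤ Dk) (hXY : X ≤ Y + c * (2 * Dk)) (h : g * (2 * c + 1) * η ≤ Γ * P) :
    N * (g * η * (X + Dk)) ≤ Γ * N * (Y + Dk) * P := by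
  calc N * (g * η * (X + Dk)) ≤ N * (g * η * ((2 * c + 1) * (Y + Dk))) := by
        have : 0 ≤ 2 * c * Y := by positivity
        have : X + Dk ≤ (2 * c + 1) * (Y + Dk) := by linarith
        gcongr
    _ = N * ((g * (2 * c + 1) * η) * (Y + Dk)) := by ring
    _ ≤ N * ((Γ * P) * (Y + Dk)) := by gcongr
    _ = _ := by ring

end Final

/-! ### Closed-loop bounds for the networked system -/

section ClosedLoop

variable {N : ℕ} {S : Network N} {Θ : Set (Vec S.nθ)} {T κ₀ d k κ : ℕ} {L γ σ μ D Dk : ℝ}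
  {p : ℕ → ℝ} {θstar : ℕ → Vec S.nθ} {θhat : ℕ → ℕ → Vec S.nθ} {x : ℕ → Vec S.nx}
  {u : ℕ → Vec S.nu}

/-- A network without nodes has diameter 0, so no κ₀ lies below it. -/
lemma SystemAssumption.pos_nodes (hS : SystemAssumption S L γ σ d κ₀) : 0 < N := by
  rcases Nat.eq_zero_or_pos N with rfl | h
  · have := hS.lt_diam
    rw [SimpleGraph.ediam_eq_zero_of_subsingleton] at this
    exact absurd this not_lt_zero
  · exact h

lemma inv_one_sub_spaceRate_le (hL : 1 < L) (hγ0 : 0 < γ) (hγ : γ < 1) (hμ : 0 < μ) :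
    (1 - spaceRate L γ μ)⁻¹ ≤ 14 * (1 - timeRate L γ μ)⁻¹ := by
  rw [inv_one_sub_spaceRate hL hγ0 hγ hμ, inv_one_sub_timeRate hL hγ0 hγ hμ]
  linarith

/-- The states along the closed loop are bounded. -/
theorem norm_state_le_min (hN : S.Networked) (hS : SystemAssumption S L γ σ d κ₀)
    (hF : TerminalCost μ L S.F) (hU : UncertaintyAssumption S Θ T μ L D) (hp : GrowthBound S.G p)
    (hL : 1 < L) (hγ0 : 0 < γ) (hγ : γ < 1) (hσ : 0 < σ) (hμ : 0 < μ) (hκ : κ₀ ≤ κ)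
    (hθ : ∀ t ≤ T, θstar t ∈ Θ) (hθh : ∀ t < T, ∀ n ≤ window k T t, θhat t n ∈ Θ)
    (hW : WindowBound S T k θstar θhat Dk) (hctl : IsUDTPC S T k κ θstar θhat x u) (hk : 0 < k)
    {C δ ε R : ℝ} (hC : omega L γ σ μ d ≤ C) (hδ1 : δ < 1) (hS_le : deltaS L γ μ ≤ δ)
    (hT_le : deltaT L γ σ μ d ≤ δ) (hδk : C * δ ^ k ≤ 1 / 36) (hδκ : C * (N * δ ^ κ) ≤ 1 / 12)
    (hfc : ForecastCondition T k θstar θhat L C δ ε R) {t : ℕ} (ht : t < T) :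
    ‖x t‖ ≤ 2 * decayConst L γ μ * ‖x 0‖
      + driftConst L γ μ * min (2 * Dk) (D / (1 - timeRate L γ μ)) := by
  have hT : 0 < T := by omega
  have hq0 := timeRate_pos hL hγ0 hγ hμ
  have hq1 := timeRate_lt_one hL hγ0 hγ hμ
  have ha := decayConst_pos hL hγ0 hγ hμ
  obtain ⟨hδT0, -, hqδT, -⟩ := deltaT_facts (d := d) hL hγ0 hγ hσ hμ
  obtain ⟨hΩ1, -, -, -, hΩ⟩ := omega_facts (d := d) hL hγ0 hγ hσ hμ
  have hC1 : 1 ≤ C := hΩ1.trans hC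
  have hδ0 : 0 < δ := hδT0.trans_le hT_le
  have hqδ : timeRate L γ μ ≤ δ ^ 2 := hqδT.trans (pow_le_pow_left₀ hδT0.le hT_le 2)
  have hqk : C * timeRate L γ μ ^ k ≤ 1 / 36 := by
    refine le_trans ?_ hδk
    have := hqδ.trans (pow_le_of_le_one hδ0.le hδ1.le two_ne_zero)
    gcongr
  have hqk' : timeRate L γ μ ^ k ≤ 1 / 2 := by
    have : timeRate L γ μ ^ k ≤ C * timeRate L γ μ ^ k := le_mul_of_one_le_left (by positivity) hC1
    linarith
  obtain ⟨η, hη0, hη1, hη2, -⟩ := hp.exists_weight_bound hS.pos_nodes hL hγ0 hγ hμ κ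
  have hδS0 : 0 < deltaS L γ μ := by linarith [(deltaS_facts hL hγ0 hγ hμ).1]
  have hNη : C * (N * η) ≤ 1 / 12 := by
    refine le_trans ?_ hδκ
    have := hη1.trans (pow_le_pow_left₀ hδS0.le hS_le κ)
    gcongr
  obtain ⟨s1, s2, s3, s4⟩ := sum_disturbance_le hU hθ hθh hW hT hk hq0 hq1 hqk'
    (spaceRate_pos hL hγ0 hγ hμ) (spaceRate_lt_one hL hγ0 hγ hμ)
    (inv_one_sub_spaceRate_le hL hγ0 hγ hμ) rfl
  have hD := hU.bound_nonneg hθ hT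
  have hDk := hW.nonneg hT
  have h1q : 0 < 1 - timeRate L γ μ := by linarith
  exact norm_state_le_of_small hF hU (hS.regular hN hL hγ0 hγ hμ) hκ hη0 hη2 hθ hk hθh hctl
    (le_min (by positivity) (by positivity)) (fun t n _ => s1 t n) s2 s3 s4
    (fun t ht => sum_gain_le hfc hL.le hq0.le hq1 hk hqk hδ0 hδ1 hqδ ha.le (by positivity) hη0 hNη
      (hΩ.trans hC) hC1 ht) ht

/-- The control error, in terms of a bound of the current state up to the drift. -/
theorem control_error_le_of_norm_le (hN : S.Networked) (hS : SystemAssumption S L γ σ d κ₀)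
    (hF : TerminalCost μ L S.F) (hU : UncertaintyAssumption S Θ T μ L D) (hp : GrowthBound S.G p)
    (hL : 1 < L) (hγ0 : 0 < γ) (hγ : γ < 1) (hσ : 0 < σ) (hμ : 0 < μ) (hκ : κ₀ ≤ κ)
    (hθ : ∀ t ≤ T, θstar t ∈ Θ) (hθh : ∀ t < T, ∀ n ≤ window k T t, θhat t n ∈ Θ)
    (hW : WindowBound S T k θstar θhat Dk) (hctl : IsUDTPC S T k κ θstar θhat x u) (hk : 0 < k)
    (hqk : timeRate L γ μ ^ k ≤ 1 / 2) {t : ℕ} (ht : t < T) {y : ℕ → Vec S.nx} {v : ℕ → Vec S.nu}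
    (hopt : IsOfflineOptimal S T θstar t (x t) y v) {Y : ℝ} (hY : 0 ≤ Y)
    (hxY : ‖x t‖ ≤ Y + driftConst L γ μ * min (2 * Dk) (D / (1 - timeRate L γ μ))) :
    ‖u t - v 0‖ ≤ Ups L γ μ D * ∑ n ∈ Finset.range (window k T t + 1),
        rho L γ μ ^ n * (1 + rho L γ μ ^ n * Y) * fcErr θstar θhat t n
      + Gam L γ μ p * N * (Y + Dk) * deltaS L γ μ ^ κ
      + 2 * omega L γ σ μ d ^ 2 * deltaT L γ σ μ d ^ k *
        (deltaT L γ σ μ d ^ k * Y + 2 * D / (1 - deltaT L γ σ μ d)) := by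
  have hT : 0 < T := by omega
  have hq0 := timeRate_pos hL hγ0 hγ hμ
  have hq1 := timeRate_lt_one hL hγ0 hγ hμ
  have hqs0 := spaceRate_pos hL hγ0 hγ hμ
  have hqs1 := spaceRate_lt_one hL hγ0 hγ hμ
  have ha := decayConst_pos hL hγ0 hγ hμ
  have hc := driftConst_pos hL hγ0 hγ hμ
  have hD := hU.bound_nonneg hθ hT
  have hDk := hW.nonneg hT
  obtain ⟨η, hη0, -, hη2, hη3⟩ := hp.exists_weight_bound hS.pos_nodes hL hγ0 hγ hμ κ
  obtain ⟨lam, hK⟩ := hopt.exists_offlineKKT hU hθ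
  have hwin : window k T t ≤ T - t := min_le_right _ _
  have hxY1 : ‖x t‖ ≤ Y + driftConst L γ μ * (2 * Dk) := hxY.trans (by gcongr; exact min_le_left _ _)
  have hxY2 : ‖x t‖ ≤ Y + driftConst L γ μ * (D / (1 - timeRate L γ μ)) :=
    hxY.trans (by gcongr; exact min_le_right _ _)
  obtain ⟨s1, s2, -, -⟩ := sum_disturbance_le hU hθ hθh hW hT hk hq0 hq1 hqk hqs0 hqs1
    (inv_one_sub_spaceRate_le hL hγ0 hγ hμ) rfl
  have hmin := mul_le_mul_of_nonneg_left (min_le_right (2 * Dk) (D / (1 - timeRate L γ μ)))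
    zero_le_two
  have hS₂ : ∑ τ ∈ Finset.range (window k T t), spaceRate L γ μ ^ (τ + 1) *
      ‖S.disturbance (t + τ) (θhat t τ)‖ ≤ Dk :=
    (sum_pow_mul_le_sum (f := fun τ => ‖S.disturbance (t + τ) (θhat t τ)‖)
      (fun _ => norm_nonneg _) hqs0.le hqs1.le _ _).trans (hW t ht).2
  have h := control_error_le hF hU (hS.regular hN hL hγ0 hγ hμ) hκ hη0 hη2 hθ ht hk (hθh t ht)
    (hctl t ht).2 hK (fun n _ => (s1 t n).trans hmin) ((s2 t ht).trans hmin) hS₂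
  have h1 := spatial_term_le (N := N) (Nat.cast_nonneg N)
    (by positivity : 0 ≤ decayConst L γ μ * (4 * L * decayConst L γ μ + 1)) hη0 hc.le hY hDk hxY1
    hη3
  have h3 := tail_term_le (d := d) hL hγ0 hγ hσ hμ hD (norm_nonneg _) hY hxY2 k
  have hφ : ∀ n, 0 ≤ fcErr θstar θhat t n := fun n => norm_nonneg _
  have h2 : decayConst L γ μ * (∑ n ∈ Finset.range (window k T t + 1), timeRate L γ μ ^ n *
        (L * fcErr θstar θhat t n * (2 * (decayConst L γ μ * (timeRate L γ μ ^ n * ‖x t‖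
          + 2 * (D / (1 - timeRate L γ μ))))))
      + ∑ n ∈ Finset.range (window k T t), timeRate L γ μ ^ (n + 1) *
        ‖S.disturbance (t + n) (θstar (t + n)) - S.disturbance (t + n) (θhat t n)‖)
      ≤ Ups L γ μ D * ∑ n ∈ Finset.range (window k T t + 1),
        rho L γ μ ^ n * (1 + rho L γ μ ^ n * Y) * fcErr θstar θhat t n := by
    -- Disturbances are Lipschitz in the parameter, so their differences join the sum of forecast
    -- errors; the added last summand is nonnegative.
    have e : ∑ n ∈ Finset.range (window k T t), timeRate L γ μ ^ (n + 1) *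
        ‖S.disturbance (t + n) (θstar (t + n)) - S.disturbance (t + n) (θhat t n)‖
        ≤ ∑ n ∈ Finset.range (window k T t + 1), timeRate L γ μ ^ n *
          (L * fcErr θstar θhat t n) := by
      refine le_trans (Finset.sum_le_sum fun n hn => ?_) (Finset.sum_le_sum_of_subset_of_nonneg
        (Finset.range_mono (Nat.le_succ _)) fun n _ _ => by have := hφ n; positivity)
      have hn := Finset.mem_range.1 hn
      have h4 := hU.dist_lip (t + n) (by omega) _ (hθ (t + n) (by omega)) _ (hθh t ht n hn.le)
      rw [norm_sub_rev (θstar _)] at h4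
      exact mul_le_mul (pow_le_pow_of_le_one hq0.le hq1.le (Nat.le_succ n)) h4 (norm_nonneg _)
        (by positivity)
    refine (mul_le_mul_of_nonneg_left (add_le_add le_rfl e) ha.le).trans ?_
    rw [← Finset.sum_add_distrib, Finset.mul_sum, Finset.mul_sum]
    refine Finset.sum_le_sum fun n _ => ?_
    have h5 := mul_le_mul_of_nonneg_right
      (forecast_term_le hL hγ0 hγ hμ hD (norm_nonneg _) hY hxY2 n) (hφ n)
    linarith
  linarith

end ClosedLoop

end NetControl

end

theorem theorem9 (L μ γ σ : ℝ) (d : ℕ) (hL : 1 < L) (hμ : 0 < μ) (hγ₀ : 0 < γ) (hγ₁ : γ < 1)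
    (hσ : 0 < σ) :
    -- the temporal constants depend on `L, μ, γ, σ, d` only
    ∃ Ω δT : ℝ, 0 < Ω ∧ 0 < δT ∧ δT < 1 ∧
      ∀ (N : ℕ) (S : Network N) (Θ : Set (Vec S.nθ)) (T κ₀ : ℕ) (D : ℝ) (p : ℕ → ℝ),
        S.Networked →
        SystemAssumption S L γ σ d κ₀ →
        TerminalCost μ L S.F →
        UncertaintyAssumption S Θ T μ L D →
        GrowthBound S.G p →
        TemporalDecay S Θ T d Ω δT ∧
        ∀ (k κ : ℕ) (ε R Dk : ℝ) (θstar : ℕ → Vec S.nθ) (θhat : ℕ → ℕ → Vec S.nθ)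
          (x : ℕ → Vec S.nx) (u : ℕ → Vec S.nu) (ρ δS Γ Υ C δ ξ W R₀ Cκ Ck : ℝ),
          ρ = rho L γ μ →
          δS = deltaS L γ μ →
          Γ = Gam L γ μ p →
          Υ = Ups L γ μ D →
          C = max (max Ω Γ) Υ →
          δ = max δS δT →
          ξ = 1 - Real.sqrt δ →
          W = 8 * L * N * C ^ 2 * (δ + ε) * R / ((1 - δ) ^ 2 * ε) * Dk →
          R₀ = C ^ 2 / ξ ^ 2 * ‖x 0‖ + 2 * C * W / ξ →
          Cκ = Γ * N * (R₀ + Dk) →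
          Ck = 2 * Ω ^ 2 * (R₀ + 2 * D / (1 - δT)) →
          0 < ε → 0 < R →
          κ₀ ≤ κ →
          Real.log (Real.sqrt δ * (1 - Real.sqrt δ) / (3 * C ^ 2 * N)) / Real.log δ ≤ κ →
          2 * Real.log (δ * (1 - δ) / (6 * C ^ 3)) / Real.log δ ≤ k →
          (∀ t ≤ T, θstar t ∈ Θ) →
          (∀ t < T, ∀ n ≤ window k T t, θhat t n ∈ Θ) →
          WindowBound S T k θstar θhat Dk →
          ForecastCondition T k θstar θhat L C δ ε R →
          IsUDTPC S T k κ θstar θhat x u →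
          -- `‖u t - v 0‖` is the control error at time `t`
          ∀ t < T, ∀ (y : ℕ → Vec S.nx) (v : ℕ → Vec S.nu),
            IsOfflineOptimal S T θstar t (x t) y v →
            ‖u t - v 0‖ ≤
                Υ * ∑ n ∈ Finset.range (window k T t + 1),
                    ρ ^ n * (1 + ρ ^ n * ‖x t‖) * fcErr θstar θhat t n
                  + Γ * N * (‖x t‖ + Dk) * δS ^ κ
                  + 2 * Ω ^ 2 * δT ^ k * (δT ^ k * ‖x t‖ + 2 * D / (1 - δT)) ∧
            ‖u t - v 0‖ ^ 2 ≤
                (Υ * (1 / (1 - ρ) + R₀ / (1 - ρ ^ 2)) + Cκ + Ck) *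
                (∑ n ∈ Finset.range (window k T t + 1),
                    Υ * (1 + R₀ * ρ ^ n) * ρ ^ n * fcErr θstar θhat t n ^ 2
                  + Cκ * δS ^ (2 * κ) + Ck * δT ^ (2 * k)) := by
  obtain ⟨hδT0, hδT1, hqδT, hfix⟩ := deltaT_facts (d := d) hL hγ₀ hγ₁ hσ hμ
  obtain ⟨hΩ1, hΩ2, hΩ3, -, -⟩ := omega_facts (d := d) hL hγ₀ hγ₁ hσ hμ
  refine ⟨omega L γ σ μ d, deltaT L γ σ μ d, by linarith, hδT0, hδT1, ?_⟩
  intro N S Θ T κ₀ D p hN hS hF hU hp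
  refine ⟨temporalDecay hN hS hL hγ₁ hσ hμ hU hfix hΩ1 hΩ2, ?_⟩
  intro k κ ε R Dk θstar θhat x u ρ δS Γ Υ C δ ξ W R₀ Cκ Ck hρ hδS hΓ hΥ hC hδ hξ hW hR₀ hCκ hCk
    hε hR hκ hκ' hk hθ hθh hwb hfc hctl t ht y v hopt
  have hT : 0 < T := by omega
  have hN0 := hS.pos_nodes
  have hD := hU.bound_nonneg hθ hT
  have hDk := hwb.nonneg hT
  obtain ⟨hδS1, hδS2, -, -⟩ := deltaS_facts hL hγ₀ hγ₁ hμ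
  obtain ⟨hρ0, hρ1, -⟩ := rho_facts hL hγ₀ hγ₁ hμ
  have hΓ0 := Gam_nonneg hp hN0 hL hγ₀ hγ₁ hμ
  have hq0 := timeRate_pos hL hγ₀ hγ₁ hμ
  have hq1 := timeRate_lt_one hL hγ₀ hγ₁ hμ
  have hc := driftConst_pos hL hγ₀ hγ₁ hμ
  rw [← hδS] at hδS1 hδS2
  rw [← hρ] at hρ0 hρ1
  rw [← hΓ] at hΓ0
  have hΥ0 : 0 ≤ Υ := by
    have h1 := alpha_pos hL hγ₀ hγ₁ hμ
    have h2 : 0 < 1 - rho L γ μ := by linarith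
    rw [hΥ, Ups]
    positivity
  have hCΩ : omega L γ σ μ d ≤ C := hC ▸ (le_max_left _ _).trans (le_max_left _ _)
  have hC1 : 1 ≤ C := hΩ1.trans hCΩ
  have hSδ : δS ≤ δ := hδ ▸ le_max_left _ _
  have hTδ : deltaT L γ σ μ d ≤ δ := hδ ▸ le_max_right _ _
  have hδ0 : 0 < δ := hδT0.trans_le hTδ
  have hδ1 : δ < 1 := hδ ▸ max_lt hδS2 hδT1
  obtain ⟨hk0, hδk⟩ := window_condition hδ0 hδ1 hC1 hk
  have hδκ := radius_condition hδ0 hδ1 hC1 hN0 hκ'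
  have hqk : timeRate L γ μ ^ k ≤ 1 / 2 := by
    have h1 : timeRate L γ μ ≤ δ :=
      (hqδT.trans (pow_le_of_le_one hδT0.le hδT1.le two_ne_zero)).trans hTδ
    have h2 : timeRate L γ μ ^ k ≤ δ ^ k := pow_le_pow_left₀ hq0.le h1 k
    have h3 : δ ^ k ≤ C * δ ^ k := le_mul_of_one_le_left (by positivity) hC1
    linarith
  have hW0 : 0 ≤ W := by
    have : 0 < 1 - δ := by linarith
    rw [hW]
    positivity
  have hsδ : √δ < 1 := by rwa [Real.sqrt_lt' one_pos, one_pow]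
  have hξ0 : 0 < ξ := by linarith
  have hξ1 : ξ ≤ 1 := by linarith [Real.sqrt_nonneg δ]
  -- The initial state's share of the state bound fits under R₀, as 2a ≤ Ω ≤ C ≤ C² and ξ ≤ 1.
  have hR₀x : 2 * decayConst L γ μ * ‖x 0‖ ≤ R₀ := by
    have h1 : 2 * decayConst L γ μ ≤ C ^ 2 / ξ ^ 2 := by
      rw [le_div_iff₀ (by positivity)]
      have h2 : 2 * decayConst L γ μ ≤ C ^ 2 :=
        (hΩ3.trans hCΩ).trans (le_self_pow₀ hC1 two_ne_zero)
      have h3 : ξ ^ 2 ≤ 1 := pow_le_one₀ hξ0.le hξ1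
      exact (mul_le_mul h2 h3 (by positivity) (by positivity)).trans (mul_one _).le
    have h4 := mul_le_mul_of_nonneg_right h1 (norm_nonneg (x 0))
    have h5 : 0 ≤ 2 * C * W / ξ := by positivity
    linarith
  have hR₀0 : 0 ≤ R₀ := by
    have := decayConst_pos hL hγ₀ hγ₁ hμ
    exact le_trans (by positivity) hR₀x
  have hmin0 : 0 ≤ min (2 * Dk) (D / (1 - timeRate L γ μ)) :=
    le_min (by positivity) (div_nonneg hD (by linarith))
  have hx := norm_state_le_min hN hS hF hU hp hL hγ₀ hγ₁ hσ hμ hκ hθ hθh hwb hctl hk0 hCΩ hδ1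
    (hδS ▸ hSδ) hTδ hδk hδκ hfc ht
  -- Used twice: Y = ‖x t‖ gives the first estimate, and Y = R₀, admissible because the closed-loop
  -- state is at most R₀ plus drift, gives the second.
  have key := fun Y hY hxY => control_error_le_of_norm_le hN hS hF hU hp hL hγ₀ hγ₁ hσ hμ hκ hθ hθh
    hwb hctl hk0 hqk ht hopt (Y := Y) hY hxY
  simp only [← hρ, ← hδS, ← hΓ, ← hΥ] at key
  refine ⟨key ‖x t‖ (norm_nonneg _) (le_add_of_nonneg_right (by positivity)), ?_⟩
  have h := key R₀ hR₀0 (hx.trans (by gcongr))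
  have h1δT : 0 < 1 - deltaT L γ σ μ d := by linarith
  have hδTk : deltaT L γ σ μ d ^ k ≤ 1 := pow_le_one₀ hδT0.le hδT1.le
  have hCk0 : 0 ≤ Ck := by rw [hCk]; positivity
  have hCκ0 : 0 ≤ Cκ := by rw [hCκ]; positivity
  have htail : 2 * omega L γ σ μ d ^ 2 * deltaT L γ σ μ d ^ k *
      (deltaT L γ σ μ d ^ k * R₀ + 2 * D / (1 - deltaT L γ σ μ d))
      ≤ Ck * deltaT L γ σ μ d ^ k := by
    have : deltaT L γ σ μ d ^ k * R₀ ≤ R₀ := mul_le_of_le_one_left hR₀0 hδTk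
    rw [hCk, mul_right_comm]
    gcongr
  rw [← hCκ, Finset.mul_sum] at h
  have hw : ∑ n ∈ Finset.range (window k T t + 1), Υ * (1 + R₀ * ρ ^ n) * ρ ^ n
      ≤ Υ * (1 / (1 - ρ) + R₀ / (1 - ρ ^ 2)) := by
    simp only [mul_assoc Υ]
    rw [← Finset.mul_sum]
    exact mul_le_mul_of_nonneg_left (sum_weights_le hρ0.le hρ1 hR₀0 _) hΥ0
  -- Cauchy–Schwarz with weights Υ(1 + R₀ρⁿ)ρⁿ, Cκ and Ck, whose sum is at most the prefactor of the
  -- claim.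
  have := sq_le_of_le_weighted_sum _ (φ := fun n => fcErr θstar θhat t n)
    (fun n _ => by positivity) (fun n _ => norm_nonneg _) hw hCκ0 hCk0
    (by positivity : 0 ≤ δS ^ κ) (by positivity : 0 ≤ deltaT L γ σ μ d ^ k) (norm_nonneg _)
    (h.trans (add_le_add (add_le_add (Finset.sum_le_sum fun n _ => le_of_eq (by ring)) le_rfl)
      htail))
  rwa [← pow_mul, ← pow_mul, mul_comm κ, mul_comm k] at this
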